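/- **Setting.** Fix integers $n,k$ with $1\le k\le n-1$. An *admissible weight* is a sequence $\lambda=(\lambda_1,\dots,\lambda_n)$ of integers with $0\le\lambda_i\le 2$ and $\sum_i\lambda_i=2k$; let $2m(\lambda)$ be the number of its entries equal to $1$. For $1\le i\le n-1$ let $\epsilon_i=(0,\dots,0,1,-1,0,\dots,0)$ with $1,-1$ in positions $i,i+1$. For a graded module $M$, $M\{a\}$ is $M$ with its grading shifted up by $a$. Let $\mathcal A=\mathbb Z[X]/(X^2)$ with $\deg 1=-1$, $\deg X=1$, and let $\mathcal F$ be the two-dimensional TQFT given by $\mathcal A$, its multiplication, and the comultiplication $\Delta(1)=1\otimes X+X\otimes 1$, $\Delta(X)=X\otimes X$; so $\mathcal F$ of $r$ disjoint circles is $\mathcal A^{\otimes r}$. Let $B_\lambda$ be the set of crossingless matchings of the positions of the $1$s of $\lambda$, drawn as arcs below the line, and let $W(b)$ be the reflection of $b$. Khovanov's arc ring is $$H_\lambda=\bigoplus_{a,b\in B_\lambda}\mathcal F(W(b)a)\{m(\lambda)\},$$ with multiplication induced by the cobordisms from $W(c)b\sqcup W(b)a$ to $W(c)a$ that contract $b$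 with $W(b)$ (products with different matchings in the middle are zero). A flat tangle $T$ whose bottom and top endpoints are at the positions of the $1$s of $\lambda$ and of $\mu$ gives the graded $(H_\mu,H_\lambda)$-bimodule $$\mathcal F(T)=\bigoplus_{b\in B_\mu,\,a\in B_\lambda}\mathcal F(W(b)Ta)\{m(\lambda)\},$$ with actions given by contraction cobordisms. Let $\mathcal C(\lambda)$ be the category of finitely generated graded left $H_\lambda$-modules and grading-preserving homomorphisms, and let $\mathcal C=\bigoplus_\lambda\mathcal C(\lambda)$ over all admissible $\lambda$. If $\lambda$ and $\mu=\lambda\pm\epsilon_i$ are admissible, let $T_i(\lambda,\mu)$ be the flat tangle with vertical strands away from positions $i,i+1$ in which the two endpoints in the positions $i,i+1$ are joined by an arc; this arc is a strand between neighbouring positions if exactly one of $\lambda_i,\lambda_{i+1}$ is $1$, a cup with two top endpoints if $\{\lambda_i,\lambda_{i+1}\}=\{0,2\}$, and a cap with two bottom endpoints if $\lambda_i=\lambda_{i+1}=1$. The functors $\mathcal E_i,\mathcal F_i:\mathcal C\to\mathcal C$ are given on $\mathcal C(\lambda)$ by $\mathcal F(T_i(\lambda,\lambda\pm\epsilon_i))\otimes_{H_\lambda}-$,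 with the sign $+$ for $\mathcal E_i$ and $-$ for $\mathcal F_i$, with values in $\mathcal C(\lambda\pm\epsilon_i)$, and by zero if $\lambda\pm\epsilon_i$ is not admissible. The functors $\mathcal K_i^{\pm1}:\mathcal C\to\mathcal C$ are given on $\mathcal C(\lambda)$ by the shifts $\{\pm(\lambda_i-\lambda_{i+1})\}$. Products of functors are compositions (the right factor is applied first), $\oplus$ is the direct sum of functors, and $c_{i,j}=2$ if $i=j$, $c_{i,j}=-1$ if $|i-j|=1$, $c_{i,j}=0$ if $|i-j|>1$. **Proposition.** For all $i,j\in\{1,\dots,n-1\}$ there are isomorphisms of functors $\mathcal C\to\mathcal C$: 1. $\mathcal K_i\mathcal K_i^{-1}\cong\mathrm{Id}\cong\mathcal K_i^{-1}\mathcal K_i$; 2. $\mathcal K_i\mathcal K_j\cong\mathcal K_j\mathcal K_i$; 3. $\mathcal K_i\mathcal E_j\cong\mathcal E_j\mathcal K_i\{c_{i,j}\}$; 4. $\mathcal K_i\mathcal F_j\cong\mathcal F_j\mathcal K_i\{-c_{i,j}\}$; 5. $\mathcal E_i\mathcal F_j\cong\mathcal F_j\mathcal E_i$ if $i\ne j$;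 6. $\mathcal E_i\mathcal E_j\cong\mathcal E_j\mathcal E_i$ if $|i-j|>1$; 7. $\mathcal F_i\mathcal F_j\cong\mathcal F_j\mathcal F_i$ if $|i-j|>1$; 8. $\mathcal E_i^2\mathcal E_j\oplus\mathcal E_j\mathcal E_i^2\cong\mathcal E_i\mathcal E_j\mathcal E_i\{1\}\oplus\mathcal E_i\mathcal E_j\mathcal E_i\{-1\}$ if $j=i\pm1$; 9. $\mathcal F_i^2\mathcal F_j\oplus\mathcal F_j\mathcal F_i^2\cong\mathcal F_i\mathcal F_j\mathcal F_i\{1\}\oplus\mathcal F_i\mathcal F_j\mathcal F_i\{-1\}$ if $j=i\pm1$. -/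

import Mathlib

noncomputable section

set_option linter.unusedSectionVars false

/-- `A^{⊗ C}` for the ring `A = ℤ[X]/(X²)` and a finite set `C` of circles, as a free abelian group
with one basis element `X_S` for each finite set `S ⊆ C`: the tensor with factor `X` at the circles
in `S` and factor `1` at the others. An element is its family of coefficients. -/
def CircleAlg (C : Type) : Type := Finset C → ℤ

namespace CircleAlg

variable {C : Type}

instance : AddCommGroup (CircleAlg C) := inferInstanceAs (AddCommGroup (Finset C → ℤ))

open scoped Classical in
instance : Mul (CircleAlg C) := ⟨fun f g S => ∑ T ∈ S.powerset, f T * g (S \ T)⟩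

open scoped Classical in
instance : One (CircleAlg C) := ⟨fun S => if S = ∅ then 1 else 0⟩

open scoped Classical in
/-- The basis monomial `X_S`. -/
def mono (S : Finset C) : CircleAlg C := fun T => if T = S then 1 else 0

/-- The generator `X` of the tensor factor of the circle `c`. -/
def X (c : C) : CircleAlg C := mono {c}

@[ext] theorem ext' {f g : CircleAlg C} (h : ∀ S, f S = g S) : f = g := funext h

theorem add_apply' (f g : CircleAlg C) (S : Finset C) : (f + g) S = f S + g S := rfl
theorem zero_apply' (S : Finset C) : (0 : CircleAlg C) S = 0 := rfl

open scoped Classical in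
theorem mul_apply' (f g : CircleAlg C) (S : Finset C) :
    (f * g) S = ∑ T ∈ S.powerset, f T * g (S \ T) := rfl

open scoped Classical in
theorem one_apply' (S : Finset C) : (1 : CircleAlg C) S = if S = ∅ then 1 else 0 := rfl

theorem mul_comm' (f g : CircleAlg C) : f * g = g * f := by
  classical
  ext S
  simp only [mul_apply']
  refine Finset.sum_nbij' (fun T => S \ T) (fun T => S \ T) ?_ ?_ ?_ ?_ ?_
  · intro T _; simp
  · intro T _; simp
  · intro T hT; simp at hT; simpa using hT
  · intro T hT; simp at hT; simpa using hT
  · intro T hT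
    simp only [Finset.mem_powerset] at hT
    rw [Finset.sdiff_sdiff_eq_self hT, mul_comm]

theorem one_mul' (f : CircleAlg C) : 1 * f = f := by
  classical
  ext S
  simp only [mul_apply', one_apply']
  rw [Finset.sum_eq_single ∅]
  · simp
  · intro T _ h; simp [h]
  · intro h; simp at h

theorem mul_assoc' (f g h : CircleAlg C) : f * g * h = f * (g * h) := by
  classical
  ext S
  simp only [mul_apply', Finset.sum_mul, Finset.mul_sum]
  rw [Finset.sum_sigma', Finset.sum_sigma']
  refine Finset.sum_nbij' (fun p => ⟨p.2, p.1 \ p.2⟩) (fun p => ⟨p.1 ∪ p.2, p.1⟩) ?_ ?_ ?_ ?_ ?_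
  · rintro ⟨T, U⟩ h
    simp only [Finset.mem_sigma, Finset.mem_powerset] at h ⊢
    exact ⟨h.2.trans h.1, Finset.sdiff_subset_sdiff h.1 le_rfl⟩
  · rintro ⟨T, U⟩ h
    simp only [Finset.mem_sigma, Finset.mem_powerset] at h ⊢
    exact ⟨Finset.union_subset h.1 (h.2.trans Finset.sdiff_subset), Finset.subset_union_left⟩
  · rintro ⟨T, U⟩ h
    simp only [Finset.mem_sigma, Finset.mem_powerset] at h ⊢
    simp [Finset.union_eq_right.mpr h.2]
  · rintro ⟨T, U⟩ h
    simp only [Finset.mem_sigma, Finset.mem_powerset] at h ⊢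
    have : (T ∪ U) \ T = U := by
      ext x
      have := @h.2 x
      simp only [Finset.mem_sdiff, Finset.mem_union] at *
      tauto
    rw [this]
  · rintro ⟨T, U⟩ h
    simp only [Finset.mem_sigma, Finset.mem_powerset] at h ⊢
    have : (S \ U) \ (T \ U) = S \ T := by
      ext x
      have := @h.2 x
      simp only [Finset.mem_sdiff] at *
      tauto
    rw [this, mul_assoc]

theorem mul_add' (f g h : CircleAlg C) : f * (g + h) = f * g + f * h := by
  ext S
  simp only [mul_apply', add_apply', mul_add, Finset.sum_add_distrib]

instance : CommRing (CircleAlg C) :=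
  { (inferInstance : AddCommGroup (CircleAlg C)) with
    mul := (· * ·)
    one := 1
    mul_assoc := mul_assoc'
    mul_comm := mul_comm'
    one_mul := one_mul'
    mul_one := fun f => by rw [mul_comm', one_mul']
    left_distrib := mul_add'
    right_distrib := fun f g h => by rw [mul_comm', mul_add', mul_comm' h f, mul_comm' h g]
    zero_mul := fun f => by ext S; simp [mul_apply', zero_apply']
    mul_zero := fun f => by ext S; simp [mul_apply', zero_apply'] }

/-- `homog d f`: only monomials with exactly `d` factors `X` occur in `f`. -/
def Homog (d : ℕ) (f : CircleAlg C) : Prop := ∀ S : Finset C, f S ≠ 0 → S.card = d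

theorem Homog.add {d : ℕ} {f g : CircleAlg C} (hf : Homog d f) (hg : Homog d g) :
    Homog d (f + g) := by
  intro S h
  by_cases h1 : f S = 0
  · exact hg S (by simpa [add_apply', h1] using h)
  · exact hf S h1

theorem Homog.mul {d e : ℕ} {f g : CircleAlg C} (hf : Homog d f) (hg : Homog e g) :
    Homog (d + e) (f * g) := by
  classical
  intro S h
  rw [mul_apply'] at h
  obtain ⟨T, hT, h⟩ := Finset.exists_ne_zero_of_sum_ne_zero h
  rw [Finset.mem_powerset] at hT
  rw [← hf T (left_ne_zero_of_mul h), ← hg _ (right_ne_zero_of_mul h), add_comm,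
    Finset.card_sdiff_add_card_eq_card hT]

theorem Homog.one : Homog 0 (1 : CircleAlg C) := by
  intro S h
  rw [one_apply'] at h
  by_contra h'
  exact h (if_neg fun e => h' (by simp [e]))

theorem Homog.X (c : C) : Homog 1 (X c) := by
  intro S h
  by_contra h'
  exact h (if_neg fun e => h' (by simp [e]))

theorem Homog.zero (d : ℕ) : Homog d (0 : CircleAlg C) := fun _ h => absurd rfl h

theorem Homog.sum {d : ℕ} {ι : Type*} (s : Finset ι) (F : ι → CircleAlg C)
    (h : ∀ i ∈ s, Homog d (F i)) : Homog d (∑ i ∈ s, F i) := by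
  classical
  induction s using Finset.induction_on with
  | empty => exact Homog.zero d
  | insert a s ha ih =>
    rw [Finset.sum_insert ha]
    exact (h a (by simp)).add (ih fun i hi => h i (by simp [hi]))

theorem Homog.prod {ι : Type*} (s : Finset ι) (F : ι → CircleAlg C)
    (h : ∀ i ∈ s, Homog 1 (F i)) : Homog s.card (∏ i ∈ s, F i) := by
  classical
  induction s using Finset.induction_on with
  | empty => exact Homog.one
  | insert a s ha ih =>
    rw [Finset.prod_insert ha, Finset.card_insert_of_notMem ha, add_comm]
    exact (h a (by simp)).mul (ih fun i hi => h i (by simp [hi]))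

theorem Homog.zsmul {d : ℕ} {f : CircleAlg C} (hf : Homog d f) (z : ℤ) : Homog d (z • f) := by
  intro S h
  refine hf S fun e => h ?_
  change z • f S = 0
  simp [e]

open scoped Classical in
theorem mono_apply (S T : Finset C) : (mono S : CircleAlg C) T = if T = S then 1 else 0 := rfl

open scoped Classical in
theorem mono_mul_mono (S T : Finset C) :
    (mono S * mono T : CircleAlg C) = if Disjoint S T then mono (S ∪ T) else 0 := by
  ext U
  rw [mul_apply']
  have key : ∀ V ∈ U.powerset, mono S V * mono T (U \ V)
      = if V = S then (if U \ S = T then 1 else 0) else 0 := by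
    intro V _
    by_cases h : V = S
    · subst h; simp [mono_apply]
    · simp [mono_apply, h]
  rw [Finset.sum_congr rfl key, Finset.sum_ite_eq']
  by_cases hd : Disjoint S T
  · rw [if_pos hd, mono_apply]
    by_cases hU : U = S ∪ T
    · subst hU
      have : (S ∪ T) \ S = T := by
        rw [Finset.union_sdiff_left, Finset.sdiff_eq_self_of_disjoint hd.symm]
      rw [if_pos this, if_pos (Finset.mem_powerset.mpr Finset.subset_union_left), if_pos rfl]
    · rw [if_neg hU]
      by_cases h1 : S ∈ U.powerset
      · rw [if_pos h1, if_neg]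
        intro h2
        apply hU
        rw [← h2, Finset.union_sdiff_of_subset (Finset.mem_powerset.mp h1)]
      · rw [if_neg h1]
  · rw [if_neg hd, zero_apply']
    by_cases h1 : S ∈ U.powerset
    · rw [if_pos h1, if_neg]
      intro h2
      exact hd (h2 ▸ Finset.disjoint_sdiff)
    · rw [if_neg h1]

theorem one_eq_mono : (1 : CircleAlg C) = mono ∅ := rfl

theorem X_mul_self (c : C) : X c * X c = 0 := by
  classical
  rw [X, mono_mul_mono, if_neg]
  simp

theorem prod_X (S : Finset C) : ∏ c ∈ S, X c = mono S := by
  classical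
  induction S using Finset.induction_on with
  | empty => rw [Finset.prod_empty, one_eq_mono]
  | insert a s ha ih =>
    rw [Finset.prod_insert ha, ih, X, mono_mul_mono, if_pos (by simpa using ha)]
    congr 1

theorem sum_apply' {ι : Type*} (s : Finset ι) (F : ι → CircleAlg C) (S : Finset C) :
    (∑ i ∈ s, F i) S = ∑ i ∈ s, F i S :=
  map_sum (AddMonoidHom.mk' (fun f : CircleAlg C => f S) fun _ _ => rfl) F s

theorem eq_sum [Finite C] (f : CircleAlg C) :
    letI := Fintype.ofFinite C; f = ∑ S : Finset C, f S • ∏ c ∈ S, X c := by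
  classical
  letI := Fintype.ofFinite C
  simp_rw [prod_X]
  funext S
  refine Eq.trans ?_ (sum_apply' _ _ S).symm
  rw [Finset.sum_eq_single S]
  · change _ = f S • mono S S
    simp [mono_apply]
  · intro T _ h
    change f T • mono T S = 0
    simp [mono_apply, h.symm]
  · simp

variable [Finite C] {B : Type*} [CommRing B]

/-- The additive map that sends `X_S` to the product of the `φ c`, `c ∈ S`. -/
def evalLin (φ : C → B) : CircleAlg C →+ B :=
  letI := Fintype.ofFinite C
  { toFun := fun f => ∑ S : Finset C, f S • ∏ c ∈ S, φ c
    map_zero' := by simp [zero_apply']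
    map_add' := fun f g => by simp [add_apply', add_smul, Finset.sum_add_distrib] }

theorem evalLin_prod_X (φ : C → B) (S : Finset C) :
    evalLin φ (∏ c ∈ S, X c) = ∏ c ∈ S, φ c := by
  classical
  letI := Fintype.ofFinite C
  rw [prod_X]
  change ∑ T : Finset C, mono S T • ∏ c ∈ T, φ c = _
  rw [Finset.sum_eq_single S]
  · simp [mono_apply]
  · intro T _ h
    simp [mono_apply, h]
  · simp

theorem addHom_ext {φ ψ : CircleAlg C →+ B}
    (h : ∀ S : Finset C, φ (∏ c ∈ S, X c) = ψ (∏ c ∈ S, X c)) : φ = ψ := by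
  letI := Fintype.ofFinite C
  ext f
  rw [eq_sum f]
  simp only [map_sum, map_zsmul, h]

theorem evalLin_mul (φ : C → B) (hφ : ∀ c, φ c * φ c = 0) (f g : CircleAlg C) :
    evalLin φ (f * g) = evalLin φ f * evalLin φ g := by
  classical
  have key : ∀ S T : Finset C, evalLin φ ((∏ c ∈ S, X c) * ∏ c ∈ T, X c)
      = evalLin φ (∏ c ∈ S, X c) * evalLin φ (∏ c ∈ T, X c) := by
    intro S T
    simp only [evalLin_prod_X]
    by_cases h : Disjoint S T
    · rw [← Finset.prod_union h, ← Finset.prod_union h, evalLin_prod_X]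
    · rw [prod_X, prod_X, mono_mul_mono, if_neg h, map_zero]
      obtain ⟨c, hc, hc'⟩ := Finset.not_disjoint_iff.mp h
      rw [← Finset.mul_prod_erase S _ hc, ← Finset.mul_prod_erase T _ hc', mul_mul_mul_comm, hφ,
        zero_mul]
  letI := Fintype.ofFinite C
  conv_lhs => rw [eq_sum f, eq_sum g, Finset.sum_mul_sum]
  conv_rhs => rw [eq_sum f, eq_sum g]
  simp only [map_sum, map_zsmul, smul_mul_smul_comm, key, Finset.sum_mul_sum]

/-- The ring homomorphism out of `A^{⊗ C}` that sends the generator of the circle `c` to `φ c`. -/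
def eval (φ : C → B) (hφ : ∀ c, φ c * φ c = 0) : CircleAlg C →+* B :=
  { evalLin φ with
    map_one' := by
      have := evalLin_prod_X φ ∅
      simpa using this
    map_mul' := evalLin_mul φ hφ }

theorem eval_prod_X (φ : C → B) (hφ : ∀ c, φ c * φ c = 0) (S : Finset C) :
    eval φ hφ (∏ c ∈ S, X c) = ∏ c ∈ S, φ c := evalLin_prod_X φ S

@[simp] theorem eval_X (φ : C → B) (hφ : ∀ c, φ c * φ c = 0) (c : C) :
    eval φ hφ (X c) = φ c := by
  simpa using eval_prod_X φ hφ {c}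

/-- Two ring homomorphisms which agree on generators after multiplication by `K` agree after
multiplication by `K`. -/
theorem hom_congr {K : B} {φ ψ : CircleAlg C →+* B}
    (h : ∀ c, φ (X c) * K = ψ (X c) * K) (f : CircleAlg C) : φ f * K = ψ f * K := by
  classical
  letI := Fintype.ofFinite C
  have key : ∀ S : Finset C, φ (∏ c ∈ S, X c) * K = ψ (∏ c ∈ S, X c) * K := by
    intro S
    induction S using Finset.induction_on with
    | empty => simp
    | insert a s ha ih =>
      rw [Finset.prod_insert ha, map_mul, map_mul, mul_assoc, ih, mul_left_comm, h, mul_left_comm,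
        mul_assoc]
  rw [eq_sum f]
  simp only [map_sum, map_zsmul, Finset.sum_mul, smul_mul_assoc, key]

/-- The ring homomorphism `A^{⊗ C} → A^{⊗ D}` induced by a map of circles: it multiplies together the
tensor factors of circles with the same image. -/
def push {D : Type} (φ : C → D) : CircleAlg C →+* CircleAlg D :=
  eval (fun c => X (φ c)) fun _ => X_mul_self _

theorem Homog.push {D : Type} (φ : C → D) {d : ℕ} {f : CircleAlg C} (hf : Homog d f) :
    Homog d (push φ f) := by
  letI := Fintype.ofFinite C
  rw [eq_sum f, map_sum]
  refine Homog.sum _ _ fun S _ => ?_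
  rw [map_zsmul]
  by_cases h : f S = 0
  · rw [h, zero_smul]; exact Homog.zero d
  · refine Homog.zsmul ?_ _
    rw [← hf S h]
    unfold CircleAlg.push
    rw [eval_prod_X]
    exact Homog.prod _ _ fun c _ => Homog.X _

theorem push_id_apply {φ : C → C} (h : ∀ c, φ c = c) (f : CircleAlg C) : push φ f = f := by
  have := hom_congr (K := (1 : CircleAlg C)) (φ := push φ) (ψ := RingHom.id _)
    (fun c => by simp [push, h]) f
  simpa using this

end CircleAlg

end

noncomputable section

set_option linter.unusedSectionVars false

namespace Surgery

open Equiv Equiv.Perm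

variable {X : Type} [DecidableEq X]

/-- The relation obtained from `r` by joining the classes of `x` and `y`. -/
def Joined (r : X → X → Prop) (x y u v : X) : Prop :=
  r u v ∨ (r u x ∧ r v y) ∨ (r u y ∧ r v x)

theorem pow_swap (θ : Perm X) (x y : X) (k : ℕ)
    (h : ∀ j, 1 ≤ j → j < k → (θ ^ j) y ≠ x ∧ (θ ^ j) y ≠ y) :
    ∀ j, 1 ≤ j → j ≤ k → ((θ * swap x y) ^ j) x = (θ ^ j) y := by
  intro j hj hjk
  induction j with
  | zero => omega
  | succ j ih =>
    rcases Nat.eq_zero_or_pos j with rfl | h0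
    · simp
    · have h1 := h j h0 (by omega)
      rw [pow_succ', Perm.mul_apply, ih h0 (by omega), Perm.mul_apply,
        swap_apply_of_ne_of_ne h1.1 h1.2, pow_succ', Perm.mul_apply]

theorem joined_of_sameCycle (θ : Perm X) (x y u v : X) (h : SameCycle (θ * swap x y) u v) :
    Joined (SameCycle θ) x y u v := by
  have hstep : ∀ z, Joined (SameCycle θ) x y z ((θ * swap x y) z) := by
    intro z
    rw [Perm.mul_apply]
    by_cases hx : z = x
    · subst hx
      rw [swap_apply_left]
      exact Or.inr (Or.inl ⟨SameCycle.refl _ _, by simp [SameCycle.refl]⟩)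
    by_cases hy : z = y
    · subst hy
      rw [swap_apply_right]
      exact Or.inr (Or.inr ⟨SameCycle.refl _ _, by simp [SameCycle.refl]⟩)
    rw [swap_apply_of_ne_of_ne hx hy]
    exact Or.inl (by simp [SameCycle.refl])
  have htrans : ∀ a b c, Joined (SameCycle θ) x y a b → Joined (SameCycle θ) x y b c →
      Joined (SameCycle θ) x y a c := by
    rintro a b c (h1 | ⟨h1, h1'⟩ | ⟨h1, h1'⟩) (h2 | ⟨h2, h2'⟩ | ⟨h2, h2'⟩)
    · exact Or.inl (h1.trans h2)
    · exact Or.inr (Or.inl ⟨h1.trans h2, h2'⟩)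
    · exact Or.inr (Or.inr ⟨h1.trans h2, h2'⟩)
    · exact Or.inr (Or.inl ⟨h1, h2.symm.trans h1'⟩)
    · exact Or.inl (h1.trans (h2.symm.trans (h1'.trans h2'.symm)))
    · exact Or.inl (h1.trans h2'.symm)
    · exact Or.inr (Or.inr ⟨h1, h2.symm.trans h1'⟩)
    · exact Or.inl (h1.trans h2'.symm)
    · exact Or.inl (h1.trans (h2.symm.trans (h1'.trans h2'.symm)))
  have hsymm : ∀ a b, Joined (SameCycle θ) x y a b → Joined (SameCycle θ) x y b a := by
    rintro a b (h1 | ⟨h1, h1'⟩ | ⟨h1, h1'⟩)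
    · exact Or.inl h1.symm
    · exact Or.inr (Or.inr ⟨h1', h1⟩)
    · exact Or.inr (Or.inl ⟨h1', h1⟩)
  have hpow : ∀ (n : ℕ) a, Joined (SameCycle θ) x y a (((θ * swap x y) ^ n) a) := by
    intro n
    induction n with
    | zero => intro a; exact Or.inl (by simp [SameCycle.refl])
    | succ n ih =>
      intro a
      rw [pow_succ', Perm.mul_apply]
      exact htrans _ _ _ (ih a) (hstep _)
  obtain ⟨k, rfl⟩ := h
  rcases Int.eq_nat_or_neg k with ⟨n, rfl | rfl⟩
  · simpa using hpow n u
  · apply hsymm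
    have := hpow n (((θ * swap x y) ^ (-(n : ℤ))) u)
    simpa using this

variable [Finite X]

theorem sameCycle_swap_of_not (θ : Perm X) (x y : X) (h : ¬ SameCycle θ x y) :
    SameCycle (θ * swap x y) x y := by
  classical
  have hex : ∃ k, 0 < k ∧ (θ ^ k) y = y := ⟨orderOf θ, orderOf_pos θ, by simp [pow_orderOf_eq_one]⟩
  obtain ⟨hk, hky⟩ := Nat.find_spec hex
  have := pow_swap θ x y (Nat.find hex) (fun j h1 hj => ⟨fun e => h ?_, fun e =>
    Nat.find_min hex hj ⟨h1, e⟩⟩) _ hk le_rfl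
  · exact ⟨(Nat.find hex : ℕ), by rw [zpow_natCast, this, hky]⟩
  · exact SameCycle.symm ⟨j, by simpa using e⟩

theorem not_sameCycle_swap (θ : Perm X) (x y : X) (hxy : x ≠ y) (h : SameCycle θ x y) :
    ¬ SameCycle (θ * swap x y) x y := by
  classical
  have : Fintype X := Fintype.ofFinite X
  have hex : ∃ k, 0 < k ∧ (θ ^ k) x = y := by
    obtain ⟨i, hi, -, h⟩ := h.exists_pow_eq
    exact ⟨i, hi, h⟩
  obtain ⟨hk, hky⟩ := Nat.find_spec hex
  set k := Nat.find hex with hkdef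
  have hmin : ∀ j, 0 < j → j < k → (θ ^ j) x ≠ y := fun j h1 hj e => Nat.find_min hex hj ⟨h1, e⟩
  have hx : ∀ j, 0 < j → j ≤ k → (θ ^ j) x ≠ x := by
    intro j h1 hj e
    rcases hj.eq_or_lt with rfl | hj
    · exact hxy (e.symm.trans hky)
    · refine hmin (k - j) (by omega) (by omega) ?_
      rw [← hky]
      conv_rhs => rw [show k = (k - j) + j by omega, pow_add, Perm.mul_apply, e]
  have key := pow_swap θ y x k (fun j h1 hj => ⟨hmin j h1 hj, hx j h1 hj.le⟩)
  rw [swap_comm y x] at key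
  intro hs
  obtain ⟨m, -, -, hm⟩ := hs.symm.exists_pow_eq
  have hper : ((θ * swap x y) ^ k) y = y := by rw [key k hk le_rfl, hky]
  have hper' : ∀ q : ℕ, ((θ * swap x y) ^ (k * q)) y = y := by
    intro q
    induction q with
    | zero => simp
    | succ q ih => rw [Nat.mul_succ, pow_add, Perm.mul_apply, hper, ih]
  rw [← Nat.mod_add_div m k, pow_add, Perm.mul_apply, hper'] at hm
  rcases Nat.eq_zero_or_pos (m % k) with h0 | h0
  · rw [h0] at hm
    exact hxy (by simpa using hm.symm)
  · have hlt := Nat.mod_lt m hk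
    rw [key _ h0 hlt.le] at hm
    exact hx _ h0 hlt.le hm

theorem swap_swap_cancel (θ : Perm X) (x y : X) : θ * swap x y * swap x y = θ := by
  rw [mul_assoc, swap_mul_self, mul_one]

/-- If the surgery joins, cycles after = cycles before with two classes joined. -/
theorem sameCycle_iff_joined (θ : Perm X) (x y u v : X) (h : SameCycle (θ * swap x y) x y) :
    SameCycle (θ * swap x y) u v ↔ Joined (SameCycle θ) x y u v := by
  refine ⟨joined_of_sameCycle θ x y u v, ?_⟩
  have hle : ∀ a b, SameCycle θ a b → SameCycle (θ * swap x y) a b := by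
    intro a b hab
    have := joined_of_sameCycle (θ * swap x y) x y a b (by rwa [swap_swap_cancel])
    rcases this with h1 | ⟨h1, h2⟩ | ⟨h1, h2⟩
    · exact h1
    · exact h1.trans (h.trans h2.symm)
    · exact h1.trans (h.symm.trans h2.symm)
  rintro (h1 | ⟨h1, h2⟩ | ⟨h1, h2⟩)
  · exact hle _ _ h1
  · exact (hle _ _ h1).trans (h.trans (hle _ _ h2).symm)
  · exact (hle _ _ h1).trans (h.symm.trans (hle _ _ h2).symm)

theorem sameCycle_iff_joined' (θ : Perm X) (x y u v : X) (h : ¬ SameCycle (θ * swap x y) x y) :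
    SameCycle θ u v ↔ Joined (SameCycle (θ * swap x y)) x y u v := by
  have h1 := sameCycle_swap_of_not _ x y h
  have := sameCycle_iff_joined (θ * swap x y) x y u v h1
  rwa [swap_swap_cancel] at this

variable {B : Type*} [CommRing B]

open scoped Classical in
/-- The factor of the surgery. -/
def factor (ξ : X → B) (θ : Perm X) (x y : X) : B :=
  if SameCycle θ x y then 1 else ξ x + ξ y

/-- The product of the factors of a sequence of surgeries. -/
def prodFactor (ξ : X → B) : Perm X → List (X × X) → B
  | _, [] => 1
  | θ, p :: L => factor ξ (θ * swap p.1 p.2) p.1 p.2 * prodFactor ξ (θ * swap p.1 p.2) L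

def after : Perm X → List (X × X) → Perm X
  | θ, [] => θ
  | θ, p :: L => after (θ * swap p.1 p.2) L

theorem prodFactor_append (ξ : X → B) (θ : Perm X) (L L' : List (X × X)) :
    prodFactor ξ θ (L ++ L') = prodFactor ξ θ L * prodFactor ξ (after θ L) L' := by
  induction L generalizing θ with
  | nil => simp [prodFactor, after]
  | cons p L ih => simp [prodFactor, after, ih, mul_assoc]

theorem after_append (θ : Perm X) (L L' : List (X × X)) :
    after θ (L ++ L') = after (after θ L) L' := by
  induction L generalizing θ with
  | nil => simp [after]
  | cons p L ih => simp [after, ih]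

theorem kill (ξ : X → B) (hsq : ∀ u, ξ u * ξ u = 0) (θ : Perm X) (L : List (X × X))
    (hc : ∀ u v, SameCycle (after θ L) u v → ξ u = ξ v) {u v : X} (h : SameCycle θ u v) :
    ξ u * prodFactor ξ θ L = ξ v * prodFactor ξ θ L := by
  induction L generalizing θ u v with
  | nil => rw [hc u v h]
  | cons p L ih =>
    obtain ⟨x, y⟩ := p
    have ih' := fun {u v} => @ih (θ * swap x y) hc u v
    simp only [prodFactor, factor]
    by_cases hs : SameCycle (θ * swap x y) x y
    · rw [if_pos hs, one_mul]
      refine ih' ?_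
      rw [sameCycle_iff_joined θ x y u v hs]
      exact Or.inl h
    · rw [if_neg hs]
      rw [sameCycle_iff_joined' θ x y u v hs] at h
      rcases h with h | ⟨h1, h2⟩ | ⟨h1, h2⟩
      · linear_combination (ξ x + ξ y) * ih' h
      · linear_combination (ξ x + ξ y) * ih' h1 - (ξ x + ξ y) * ih' h2
          + prodFactor ξ (θ * swap x y) L * (hsq x - hsq y)
      · linear_combination (ξ x + ξ y) * ih' h1 - (ξ x + ξ y) * ih' h2
          - prodFactor ξ (θ * swap x y) L * (hsq x - hsq y)

theorem prodFactor_swap (ξ : X → B) (hsq : ∀ u, ξ u * ξ u = 0) (θ : Perm X) (x y x' y' : X)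
    (h1 : x ≠ x') (h2 : x ≠ y') (h3 : y ≠ x') (h4 : y ≠ y') (L : List (X × X))
    (hc : ∀ u v, SameCycle (after θ ((x, y) :: (x', y') :: L)) u v → ξ u = ξ v) :
    prodFactor ξ θ ((x, y) :: (x', y') :: L) = prodFactor ξ θ ((x', y') :: (x, y) :: L) := by
  have hcomm : θ * swap x' y' * swap x y = θ * swap x y * swap x' y' := by
    rw [mul_assoc, mul_assoc]
    congr 1
    apply Disjoint.commute
    intro z
    by_cases hz : z = x
    · subst hz; exact Or.inl (swap_apply_of_ne_of_ne h1 h2)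
    by_cases hz' : z = y
    · subst hz'; exact Or.inl (swap_apply_of_ne_of_ne h3 h4)
    · exact Or.inr (swap_apply_of_ne_of_ne hz hz')
  simp only [prodFactor, hcomm]
  simp only [after] at hc
  have hk := fun {u v} => @kill X _ _ B _ ξ hsq _ L hc u v
  rw [← mul_assoc, ← mul_assoc]
  have e1 : θ * swap x y * swap x' y' * swap x' y' = θ * swap x y := swap_swap_cancel _ _ _
  have e2 : θ * swap x y * swap x' y' * swap x y = θ * swap x' y' := by
    rw [← hcomm, swap_swap_cancel]
  set σ := θ * swap x y * swap x' y' with hσ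
  set σs := θ * swap x y with hσs
  set σt := θ * swap x' y' with hσt
  have Rs1 := fun (h : SameCycle σ x' y') (u v : X) => sameCycle_iff_joined σs x' y' u v h
  have Rs2 := fun (h : ¬ SameCycle σ x' y') (u v : X) => sameCycle_iff_joined' σs x' y' u v h
  have Rt1 := fun (h : SameCycle σ x y) (u v : X) =>
    sameCycle_iff_joined σt x y u v (by rwa [← e2, swap_swap_cancel])
  have Rt2 := fun (h : ¬ SameCycle σ x y) (u v : X) =>
    sameCycle_iff_joined' σt x y u v (by rwa [← e2, swap_swap_cancel])
  have hb : σt * swap x y = σ := hcomm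
  rw [hb] at Rt1 Rt2
  rw [← hσ] at Rs1 Rs2
  by_cases Bt : SameCycle σ x' y' <;> by_cases Bs : SameCycle σ x y
  · -- both join at the last step
    have key : SameCycle σs x y ↔ SameCycle σt x' y' := by
      constructor
      · intro As
        by_contra At
        have q := (Rt1 Bs x' y').mp Bt
        have r := sameCycle_iff_joined' θ x' y' x y (by rwa [← hσt])
        have : SameCycle θ x y := by
          rw [r, ← hσt]
          rcases q with q | ⟨q1, q2⟩ | ⟨q1, q2⟩
          · exact absurd q At
          · exact Or.inr (Or.inl ⟨q1.symm, q2.symm⟩)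
          · exact Or.inr (Or.inr ⟨q2.symm, q1.symm⟩)
        by_cases hxy : x = y
        · have hA : ¬ SameCycle σt x x := by
            rcases q with q | ⟨q1, q2⟩ | ⟨q1, q2⟩
            · exact absurd q At
            · subst hxy; exact absurd (q1.trans q2.symm) At
            · subst hxy; exact absurd (q1.trans q2.symm) At
          exact hA (SameCycle.refl _ _)
        · exact not_sameCycle_swap θ x y hxy this As
      · intro At
        by_contra As
        have q := (Rs1 Bt x y).mp Bs
        have r := sameCycle_iff_joined' θ x y x' y' (by rwa [← hσs])
        have : SameCycle θ x' y' := by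
          rw [r, ← hσs]
          rcases q with q | ⟨q1, q2⟩ | ⟨q1, q2⟩
          · exact absurd q As
          · exact Or.inr (Or.inl ⟨q1.symm, q2.symm⟩)
          · exact Or.inr (Or.inr ⟨q2.symm, q1.symm⟩)
        by_cases hxy : x' = y'
        · have hA : ¬ SameCycle σs x' x' := by
            rcases q with q | ⟨q1, q2⟩ | ⟨q1, q2⟩
            · exact absurd q As
            · subst hxy; exact absurd (q1.trans q2.symm) As
            · subst hxy; exact absurd (q1.trans q2.symm) As
          exact hA (SameCycle.refl _ _)
        · exact not_sameCycle_swap θ x' y' hxy this At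
    by_cases As : SameCycle σs x y
    · have At := key.mp As
      simp [factor, As, At, Bs, Bt]
    · have At := fun h => As (key.mpr h)
      simp only [factor, if_neg As, if_neg At, if_pos Bs, if_pos Bt, mul_one]
      have hle : ∀ u v, SameCycle σs u v → SameCycle σ u v :=
        fun u v h => (Rs1 Bt u v).mpr (Or.inl h)
      have hx : SameCycle σ x x' := by
        rcases (Rs1 Bt x y).mp Bs with q | ⟨q1, q2⟩ | ⟨q1, q2⟩
        · exact absurd q As
        · exact hle _ _ q1
        · exact (hle _ _ q1).trans Bt.symm
      have hy : SameCycle σ y y' := Bs.symm.trans (hx.trans Bt)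
      linear_combination hk hx + hk hy
  · have As : ¬ SameCycle σs x y := fun h => Bs ((Rs1 Bt x y).mpr (Or.inl h))
    have At : SameCycle σt x' y' := (Rt2 Bs x' y').mpr (Or.inl Bt)
    simp [factor, As, At, Bs, Bt]
  · have At : ¬ SameCycle σt x' y' := fun h => Bt ((Rt1 Bs x' y').mpr (Or.inl h))
    have As : SameCycle σs x y := (Rs2 Bt x y).mpr (Or.inl Bs)
    simp [factor, As, At, Bs, Bt]
  · have a1 := Rs2 Bt x y
    have a2 := Rt2 Bs x' y'
    have hcase : (SameCycle σs x y ↔ SameCycle σt x' y') := by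
      rw [a1, a2]
      constructor
      · rintro (q | ⟨q1, q2⟩ | ⟨q1, q2⟩)
        · exact absurd q Bs
        · exact Or.inr (Or.inl ⟨q1.symm, q2.symm⟩)
        · exact Or.inr (Or.inr ⟨q2.symm, q1.symm⟩)
      · rintro (q | ⟨q1, q2⟩ | ⟨q1, q2⟩)
        · exact absurd q Bt
        · exact Or.inr (Or.inl ⟨q1.symm, q2.symm⟩)
        · exact Or.inr (Or.inr ⟨q2.symm, q1.symm⟩)
    by_cases As : SameCycle σs x y
    · have At := hcase.mp As
      simp only [factor, if_pos As, if_pos At, if_neg Bs, if_neg Bt, one_mul]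
      rcases a1.mp As with q | ⟨q1, q2⟩ | ⟨q1, q2⟩
      · exact absurd q Bs
      · linear_combination -hk q1 - hk q2
      · linear_combination -hk q1 - hk q2
    · have At := fun h => As (hcase.mpr h)
      simp only [factor, if_neg As, if_neg At, if_neg Bs, if_neg Bt]
      ring

/-- The two pairs have no point in common. -/
def Apart (p q : X × X) : Prop := p.1 ≠ q.1 ∧ p.1 ≠ q.2 ∧ p.2 ≠ q.1 ∧ p.2 ≠ q.2

theorem Apart.symm {p q : X × X} (h : Apart p q) : Apart q p :=
  ⟨h.1.symm, h.2.2.1.symm, h.2.1.symm, h.2.2.2.symm⟩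

theorem after_swap (θ : Perm X) (p q : X × X) (h : Apart p q) (L : List (X × X)) :
    after θ (p :: q :: L) = after θ (q :: p :: L) := by
  simp only [after]
  congr 1
  rw [mul_assoc, mul_assoc]
  congr 1
  apply Disjoint.commute
  intro z
  by_cases hz : z = p.1
  · subst hz; exact Or.inr (swap_apply_of_ne_of_ne h.1 h.2.1)
  by_cases hz' : z = p.2
  · subst hz'; exact Or.inr (swap_apply_of_ne_of_ne h.2.2.1 h.2.2.2)
  · exact Or.inl (swap_apply_of_ne_of_ne hz hz')

theorem prodFactor_perm (ξ : X → B) (hsq : ∀ u, ξ u * ξ u = 0) {L L' : List (X × X)}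
    (hp : L.Perm L') : ∀ θ : Perm X, L.Pairwise Apart →
    (∀ u v, SameCycle (after θ L) u v → ξ u = ξ v) →
    after θ L = after θ L' ∧ prodFactor ξ θ L = prodFactor ξ θ L' := by
  induction hp with
  | nil => intro θ _ _; exact ⟨rfl, rfl⟩
  | cons x _ ih =>
    intro θ hpw hc
    have := ih (θ * swap x.1 x.2) (List.pairwise_cons.mp hpw).2 hc
    exact ⟨this.1, by simp only [prodFactor, this.2]⟩
  | swap p q l =>
    intro θ hpw hc
    have hap : Apart q p := (List.pairwise_cons.mp hpw).1 p (by simp)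
    exact ⟨after_swap θ q p hap l,
      prodFactor_swap ξ hsq θ _ _ _ _ hap.1 hap.2.1 hap.2.2.1 hap.2.2.2 l hc⟩
  | trans h1 _ ih1 ih2 =>
    intro θ hpw hc
    have a := ih1 θ hpw hc
    have b := ih2 θ ((h1.pairwise_iff fun h => Apart.symm h).mp hpw) (by rwa [← a.1])
    exact ⟨a.1.trans b.1, a.2.trans b.2⟩

/-- The number of cycles (fixed points included). -/
def cycles (θ : Perm X) : ℕ := Nat.card (Quotient (SameCycle.setoid θ))

theorem card_joined (r r' : Setoid X) (x y : X) (hxy : ¬ r x y)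
    (h : ∀ u v, r' u v ↔ Joined r x y u v) :
    Nat.card (Quotient r) = Nat.card (Quotient r') + 1 := by
  classical
  have e : {q : Quotient r // q ≠ Quotient.mk r y} ≃ Quotient r' := by
    refine Equiv.ofBijective (fun q => Quotient.map' (s₁ := r) (s₂ := r') id
      (fun a b hab => (h a b).mpr (Or.inl hab)) q.1) ⟨?_, ?_⟩
    · rintro ⟨q1, h1⟩ ⟨q2, h2⟩ he
      induction q1 using Quotient.inductionOn with | _ a => ?_
      induction q2 using Quotient.inductionOn with | _ b => ?_
      have he' : r' a b := Quotient.exact he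
      rw [h] at he'
      apply Subtype.ext
      rcases he' with q | ⟨-, q⟩ | ⟨q, -⟩
      · exact Quotient.sound q
      · exact absurd (Quotient.sound q) h2
      · exact absurd (Quotient.sound q) h1
    · intro q
      induction q using Quotient.inductionOn with | _ a => ?_
      by_cases ha : r a y
      · refine ⟨⟨Quotient.mk r x, fun e => hxy (Quotient.exact e)⟩, ?_⟩
        refine Quotient.sound ((h x a).mpr (Or.inr (Or.inl ⟨r.refl x, ha⟩)))
      · exact ⟨⟨Quotient.mk r a, fun e => ha (Quotient.exact e)⟩, rfl⟩
  rw [← Nat.card_congr e]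
  have := Nat.card_congr (Equiv.sumCompl (fun q : Quotient r => q = Quotient.mk r y))
  rw [← this, Nat.card_sum, add_comm]
  congr 1
  simp

theorem homog_prodFactor {C : Type} (ξ : X → CircleAlg C) (hξ : ∀ u, (ξ u).Homog 1)
    (θ : Perm X) (L : List (X × X)) (hL : ∀ p ∈ L, p.1 ≠ p.2) :
    ∃ s, (prodFactor ξ θ L).Homog s ∧ cycles (after θ L) + L.length = cycles θ + 2 * s := by
  induction L generalizing θ with
  | nil => exact ⟨0, CircleAlg.Homog.one, by simp [after]⟩
  | cons p L ih =>
    obtain ⟨x, y⟩ := p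
    obtain ⟨s, h1, h2⟩ := ih (θ * swap x y) fun p hp => hL p (by simp [hp])
    have hxy : x ≠ y := hL (x, y) (by simp)
    by_cases hs : SameCycle (θ * swap x y) x y
    · refine ⟨s, ?_, ?_⟩
      · simpa [prodFactor, factor, hs] using h1
      · have : cycles θ = cycles (θ * swap x y) + 1 := by
          refine card_joined _ _ x y ?_ (fun u v => sameCycle_iff_joined θ x y u v hs)
          exact fun h => not_sameCycle_swap θ x y hxy h hs
        simp only [after, List.length_cons]
        omega
    · refine ⟨1 + s, ?_, ?_⟩
      · simp only [prodFactor, factor, if_neg hs]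
        exact ((hξ x).add (hξ y)).mul h1
      · have : cycles (θ * swap x y) = cycles θ + 1 :=
          card_joined _ _ x y hs (fun u v => sameCycle_iff_joined' θ x y u v hs)
        simp only [after, List.length_cons]
        omega

end Surgery

end

noncomputable section

set_option linter.unusedSectionVars false

open Relation

section Stages

variable {S X : Type}

/-- Two horizontal lines of points `up p` and `lo p`, each joined by the arcs of a matching `b`, next
to a diagram `R`. After surgery at the arcs with endpoints in `D`, the points `up p` and `lo p` are
joined for `p ∈ D`, and the arcs of `b` remain elsewhere. -/
def stage (R : X → X → Prop) (up lo : S → X) (b : S → S) (D : Set S) (x y : X) : Prop :=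
  R x y ∨ (∃ p ∈ D, x = up p ∧ y = lo p) ∨
    ∃ p ∉ D, (x = up p ∧ y = up (b p)) ∨ (x = lo p ∧ y = lo (b p))

open scoped Classical in
/-- The product of the factors of a sequence of saddles, one for each arc `p` of the list, where `ξ x` is
`X` at the circle through `x`. A saddle that merges two circles induces the multiplication of `A` and
contributes the factor `1`; a saddle that splits a circle in two induces the comultiplication
`f ↦ f · Δ(1)`, `Δ(1) = X ⊗ 1 + 1 ⊗ X`, and contributes the sum of the `X` of the two circles. -/
def saddles {B : Type*} [CommRing B] (R : X → X → Prop) (up lo : S → X) (b : S → S) (ξ : X → B) :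
    Set S → List S → B
  | _, [] => 1
  | D, p :: l =>
    (if EqvGen (stage R up lo b (insert p (insert (b p) D))) (up p) (up (b p)) then 1
      else ξ (up p) + ξ (up (b p))) * saddles R up lo b ξ (insert p (insert (b p) D)) l

theorem eqvGen_of_le {R R' : X → X → Prop} (h : ∀ x y, R x y → EqvGen R' x y) {x y : X}
    (hxy : EqvGen R x y) : EqvGen R' x y := by
  induction hxy with
  | rel x y hr => exact h x y hr
  | refl x => exact EqvGen.refl x
  | symm x y _ ih => exact ih.symm
  | trans x y z _ _ h1 h2 => exact h1.trans _ _ _ h2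

theorem eqvGen_map {Y : Type} {R : X → X → Prop} {R' : Y → Y → Prop} (f : X → Y)
    (h : ∀ x y, R x y → EqvGen R' (f x) (f y)) {x y : X}
    (hxy : EqvGen R x y) : EqvGen R' (f x) (f y) := by
  induction hxy with
  | rel x y hr => exact h x y hr
  | refl x => exact EqvGen.refl _
  | symm x y _ ih => exact ih.symm
  | trans x y z _ _ h1 h2 => exact h1.trans _ _ _ h2

theorem eqvGen_retract {Y : Type} {R : X → X → Prop} {R' : Y → Y → Prop} (f : X → Y) (s : Y → X)
    (h1 : ∀ x y, R x y → EqvGen R' (f x) (f y)) (h2 : ∀ x y, R' x y → EqvGen R (s x) (s y))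
    (h3 : ∀ x, EqvGen R x (s (f x))) (x y : X) :
    EqvGen R x y ↔ EqvGen R' (f x) (f y) :=
  ⟨eqvGen_map f h1, fun h =>
    ((h3 x).trans _ _ _ (eqvGen_map s h2 h)).trans _ _ _ (h3 y).symm⟩

theorem eqvGen_embed {Y : Type} {R : X → X → Prop} {R' : Y → Y → Prop} (f : X → Y)
    (hf : Function.Injective f)
    (h1 : ∀ x y, R x y → R' (f x) (f y))
    (h2 : ∀ x z, R' (f x) z → ∃ y, z = f y ∧ R x y)
    (h3 : ∀ x z, R' z (f x) → ∃ y, z = f y ∧ R y x) (x y : X) :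
    EqvGen R x y ↔ EqvGen R' (f x) (f y) := by
  refine ⟨eqvGen_map f fun x y h => EqvGen.rel _ _ (h1 x y h), fun h => ?_⟩
  have key : ∀ z z', EqvGen R' z z' → (∀ x, z = f x → ∃ y, z' = f y ∧ EqvGen R x y) ∧
      (∀ x, z' = f x → ∃ y, z = f y ∧ EqvGen R x y) := by
    intro z z' h
    induction h with
    | rel z z' hr =>
      constructor
      · rintro x rfl
        obtain ⟨y, rfl, h⟩ := h2 _ _ hr
        exact ⟨y, rfl, EqvGen.rel _ _ h⟩
      · rintro x rfl
        obtain ⟨y, rfl, h⟩ := h3 _ _ hr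
        exact ⟨y, rfl, (EqvGen.rel _ _ h).symm⟩
    | refl z => exact ⟨fun x hx => ⟨x, hx, EqvGen.refl _⟩, fun x hx => ⟨x, hx, EqvGen.refl _⟩⟩
    | symm z z' _ ih => exact ⟨ih.2, ih.1⟩
    | trans z z' z'' _ _ i1 i2 =>
      constructor
      · intro x hx
        obtain ⟨y, hy, h⟩ := i1.1 x hx
        obtain ⟨y', hy', h'⟩ := i2.1 y hy
        exact ⟨y', hy', h.trans _ _ _ h'⟩
      · intro x hx
        obtain ⟨y, hy, h⟩ := i2.2 x hx
        obtain ⟨y', hy', h'⟩ := i1.2 y hy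
        exact ⟨y', hy', h.trans _ _ _ h'⟩
  obtain ⟨y', hy', h'⟩ := (key _ _ h).1 x rfl
  rwa [hf hy']

theorem saddles_transfer {Y : Type} {B : Type*} [CommRing B] {R : X → X → Prop}
    {R' : Y → Y → Prop} {up lo : S → X} {up' lo' : S → Y} {b : S → S} {ξ : X → B} {ξ' : Y → B}
    (h : ∀ D p q, EqvGen (stage R up lo b D) (up p) (up q) ↔
      EqvGen (stage R' up' lo' b D) (up' p) (up' q))
    (hξ : ∀ p, ξ (up p) = ξ' (up' p)) (D : Set S) (l : List S) :
    saddles R up lo b ξ D l = saddles R' up' lo' b ξ' D l := by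
  induction l generalizing D with
  | nil => rfl
  | cons p l ih =>
    simp only [saddles, ih, hξ]
    congr 1
    by_cases hc : EqvGen (stage R up lo b (insert p (insert (b p) D))) (up p) (up (b p))
    · rw [if_pos hc, if_pos ((h _ _ _).mp hc)]
    · rw [if_neg hc, if_neg fun h' => hc ((h _ _ _).mpr h')]

theorem saddles_map {B B' : Type*} [CommRing B] [CommRing B'] (φ : B →+* B') (R : X → X → Prop)
    (up lo : S → X) (b : S → S) (ξ : X → B) (D : Set S) (l : List S) :
    φ (saddles R up lo b ξ D l) = saddles R up lo b (fun x => φ (ξ x)) D l := by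
  induction l generalizing D with
  | nil => simp [saddles]
  | cons p l ih =>
    simp only [saddles, map_mul, ih]
    congr 1
    split_ifs <;> simp

theorem saddles_congr_mul {B : Type*} [CommRing B] {K : B} (R : X → X → Prop)
    (up lo : S → X) (b : S → S) (ξ ξ' : X → B) (h : ∀ p, ξ (up p) * K = ξ' (up p) * K)
    (D : Set S) (l : List S) :
    saddles R up lo b ξ D l * K = saddles R up lo b ξ' D l * K := by
  induction l generalizing D with
  | nil => rfl
  | cons p l ih =>
    simp only [saddles]
    rw [mul_assoc, ih]
    split_ifs
    · ring
    · linear_combination (h p + h (b p)) * saddles R up lo b ξ' (insert p (insert (b p) D)) l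

theorem saddles_eq_one {B : Type*} [CommRing B] {R : X → X → Prop}
    {up lo : S → X} {b : S → S} {ξ : X → B}
    (h : ∀ D p, p ∈ D → b p ∈ D → EqvGen (stage R up lo b D) (up p) (up (b p)))
    (D : Set S) (l : List S) : saddles R up lo b ξ D l = 1 := by
  induction l generalizing D with
  | nil => rfl
  | cons p l ih =>
    simp only [saddles, ih]
    rw [if_pos (h _ _ (by simp) (by simp)), one_mul]

open Equiv Equiv.Perm

/-- The permutation `θ` follows the arcs of `R` along an orientation, and leaves the points of `N` by
other arcs. -/
def IsFlow (θ : Perm X) (R : X → X → Prop) (N : Set X) : Prop :=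
  (∀ z ∉ N, R z (θ z) ∨ R (θ z) z) ∧
    ∀ z z', R z z' → (z ∉ N ∧ z' = θ z) ∨ (z' ∉ N ∧ z = θ z')

/-- Conditions on a pair of lines of points with a matching and a two-colouring of the points. -/
structure IsLayer (up lo : S → X) (b : S → S) (ps : S → Prop) : Prop where
  invol : ∀ p, b (b p) = p
  flip : ∀ p, ps (b p) ↔ ¬ ps p
  up_inj : Function.Injective up
  lo_inj : Function.Injective lo
  up_ne_lo : ∀ p q, up p ≠ lo q

/-- The points that are left by arcs of the matching. -/
def exits (up lo : S → X) (ps : S → Prop) : Set X :=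
  {x | (∃ p, ¬ ps p ∧ x = up p) ∨ ∃ p, ps p ∧ x = lo p}

open scoped Classical in
/-- `θ'` is obtained from `θ` by the surgeries in `D`. -/
structure SurgeryState (up lo : S → X) (b : S → S) (ps : S → Prop) (θ θ' : Perm X) (D : Set S) :
    Prop where
  up_eq : ∀ p, ¬ ps p → θ' (up p) = if p ∈ D then lo p else up (b p)
  lo_eq : ∀ p, ps p → θ' (lo p) = if p ∈ D then up p else lo (b p)
  other : ∀ z ∉ exits up lo ps, θ' z = θ z

variable {up lo : S → X} {b : S → S} {ps : S → Prop}

theorem SurgeryState.zero {θ : Perm X} (h1 : ∀ p, ¬ ps p → θ (up p) = up (b p))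
    (h2 : ∀ p, ps p → θ (lo p) = lo (b p)) : SurgeryState up lo b ps θ θ ∅ :=
  ⟨fun p hp => by simp [h1 p hp], fun p hp => by simp [h2 p hp], fun _ _ => rfl⟩

theorem SurgeryState.rep (hl : IsLayer up lo b ps) {θ θ' : Perm X} {D : Set S} {R : X → X → Prop}
    {N : Set X} (hR : IsFlow θ R (N ∪ exits up lo ps)) (hs : SurgeryState up lo b ps θ θ' D)
    (hD : ∀ p ∈ D, b p ∈ D) (hN : ∀ x ∈ N, x ∉ exits up lo ps) :
    IsFlow θ' (stage R up lo b D) N := by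
  have hD' : ∀ p ∉ D, b p ∉ D := fun p hp h => hp (by simpa [hl.invol] using hD _ h)
  have hup : ∀ p, ¬ ps p → up p ∉ N := fun p hp h => hN _ h (Or.inl ⟨p, hp, rfl⟩)
  have hlo : ∀ p, ps p → lo p ∉ N := fun p hp h => hN _ h (Or.inr ⟨p, hp, rfl⟩)
  constructor
  · intro z hz
    by_cases he : z ∈ exits up lo ps
    · rcases he with ⟨p, hp, rfl⟩ | ⟨p, hp, rfl⟩
      · rw [hs.up_eq p hp]
        by_cases hpD : p ∈ D
        · rw [if_pos hpD]; exact Or.inl (Or.inr (Or.inl ⟨p, hpD, rfl, rfl⟩))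
        · rw [if_neg hpD]; exact Or.inl (Or.inr (Or.inr ⟨p, hpD, Or.inl ⟨rfl, rfl⟩⟩))
      · rw [hs.lo_eq p hp]
        by_cases hpD : p ∈ D
        · rw [if_pos hpD]; exact Or.inr (Or.inr (Or.inl ⟨p, hpD, rfl, rfl⟩))
        · rw [if_neg hpD]; exact Or.inl (Or.inr (Or.inr ⟨p, hpD, Or.inr ⟨rfl, rfl⟩⟩))
    · rw [hs.other z he]
      exact (hR.1 z (by simp [hz, he])).imp Or.inl Or.inl
  · rintro z z' (h | ⟨p, hp, rfl, rfl⟩ | ⟨p, hp, ⟨rfl, rfl⟩ | ⟨rfl, rfl⟩⟩)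
    · rcases hR.2 z z' h with ⟨h1, h2⟩ | ⟨h1, h2⟩
      · simp only [Set.mem_union, not_or] at h1
        exact Or.inl ⟨h1.1, by rw [hs.other z h1.2, h2]⟩
      · simp only [Set.mem_union, not_or] at h1
        exact Or.inr ⟨h1.1, by rw [hs.other z' h1.2, h2]⟩
    · by_cases hpp : ps p
      · exact Or.inr ⟨hlo p hpp, by rw [hs.lo_eq p hpp, if_pos hp]⟩
      · exact Or.inl ⟨hup p hpp, by rw [hs.up_eq p hpp, if_pos hp]⟩
    · by_cases hpp : ps p
      · have : ¬ ps (b p) := by rw [hl.flip]; simpa using hpp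
        exact Or.inr ⟨hup _ this, by rw [hs.up_eq _ this, if_neg (hD' p hp), hl.invol]⟩
      · exact Or.inl ⟨hup p hpp, by rw [hs.up_eq p hpp, if_neg hp]⟩
    · by_cases hpp : ps p
      · exact Or.inl ⟨hlo p hpp, by rw [hs.lo_eq p hpp, if_neg hp]⟩
      · have : ps (b p) := by rw [hl.flip]; simpa using hpp
        exact Or.inr ⟨hlo _ this, by rw [hs.lo_eq _ this, if_neg (hD' p hp), hl.invol]⟩

theorem IsFlow.eqvGen_iff [Finite X] {θ : Perm X} {R : X → X → Prop} (h : IsFlow θ R ∅) (x y : X) :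
    EqvGen R x y ↔ SameCycle θ x y := by
  constructor
  · intro hxy
    induction hxy with
    | rel x y hr =>
      rcases h.2 x y hr with ⟨-, rfl⟩ | ⟨-, rfl⟩
      · simp [SameCycle.refl]
      · simp [SameCycle.refl]
    | refl x => exact SameCycle.refl _ _
    | symm x y _ ih => exact ih.symm
    | trans x y z _ _ h1 h2 => exact h1.trans h2
  · intro hxy
    have : Fintype X := Fintype.ofFinite X
    classical
    obtain ⟨m, -, -, rfl⟩ := hxy.exists_pow_eq
    clear hxy
    induction m with
    | zero => exact EqvGen.refl _
    | succ m ih =>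
      refine ih.trans _ _ _ ?_
      rw [pow_succ', Perm.mul_apply]
      rcases h.1 ((θ ^ m) x) (by simp) with h | h
      · exact EqvGen.rel _ _ h
      · exact (EqvGen.rel _ _ h).symm

open scoped Classical in
/-- The pair of points at which the surgery along the arc of `p` is done. -/
def arcPair (up lo : S → X) (b : S → S) (ps : S → Prop) (p : S) : X × X :=
  if ps p then (up (b p), lo p) else (up p, lo (b p))

variable [DecidableEq X]

theorem SurgeryState.step (hl : IsLayer up lo b ps) {θ θ' : Perm X} {D : Set S}
    (hs : SurgeryState up lo b ps θ θ' D) (hD : ∀ p ∈ D, b p ∈ D) {p : S} (hp : p ∉ D) :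
    SurgeryState up lo b ps θ (θ' * swap (arcPair up lo b ps p).1 (arcPair up lo b ps p).2)
      (insert p (insert (b p) D)) := by
  classical
  -- reduce to `p` negative
  wlog hpp : ¬ ps p generalizing p
  · have hb : ¬ ps (b p) := by rw [hl.flip]; exact hpp
    have := this (p := b p) (fun h => hp (by simpa [hl.invol] using hD _ h)) hb
    have e : arcPair up lo b ps (b p) = arcPair up lo b ps p := by
      rw [not_not] at hpp
      simp [arcPair, hpp, hb, hl.invol]
    rw [e, hl.invol, Set.insert_comm] at this
    exact this
  have hbp : ps (b p) := by rw [hl.flip]; exact hpp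
  have hbD : b p ∉ D := fun h => hp (by simpa [hl.invol] using hD _ h)
  have e : arcPair up lo b ps p = (up p, lo (b p)) := by simp [arcPair, hpp]
  rw [e]
  constructor
  · intro q hq
    by_cases hqp : q = p
    · subst hqp
      rw [Perm.mul_apply, swap_apply_left, hs.lo_eq _ hbp, if_neg hbD, hl.invol, if_pos (by simp)]
    · have hqb : q ≠ b p := by rintro rfl; exact hq hbp
      rw [Perm.mul_apply, swap_apply_of_ne_of_ne (fun h => hqp (hl.up_inj h)) (hl.up_ne_lo _ _),
        hs.up_eq q hq]
      simp [hqp, hqb]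
  · intro q hq
    by_cases hqp : q = b p
    · subst hqp
      rw [Perm.mul_apply, swap_apply_right, hs.up_eq _ hpp, if_neg hp, if_pos (by simp)]
    · have hqb : q ≠ p := by rintro rfl; exact hpp hq
      rw [Perm.mul_apply, swap_apply_of_ne_of_ne (hl.up_ne_lo _ _).symm
        (fun h => hqp (hl.lo_inj h)), hs.lo_eq q hq]
      simp [hqp, hqb]
  · intro z hz
    rw [Perm.mul_apply, swap_apply_of_ne_of_ne, hs.other z hz]
    · rintro rfl; exact hz (Or.inl ⟨p, hpp, rfl⟩)
    · rintro rfl; exact hz (Or.inr ⟨b p, hbp, rfl⟩)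

open Surgery

theorem SurgeryState.list (hl : IsLayer up lo b ps) {θ : Perm X} (l : List S) :
    ∀ {θ' : Perm X} {D : Set S}, SurgeryState up lo b ps θ θ' D → (∀ p ∈ D, b p ∈ D) →
    (∀ p ∈ l, p ∉ D) → l.Pairwise (fun p q => p ≠ q ∧ b p ≠ q) →
    SurgeryState up lo b ps θ (after θ' (l.map (arcPair up lo b ps)))
      (D ∪ {q | q ∈ l ∨ b q ∈ l}) := by
  induction l with
  | nil => intro θ' D hs _ _ _; simpa [after] using hs
  | cons p l ih =>
    intro θ' D hs hD hlD hpw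
    have h1 := hs.step hl hD (hlD p (by simp))
    rw [List.pairwise_cons] at hpw
    have h2 := ih h1 ?_ ?_ hpw.2
    · simp only [List.map_cons, after]
      convert h2 using 1
      ext q
      simp only [Set.mem_union, Set.mem_ofPred_eq, Set.mem_insert_iff, List.mem_cons]
      have : b q = p ↔ q = b p := ⟨fun h => by rw [← h, hl.invol], fun h => by rw [h, hl.invol]⟩
      tauto
    · rintro q (rfl | rfl | hq)
      · simp
      · simp [hl.invol]
      · exact Or.inr (Or.inr (hD q hq))
    · rintro q hq (rfl | rfl | h)
      · exact (hpw.1 _ hq).1 rfl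
      · exact (hpw.1 _ hq).2 rfl
      · exact hlD q (by simp [hq]) h

theorem saddles_eq_prodFactor [Finite X] {B : Type*} [CommRing B] (hl : IsLayer up lo b ps)
    {θ : Perm X} {R : X → X → Prop} (hR : IsFlow θ R (exits up lo ps)) {ξ : X → B}
    (hξ : ∀ p, ξ (lo p) = ξ (up p)) (l : List S) :
    ∀ {θ' : Perm X} {D : Set S}, SurgeryState up lo b ps θ θ' D → (∀ p ∈ D, b p ∈ D) →
    (∀ p ∈ l, p ∉ D) → l.Pairwise (fun p q => p ≠ q ∧ b p ≠ q) →
    saddles R up lo b ξ D l = prodFactor ξ θ' (l.map (arcPair up lo b ps)) := by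
  induction l with
  | nil => intro θ' D hs _ _ _; rfl
  | cons p l ih =>
    intro θ' D hs hD hlD hpw
    have h1 := hs.step hl hD (hlD p (by simp))
    rw [List.pairwise_cons] at hpw
    have hD' : ∀ q ∈ insert p (insert (b p) D), b q ∈ insert p (insert (b p) D) := by
      rintro q (rfl | rfl | hq)
      · simp
      · simp [hl.invol]
      · exact Or.inr (Or.inr (hD q hq))
    have h2 := ih h1 hD' ?_ hpw.2
    · simp only [List.map_cons, saddles, prodFactor, h2]
      congr 1
      have hrep := h1.rep hl (N := ∅) (by simpa using hR) hD' (by simp)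
      have hu : ∀ q, EqvGen (stage R up lo b (insert p (insert (b p) D))) (up q) (lo q) ∨
          q ∉ (insert p (insert (b p) D)) := by
        intro q
        by_cases hq : q ∈ insert p (insert (b p) D)
        · exact Or.inl (EqvGen.rel _ _ (Or.inr (Or.inl ⟨q, hq, rfl, rfl⟩)))
        · exact Or.inr hq
      have hup := (hu p).resolve_right (by simp)
      have hub := (hu (b p)).resolve_right (by simp)
      have hcond : EqvGen (stage R up lo b (insert p (insert (b p) D))) (up p) (up (b p)) ↔
          SameCycle (θ' * swap (arcPair up lo b ps p).1 (arcPair up lo b ps p).2)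
            (arcPair up lo b ps p).1 (arcPair up lo b ps p).2 := by
        rw [← hrep.eqvGen_iff]
        by_cases hpp : ps p
        · simp only [arcPair, if_pos hpp]
          exact ⟨fun h => h.symm.trans _ _ _ hup, fun h => (h.trans _ _ _ hup.symm).symm⟩
        · simp only [arcPair, if_neg hpp]
          exact ⟨fun h => h.trans _ _ _ hub, fun h => h.trans _ _ _ hub.symm⟩
      unfold factor
      by_cases hc : EqvGen (stage R up lo b (insert p (insert (b p) D))) (up p) (up (b p))
      · rw [if_pos hc, if_pos (hcond.mp hc)]
      · rw [if_neg hc, if_neg fun h' => hc (hcond.mpr h')]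
        by_cases hpp : ps p
        · simp only [arcPair, if_pos hpp, hξ, add_comm]
        · simp only [arcPair, if_neg hpp, hξ]
    · rintro q hq (rfl | rfl | h)
      · exact (hpw.1 _ hq).1 rfl
      · exact (hpw.1 _ hq).2 rfl
      · exact hlD q (by simp [hq]) h

theorem arcPair_mem (hl : IsLayer up lo b ps) (p : S) :
    (arcPair up lo b ps p).1 ∈ exits up lo ps ∧ (arcPair up lo b ps p).2 ∈ exits up lo ps := by
  by_cases hpp : ps p
  · have : ¬ ps (b p) := by rw [hl.flip]; simpa using hpp
    simp only [arcPair, if_pos hpp]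
    exact ⟨Or.inl ⟨_, this, rfl⟩, Or.inr ⟨_, hpp, rfl⟩⟩
  · have : ps (b p) := by rw [hl.flip]; simpa using hpp
    simp only [arcPair, if_neg hpp]
    exact ⟨Or.inl ⟨_, hpp, rfl⟩, Or.inr ⟨_, this, rfl⟩⟩

theorem arcPair_ne (hl : IsLayer up lo b ps) (p : S) :
    (arcPair up lo b ps p).1 ≠ (arcPair up lo b ps p).2 := by
  unfold arcPair
  split_ifs <;> exact hl.up_ne_lo _ _

theorem arcPair_apart (hl : IsLayer up lo b ps) {p q : S} (h : p ≠ q ∧ b p ≠ q) :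
    Apart (arcPair up lo b ps p) (arcPair up lo b ps q) := by
  have h' : p ≠ b q := fun e => h.2 (by rw [e, hl.invol])
  have h'' : b p ≠ b q := fun e => h.1 (by rw [← hl.invol p, e, hl.invol])
  have i1 := fun {x y} => hl.up_inj.ne_iff (x := x) (y := y)
  have i2 := fun {x y} => hl.lo_inj.ne_iff (x := x) (y := y)
  have i3 := hl.up_ne_lo
  unfold arcPair Apart
  split_ifs <;> refine ⟨?_, ?_, ?_, ?_⟩ <;>
    first
      | exact i3 _ _
      | exact (i3 _ _).symm
      | exact i1.mpr (by assumption)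
      | exact i2.mpr (by assumption)
      | exact i1.mpr h.1
      | exact i2.mpr h.1
      | exact i1.mpr h.2
      | exact i2.mpr h.2

theorem map_arcPair_pairwise (hl : IsLayer up lo b ps) {l : List S}
    (h : l.Pairwise (fun p q => p ≠ q ∧ b p ≠ q)) :
    (l.map (arcPair up lo b ps)).Pairwise Apart := by
  rw [List.pairwise_map]
  exact h.imp fun h => arcPair_apart hl h

/-- Surgery along two disjoint families of arcs can be done in either order. -/
theorem two_layers [Finite X] {B : Type*} [CommRing B] {S' : Type} {up' lo' : S' → X}
    {b' : S' → S'} {ps' : S' → Prop}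
    (hl : IsLayer up lo b ps) (hl' : IsLayer up' lo' b' ps')
    (hdisj : ∀ x ∈ exits up lo ps, x ∉ exits up' lo' ps')
    {θ : Perm X} {R : X → X → Prop} (hR : IsFlow θ R (exits up lo ps ∪ exits up' lo' ps'))
    (h1 : ∀ p, ¬ ps p → θ (up p) = up (b p)) (h2 : ∀ p, ps p → θ (lo p) = lo (b p))
    (h1' : ∀ p, ¬ ps' p → θ (up' p) = up' (b' p)) (h2' : ∀ p, ps' p → θ (lo' p) = lo' (b' p))
    {ξ : X → B} (hsq : ∀ u, ξ u * ξ u = 0)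
    (hξ : ∀ u v, stage (stage R up lo b Set.univ) up' lo' b' Set.univ u v → ξ u = ξ v)
    {l : List S} {l' : List S'}
    (hlp : l.Pairwise (fun p q => p ≠ q ∧ b p ≠ q)) (hlu : ∀ q, q ∈ l ∨ b q ∈ l)
    (hlp' : l'.Pairwise (fun p q => p ≠ q ∧ b' p ≠ q)) (hlu' : ∀ q, q ∈ l' ∨ b' q ∈ l') :
    (saddles (stage R up' lo' b' ∅) up lo b ξ ∅ l *
        saddles (stage R up lo b Set.univ) up' lo' b' ξ ∅ l' =
      saddles (stage R up lo b ∅) up' lo' b' ξ ∅ l' *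
        saddles (stage R up' lo' b' Set.univ) up lo b ξ ∅ l) ∧
    (∀ u v, EqvGen (stage (stage R up lo b Set.univ) up' lo' b' ∅) u v →
      ξ u * saddles (stage R up lo b Set.univ) up' lo' b' ξ ∅ l' =
      ξ v * saddles (stage R up lo b Set.univ) up' lo' b' ξ ∅ l') ∧
    (∀ u v, EqvGen (stage (stage R up' lo' b' Set.univ) up lo b ∅) u v →
      ξ u * saddles (stage R up' lo' b' Set.univ) up lo b ξ ∅ l =
      ξ v * saddles (stage R up' lo' b' Set.univ) up lo b ξ ∅ l) := by
  have hdisj' : ∀ x ∈ exits up' lo' ps', x ∉ exits up lo ps := fun x h h' => hdisj x h' h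
  have hξ1 : ∀ p, ξ (lo p) = ξ (up p) := fun p =>
    (hξ _ _ (Or.inl (Or.inr (Or.inl ⟨p, by simp, rfl, rfl⟩)))).symm
  have hξ2 : ∀ p, ξ (lo' p) = ξ (up' p) := fun p =>
    (hξ _ _ (Or.inr (Or.inl ⟨p, by simp, rfl, rfl⟩))).symm
  have s1 : SurgeryState up lo b ps θ θ ∅ := SurgeryState.zero h1 h2
  have s2 : SurgeryState up' lo' b' ps' θ θ ∅ := SurgeryState.zero h1' h2'
  have hR' : IsFlow θ R (exits up' lo' ps' ∪ exits up lo ps) := by rwa [Set.union_comm]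
  -- first layer done
  have t1 := s1.list hl l (by simp) (by simp) hlp
  have t2 := s2.list hl' l' (by simp) (by simp) hlp'
  have hu : (∅ ∪ {q | q ∈ l ∨ b q ∈ l} : Set S) = Set.univ := by
    ext q; simpa using hlu q
  have hu' : (∅ ∪ {q | q ∈ l' ∨ b' q ∈ l'} : Set S') = Set.univ := by
    ext q; simpa using hlu' q
  rw [hu] at t1
  rw [hu'] at t2
  set L := l.map (arcPair up lo b ps) with hL
  set L' := l'.map (arcPair up' lo' b' ps') with hL'
  have r1 : IsFlow (after θ L) (stage R up lo b Set.univ) (exits up' lo' ps') :=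
    t1.rep hl hR' (by simp) hdisj'
  have r2 : IsFlow (after θ L') (stage R up' lo' b' Set.univ) (exits up lo ps) :=
    t2.rep hl' hR (by simp) hdisj
  have r01 : IsFlow θ (stage R up lo b ∅) (exits up' lo' ps') := s1.rep hl hR' (by simp) hdisj'
  have r02 : IsFlow θ (stage R up' lo' b' ∅) (exits up lo ps) := s2.rep hl' hR (by simp) hdisj
  have s12 : SurgeryState up' lo' b' ps' (after θ L) (after θ L) ∅ := by
    refine SurgeryState.zero (fun p hp => ?_) (fun p hp => ?_)
    · rw [t1.other _ (hdisj' _ (Or.inl ⟨p, hp, rfl⟩)), h1' p hp]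
    · rw [t1.other _ (hdisj' _ (Or.inr ⟨p, hp, rfl⟩)), h2' p hp]
  have s21 : SurgeryState up lo b ps (after θ L') (after θ L') ∅ := by
    refine SurgeryState.zero (fun p hp => ?_) (fun p hp => ?_)
    · rw [t2.other _ (hdisj _ (Or.inl ⟨p, hp, rfl⟩)), h1 p hp]
    · rw [t2.other _ (hdisj _ (Or.inr ⟨p, hp, rfl⟩)), h2 p hp]
  have e1 := saddles_eq_prodFactor hl r02 hξ1 l s1 (by simp) (by simp) hlp
  have e2 := saddles_eq_prodFactor hl' r1 hξ2 l' s12 (by simp) (by simp) hlp'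
  have e3 := saddles_eq_prodFactor hl' r01 hξ2 l' s2 (by simp) (by simp) hlp'
  have e4 := saddles_eq_prodFactor hl r2 hξ1 l s21 (by simp) (by simp) hlp
  -- the final permutation
  have f1 := s12.list hl' l' (by simp) (by simp) hlp'
  rw [hu'] at f1
  have rf := f1.rep hl' (N := ∅) (by simpa using r1) (by simp) (by simp)
  have hcomp : ∀ u v, SameCycle (after (after θ L) L') u v → ξ u = ξ v := by
    intro u v huv
    rw [← rf.eqvGen_iff] at huv
    induction huv with
    | rel x y hr => exact hξ x y hr
    | refl x => rfl
    | symm x y _ ih => exact ih.symm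
    | trans x y z _ _ h1 h2 => exact h1.trans h2
  have hpw : (L ++ L').Pairwise Apart := by
    rw [List.pairwise_append]
    refine ⟨map_arcPair_pairwise hl hlp, map_arcPair_pairwise hl' hlp', ?_⟩
    intro x hx y hy
    rw [hL, List.mem_map] at hx
    rw [hL', List.mem_map] at hy
    obtain ⟨p, -, rfl⟩ := hx
    obtain ⟨q, -, rfl⟩ := hy
    have hp := arcPair_mem hl p
    have hq := arcPair_mem hl' q
    exact ⟨fun e => hdisj _ hp.1 (e ▸ hq.1), fun e => hdisj _ hp.1 (e ▸ hq.2),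
      fun e => hdisj _ hp.2 (e ▸ hq.1), fun e => hdisj _ hp.2 (e ▸ hq.2)⟩
  have main := prodFactor_perm ξ hsq (List.perm_append_comm (l₁ := L) (l₂ := L')) θ hpw
    (by rw [after_append]; exact hcomp)
  rw [prodFactor_append, prodFactor_append, after_append, after_append] at main
  refine ⟨by rw [e1, e2, e3, e4]; exact main.2, ?_, ?_⟩
  · intro u v huv
    have := s12.rep hl' (N := ∅) (by simpa using r1) (by simp) (by simp)
    rw [this.eqvGen_iff] at huv
    rw [e2]
    exact kill ξ hsq _ _ hcomp huv
  · intro u v huv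
    have := s21.rep hl (N := ∅) (by simpa using r2) (by simp) (by simp)
    rw [this.eqvGen_iff] at huv
    rw [e4]
    exact kill ξ hsq _ _ (by rw [← main.1]; exact hcomp) huv

end Stages

end

noncomputable section

set_option linter.unusedSectionVars false

open Relation Equiv Equiv.Perm

/-- Admissible sequences: `0 ≤ w_i ≤ 2` and `∑ w_i = 2 k`. -/
def Admissible (n k : ℕ) (w : Fin n → ℤ) : Prop :=
  (∀ i, 0 ≤ w i ∧ w i ≤ 2) ∧ ∑ i, w i = 2 * (k : ℤ)

/-- Admissible weights. -/
def Weight (n k : ℕ) : Type := {w : Fin n → ℤ // Admissible n k w}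

variable {n k : ℕ}

/-- The positions of the 1s of a weight. -/
abbrev Ones (w : Weight n k) : Type := {p : Fin n // w.1 p = 1}

/-- Crossingless matchings of the positions of the 1s. -/
structure Matching (w : Weight n k) where
  toFun : Ones w → Ones w
  invol : ∀ p, toFun (toFun p) = p
  ne : ∀ p, toFun p ≠ p
  noncrossing : ∀ p q, p < q → q < toFun p → p < toFun q ∧ toFun q < toFun p

theorem Matching.toFun_injective (w : Weight n k) :
    Function.Injective (Matching.toFun : Matching w → _) := by
  rintro ⟨f, _, _, _⟩ ⟨g, _, _, _⟩ h
  cases h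
  rfl

instance (w : Weight n k) : Finite (Matching w) :=
  Finite.of_injective _ (Matching.toFun_injective w)

instance (w : Weight n k) : Fintype (Matching w) := Fintype.ofFinite _

/-- The arcs of `b`, given by their left endpoints. -/
def Matching.arcs {w : Weight n k} (b : Matching w) : List (Ones w) :=
  (Finset.univ.filter fun p => p < b.toFun p).sort (· ≤ ·)

theorem Matching.mem_arcs {w : Weight n k} (b : Matching w) (p : Ones w) :
    p ∈ b.arcs ↔ p < b.toFun p := by
  simp [Matching.arcs]

theorem Matching.arcs_pairwise {w : Weight n k} (b : Matching w) :
    b.arcs.Pairwise (fun p q => p ≠ q ∧ b.toFun p ≠ q) := by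
  have h : b.arcs.Nodup := Finset.sort_nodup _ _
  refine List.Pairwise.imp_of_mem ?_ h
  intro p q hp hq hne
  refine ⟨hne, ?_⟩
  rintro rfl
  rw [Matching.mem_arcs] at hp hq
  rw [b.invol] at hq
  exact lt_asymm hp hq

theorem Matching.arcs_cover {w : Weight n k} (b : Matching w) (p : Ones w) :
    p ∈ b.arcs ∨ b.toFun p ∈ b.arcs := by
  rw [Matching.mem_arcs, Matching.mem_arcs, b.invol]
  exact lt_or_gt_of_ne (b.ne p).symm

theorem Matching.two_mul_length {w : Weight n k} (b : Matching w) :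
    2 * b.arcs.length = Fintype.card (Ones w) := by
  have h1 : b.arcs.length = (Finset.univ.filter fun p => p < b.toFun p).card := by
    simp [Matching.arcs]
  have h2 : (Finset.univ.filter fun p => p < b.toFun p).card =
      (Finset.univ.filter fun p => ¬ p < b.toFun p).card := by
    refine Finset.card_nbij' b.toFun b.toFun ?_ ?_ ?_ ?_
    · intro p hp
      simp only [Finset.coe_filter, Finset.mem_univ, true_and, Set.mem_ofPred_eq] at hp ⊢
      rw [b.invol]; exact not_lt_of_gt hp
    · intro p hp
      simp only [Finset.coe_filter, Finset.mem_univ, true_and, Set.mem_ofPred_eq] at hp ⊢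
      rw [b.invol]
      exact lt_of_le_of_ne (not_lt.mp hp) (b.ne p)
    · intro p _; exact b.invol p
    · intro p _; exact b.invol p
  have h3 := Finset.card_filter_add_card_filter_not (s := (Finset.univ : Finset (Ones w)))
    (fun p => p < b.toFun p)
  rw [Finset.card_univ] at h3
  omega

/-- A position is positive if it has an even number of 1s to its left. -/
def Positive (w : Weight n k) (p : Fin n) : Prop := Even (∑ q ∈ Finset.Iio p, w.1 q)

theorem even_of_paired {w : Weight n k} (b : Matching w) (s : Finset (Fin n))
    (h : ∀ p : Ones w, p.1 ∈ s → (b.toFun p).1 ∈ s) : Even (∑ q ∈ s, w.1 q) := by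
  classical
  have h2 : ((∑ q ∈ s, w.1 q : ℤ) : ZMod 2) = 0 := by
    push_cast
    refine Finset.sum_involution
      (fun q _ => if hq : w.1 q = 1 then (b.toFun ⟨q, hq⟩).1 else q) ?_ ?_ ?_ ?_
    · intro q _
      by_cases hq : w.1 q = 1
      · simp only [hq, dif_pos, (b.toFun ⟨q, hq⟩).2]
        decide
      · simp only [hq, dif_neg, not_false_eq_true]
        have := w.2.1 q
        have h02 : w.1 q = 0 ∨ w.1 q = 2 := by omega
        rcases h02 with h | h <;> rw [h] <;> decide
    · intro q _ hne
      by_cases hq : w.1 q = 1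
      · simp only [hq, dif_pos]
        exact fun e => b.ne ⟨q, hq⟩ (Subtype.ext e)
      · exfalso
        apply hne
        have := w.2.1 q
        have h02 : w.1 q = 0 ∨ w.1 q = 2 := by omega
        rcases h02 with h | h <;> rw [h] <;> decide
    · intro q hq'
      by_cases hq : w.1 q = 1
      · simp only [hq, dif_pos]
        exact h ⟨q, hq⟩ hq'
      · simpa only [hq, dif_neg, not_false_eq_true] using hq'
    · intro q _
      by_cases hq : w.1 q = 1
      · simp only [hq, dif_pos, (b.toFun ⟨q, hq⟩).2, Subtype.coe_eta, b.invol]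
      · simp only [hq, dif_neg, not_false_eq_true]
  rw [ZMod.intCast_eq_zero_iff_even] at h2
  exact h2

theorem Matching.flip {w : Weight n k} (b : Matching w) (p : Ones w) :
    Positive w (b.toFun p).1 ↔ ¬ Positive w p.1 := by
  wlog h : p < b.toFun p generalizing p
  · have hlt : b.toFun p < b.toFun (b.toFun p) := by
      rw [b.invol]; exact lt_of_le_of_ne (not_lt.mp h) (b.ne p)
    have := this (b.toFun p) hlt
    rw [b.invol] at this
    tauto
  · have hlt : p.1 < (b.toFun p).1 := h
    have e1 : Finset.Iio (b.toFun p).1 = Finset.Iio p.1 ∪ ({p.1} ∪ Finset.Ioo p.1 (b.toFun p).1) := by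
      ext q
      simp only [Finset.mem_Iio, Finset.mem_union, Finset.mem_singleton, Finset.mem_Ioo]
      constructor
      · intro hq
        rcases lt_trichotomy q p.1 with h1 | h1 | h1
        · exact Or.inl h1
        · exact Or.inr (Or.inl h1)
        · exact Or.inr (Or.inr ⟨h1, hq⟩)
      · rintro (h1 | rfl | h1)
        · exact h1.trans hlt
        · exact hlt
        · exact h1.2
    have e2 : ∑ q ∈ Finset.Iio (b.toFun p).1, w.1 q =
        ∑ q ∈ Finset.Iio p.1, w.1 q + (1 + ∑ q ∈ Finset.Ioo p.1 (b.toFun p).1, w.1 q) := by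
      rw [e1, Finset.sum_union, Finset.sum_union, Finset.sum_singleton, p.2]
      · simp
      · rw [Finset.disjoint_left]
        intro q hq
        simp only [Finset.mem_Iio, Finset.mem_union, Finset.mem_singleton, Finset.mem_Ioo] at hq ⊢
        rintro (rfl | h')
        · exact lt_irrefl _ hq
        · exact lt_asymm hq h'.1
    have e3 : Even (∑ q ∈ Finset.Ioo p.1 (b.toFun p).1, w.1 q) := by
      apply even_of_paired b
      intro q hq
      rw [Finset.mem_Ioo] at hq ⊢
      exact b.noncrossing p q hq.1 hq.2
    unfold Positive
    rw [e2, Int.even_add, Int.even_add]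
    simp [e3]

end

noncomputable section

set_option linter.unusedSectionVars false

open Relation Equiv Equiv.Perm

variable {n k : ℕ}

/-- A flat tangle with bottom endpoints at the 1s of `v` and top endpoints at the 1s of `w`, presented
by finitely many points on it, with `adj x y` if an arc joins `x` and `y`; a bottom endpoint may be
equal to a top endpoint (a strand of length zero). The last two fields say that the closures of the
tangle by matchings `b` and `a` are 1-manifolds with an orientation that points in opposite directions at
neighbouring endpoints, as holds for planar diagrams: following it is a permutation `θ` of the points
which leaves each point along an arc of the tangle, of `b` (from the positive top endpoints) or of `a`
(from the other bottom endpoints), and each arc of the tangle is followed exactly in one direction. -/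
structure FlatTangle (v w : Weight n k) where
  Pt : Type
  finite : Finite Pt
  bot : Ones v → Pt
  top : Ones w → Pt
  adj : Pt → Pt → Prop
  bot_inj : Function.Injective bot
  top_inj : Function.Injective top
  colour : ∀ p q, top p = bot q → (Positive w p.1 ↔ Positive v q.1)
  orient : ∀ (b : Matching w) (a : Matching v), ∃ θ : Perm Pt,
    (∀ p, Positive w p.1 → θ (top p) = top (b.toFun p)) ∧
    (∀ p, ¬ Positive v p.1 → θ (bot p) = bot (a.toFun p)) ∧
    IsFlow θ adj {x | (∃ p, Positive w p.1 ∧ x = top p) ∨ ∃ p, ¬ Positive v p.1 ∧ x = bot p}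

attribute [instance] FlatTangle.finite

namespace FlatTangle

variable {u v w t : Weight n k}

/-- The diagram `W(b) T`. -/
def capped (T : FlatTangle v w) (b : Matching w) (x y : T.Pt) : Prop :=
  T.adj x y ∨ ∃ p, x = T.top p ∧ y = T.top (b.toFun p)

/-- The diagram `T a`. -/
def cupped (T : FlatTangle v w) (a : Matching v) (x y : T.Pt) : Prop :=
  T.adj x y ∨ ∃ p, x = T.bot p ∧ y = T.bot (a.toFun p)

/-- The closed diagram `W(b) T a`. -/
def closed (T : FlatTangle v w) (b : Matching w) (a : Matching v) (x y : T.Pt) : Prop :=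
  T.capped b x y ∨ T.cupped a x y

/-- The circles of `W(b) T a`. -/
def Circles (T : FlatTangle v w) (b : Matching w) (a : Matching v) : Type :=
  Quotient (EqvGen.setoid (T.closed b a))

instance (T : FlatTangle v w) (b : Matching w) (a : Matching v) : Finite (T.Circles b a) :=
  inferInstanceAs (Finite (Quotient _))

/-- The circle through a point. -/
def circle (T : FlatTangle v w) (b : Matching w) (a : Matching v) (x : T.Pt) : T.Circles b a :=
  Quotient.mk _ x

theorem circle_eq (T : FlatTangle v w) {b : Matching w} {a : Matching v} {x y : T.Pt} :
    T.circle b a x = T.circle b a y ↔ EqvGen (T.closed b a) x y :=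
  ⟨fun h => Quotient.exact h, fun h => Quotient.sound h⟩

/-- A point on a circle. -/
def rep (T : FlatTangle v w) {b : Matching w} {a : Matching v} (C : T.Circles b a) : T.Pt :=
  Quotient.out C

theorem circle_rep (T : FlatTangle v w) {b : Matching w} {a : Matching v} (C : T.Circles b a) :
    T.circle b a (T.rep C) = C := Quotient.out_eq C

theorem rep_circle (T : FlatTangle v w) (b : Matching w) (a : Matching v) (x : T.Pt) :
    EqvGen (T.closed b a) (T.rep (T.circle b a x)) x :=
  T.circle_eq.mp (T.circle_rep _)

/-- `T₁₂` is the composition `T₁ T₂`, the points `T₁.bot p` and `T₂.top p` being identified: `π` maps the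
points of `T₁` and `T₂` to those of `T₁₂`, and `σ` is a section of `π` that lifts the arcs. -/
structure Gluing (T₁ : FlatTangle w u) (T₂ : FlatTangle v w) (T₁₂ : FlatTangle v u) where
  π : T₁.Pt ⊕ T₂.Pt → T₁₂.Pt
  σ : T₁₂.Pt → T₁.Pt ⊕ T₂.Pt
  π_σ : ∀ x, π (σ x) = x
  mid : ∀ p, π (Sum.inl (T₁.bot p)) = π (Sum.inr (T₂.top p))
  top : ∀ p, π (Sum.inl (T₁.top p)) = T₁₂.top p
  bot : ∀ p, π (Sum.inr (T₂.bot p)) = T₁₂.bot p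
  adj : ∀ x y, Sum.LiftRel T₁.adj T₂.adj x y → T₁₂.adj (π x) (π y)
  lift : ∀ x y, T₁₂.adj x y → Sum.LiftRel T₁.adj T₂.adj (σ x) (σ y)
  sect : ∀ x, EqvGen (fun x y => ∃ p, x = Sum.inl (T₁.bot p) ∧ y = Sum.inr (T₂.top p)) x (σ (π x))

/-- The product of the factors of the saddles that contract `b` with `W(b)` in the middle of
`W(c) T₁ b W(b) T₂ a`. -/
def saddleElement {T₁ : FlatTangle w u} {T₂ : FlatTangle v w} {T₁₂ : FlatTangle v u}
    (g : Gluing T₁ T₂ T₁₂) (c : Matching u) (b : Matching w) (a : Matching v) :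
    CircleAlg (T₁₂.Circles c a) :=
  saddles (Sum.LiftRel (T₁.capped c) (T₂.cupped a)) (fun p => Sum.inl (T₁.bot p))
    (fun p => Sum.inr (T₂.top p)) b.toFun (fun x => CircleAlg.X (T₁₂.circle c a (g.π x))) ∅ b.arcs

/-- The map `F(W(c) T₁ b) ⊗ F(W(b) T₂ a) → F(W(c) T₁ T₂ a)` induced by the contraction cobordism. As all maps
involved are linear over the ring of the final diagram, it is the product of the images of `f` and `h`
there with the factors of the saddles. -/
def contract {T₁ : FlatTangle w u} {T₂ : FlatTangle v w} {T₁₂ : FlatTangle v u}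
    (g : Gluing T₁ T₂ T₁₂) (c : Matching u) (b : Matching w) (a : Matching v)
    (f : CircleAlg (T₁.Circles c b)) (h : CircleAlg (T₂.Circles b a)) :
    CircleAlg (T₁₂.Circles c a) :=
  CircleAlg.push (fun C => T₁₂.circle c a (g.π (Sum.inl (T₁.rep C)))) f *
    CircleAlg.push (fun C => T₁₂.circle c a (g.π (Sum.inr (T₂.rep C)))) h *
    saddleElement g c b a

theorem isLayer_mid (T₁ : FlatTangle w u) (T₂ : FlatTangle v w) (b : Matching w) :
    IsLayer (X := T₁.Pt ⊕ T₂.Pt) (fun p => Sum.inl (T₁.bot p))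
      (fun p => Sum.inr (T₂.top p)) b.toFun (fun p => Positive w p.1) where
  invol := b.invol
  flip := b.flip
  up_inj := fun _ _ h => T₁.bot_inj (Sum.inl_injective h)
  lo_inj := fun _ _ h => T₂.top_inj (Sum.inr_injective h)
  up_ne_lo := fun _ _ h => by cases h

/-- Gluing along the middle layer -/
theorem Gluing.eqvGen_iff {T₁ : FlatTangle w u} {T₂ : FlatTangle v w} {T₁₂ : FlatTangle v u}
    (g : Gluing T₁ T₂ T₁₂) (c : Matching u) (b : Matching w) (a : Matching v)
    (x y : T₁.Pt ⊕ T₂.Pt) :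
    EqvGen (stage (Sum.LiftRel (T₁.capped c) (T₂.cupped a)) (fun p => Sum.inl (T₁.bot p))
      (fun p => Sum.inr (T₂.top p)) b.toFun Set.univ) x y ↔
    EqvGen (T₁₂.closed c a) (g.π x) (g.π y) := by
  have hsect : ∀ x, EqvGen (stage (Sum.LiftRel (T₁.capped c) (T₂.cupped a))
      (fun p => Sum.inl (T₁.bot p)) (fun p => Sum.inr (T₂.top p)) b.toFun Set.univ) x
      (g.σ (g.π x)) := by
    intro x
    refine eqvGen_of_le ?_ (g.sect x)
    rintro _ _ ⟨p, rfl, rfl⟩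
    exact EqvGen.rel _ _ (Or.inr (Or.inl ⟨p, by simp, rfl, rfl⟩))
  refine eqvGen_retract g.π g.σ ?_ ?_ hsect x y
  · rintro x y (h | ⟨p, -, rfl, rfl⟩ | ⟨p, hp, -⟩)
    · rcases h with ⟨h | ⟨p, rfl, rfl⟩⟩ | ⟨h | ⟨p, rfl, rfl⟩⟩
      · exact EqvGen.rel _ _ (Or.inl (Or.inl (g.adj _ _ (Sum.LiftRel.inl h))))
      · rw [g.top, g.top]
        exact EqvGen.rel _ _ (Or.inl (Or.inr ⟨p, rfl, rfl⟩))
      · exact EqvGen.rel _ _ (Or.inl (Or.inl (g.adj _ _ (Sum.LiftRel.inr h))))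
      · rw [g.bot, g.bot]
        exact EqvGen.rel _ _ (Or.inr (Or.inr ⟨p, rfl, rfl⟩))
    · rw [g.mid]; exact EqvGen.refl _
    · exact absurd (Set.mem_univ p) hp
  · have hadj : ∀ x y, T₁₂.adj x y → EqvGen (stage (Sum.LiftRel (T₁.capped c) (T₂.cupped a))
      (fun p => Sum.inl (T₁.bot p)) (fun p => Sum.inr (T₂.top p)) b.toFun Set.univ)
        (g.σ x) (g.σ y) := by
      intro x y h
      refine EqvGen.rel _ _ (Or.inl ?_)
      exact (g.lift x y h).mono (fun _ _ h => Or.inl h) (fun _ _ h => Or.inl h)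
    rintro x y ((h | ⟨p, rfl, rfl⟩) | (h | ⟨p, rfl, rfl⟩))
    · exact hadj x y h
    · rw [← g.top, ← g.top]
      refine ((hsect _).symm.trans _ _ _ ?_).trans _ _ _ (hsect _)
      exact EqvGen.rel _ _ (Or.inl (Sum.LiftRel.inl (Or.inr ⟨p, rfl, rfl⟩)))
    · exact hadj x y h
    · rw [← g.bot, ← g.bot]
      refine ((hsect _).symm.trans _ _ _ ?_).trans _ _ _ (hsect _)
      exact EqvGen.rel _ _ (Or.inl (Sum.LiftRel.inr (Or.inr ⟨p, rfl, rfl⟩)))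

theorem sumCongr_flow {X Y : Type} {θ : Perm X} {θ' : Perm Y} {R : X → X → Prop}
    {R' : Y → Y → Prop} {N : Set X} {N' : Set Y} (h : IsFlow θ R N) (h' : IsFlow θ' R' N') :
    IsFlow (Equiv.sumCongr θ θ') (Sum.LiftRel R R') (Sum.inl '' N ∪ Sum.inr '' N') := by
  have hl : ∀ z : X, (Sum.inl z : X ⊕ Y) ∈ Sum.inl '' N ∪ Sum.inr '' N' → z ∈ N := by
    intro z hz
    simpa using hz
  have hr : ∀ z : Y, (Sum.inr z : X ⊕ Y) ∈ Sum.inl '' N ∪ Sum.inr '' N' → z ∈ N' := by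
    intro z hz
    simpa using hz
  constructor
  · rintro (z | z) hz
    · exact (h.1 z fun h => hz (Or.inl ⟨z, h, rfl⟩)).imp Sum.LiftRel.inl Sum.LiftRel.inl
    · exact (h'.1 z fun h => hz (Or.inr ⟨z, h, rfl⟩)).imp Sum.LiftRel.inr Sum.LiftRel.inr
  · rintro _ _ (hR | hR)
    · rcases h.2 _ _ hR with ⟨h1, h2⟩ | ⟨h1, h2⟩
      · exact Or.inl ⟨fun h => h1 (hl _ h), congrArg Sum.inl h2⟩
      · exact Or.inr ⟨fun h => h1 (hl _ h), congrArg Sum.inl h2⟩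
    · rcases h'.2 _ _ hR with ⟨h1, h2⟩ | ⟨h1, h2⟩
      · exact Or.inl ⟨fun h => h1 (hr _ h), congrArg Sum.inr h2⟩
      · exact Or.inr ⟨fun h => h1 (hr _ h), congrArg Sum.inr h2⟩

/-- Flow of `W(b) T`. -/
theorem flow_capped (T : FlatTangle v w) (b : Matching w) {θ : Perm T.Pt}
    (h1 : ∀ p, Positive w p.1 → θ (T.top p) = T.top (b.toFun p)) {N : Set T.Pt}
    (hN : ∀ p, Positive w p.1 → T.top p ∉ N)
    (h : IsFlow θ T.adj ({x | ∃ p, Positive w p.1 ∧ x = T.top p} ∪ N)) :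
    IsFlow θ (T.capped b) N := by
  constructor
  · intro z hz
    by_cases hz' : ∃ p, Positive w p.1 ∧ z = T.top p
    · obtain ⟨p, hp, rfl⟩ := hz'
      exact Or.inl (Or.inr ⟨p, rfl, h1 p hp⟩)
    · exact (h.1 z (by rintro (h | h); exacts [hz' h, hz h])).imp Or.inl Or.inl
  · rintro z z' (hr | ⟨p, rfl, rfl⟩)
    · rcases h.2 z z' hr with ⟨h2, h3⟩ | ⟨h2, h3⟩
      · exact Or.inl ⟨fun h => h2 (Or.inr h), h3⟩
      · exact Or.inr ⟨fun h => h2 (Or.inr h), h3⟩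
    · by_cases hp : Positive w p.1
      · exact Or.inl ⟨hN p hp, (h1 p hp).symm⟩
      · have hb : Positive w (b.toFun p).1 := (b.flip p).mpr hp
        exact Or.inr ⟨hN _ hb, by rw [h1 _ hb, b.invol]⟩

/-- Flow of `T a`. -/
theorem flow_cupped (T : FlatTangle v w) (a : Matching v) {θ : Perm T.Pt}
    (h1 : ∀ p, ¬ Positive v p.1 → θ (T.bot p) = T.bot (a.toFun p)) {N : Set T.Pt}
    (hN : ∀ p, ¬ Positive v p.1 → T.bot p ∉ N)
    (h : IsFlow θ T.adj ({x | ∃ p, ¬ Positive v p.1 ∧ x = T.bot p} ∪ N)) :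
    IsFlow θ (T.cupped a) N := by
  constructor
  · intro z hz
    by_cases hz' : ∃ p, ¬ Positive v p.1 ∧ z = T.bot p
    · obtain ⟨p, hp, rfl⟩ := hz'
      exact Or.inl (Or.inr ⟨p, rfl, h1 p hp⟩)
    · exact (h.1 z (by rintro (h | h); exacts [hz' h, hz h])).imp Or.inl Or.inl
  · rintro z z' (hr | ⟨p, rfl, rfl⟩)
    · rcases h.2 z z' hr with ⟨h2, h3⟩ | ⟨h2, h3⟩
      · exact Or.inl ⟨fun h => h2 (Or.inr h), h3⟩
      · exact Or.inr ⟨fun h => h2 (Or.inr h), h3⟩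
    · by_cases hp : Positive v p.1
      · have hb : ¬ Positive v (a.toFun p).1 := fun h => (a.flip p).mp h hp
        exact Or.inr ⟨hN _ hb, by rw [h1 _ hb, a.invol]⟩
      · exact Or.inl ⟨hN p hp, (h1 p hp).symm⟩

theorem top_ne_bot (T : FlatTangle v w) {p : Ones w} {q : Ones v} (hp : Positive w p.1)
    (hq : ¬ Positive v q.1) : T.top p ≠ T.bot q := fun h => hq ((T.colour p q h).mp hp)

/-- The three-layer diagram `W(d) T₁ | T₂ | T₃ a`. -/
def tripleRel (T₁ : FlatTangle w u) (T₂ : FlatTangle v w) (T₃ : FlatTangle t v)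
    (d : Matching u) (a : Matching t) : T₁.Pt ⊕ (T₂.Pt ⊕ T₃.Pt) → T₁.Pt ⊕ (T₂.Pt ⊕ T₃.Pt) → Prop :=
  Sum.LiftRel (T₁.capped d) (Sum.LiftRel T₂.adj (T₃.cupped a))

theorem contract_assoc {T₁ : FlatTangle w u} {T₂ : FlatTangle v w} {T₃ : FlatTangle t v}
    {T₁₂ : FlatTangle v u} {T₂₃ : FlatTangle t w} {T : FlatTangle t u}
    (g₁₂ : Gluing T₁ T₂ T₁₂) (g₂₃ : Gluing T₂ T₃ T₂₃)
    (g : Gluing T₁₂ T₃ T) (g' : Gluing T₁ T₂₃ T)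
    (h₁ : ∀ x, g.π (Sum.inl (g₁₂.π (Sum.inl x))) = g'.π (Sum.inl x))
    (h₂ : ∀ x, g.π (Sum.inl (g₁₂.π (Sum.inr x))) = g'.π (Sum.inr (g₂₃.π (Sum.inl x))))
    (h₃ : ∀ x, g.π (Sum.inr x) = g'.π (Sum.inr (g₂₃.π (Sum.inr x))))
    (d : Matching u) (c : Matching w) (b : Matching v) (a : Matching t)
    (x : CircleAlg (T₁.Circles d c)) (y : CircleAlg (T₂.Circles c b))
    (z : CircleAlg (T₃.Circles b a)) :
    contract g d b a (contract g₁₂ d c b x y) z = contract g' d c a x (contract g₂₃ c b a y z) := by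
  classical
  -- the big diagram
  let P := T₁.Pt ⊕ (T₂.Pt ⊕ T₃.Pt)
  let up : Ones w → P := fun p => Sum.inl (T₁.bot p)
  let lo : Ones w → P := fun p => Sum.inr (Sum.inl (T₂.top p))
  let up' : Ones v → P := fun p => Sum.inr (Sum.inl (T₂.bot p))
  let lo' : Ones v → P := fun p => Sum.inr (Sum.inr (T₃.top p))
  let ps : Ones w → Prop := fun p => Positive w p.1
  let ps' : Ones v → Prop := fun p => Positive v p.1
  let R := tripleRel T₁ T₂ T₃ d a
  have hl : IsLayer up lo c.toFun ps :=
    { invol := c.invol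
      flip := c.flip
      up_inj := fun _ _ h => T₁.bot_inj (Sum.inl_injective h)
      lo_inj := fun _ _ h => T₂.top_inj (Sum.inl_injective (Sum.inr_injective h))
      up_ne_lo := fun _ _ h => by cases h }
  have hl' : IsLayer up' lo' b.toFun ps' :=
    { invol := b.invol
      flip := b.flip
      up_inj := fun _ _ h => T₂.bot_inj (Sum.inl_injective (Sum.inr_injective h))
      lo_inj := fun _ _ h => T₃.top_inj (Sum.inr_injective (Sum.inr_injective h))
      up_ne_lo := fun _ _ h => by cases h }
  have hdisj : ∀ x ∈ exits up lo ps, x ∉ exits up' lo' ps' := by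
    rintro _ (⟨p, hp, rfl⟩ | ⟨p, hp, rfl⟩) (⟨q, hq, h⟩ | ⟨q, hq, h⟩)
    · cases h
    · cases h
    · exact T₂.top_ne_bot hp hq (Sum.inl_injective (Sum.inr_injective h))
    · cases h
  obtain ⟨θ₁, a1, a2, a3⟩ := T₁.orient d c
  obtain ⟨θ₂, b1, b2, b3⟩ := T₂.orient c b
  obtain ⟨θ₃, c1, c2, c3⟩ := T₃.orient b a
  have f1 : IsFlow θ₁ (T₁.capped d) {x | ∃ p, ¬ Positive w p.1 ∧ x = T₁.bot p} := by
    refine T₁.flow_capped d a1 ?_ a3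
    rintro p hp ⟨q, hq, h⟩
    exact T₁.top_ne_bot hp hq h
  have f3 : IsFlow θ₃ (T₃.cupped a) {x | ∃ p, Positive v p.1 ∧ x = T₃.top p} := by
    refine T₃.flow_cupped a c2 ?_ ?_
    · rintro p hp ⟨q, hq, h⟩
      exact T₃.top_ne_bot hq hp h.symm
    · rw [Set.union_comm]; exact c3
  let θ : Perm P := Equiv.sumCongr θ₁ (Equiv.sumCongr θ₂ θ₃)
  have hR : IsFlow θ R (exits up lo ps ∪ exits up' lo' ps') := by
    have h := sumCongr_flow f1 (sumCongr_flow b3 f3)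
    have e : (exits up lo ps ∪ exits up' lo' ps') = (Sum.inl '' {x | ∃ p, ¬ Positive w p.1 ∧ x = T₁.bot p} ∪
        Sum.inr '' (Sum.inl '' {x | (∃ p, Positive w p.1 ∧ x = T₂.top p) ∨
          ∃ p, ¬ Positive v p.1 ∧ x = T₂.bot p} ∪
          Sum.inr '' {x | ∃ p, Positive v p.1 ∧ x = T₃.top p}) : Set P) := by
      ext x
      constructor
      · rintro ((⟨p, hp, rfl⟩ | ⟨p, hp, rfl⟩) | (⟨p, hp, rfl⟩ | ⟨p, hp, rfl⟩))
        · exact Or.inl ⟨_, ⟨p, hp, rfl⟩, rfl⟩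
        · exact Or.inr ⟨_, Or.inl ⟨_, Or.inl ⟨p, hp, rfl⟩, rfl⟩, rfl⟩
        · exact Or.inr ⟨_, Or.inl ⟨_, Or.inr ⟨p, hp, rfl⟩, rfl⟩, rfl⟩
        · exact Or.inr ⟨_, Or.inr ⟨_, ⟨p, hp, rfl⟩, rfl⟩, rfl⟩
      · rintro (⟨_, ⟨p, hp, rfl⟩, rfl⟩ | ⟨_, ⟨_, ⟨p, hp, rfl⟩ | ⟨p, hp, rfl⟩, rfl⟩ |
          ⟨_, ⟨p, hp, rfl⟩, rfl⟩, rfl⟩)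
        · exact Or.inl (Or.inl ⟨p, hp, rfl⟩)
        · exact Or.inl (Or.inr ⟨p, hp, rfl⟩)
        · exact Or.inr (Or.inl ⟨p, hp, rfl⟩)
        · exact Or.inr (Or.inr ⟨p, hp, rfl⟩)
    rw [e]
    exact h
  -- points of the final diagram
  let pr : P → T.Pt := Sum.elim (fun x => g.π (Sum.inl (g₁₂.π (Sum.inl x))))
    (Sum.elim (fun x => g.π (Sum.inl (g₁₂.π (Sum.inr x)))) (fun x => g.π (Sum.inr x)))
  let ξ : P → CircleAlg (T.Circles d a) := fun x => CircleAlg.X (T.circle d a (pr x))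
  have hsq : ∀ x, ξ x * ξ x = 0 := fun x => CircleAlg.X_mul_self _
  -- embeddings and projections
  let i₁₂ : T₁.Pt ⊕ T₂.Pt → P := Sum.elim Sum.inl (fun x => Sum.inr (Sum.inl x))
  let i₂₃ : T₂.Pt ⊕ T₃.Pt → P := Sum.inr
  have hi₁₂ : Function.Injective i₁₂ := by
    rintro (x | x) (y | y) h
    · exact congrArg Sum.inl (Sum.inl_injective h)
    · cases h
    · cases h
    · exact congrArg Sum.inr (Sum.inl_injective (Sum.inr_injective h))
  let pr₁₂ : P → T₁₂.Pt ⊕ T₃.Pt := Sum.elim (fun x => Sum.inl (g₁₂.π (Sum.inl x)))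
    (Sum.elim (fun x => Sum.inl (g₁₂.π (Sum.inr x))) Sum.inr)
  let σ₁₂ : T₁₂.Pt ⊕ T₃.Pt → P := Sum.elim (fun x => i₁₂ (g₁₂.σ x)) (fun x => Sum.inr (Sum.inr x))
  let pr₂₃ : P → T₁.Pt ⊕ T₂₃.Pt := Sum.elim Sum.inl (fun x => Sum.inr (g₂₃.π x))
  let σ₂₃ : T₁.Pt ⊕ T₂₃.Pt → P := Sum.elim Sum.inl (fun x => Sum.inr (g₂₃.σ x))
  have hpr : ∀ x, pr x = g.π (pr₁₂ x) := by rintro (x | x | x) <;> rfl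
  have hpr' : ∀ x, pr x = g'.π (pr₂₃ x) := by
    rintro (x | x | x)
    · exact h₁ x
    · exact h₂ x
    · exact h₃ x
  have hprσ : ∀ x, pr₁₂ (σ₁₂ x) = x := by
    rintro (x | x)
    · have h : ∀ y, pr₁₂ (i₁₂ y) = Sum.inl (g₁₂.π y) := by rintro (y | y) <;> rfl
      exact (h _).trans (by rw [g₁₂.π_σ])
    · rfl
  have hprσ' : ∀ x, pr₂₃ (σ₂₃ x) = x := by
    rintro (x | x)
    · rfl
    · exact congrArg Sum.inr (g₂₃.π_σ x)
  -- transfer of relations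
  have tr12 : ∀ (D : Set (Ones w)) x y,
      EqvGen (stage (Sum.LiftRel (T₁.capped d) (T₂.cupped b)) (fun p => Sum.inl (T₁.bot p))
        (fun p => Sum.inr (T₂.top p)) c.toFun D) x y ↔
      EqvGen (stage (stage R up' lo' b.toFun ∅) up lo c.toFun D) (i₁₂ x) (i₁₂ y) := by
    intro D
    refine eqvGen_embed i₁₂ hi₁₂ ?_ ?_ ?_
    · rintro _ _ ((⟨h⟩ | ⟨h | ⟨p, rfl, rfl⟩⟩) | ⟨p, hp, rfl, rfl⟩ | ⟨p, hp, ⟨rfl, rfl⟩ | ⟨rfl, rfl⟩⟩)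
      · exact Or.inl (Or.inl (Sum.LiftRel.inl (by assumption)))
      · exact Or.inl (Or.inl (Sum.LiftRel.inr (Sum.LiftRel.inl h)))
      · exact Or.inl (Or.inr (Or.inr ⟨p, by simp, Or.inl ⟨rfl, rfl⟩⟩))
      · exact Or.inr (Or.inl ⟨p, hp, rfl, rfl⟩)
      · exact Or.inr (Or.inr ⟨p, hp, Or.inl ⟨rfl, rfl⟩⟩)
      · exact Or.inr (Or.inr ⟨p, hp, Or.inr ⟨rfl, rfl⟩⟩)
    · rintro (x | x) z h
      · rcases h with (h | ⟨p, hp, -⟩ | ⟨p, -, ⟨h, h'⟩ | ⟨h, h'⟩⟩) | ⟨p, hp, h, rfl⟩ |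
          ⟨p, hp, ⟨h, rfl⟩ | ⟨h, rfl⟩⟩
        · cases h
          exact ⟨Sum.inl _, rfl, Or.inl (Sum.LiftRel.inl (by assumption))⟩
        · exact absurd hp (by simp)
        · cases h
        · cases h
        · cases h
          exact ⟨Sum.inr _, rfl, Or.inr (Or.inl ⟨p, hp, rfl, rfl⟩)⟩
        · cases h
          exact ⟨Sum.inl _, rfl, Or.inr (Or.inr ⟨p, hp, Or.inl ⟨rfl, rfl⟩⟩)⟩
        · cases h
      · rcases h with (h | ⟨p, hp, -⟩ | ⟨p, -, ⟨h, rfl⟩ | ⟨h, h'⟩⟩) | ⟨p, hp, h, rfl⟩ |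
          ⟨p, hp, ⟨h, rfl⟩ | ⟨h, rfl⟩⟩
        · cases h with
          | inr h =>
            cases h with
            | inl h => exact ⟨Sum.inr _, rfl, Or.inl (Sum.LiftRel.inr (Or.inl h))⟩
        · exact absurd hp (by simp)
        · cases h
          exact ⟨Sum.inr _, rfl, Or.inl (Sum.LiftRel.inr (Or.inr ⟨p, rfl, rfl⟩))⟩
        · cases h
        · cases h
        · cases h
        · cases h
          exact ⟨Sum.inr _, rfl, Or.inr (Or.inr ⟨p, hp, Or.inr ⟨rfl, rfl⟩⟩)⟩
    · rintro (x | x) z h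
      · rcases h with (h | ⟨p, hp, -⟩ | ⟨p, -, ⟨h, h'⟩ | ⟨h, h'⟩⟩) | ⟨p, hp, rfl, h⟩ |
          ⟨p, hp, ⟨rfl, h⟩ | ⟨rfl, h⟩⟩
        · cases h
          exact ⟨Sum.inl _, rfl, Or.inl (Sum.LiftRel.inl (by assumption))⟩
        · exact absurd hp (by simp)
        · cases h'
        · cases h'
        · cases h
        · cases h
          exact ⟨Sum.inl _, rfl, Or.inr (Or.inr ⟨p, hp, Or.inl ⟨rfl, rfl⟩⟩)⟩
        · cases h
      · rcases h with (h | ⟨p, hp, -⟩ | ⟨p, -, ⟨rfl, h⟩ | ⟨h, h'⟩⟩) | ⟨p, hp, rfl, h⟩ |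
          ⟨p, hp, ⟨rfl, h⟩ | ⟨rfl, h⟩⟩
        · cases h with
          | inr h =>
            cases h with
            | inl h => exact ⟨Sum.inr _, rfl, Or.inl (Sum.LiftRel.inr (Or.inl h))⟩
        · exact absurd hp (by simp)
        · cases h
          exact ⟨Sum.inr _, rfl, Or.inl (Sum.LiftRel.inr (Or.inr ⟨p, rfl, rfl⟩))⟩
        · cases h'
        · cases h
          exact ⟨Sum.inl _, rfl, Or.inr (Or.inl ⟨p, hp, rfl, rfl⟩)⟩
        · cases h
        · cases h
          exact ⟨Sum.inr _, rfl, Or.inr (Or.inr ⟨p, hp, Or.inr ⟨rfl, rfl⟩⟩)⟩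
  have tr23 : ∀ (D : Set (Ones v)) x y,
      EqvGen (stage (Sum.LiftRel (T₂.capped c) (T₃.cupped a)) (fun p => Sum.inl (T₂.bot p))
        (fun p => Sum.inr (T₃.top p)) b.toFun D) x y ↔
      EqvGen (stage (stage R up lo c.toFun ∅) up' lo' b.toFun D) (i₂₃ x) (i₂₃ y) := by
    intro D
    refine eqvGen_embed i₂₃ Sum.inr_injective ?_ ?_ ?_
    · rintro _ _ ((⟨h | ⟨p, rfl, rfl⟩⟩ | ⟨h⟩) | ⟨p, hp, rfl, rfl⟩ | ⟨p, hp, ⟨rfl, rfl⟩ | ⟨rfl, rfl⟩⟩)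
      · exact Or.inl (Or.inl (Sum.LiftRel.inr (Sum.LiftRel.inl h)))
      · exact Or.inl (Or.inr (Or.inr ⟨p, by simp, Or.inr ⟨rfl, rfl⟩⟩))
      · exact Or.inl (Or.inl (Sum.LiftRel.inr (Sum.LiftRel.inr (by assumption))))
      · exact Or.inr (Or.inl ⟨p, hp, rfl, rfl⟩)
      · exact Or.inr (Or.inr ⟨p, hp, Or.inl ⟨rfl, rfl⟩⟩)
      · exact Or.inr (Or.inr ⟨p, hp, Or.inr ⟨rfl, rfl⟩⟩)
    · rintro (x | x) z h
      · rcases h with (h | ⟨p, hp, -⟩ | ⟨p, -, ⟨h, h'⟩ | ⟨h, rfl⟩⟩) | ⟨p, hp, h, rfl⟩ |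
          ⟨p, hp, ⟨h, rfl⟩ | ⟨h, rfl⟩⟩
        · cases h with
          | inr h =>
            cases h with
            | inl h => exact ⟨Sum.inl _, rfl, Or.inl (Sum.LiftRel.inl (Or.inl h))⟩
        · exact absurd hp (by simp)
        · cases h
        · cases h
          exact ⟨Sum.inl _, rfl, Or.inl (Sum.LiftRel.inl (Or.inr ⟨p, rfl, rfl⟩))⟩
        · cases h
          exact ⟨Sum.inr _, rfl, Or.inr (Or.inl ⟨p, hp, rfl, rfl⟩)⟩
        · cases h
          exact ⟨Sum.inl _, rfl, Or.inr (Or.inr ⟨p, hp, Or.inl ⟨rfl, rfl⟩⟩)⟩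
        · cases h
      · rcases h with (h | ⟨p, hp, -⟩ | ⟨p, -, ⟨h, h'⟩ | ⟨h, h'⟩⟩) | ⟨p, hp, h, rfl⟩ |
          ⟨p, hp, ⟨h, rfl⟩ | ⟨h, rfl⟩⟩
        · cases h with
          | inr h =>
            cases h with
            | inr h => exact ⟨Sum.inr _, rfl, Or.inl (Sum.LiftRel.inr h)⟩
        · exact absurd hp (by simp)
        · cases h
        · cases h
        · cases h
        · cases h
        · cases h
          exact ⟨Sum.inr _, rfl, Or.inr (Or.inr ⟨p, hp, Or.inr ⟨rfl, rfl⟩⟩)⟩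
    · rintro (x | x) z h
      · rcases h with (h | ⟨p, hp, -⟩ | ⟨p, -, ⟨h', h⟩ | ⟨rfl, h⟩⟩) | ⟨p, hp, rfl, h⟩ |
          ⟨p, hp, ⟨rfl, h⟩ | ⟨rfl, h⟩⟩
        · cases h with
          | inr h =>
            cases h with
            | inl h => exact ⟨Sum.inl _, rfl, Or.inl (Sum.LiftRel.inl (Or.inl h))⟩
        · exact absurd hp (by simp)
        · cases h
        · cases h
          exact ⟨Sum.inl _, rfl, Or.inl (Sum.LiftRel.inl (Or.inr ⟨p, rfl, rfl⟩))⟩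
        · cases h
        · cases h
          exact ⟨Sum.inl _, rfl, Or.inr (Or.inr ⟨p, hp, Or.inl ⟨rfl, rfl⟩⟩)⟩
        · cases h
      · rcases h with (h | ⟨p, hp, -⟩ | ⟨p, -, ⟨h', h⟩ | ⟨h', h⟩⟩) | ⟨p, hp, rfl, h⟩ |
          ⟨p, hp, ⟨rfl, h⟩ | ⟨rfl, h⟩⟩
        · cases h with
          | inr h =>
            cases h with
            | inr h => exact ⟨Sum.inr _, rfl, Or.inl (Sum.LiftRel.inr h)⟩
        · exact absurd hp (by simp)
        · cases h
        · cases h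
        · cases h
          exact ⟨Sum.inl _, rfl, Or.inr (Or.inl ⟨p, hp, rfl, rfl⟩)⟩
        · cases h
        · cases h
          exact ⟨Sum.inr _, rfl, Or.inr (Or.inr ⟨p, hp, Or.inr ⟨rfl, rfl⟩⟩)⟩
  have tr2 : ∀ (D : Set (Ones v)) x y,
      EqvGen (stage (stage R up lo c.toFun Set.univ) up' lo' b.toFun D) x y ↔
      EqvGen (stage (Sum.LiftRel (T₁₂.capped d) (T₃.cupped a)) (fun p => Sum.inl (T₁₂.bot p))
        (fun p => Sum.inr (T₃.top p)) b.toFun D) (pr₁₂ x) (pr₁₂ y) := by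
    intro D
    have hs : ∀ y, EqvGen (stage (stage R up lo c.toFun Set.univ) up' lo' b.toFun D) (i₁₂ y)
        (i₁₂ (g₁₂.σ (g₁₂.π y))) := by
      intro y
      refine eqvGen_map i₁₂ ?_ (g₁₂.sect y)
      rintro _ _ ⟨p, rfl, rfl⟩
      exact EqvGen.rel _ _ (Or.inl (Or.inr (Or.inl ⟨p, by simp, rfl, rfl⟩)))
    refine eqvGen_retract pr₁₂ σ₁₂ ?_ ?_ ?_
    · rintro x y ((h | ⟨p, -, rfl, rfl⟩ | ⟨p, hp, -⟩) | ⟨p, hp, rfl, rfl⟩ |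
        ⟨p, hp, ⟨rfl, rfl⟩ | ⟨rfl, rfl⟩⟩)
      · rcases h with ⟨h | ⟨p, rfl, rfl⟩⟩ | ⟨⟨h⟩ | ⟨h⟩⟩
        · exact EqvGen.rel _ _ (Or.inl (Sum.LiftRel.inl (Or.inl (g₁₂.adj _ _ (Sum.LiftRel.inl h)))))
        · refine EqvGen.rel _ _ (Or.inl (Sum.LiftRel.inl (Or.inr ⟨p, ?_, ?_⟩)))
          · exact g₁₂.top p
          · exact g₁₂.top _
        · exact EqvGen.rel _ _ (Or.inl (Sum.LiftRel.inl (Or.inl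
            (g₁₂.adj _ _ (Sum.LiftRel.inr (by assumption))))))
        · exact EqvGen.rel _ _ (Or.inl (Sum.LiftRel.inr (by assumption)))
      · have : pr₁₂ (up p) = pr₁₂ (lo p) := congrArg Sum.inl (g₁₂.mid p)
        rw [this]; exact EqvGen.refl _
      · exact absurd (Set.mem_univ p) hp
      · exact EqvGen.rel _ _ (Or.inr (Or.inl ⟨p, hp, congrArg Sum.inl (g₁₂.bot p), rfl⟩))
      · exact EqvGen.rel _ _ (Or.inr (Or.inr ⟨p, hp, Or.inl ⟨congrArg Sum.inl (g₁₂.bot p),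
          congrArg Sum.inl (g₁₂.bot _)⟩⟩))
      · exact EqvGen.rel _ _ (Or.inr (Or.inr ⟨p, hp, Or.inr ⟨rfl, rfl⟩⟩))
    · have hbot : ∀ p, EqvGen (stage (stage R up lo c.toFun Set.univ) up' lo' b.toFun D)
          (up' p) (σ₁₂ (Sum.inl (T₁₂.bot p))) := by
        intro p
        rw [← g₁₂.bot p]
        exact hs (Sum.inr (T₂.bot p))
      rintro _ _ ((⟨h | ⟨p, rfl, rfl⟩⟩ | ⟨h⟩) | ⟨p, hp, rfl, rfl⟩ | ⟨p, hp, ⟨rfl, rfl⟩ | ⟨rfl, rfl⟩⟩)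
      · refine EqvGen.rel _ _ (Or.inl (Or.inl ?_))
        have := g₁₂.lift _ _ h
        revert this
        simp only [σ₁₂, Sum.elim_inl]
        generalize g₁₂.σ _ = x'
        generalize g₁₂.σ _ = y'
        rintro (h | h)
        · exact Sum.LiftRel.inl (Or.inl h)
        · exact Sum.LiftRel.inr (Sum.LiftRel.inl h)
      · rw [← g₁₂.top, ← g₁₂.top]
        refine ((hs (Sum.inl (T₁.top p))).symm.trans _ _ _ ?_).trans _ _ _ (hs (Sum.inl _))
        exact EqvGen.rel _ _ (Or.inl (Or.inl (Sum.LiftRel.inl (Or.inr ⟨p, rfl, rfl⟩))))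
      · exact EqvGen.rel _ _ (Or.inl (Or.inl (Sum.LiftRel.inr (Sum.LiftRel.inr (by assumption)))))
      · refine (hbot p).symm.trans _ _ _ ?_
        exact EqvGen.rel _ _ (Or.inr (Or.inl ⟨p, hp, rfl, rfl⟩))
      · refine ((hbot p).symm.trans _ _ _ ?_).trans _ _ _ (hbot _)
        exact EqvGen.rel _ _ (Or.inr (Or.inr ⟨p, hp, Or.inl ⟨rfl, rfl⟩⟩))
      · exact EqvGen.rel _ _ (Or.inr (Or.inr ⟨p, hp, Or.inr ⟨rfl, rfl⟩⟩))
    · rintro (x | x | x)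
      · exact hs (Sum.inl x)
      · exact hs (Sum.inr x)
      · exact EqvGen.refl _
  have tr4 : ∀ (D : Set (Ones w)) x y,
      EqvGen (stage (stage R up' lo' b.toFun Set.univ) up lo c.toFun D) x y ↔
      EqvGen (stage (Sum.LiftRel (T₁.capped d) (T₂₃.cupped a)) (fun p => Sum.inl (T₁.bot p))
        (fun p => Sum.inr (T₂₃.top p)) c.toFun D) (pr₂₃ x) (pr₂₃ y) := by
    intro D
    have hs : ∀ y, EqvGen (stage (stage R up' lo' b.toFun Set.univ) up lo c.toFun D) (i₂₃ y)
        (i₂₃ (g₂₃.σ (g₂₃.π y))) := by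
      intro y
      refine eqvGen_map i₂₃ ?_ (g₂₃.sect y)
      rintro _ _ ⟨p, rfl, rfl⟩
      exact EqvGen.rel _ _ (Or.inl (Or.inr (Or.inl ⟨p, by simp, rfl, rfl⟩)))
    refine eqvGen_retract pr₂₃ σ₂₃ ?_ ?_ ?_
    · rintro x y ((h | ⟨p, -, rfl, rfl⟩ | ⟨p, hp, -⟩) | ⟨p, hp, rfl, rfl⟩ |
        ⟨p, hp, ⟨rfl, rfl⟩ | ⟨rfl, rfl⟩⟩)
      · rcases h with ⟨h⟩ | ⟨⟨h⟩ | ⟨h | ⟨p, rfl, rfl⟩⟩⟩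
        · exact EqvGen.rel _ _ (Or.inl (Sum.LiftRel.inl (by assumption)))
        · exact EqvGen.rel _ _ (Or.inl (Sum.LiftRel.inr (Or.inl
            (g₂₃.adj _ _ (Sum.LiftRel.inl (by assumption))))))
        · exact EqvGen.rel _ _ (Or.inl (Sum.LiftRel.inr (Or.inl (g₂₃.adj _ _ (Sum.LiftRel.inr h)))))
        · refine EqvGen.rel _ _ (Or.inl (Sum.LiftRel.inr (Or.inr ⟨p, ?_, ?_⟩)))
          · exact g₂₃.bot p
          · exact g₂₃.bot _
      · have : pr₂₃ (up' p) = pr₂₃ (lo' p) := congrArg Sum.inr (g₂₃.mid p)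
        rw [this]; exact EqvGen.refl _
      · exact absurd (Set.mem_univ p) hp
      · exact EqvGen.rel _ _ (Or.inr (Or.inl ⟨p, hp, rfl, congrArg Sum.inr (g₂₃.top p)⟩))
      · exact EqvGen.rel _ _ (Or.inr (Or.inr ⟨p, hp, Or.inl ⟨rfl, rfl⟩⟩))
      · exact EqvGen.rel _ _ (Or.inr (Or.inr ⟨p, hp, Or.inr ⟨congrArg Sum.inr (g₂₃.top p),
          congrArg Sum.inr (g₂₃.top _)⟩⟩))
    · have htop : ∀ p, EqvGen (stage (stage R up' lo' b.toFun Set.univ) up lo c.toFun D)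
          (lo p) (σ₂₃ (Sum.inr (T₂₃.top p))) := by
        intro p
        rw [← g₂₃.top p]
        exact hs (Sum.inl (T₂.top p))
      rintro _ _ ((⟨h⟩ | ⟨h | ⟨p, rfl, rfl⟩⟩) | ⟨p, hp, rfl, rfl⟩ | ⟨p, hp, ⟨rfl, rfl⟩ | ⟨rfl, rfl⟩⟩)
      · exact EqvGen.rel _ _ (Or.inl (Or.inl (Sum.LiftRel.inl (by assumption))))
      · refine EqvGen.rel _ _ (Or.inl (Or.inl ?_))
        have := g₂₃.lift _ _ h
        revert this
        simp only [σ₂₃, Sum.elim_inr]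
        generalize g₂₃.σ _ = x'
        generalize g₂₃.σ _ = y'
        rintro (h | h)
        · exact Sum.LiftRel.inr (Sum.LiftRel.inl h)
        · exact Sum.LiftRel.inr (Sum.LiftRel.inr (Or.inl h))
      · rw [← g₂₃.bot, ← g₂₃.bot]
        refine ((hs (Sum.inr (T₃.bot p))).symm.trans _ _ _ ?_).trans _ _ _ (hs (Sum.inr _))
        exact EqvGen.rel _ _ (Or.inl (Or.inl (Sum.LiftRel.inr (Sum.LiftRel.inr
          (Or.inr ⟨p, rfl, rfl⟩)))))
      · refine EqvGen.trans _ _ _ ?_ (htop p)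
        exact EqvGen.rel _ _ (Or.inr (Or.inl ⟨p, hp, rfl, rfl⟩))
      · exact EqvGen.rel _ _ (Or.inr (Or.inr ⟨p, hp, Or.inl ⟨rfl, rfl⟩⟩))
      · refine ((htop p).symm.trans _ _ _ ?_).trans _ _ _ (htop _)
        exact EqvGen.rel _ _ (Or.inr (Or.inr ⟨p, hp, Or.inr ⟨rfl, rfl⟩⟩))
    · rintro (x | x)
      · exact EqvGen.refl _
      · exact hs x
  -- compatibility with the final circles
  have hξ : ∀ x y, stage (stage R up lo c.toFun Set.univ) up' lo' b.toFun Set.univ x y →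
      ξ x = ξ y := by
    intro x y h
    have h1 := (tr2 _ _ _).mp (EqvGen.rel _ _ h)
    rw [g.eqvGen_iff, ← hpr, ← hpr, ← T.circle_eq] at h1
    exact congrArg CircleAlg.X h1
  obtain ⟨main, kill1, kill2⟩ := two_layers hl hl' hdisj hR
    (fun p hp => congrArg Sum.inl (a2 p hp))
    (fun p hp => congrArg (fun x => Sum.inr (Sum.inl x)) (b1 p hp))
    (fun p hp => congrArg (fun x => Sum.inr (Sum.inl x)) (b2 p hp))
    (fun p hp => congrArg (fun x => Sum.inr (Sum.inr x)) (c1 p hp)) hsq hξ c.arcs_pairwise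
    c.arcs_cover b.arcs_pairwise b.arcs_cover
  set E2 := saddles (stage R up lo c.toFun Set.univ) up' lo' b.toFun ξ ∅ b.arcs with hE2
  set E4 := saddles (stage R up' lo' b.toFun Set.univ) up lo c.toFun ξ ∅ c.arcs with hE4
  have e2 : saddleElement g d b a = E2 := by
    refine (saddles_transfer (fun D p q => ?_) (fun p => ?_) _ _).symm
    · rw [tr2]
      simp only [up', pr₁₂, Sum.elim_inr, Sum.elim_inl, g₁₂.bot]
    · simp only [ξ, pr, up', Sum.elim_inr, Sum.elim_inl, g₁₂.bot]
  have e4 : saddleElement g' d c a = E4 := by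
    refine (saddles_transfer (fun D p q => ?_) (fun p => ?_) _ _).symm
    · rw [tr4]
      rfl
    · exact congrArg (fun x => CircleAlg.X (T.circle d a x)) (h₁ _)
  -- values of the pushforwards on generators
  have cl12 : ∀ s s' : T₁₂.Pt, EqvGen (T₁₂.closed d b) s s' →
      CircleAlg.X (T.circle d a (g.π (Sum.inl s))) * E2 =
      CircleAlg.X (T.circle d a (g.π (Sum.inl s'))) * E2 := by
    intro s s' h
    have h1 : EqvGen (stage (Sum.LiftRel (T₁₂.capped d) (T₃.cupped a))
        (fun p => Sum.inl (T₁₂.bot p)) (fun p => Sum.inr (T₃.top p)) b.toFun ∅)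
        (Sum.inl s) (Sum.inl s') := by
      refine eqvGen_map Sum.inl ?_ h
      rintro x y ((h | ⟨p, rfl, rfl⟩) | (h | ⟨p, rfl, rfl⟩))
      · exact EqvGen.rel _ _ (Or.inl (Sum.LiftRel.inl (Or.inl h)))
      · exact EqvGen.rel _ _ (Or.inl (Sum.LiftRel.inl (Or.inr ⟨p, rfl, rfl⟩)))
      · exact EqvGen.rel _ _ (Or.inl (Sum.LiftRel.inl (Or.inl h)))
      · exact EqvGen.rel _ _ (Or.inr (Or.inr ⟨p, by simp, Or.inl ⟨rfl, rfl⟩⟩))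
    rw [← hprσ (Sum.inl s), ← hprσ (Sum.inl s'), ← tr2] at h1
    have := kill1 _ _ h1
    simpa only [ξ, hpr, hprσ] using this
  have cl23 : ∀ s s' : T₂₃.Pt, EqvGen (T₂₃.closed c a) s s' →
      CircleAlg.X (T.circle d a (g'.π (Sum.inr s))) * E4 =
      CircleAlg.X (T.circle d a (g'.π (Sum.inr s'))) * E4 := by
    intro s s' h
    have h1 : EqvGen (stage (Sum.LiftRel (T₁.capped d) (T₂₃.cupped a))
        (fun p => Sum.inl (T₁.bot p)) (fun p => Sum.inr (T₂₃.top p)) c.toFun ∅)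
        (Sum.inr s) (Sum.inr s') := by
      refine eqvGen_map Sum.inr ?_ h
      rintro x y ((h | ⟨p, rfl, rfl⟩) | (h | ⟨p, rfl, rfl⟩))
      · exact EqvGen.rel _ _ (Or.inl (Sum.LiftRel.inr (Or.inl h)))
      · exact EqvGen.rel _ _ (Or.inr (Or.inr ⟨p, by simp, Or.inr ⟨rfl, rfl⟩⟩))
      · exact EqvGen.rel _ _ (Or.inl (Sum.LiftRel.inr (Or.inl h)))
      · exact EqvGen.rel _ _ (Or.inl (Sum.LiftRel.inr (Or.inr ⟨p, rfl, rfl⟩)))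
    rw [← hprσ' (Sum.inr s), ← hprσ' (Sum.inr s'), ← tr4] at h1
    have := kill2 _ _ h1
    simpa only [ξ, hpr', hprσ'] using this
  -- the common value
  let F : CircleAlg (T₁.Circles d c) →+* CircleAlg (T.Circles d a) :=
    CircleAlg.push (fun C => T.circle d a (pr (Sum.inl (T₁.rep C))))
  let G : CircleAlg (T₂.Circles c b) →+* CircleAlg (T.Circles d a) :=
    CircleAlg.push (fun C => T.circle d a (pr (Sum.inr (Sum.inl (T₂.rep C)))))
  let H : CircleAlg (T₃.Circles b a) →+* CircleAlg (T.Circles d a) :=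
    CircleAlg.push (fun C => T.circle d a (pr (Sum.inr (Sum.inr (T₃.rep C)))))
  let Φ : CircleAlg (T₁₂.Circles d b) →+* CircleAlg (T.Circles d a) :=
    CircleAlg.push (fun C => T.circle d a (g.π (Sum.inl (T₁₂.rep C))))
  let Ψ : CircleAlg (T₂₃.Circles c a) →+* CircleAlg (T.Circles d a) :=
    CircleAlg.push (fun C => T.circle d a (g'.π (Sum.inr (T₂₃.rep C))))
  have ΦX : ∀ s, Φ (CircleAlg.X (T₁₂.circle d b s)) * E2 =
      CircleAlg.X (T.circle d a (g.π (Sum.inl s))) * E2 := by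
    intro s
    simp only [Φ, CircleAlg.push, CircleAlg.eval_X]
    exact cl12 _ _ (T₁₂.rep_circle d b s)
  have ΨX : ∀ s, Ψ (CircleAlg.X (T₂₃.circle c a s)) * E4 =
      CircleAlg.X (T.circle d a (g'.π (Sum.inr s))) * E4 := by
    intro s
    simp only [Ψ, CircleAlg.push, CircleAlg.eval_X]
    exact cl23 _ _ (T₂₃.rep_circle c a s)
  have k1 : Φ (saddleElement g₁₂ d c b) * E2 =
      saddles (stage R up' lo' b.toFun ∅) up lo c.toFun ξ ∅ c.arcs * E2 := by
    unfold saddleElement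
    rw [saddles_map, ← saddles_transfer (up := fun p => Sum.inl (T₁.bot p))
      (lo := fun p => Sum.inr (T₂.top p)) (R := Sum.LiftRel (T₁.capped d) (T₂.cupped b))
      (ξ := fun x => ξ (i₁₂ x)) (fun D p q => tr12 D _ _) (fun p => rfl)]
    refine saddles_congr_mul _ _ _ _ _ _ (fun p => ?_) _ _
    exact ΦX _
  have k3 : Ψ (saddleElement g₂₃ c b a) * E4 =
      saddles (stage R up lo c.toFun ∅) up' lo' b.toFun ξ ∅ b.arcs * E4 := by
    unfold saddleElement
    rw [saddles_map, ← saddles_transfer (up := fun p => Sum.inl (T₂.bot p))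
      (lo := fun p => Sum.inr (T₃.top p)) (R := Sum.LiftRel (T₂.capped c) (T₃.cupped a))
      (ξ := fun x => ξ (i₂₃ x)) (fun D p q => tr23 D _ _) (fun p => rfl)]
    refine saddles_congr_mul _ _ _ _ _ _ (fun p => ?_) _ _
    refine (ΨX _).trans ?_
    simp only [ξ, hpr']
    rfl
  have kF : ∀ f, Φ (CircleAlg.push (fun C => T₁₂.circle d b (g₁₂.π (Sum.inl (T₁.rep C)))) f) * E2
      = F f * E2 := by
    intro f
    refine CircleAlg.hom_congr (φ := Φ.comp (CircleAlg.push _)) (ψ := F) (fun C => ?_) f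
    rw [RingHom.comp_apply]
    simp only [F, CircleAlg.push, CircleAlg.eval_X]
    exact ΦX _
  have kG : ∀ f, Φ (CircleAlg.push (fun C => T₁₂.circle d b (g₁₂.π (Sum.inr (T₂.rep C)))) f) * E2
      = G f * E2 := by
    intro f
    refine CircleAlg.hom_congr (φ := Φ.comp (CircleAlg.push _)) (ψ := G) (fun C => ?_) f
    rw [RingHom.comp_apply]
    simp only [G, CircleAlg.push, CircleAlg.eval_X]
    exact ΦX _
  have kG' : ∀ f, Ψ (CircleAlg.push (fun C => T₂₃.circle c a (g₂₃.π (Sum.inl (T₂.rep C)))) f) * E4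
      = G f * E4 := by
    intro f
    refine CircleAlg.hom_congr (φ := Ψ.comp (CircleAlg.push _)) (ψ := G) (fun C => ?_) f
    rw [RingHom.comp_apply]
    simp only [G, CircleAlg.push, CircleAlg.eval_X, hpr']
    exact ΨX _
  have kH' : ∀ f, Ψ (CircleAlg.push (fun C => T₂₃.circle c a (g₂₃.π (Sum.inr (T₃.rep C)))) f) * E4
      = H f * E4 := by
    intro f
    refine CircleAlg.hom_congr (φ := Ψ.comp (CircleAlg.push _)) (ψ := H) (fun C => ?_) f
    rw [RingHom.comp_apply]
    simp only [H, CircleAlg.push, CircleAlg.eval_X, hpr']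
    exact ΨX _
  have kF' : CircleAlg.push (fun C => T.circle d a (g'.π (Sum.inl (T₁.rep C)))) = F := by
    simp only [F, hpr']
    rfl
  have lhs : contract g d b a (contract g₁₂ d c b x y) z =
      F x * G y * H z * (saddles (stage R up' lo' b.toFun ∅) up lo c.toFun ξ ∅ c.arcs * E2) := by
    have : contract g d b a (contract g₁₂ d c b x y) z =
        Φ (contract g₁₂ d c b x y) * H z * E2 := by
      rw [← e2]; rfl
    rw [this]
    unfold contract
    rw [map_mul, map_mul]
    have q1 := kF x
    have q2 := kG y
    generalize Φ (CircleAlg.push _ x) = X1 at *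
    generalize Φ (CircleAlg.push _ y) = X2 at *
    generalize Φ (saddleElement g₁₂ d c b) = X3 at *
    linear_combination X2 * X3 * H z * q1 + F x * X3 * H z * q2 + F x * G y * H z * k1
  have rhs : contract g' d c a x (contract g₂₃ c b a y z) =
      F x * G y * H z * (saddles (stage R up lo c.toFun ∅) up' lo' b.toFun ξ ∅ b.arcs * E4) := by
    have : contract g' d c a x (contract g₂₃ c b a y z) =
        F x * Ψ (contract g₂₃ c b a y z) * E4 := by
      rw [← e4, ← kF']; rfl
    rw [this]
    unfold contract
    rw [map_mul, map_mul]
    have q1 := kG' y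
    have q2 := kH' z
    generalize Ψ (CircleAlg.push _ y) = X1 at *
    generalize Ψ (CircleAlg.push _ z) = X2 at *
    generalize Ψ (saddleElement g₂₃ c b a) = X3 at *
    linear_combination F x * X2 * X3 * q1 + F x * G y * X3 * q2 + F x * G y * H z * k3
  rw [lhs, rhs, main]

end FlatTangle

end

noncomputable section

set_option linter.unusedSectionVars false

open Relation Equiv Equiv.Perm

variable {n k : ℕ}

namespace FlatTangle

variable {u v w t : Weight n k}

/-- number of circles after contraction, and degree of the saddle element -/
theorem homog_saddleElement {T₁ : FlatTangle w u} {T₂ : FlatTangle v w} {T₁₂ : FlatTangle v u}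
    (g : Gluing T₁ T₂ T₁₂) (c : Matching u) (b : Matching w) (a : Matching v) :
    ∃ e, (saddleElement g c b a).Homog e ∧
      Nat.card (T₁₂.Circles c a) + b.arcs.length =
        Nat.card (T₁.Circles c b) + Nat.card (T₂.Circles b a) + 2 * e := by
  classical
  let up : Ones w → T₁.Pt ⊕ T₂.Pt := fun p => Sum.inl (T₁.bot p)
  let lo : Ones w → T₁.Pt ⊕ T₂.Pt := fun p => Sum.inr (T₂.top p)
  let ps : Ones w → Prop := fun p => Positive w p.1
  let R := Sum.LiftRel (T₁.capped c) (T₂.cupped a)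
  have hl : IsLayer up lo b.toFun ps := isLayer_mid T₁ T₂ b
  obtain ⟨θ₁, a1, a2, a3⟩ := T₁.orient c b
  obtain ⟨θ₂, b1, b2, b3⟩ := T₂.orient b a
  have f1 : IsFlow θ₁ (T₁.capped c) {x | ∃ p, ¬ Positive w p.1 ∧ x = T₁.bot p} := by
    refine T₁.flow_capped c a1 ?_ a3
    rintro p hp ⟨q, hq, h⟩
    exact T₁.top_ne_bot hp hq h
  have f2 : IsFlow θ₂ (T₂.cupped a) {x | ∃ p, Positive w p.1 ∧ x = T₂.top p} := by
    refine T₂.flow_cupped a b2 ?_ ?_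
    · rintro p hp ⟨q, hq, h⟩
      exact T₂.top_ne_bot hq hp h.symm
    · rw [Set.union_comm]; exact b3
  let θ : Perm (T₁.Pt ⊕ T₂.Pt) := Equiv.sumCongr θ₁ θ₂
  have hR : IsFlow θ R (exits up lo ps) := by
    have h := sumCongr_flow f1 f2
    have e : exits up lo ps = (Sum.inl '' {x | ∃ p, ¬ Positive w p.1 ∧ x = T₁.bot p} ∪
        Sum.inr '' {x | ∃ p, Positive w p.1 ∧ x = T₂.top p} : Set (T₁.Pt ⊕ T₂.Pt)) := by
      ext x
      constructor
      · rintro (⟨p, hp, rfl⟩ | ⟨p, hp, rfl⟩)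
        · exact Or.inl ⟨_, ⟨p, hp, rfl⟩, rfl⟩
        · exact Or.inr ⟨_, ⟨p, hp, rfl⟩, rfl⟩
      · rintro (⟨_, ⟨p, hp, rfl⟩, rfl⟩ | ⟨_, ⟨p, hp, rfl⟩, rfl⟩)
        · exact Or.inl ⟨p, hp, rfl⟩
        · exact Or.inr ⟨p, hp, rfl⟩
    rw [e]
    exact h
  let ξ : T₁.Pt ⊕ T₂.Pt → CircleAlg (T₁₂.Circles c a) :=
    fun x => CircleAlg.X (T₁₂.circle c a (g.π x))
  have s0 : SurgeryState up lo b.toFun ps θ θ ∅ := SurgeryState.zero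
    (fun p hp => congrArg Sum.inl (a2 p hp)) (fun p hp => congrArg Sum.inr (b1 p hp))
  have s1 := s0.list hl b.arcs (by simp) (by simp) b.arcs_pairwise
  have hu : (∅ ∪ {q | q ∈ b.arcs ∨ b.toFun q ∈ b.arcs} : Set (Ones w)) = Set.univ := by
    ext q; simpa using b.arcs_cover q
  rw [hu] at s1
  have e1 : saddleElement g c b a =
      Surgery.prodFactor ξ θ (b.arcs.map (arcPair up lo b.toFun ps)) := by
    refine saddles_eq_prodFactor hl hR (fun p => ?_) b.arcs s0 (by simp) (by simp) b.arcs_pairwise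
    exact congrArg (fun x => CircleAlg.X (T₁₂.circle c a x)) (g.mid p).symm
  obtain ⟨e, he, hcard⟩ := Surgery.homog_prodFactor ξ (fun x => CircleAlg.Homog.X _) θ
    (b.arcs.map (arcPair up lo b.toFun ps)) (by
      intro p hp
      obtain ⟨q, -, rfl⟩ := List.mem_map.mp hp
      exact arcPair_ne hl q)
  refine ⟨e, by rw [e1]; exact he, ?_⟩
  rw [List.length_map] at hcard
  -- circles at the end
  have r1 := s1.rep hl (N := ∅) (by simpa using hR) (by simp) (by simp)
  have c1 : Surgery.cycles (Surgery.after θ (b.arcs.map (arcPair up lo b.toFun ps))) =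
      Nat.card (T₁₂.Circles c a) := by
    refine Nat.card_congr (Equiv.ofBijective (Quotient.map' (s₁ := SameCycle.setoid _)
      (s₂ := EqvGen.setoid (T₁₂.closed c a)) g.π (fun x y h => ?_)) ⟨?_, ?_⟩)
    · exact (g.eqvGen_iff c b a x y).mp ((r1.eqvGen_iff x y).mpr h)
    · intro q1 q2 h
      induction q1 using Quotient.inductionOn with | _ x => ?_
      induction q2 using Quotient.inductionOn with | _ y => ?_
      exact Quotient.sound ((r1.eqvGen_iff x y).mp ((g.eqvGen_iff c b a x y).mpr (Quotient.exact h)))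
    · intro q
      induction q using Quotient.inductionOn with | _ x => ?_
      exact ⟨Quotient.mk _ (g.σ x), congrArg (T₁₂.circle c a) (g.π_σ x)⟩
  -- circles at the start
  have r0 := s0.rep hl (N := ∅) (by simpa using hR) (by simp) (by simp)
  have hrel : ∀ x y, SameCycle θ x y ↔
      EqvGen (Sum.LiftRel (T₁.closed c b) (T₂.closed b a)) x y := by
    intro x y
    rw [← r0.eqvGen_iff]
    constructor
    · refine eqvGen_of_le ?_
      rintro _ _ ((h | h) | ⟨p, hp, -⟩ | ⟨p, -, ⟨rfl, rfl⟩ | ⟨rfl, rfl⟩⟩)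
      · exact EqvGen.rel _ _ (Sum.LiftRel.inl (Or.inl h))
      · exact EqvGen.rel _ _ (Sum.LiftRel.inr (Or.inr h))
      · exact absurd hp (by simp)
      · exact EqvGen.rel _ _ (Sum.LiftRel.inl (Or.inr (Or.inr ⟨p, rfl, rfl⟩)))
      · exact EqvGen.rel _ _ (Sum.LiftRel.inr (Or.inl (Or.inr ⟨p, rfl, rfl⟩)))
    · refine eqvGen_of_le ?_
      rintro _ _ ((h | (h | ⟨p, rfl, rfl⟩)) | ((h | ⟨p, rfl, rfl⟩) | h))
      · exact EqvGen.rel _ _ (Or.inl (Sum.LiftRel.inl h))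
      · exact EqvGen.rel _ _ (Or.inl (Sum.LiftRel.inl (Or.inl h)))
      · exact EqvGen.rel _ _ (Or.inr (Or.inr ⟨p, by simp, Or.inl ⟨rfl, rfl⟩⟩))
      · exact EqvGen.rel _ _ (Or.inl (Sum.LiftRel.inr (Or.inl h)))
      · exact EqvGen.rel _ _ (Or.inr (Or.inr ⟨p, by simp, Or.inr ⟨rfl, rfl⟩⟩))
      · exact EqvGen.rel _ _ (Or.inl (Sum.LiftRel.inr h))
  have il : ∀ x y, EqvGen (T₁.closed c b) x y ↔
      EqvGen (Sum.LiftRel (T₁.closed c b) (T₂.closed b a)) (Sum.inl x) (Sum.inl y) := by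
    refine eqvGen_embed Sum.inl Sum.inl_injective (fun _ _ h => Sum.LiftRel.inl h) ?_ ?_
    · rintro x z (h | h); exact ⟨_, rfl, h⟩
    · rintro x z (h | h); exact ⟨_, rfl, h⟩
  have ir : ∀ x y, EqvGen (T₂.closed b a) x y ↔
      EqvGen (Sum.LiftRel (T₁.closed c b) (T₂.closed b a)) (Sum.inr x) (Sum.inr y) := by
    refine eqvGen_embed Sum.inr Sum.inr_injective (fun _ _ h => Sum.LiftRel.inr h) ?_ ?_
    · rintro x z (h | h); exact ⟨_, rfl, h⟩
    · rintro x z (h | h); exact ⟨_, rfl, h⟩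
  have isep : ∀ x y, ¬ EqvGen (Sum.LiftRel (T₁.closed c b) (T₂.closed b a))
      (Sum.inl x) (Sum.inr y) := by
    intro x y h
    have := eqvGen_map (R' := (Eq : Bool → Bool → Prop)) Sum.isLeft (by
      rintro _ _ (h | h) <;> exact EqvGen.refl _) h
    have h2 : ∀ p q : Bool, EqvGen Eq p q → p = q := by
      intro p q h
      induction h with
      | rel x y h => exact h
      | refl x => rfl
      | symm x y _ ih => exact ih.symm
      | trans x y z _ _ h1 h2 => exact h1.trans h2
    exact absurd (h2 _ _ this) (by simp)
  have c0 : Surgery.cycles θ = Nat.card (T₁.Circles c b) + Nat.card (T₂.Circles b a) := by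
    rw [← Nat.card_sum]
    symm
    refine Nat.card_congr (Equiv.ofBijective (Sum.elim
      (Quotient.map' (s₁ := EqvGen.setoid (T₁.closed c b)) (s₂ := SameCycle.setoid θ) Sum.inl
        (fun x y h => (hrel _ _).mpr ((il x y).mp h)))
      (Quotient.map' (s₁ := EqvGen.setoid (T₂.closed b a)) (s₂ := SameCycle.setoid θ) Sum.inr
        (fun x y h => (hrel _ _).mpr ((ir x y).mp h)))) ⟨?_, ?_⟩)
    · rintro (q1 | q1) (q2 | q2) h <;>
      induction q1 using Quotient.inductionOn with | _ x => ?_ <;>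
      induction q2 using Quotient.inductionOn with | _ y => ?_
      · exact congrArg Sum.inl (Quotient.sound ((il x y).mpr ((hrel _ _).mp (Quotient.exact h))))
      · exact absurd ((hrel _ _).mp (Quotient.exact h)) (isep x y)
      · exact absurd ((hrel _ _).mp (Quotient.exact h.symm)) (isep y x)
      · exact congrArg Sum.inr (Quotient.sound ((ir x y).mpr ((hrel _ _).mp (Quotient.exact h))))
    · intro q
      induction q using Quotient.inductionOn with | _ x => ?_
      rcases x with x | x
      · exact ⟨Sum.inl (Quotient.mk _ x), rfl⟩
      · exact ⟨Sum.inr (Quotient.mk _ x), rfl⟩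
  rw [← c1, ← c0, ← hcard]

/-- The identity tangle, with strands of length zero. -/
def one (w : Weight n k) : FlatTangle w w where
  Pt := Ones w
  finite := inferInstance
  bot := id
  top := id
  adj := fun _ _ => False
  bot_inj := Function.injective_id
  top_inj := Function.injective_id
  colour := by rintro p q h; cases h; exact Iff.rfl
  orient := by
    classical
    intro b a
    refine ⟨⟨fun p => if Positive w p.1 then b.toFun p else a.toFun p,
      fun p => if Positive w p.1 then a.toFun p else b.toFun p, ?_, ?_⟩, ?_, ?_, ?_, ?_⟩
    · intro p
      by_cases hp : Positive w p.1
      · have : ¬ Positive w (b.toFun p).1 := fun h => (b.flip p).mp h hp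
        simp [hp, this, b.invol]
      · have : Positive w (a.toFun p).1 := (a.flip p).mpr hp
        simp [hp, this, a.invol]
    · intro p
      by_cases hp : Positive w p.1
      · have : ¬ Positive w (a.toFun p).1 := fun h => (a.flip p).mp h hp
        simp [hp, this, a.invol]
      · have : Positive w (b.toFun p).1 := (b.flip p).mpr hp
        simp [hp, this, b.invol]
    · intro p hp
      exact if_pos hp
    · intro p hp
      exact if_neg hp
    · intro z hz
      exfalso
      by_cases hp : Positive w z.1
      · exact hz (Or.inl ⟨z, hp, rfl⟩)
      · exact hz (Or.inr ⟨z, hp, rfl⟩)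
    · intro z z' h
      exact h.elim

/-- The composition `1 T = T`. -/
def gluingLeft (T : FlatTangle v w) : Gluing (one w) T T where
  π := Sum.elim T.top id
  σ := Sum.inr
  π_σ := fun _ => rfl
  mid := fun _ => rfl
  top := fun _ => rfl
  bot := fun _ => rfl
  adj := by
    rintro _ _ (h | h)
    · exact h.elim
    · exact h
  lift := fun _ _ h => Sum.LiftRel.inr h
  sect := by
    rintro (x | x)
    · exact EqvGen.rel _ _ ⟨x, rfl, rfl⟩
    · exact EqvGen.refl _

/-- The composition `T 1 = T`. -/
def gluingRight (T : FlatTangle v w) : Gluing T (one v) T where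
  π := Sum.elim id T.bot
  σ := Sum.inl
  π_σ := fun _ => rfl
  mid := fun _ => rfl
  top := fun _ => rfl
  bot := fun _ => rfl
  adj := by
    rintro _ _ (h | h)
    · exact h
    · exact h.elim
  lift := fun _ _ h => Sum.LiftRel.inl h
  sect := by
    rintro (x | x)
    · exact EqvGen.refl _
    · exact (EqvGen.rel _ _ ⟨x, rfl, rfl⟩).symm

theorem contract_one_left (T : FlatTangle v w) (b : Matching w) (a : Matching v)
    (y : CircleAlg (T.Circles b a)) : contract T.gluingLeft b b a 1 y = y := by
  have hE : saddleElement T.gluingLeft b b a = 1 := by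
    refine saddles_eq_one (fun D p _ _ => EqvGen.rel _ _ (Or.inl (Sum.LiftRel.inl ?_))) _ _
    exact Or.inr ⟨p, rfl, rfl⟩
  unfold contract
  rw [hE, map_one, one_mul, mul_one]
  exact CircleAlg.push_id_apply (fun C => T.circle_rep C) y

theorem contract_one_right (T : FlatTangle v w) (b : Matching w) (a : Matching v)
    (y : CircleAlg (T.Circles b a)) : contract T.gluingRight b a a y 1 = y := by
  have hE : saddleElement T.gluingRight b a a = 1 := by
    refine saddles_eq_one (fun D p hp hp' => ?_) _ _
    refine EqvGen.trans _ _ _ (EqvGen.rel _ _ (Or.inr (Or.inl ⟨p, hp, rfl, rfl⟩))) ?_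
    refine EqvGen.trans _ _ _ ?_ (EqvGen.symm _ _
      (EqvGen.rel _ _ (Or.inr (Or.inl ⟨_, hp', rfl, rfl⟩))))
    exact EqvGen.rel _ _ (Or.inl (Sum.LiftRel.inr (Or.inr ⟨p, rfl, rfl⟩)))
  unfold contract
  rw [hE, map_one, mul_one, mul_one]
  exact CircleAlg.push_id_apply (fun C => T.circle_rep C) y

/-- The bimodule `F(T) = ⊕_{b, a} F(W(b) T a)`. -/
def Space (T : FlatTangle v w) : Type :=
  (b : Matching w) → (a : Matching v) → CircleAlg (T.Circles b a)

instance (T : FlatTangle v w) : AddCommGroup T.Space :=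
  inferInstanceAs (AddCommGroup ((b : Matching w) → (a : Matching v) → CircleAlg (T.Circles b a)))

theorem Space.add_apply {T : FlatTangle v w} (x y : T.Space) (b a) :
    (x + y) b a = x b a + y b a := rfl

theorem Space.zero_apply {T : FlatTangle v w} (b a) : (0 : T.Space) b a = 0 := rfl

theorem contract_add_left {T₁ : FlatTangle w u} {T₂ : FlatTangle v w} {T₁₂ : FlatTangle v u}
    (g : Gluing T₁ T₂ T₁₂) (c b a) (f f' h) :
    contract g c b a (f + f') h = contract g c b a f h + contract g c b a f' h := by
  simp only [contract, map_add]; ring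

theorem contract_add_right {T₁ : FlatTangle w u} {T₂ : FlatTangle v w} {T₁₂ : FlatTangle v u}
    (g : Gluing T₁ T₂ T₁₂) (c b a) (f h h') :
    contract g c b a f (h + h') = contract g c b a f h + contract g c b a f h' := by
  simp only [contract, map_add]; ring

theorem contract_zero_left {T₁ : FlatTangle w u} {T₂ : FlatTangle v w} {T₁₂ : FlatTangle v u}
    (g : Gluing T₁ T₂ T₁₂) (c b a) (h) : contract g c b a 0 h = 0 := by
  simp [contract]

theorem contract_zero_right {T₁ : FlatTangle w u} {T₂ : FlatTangle v w} {T₁₂ : FlatTangle v u}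
    (g : Gluing T₁ T₂ T₁₂) (c b a) (f) : contract g c b a f 0 = 0 := by
  simp [contract]

theorem contract_sum_left {T₁ : FlatTangle w u} {T₂ : FlatTangle v w} {T₁₂ : FlatTangle v u}
    (g : Gluing T₁ T₂ T₁₂) (c b a) {ι : Type} (s : Finset ι) (f : ι → _) (h) :
    contract g c b a (∑ i ∈ s, f i) h = ∑ i ∈ s, contract g c b a (f i) h := by
  simp only [contract, map_sum, Finset.sum_mul]

theorem contract_sum_right {T₁ : FlatTangle w u} {T₂ : FlatTangle v w} {T₁₂ : FlatTangle v u}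
    (g : Gluing T₁ T₂ T₁₂) (c b a) {ι : Type} (s : Finset ι) (f) (h : ι → _) :
    contract g c b a f (∑ i ∈ s, h i) = ∑ i ∈ s, contract g c b a f (h i) := by
  simp only [contract, map_sum, Finset.sum_mul, Finset.mul_sum]

/-- The map `F(T₁) × F(T₂) → F(T₁ T₂)` given by the contraction cobordisms; products of components with
different matchings in the middle are zero. -/
def compose {T₁ : FlatTangle w u} {T₂ : FlatTangle v w} {T₁₂ : FlatTangle v u}
    (g : Gluing T₁ T₂ T₁₂) (x : T₁.Space) (y : T₂.Space) : T₁₂.Space :=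
  fun c a => ∑ b, contract g c b a (x c b) (y b a)

theorem compose_add_left {T₁ : FlatTangle w u} {T₂ : FlatTangle v w} {T₁₂ : FlatTangle v u}
    (g : Gluing T₁ T₂ T₁₂) (x x' : T₁.Space) (y : T₂.Space) :
    compose g (x + x') y = compose g x y + compose g x' y := by
  funext c a
  simp only [compose, Space.add_apply, contract_add_left, Finset.sum_add_distrib]

theorem compose_add_right {T₁ : FlatTangle w u} {T₂ : FlatTangle v w} {T₁₂ : FlatTangle v u}
    (g : Gluing T₁ T₂ T₁₂) (x : T₁.Space) (y y' : T₂.Space) :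
    compose g x (y + y') = compose g x y + compose g x y' := by
  funext c a
  simp only [compose, Space.add_apply, contract_add_right, Finset.sum_add_distrib]

theorem compose_zero_left {T₁ : FlatTangle w u} {T₂ : FlatTangle v w} {T₁₂ : FlatTangle v u}
    (g : Gluing T₁ T₂ T₁₂) (y : T₂.Space) : compose g 0 y = 0 := by
  funext c a
  simp only [compose, Space.zero_apply, contract_zero_left, Finset.sum_const_zero]

theorem compose_zero_right {T₁ : FlatTangle w u} {T₂ : FlatTangle v w} {T₁₂ : FlatTangle v u}
    (g : Gluing T₁ T₂ T₁₂) (x : T₁.Space) : compose g x 0 = 0 := by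
  funext c a
  simp only [compose, Space.zero_apply, contract_zero_right, Finset.sum_const_zero]

theorem compose_assoc {T₁ : FlatTangle w u} {T₂ : FlatTangle v w} {T₃ : FlatTangle t v}
    {T₁₂ : FlatTangle v u} {T₂₃ : FlatTangle t w} {T : FlatTangle t u}
    (g₁₂ : Gluing T₁ T₂ T₁₂) (g₂₃ : Gluing T₂ T₃ T₂₃)
    (g : Gluing T₁₂ T₃ T) (g' : Gluing T₁ T₂₃ T)
    (h₁ : ∀ x, g.π (Sum.inl (g₁₂.π (Sum.inl x))) = g'.π (Sum.inl x))
    (h₂ : ∀ x, g.π (Sum.inl (g₁₂.π (Sum.inr x))) = g'.π (Sum.inr (g₂₃.π (Sum.inl x))))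
    (h₃ : ∀ x, g.π (Sum.inr x) = g'.π (Sum.inr (g₂₃.π (Sum.inr x))))
    (x : T₁.Space) (y : T₂.Space) (z : T₃.Space) :
    compose g (compose g₁₂ x y) z = compose g' x (compose g₂₃ y z) := by
  funext d a
  simp only [compose, contract_sum_left, contract_sum_right]
  rw [Finset.sum_comm]
  refine Finset.sum_congr rfl fun c _ => Finset.sum_congr rfl fun b _ => ?_
  exact contract_assoc g₁₂ g₂₃ g g' h₁ h₂ h₃ d c b a _ _ _

open scoped Classical in
/-- The unit `∑ 1_a` of the ring. -/
def unit (w : Weight n k) : (one w).Space := fun b a => if b = a then 1 else 0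

theorem compose_unit_left (T : FlatTangle v w) (y : T.Space) :
    compose T.gluingLeft (unit w) y = y := by
  classical
  funext b a
  simp only [compose]
  rw [Finset.sum_eq_single b]
  · rw [unit, if_pos rfl]; exact contract_one_left T b a _
  · intro c _ hc
    rw [unit, if_neg hc.symm, contract_zero_left]
  · intro h; exact absurd (Finset.mem_univ b) h

theorem compose_unit_right (T : FlatTangle v w) (y : T.Space) :
    compose T.gluingRight y (unit v) = y := by
  classical
  funext b a
  simp only [compose]
  rw [Finset.sum_eq_single a]
  · rw [unit, if_pos rfl]; exact contract_one_right T b a _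
  · intro c _ hc
    rw [unit, if_neg hc, contract_zero_right]
  · intro h; exact absurd (Finset.mem_univ a) h

end FlatTangle

/-- The ring `H_w = ⊕_{b, a} F(W(b) a)`. -/
def ArcRing (w : Weight n k) : Type := (FlatTangle.one w).Space

open FlatTangle

namespace ArcRing

variable {v w : Weight n k}

instance : AddCommGroup (ArcRing w) := inferInstanceAs (AddCommGroup (one w).Space)

instance : Mul (ArcRing w) := ⟨fun x y => compose (one w).gluingLeft x y⟩

instance : One (ArcRing w) := ⟨FlatTangle.unit w⟩

instance : Ring (ArcRing w) :=
  { (inferInstance : AddCommGroup (ArcRing w)) with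
    mul := (· * ·)
    one := 1
    mul_assoc := fun x y z => compose_assoc _ _ _ _ (fun _ => rfl) (fun _ => rfl) (fun _ => rfl) x y z
    one_mul := fun x => compose_unit_left _ x
    mul_one := fun x => compose_unit_right _ x
    left_distrib := compose_add_right _
    right_distrib := compose_add_left _
    zero_mul := compose_zero_left _
    mul_zero := compose_zero_right _ }

/-- The left action of `H_w` on `F(T)`. -/
instance (T : FlatTangle v w) : Module (ArcRing w) T.Space where
  smul h x := compose T.gluingLeft h x
  one_smul := compose_unit_left T
  mul_smul h h' x := compose_assoc (T₂ := one w) _ _ _ _ (fun _ => rfl) (fun _ => rfl)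
    (fun _ => rfl) h h' x
  smul_zero := compose_zero_right _
  zero_smul := compose_zero_left _
  smul_add := compose_add_right _
  add_smul := compose_add_left _

/-- The right action of `H_v` on `F(T)`. -/
instance (T : FlatTangle v w) : Module (ArcRing v)ᵐᵒᵖ T.Space where
  smul h x := compose T.gluingRight x h.unop
  one_smul := compose_unit_right T
  mul_smul h h' x := (compose_assoc (T₂ := one v) (T₂₃ := one v) T.gluingRight (one v).gluingLeft
    T.gluingRight T.gluingRight (fun _ => rfl) (fun _ => rfl) (fun _ => rfl)
    x h'.unop h.unop).symm
  smul_zero _ := compose_zero_left _ _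
  zero_smul := compose_zero_right _
  smul_add _ x y := compose_add_left _ x y _
  add_smul _ _ x := compose_add_right _ x _ _

theorem smul_def (T : FlatTangle v w) (h : ArcRing w) (x : T.Space) :
    h • x = compose T.gluingLeft h x := rfl

theorem op_smul_def (T : FlatTangle v w) (h : (ArcRing v)ᵐᵒᵖ) (x : T.Space) :
    h • x = compose T.gluingRight x h.unop := rfl

instance (T : FlatTangle v w) : SMulCommClass (ArcRing w) (ArcRing v)ᵐᵒᵖ T.Space where
  smul_comm h h' x := (compose_assoc (T₂ := T) T.gluingLeft T.gluingRight T.gluingRight T.gluingLeft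
    (fun _ => rfl) (fun _ => rfl) (fun _ => rfl) h x h'.unop).symm

end ArcRing

end

noncomputable section

set_option linter.unusedSectionVars false

open Relation Equiv Equiv.Perm

theorem isInternal_of_proj {M : Type*} [AddCommGroup M] (G : ℤ → AddSubgroup M)
    (pr : ℤ → M →+ M) (hmem : ∀ d x, pr d x ∈ G d) (hfix : ∀ d, ∀ x ∈ G d, pr d x = x)
    (hkill : ∀ d e, d ≠ e → ∀ x ∈ G e, pr d x = 0)
    (hs : ∀ x, ∃ s : Finset ℤ, ∑ d ∈ s, pr d x = x) : DirectSum.IsInternal G := by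
  classical
  have key : ∀ (f : DirectSum ℤ fun d => G d) d, pr d (DirectSum.coeAddMonoidHom G f) = f d := by
    intro f d
    induction f using DirectSum.induction_on with
    | zero => simp
    | of e x =>
      rw [DirectSum.coeAddMonoidHom_of]
      by_cases h : d = e
      · subst h; rw [hfix _ _ x.2, DirectSum.of_eq_same]
      · rw [hkill _ _ h _ x.2, DirectSum.of_eq_of_ne _ _ _ h]; rfl
    | add f g hf hg => rw [map_add, map_add, hf, hg]; rfl
  constructor
  · intro f g h
    ext d
    rw [← key f d, ← key g d, h]
  · intro x
    obtain ⟨s, h⟩ := hs x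
    refine ⟨∑ d ∈ s, DirectSum.of (fun d => G d) d ⟨pr d x, hmem d x⟩, ?_⟩
    rw [map_sum]
    simpa only [DirectSum.coeAddMonoidHom_of] using h

variable {n k : ℕ}

/-- Half the number of 1s of a weight. -/
def halfOnes (w : Weight n k) : ℕ := Fintype.card (Ones w) / 2

namespace FlatTangle

variable {u v w t : Weight n k}

/-- The degree of the basis element `X_S` of `F(W(b) T a){m}`, where `1, X ∈ A` have degrees `-1, 1` and
`m` is half the number of bottom endpoints. -/
def degree (T : FlatTangle v w) (b : Matching w) (a : Matching v) (S : Finset (T.Circles b a)) : ℤ :=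
  2 * (S.card : ℤ) - Nat.card (T.Circles b a) + halfOnes v

/-- The part of `F(T)` of degree `d`. -/
def part (T : FlatTangle v w) (d : ℤ) : AddSubgroup T.Space where
  carrier := {x | ∀ b a S, x b a S ≠ 0 → T.degree b a S = d}
  zero_mem' := fun _ _ _ h => absurd rfl h
  add_mem' := by
    intro x y hx hy b a S h
    by_cases h1 : x b a S = 0
    · refine hy b a S fun h2 => h ?_
      change x b a S + y b a S = 0
      rw [h1, h2, add_zero]
    · exact hx b a S h1
  neg_mem' := by
    intro x hx b a S h
    refine hx b a S fun h1 => h ?_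
    change - x b a S = 0
    rw [h1, neg_zero]

theorem part_isInternal (T : FlatTangle v w) : DirectSum.IsInternal T.part := by
  classical
  let pr : ℤ → T.Space →+ T.Space := fun d =>
    { toFun := fun x b a S => if T.degree b a S = d then x b a S else 0
      map_zero' := by
        funext b a S
        exact ite_self _
      map_add' := fun x y => by
        funext b a S
        change (if T.degree b a S = d then x b a S + y b a S else 0) =
          (if T.degree b a S = d then x b a S else 0) + (if T.degree b a S = d then y b a S else 0)
        split_ifs <;> simp }
  have hpr : ∀ d x b a S, pr d x b a S = if T.degree b a S = d then x b a S else 0 :=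
    fun _ _ _ _ _ => rfl
  refine isInternal_of_proj T.part pr ?_ ?_ ?_ ?_
  · intro d x b a S h
    by_contra h'
    exact h (if_neg h')
  · intro d x hx
    funext b a S
    rw [hpr]
    by_cases h : x b a S = 0
    · rw [h, ite_self]
    · rw [if_pos (hx b a S h)]
  · intro d e hde x hx
    funext b a S
    rw [hpr]
    by_cases h : x b a S = 0
    · rw [h, ite_self]; rfl
    · rw [if_neg]
      · rfl
      · rw [hx b a S h]; exact hde.symm
  · intro x
    have hfin : (Set.range fun q : Σ (b : Matching w) (a : Matching v), Finset (T.Circles b a) =>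
        T.degree q.1 q.2.1 q.2.2).Finite := by
      have : ∀ b a, Fintype (T.Circles b a) := fun b a => Fintype.ofFinite _
      exact Set.finite_range _
    refine ⟨hfin.toFinset, ?_⟩
    funext b a S
    let ev : T.Space →+ ℤ := AddMonoidHom.mk' (fun x => x b a S) fun _ _ => rfl
    refine (map_sum ev (fun d => pr d x) hfin.toFinset).trans ?_
    change ∑ d ∈ hfin.toFinset, (if T.degree b a S = d then x b a S else 0) = _
    rw [Finset.sum_ite_eq, if_pos]
    rw [Set.Finite.mem_toFinset]
    exact ⟨⟨b, a, S⟩, rfl⟩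

instance (T : FlatTangle v w) : Module.Finite ℤ T.Space := by
  have : ∀ b a, Fintype (T.Circles b a) := fun b a => Fintype.ofFinite _
  exact inferInstanceAs (Module.Finite ℤ
    ((b : Matching w) → (a : Matching v) → Finset (T.Circles b a) → ℤ))

theorem two_mul_halfOnes (b : Matching w) : halfOnes w = b.arcs.length := by
  have := b.two_mul_length
  unfold halfOnes
  omega

theorem compose_mem_part {T₁ : FlatTangle w u} {T₂ : FlatTangle v w} {T₁₂ : FlatTangle v u}
    (g : Gluing T₁ T₂ T₁₂) {d e : ℤ} {x : T₁.Space} {y : T₂.Space} (hx : x ∈ T₁.part d)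
    (hy : y ∈ T₂.part e) : compose g x y ∈ T₁₂.part (d + e) := by
  intro c a S h
  simp only [compose] at h
  rw [CircleAlg.sum_apply'] at h
  obtain ⟨b, -, h⟩ := Finset.exists_ne_zero_of_sum_ne_zero h
  have hx0 : x c b ≠ 0 := by
    intro h0
    rw [h0, contract_zero_left] at h
    exact h rfl
  have hy0 : y b a ≠ 0 := by
    intro h0
    rw [h0, contract_zero_right] at h
    exact h rfl
  obtain ⟨S₁, h₁⟩ := Function.ne_iff.mp hx0
  obtain ⟨S₂, h₂⟩ := Function.ne_iff.mp hy0
  have d₁ := hx c b S₁ h₁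
  have d₂ := hy b a S₂ h₂
  have k₁ : (x c b).Homog S₁.card := by
    intro S' h'
    have := hx c b S' h'
    simp only [degree] at this d₁
    omega
  have k₂ : (y b a).Homog S₂.card := by
    intro S' h'
    have := hy b a S' h'
    simp only [degree] at this d₂
    omega
  obtain ⟨s, hs, hc⟩ := homog_saddleElement g c b a
  have k := ((k₁.push (fun C => T₁₂.circle c a (g.π (Sum.inl (T₁.rep C))))).mul
    (k₂.push (fun C => T₁₂.circle c a (g.π (Sum.inr (T₂.rep C)))))).mul hs
  have hS : S.card = S₁.card + S₂.card + s := k S h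
  have hb := two_mul_halfOnes b
  simp only [degree] at d₁ d₂ ⊢
  omega

end FlatTangle

/-- The first of the two positions exchanged by the `i`-th simple root. -/
def lft (i : Fin (n - 1)) : Fin n := ⟨i, by omega⟩

/-- The second position, next to the first one. -/
def rgt (i : Fin (n - 1)) : Fin n := ⟨i + 1, by omega⟩

/-- The `i`-th simple root `ε_i = (0, …, 0, 1, -1, 0, …, 0)`. -/
def root (i : Fin (n - 1)) : Fin n → ℤ := Pi.single (lft i) 1 - Pi.single (rgt i) 1

theorem lft_ne_rgt (i : Fin (n - 1)) : lft i ≠ rgt i := by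
  intro h
  have := congrArg Fin.val h
  simp [lft, rgt] at this

/-- `w = v ± ε_i`. -/
def Neighbours (i : Fin (n - 1)) (v w : Weight n k) : Prop :=
  w.1 = v.1 + root i ∨ w.1 = v.1 - root i

namespace ElemTangle

variable {v w : Weight n k} {i : Fin (n - 1)}

/-- The position of an endpoint. -/
def pos : Ones v ⊕ Ones w → Fin n := Sum.elim Subtype.val Subtype.val

/-- The arcs of the elementary tangle: vertical strands away from the positions `i` and `i + 1`, and one arc
that joins the two endpoints in these positions. -/
def adj (i : Fin (n - 1)) (x y : Ones v ⊕ Ones w) : Prop :=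
  x ≠ y ∧ ((pos x ≠ lft i ∧ pos x ≠ rgt i ∧ pos y = pos x) ∨
    ((pos x = lft i ∨ pos x = rgt i) ∧ (pos y = lft i ∨ pos y = rgt i)))

theorem exists_sign (h : Neighbours i v w) : ∃ s : ℤ, (s = 1 ∨ s = -1) ∧
    ∀ p, w.1 p = v.1 p + s * root i p := by
  rcases h with h | h
  · exact ⟨1, Or.inl rfl, fun p => by rw [h]; simp⟩
  · exact ⟨-1, Or.inr rfl, fun p => by rw [h]; simp [sub_eq_add_neg]⟩

theorem root_lft (i : Fin (n - 1)) : root i (lft i) = 1 := by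
  simp [root, lft_ne_rgt]

theorem root_rgt (i : Fin (n - 1)) : root i (rgt i) = -1 := by
  simp [root, (lft_ne_rgt i).symm]

theorem root_other (i : Fin (n - 1)) {p : Fin n} (h1 : p ≠ lft i) (h2 : p ≠ rgt i) :
    root i p = 0 := by
  simp [root, h1, h2]

theorem sum_root (i : Fin (n - 1)) (p : Fin n) (hp : p ≠ rgt i) :
    ∑ q ∈ Finset.Iio p, root i q = 0 := by
  simp only [root, Pi.sub_apply, Finset.sum_sub_distrib, Finset.sum_pi_single', Finset.mem_Iio]
  have h : lft i < p ↔ rgt i < p := by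
    have : (p : ℕ) ≠ i + 1 := fun h => hp (Fin.ext h)
    rw [Fin.lt_def, Fin.lt_def]
    simp only [lft, rgt]
    omega
  simp [h]

theorem positive_iff (h : Neighbours i v w) (p : Fin n) (hp : p ≠ rgt i) :
    Positive v p ↔ Positive w p := by
  obtain ⟨s, -, h⟩ := exists_sign h
  unfold Positive
  simp only [h, Finset.sum_add_distrib, ← Finset.mul_sum, sum_root i p hp, mul_zero, add_zero]

theorem positive_rgt (w : Weight n k) (i : Fin (n - 1)) :
    Positive w (rgt i) ↔ (Positive w (lft i) ↔ Even (w.1 (lft i))) := by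
  have : Finset.Iio (rgt i) = insert (lft i) (Finset.Iio (lft i)) := by
    ext q
    simp only [Finset.mem_Iio, Finset.mem_insert, Fin.lt_def, Fin.ext_iff, lft, rgt]
    omega
  unfold Positive
  rw [this, Finset.sum_insert (by simp), Int.even_add]
  tauto

/-- The colour of an endpoint. -/
def col : Ones v ⊕ Ones w → Prop :=
  Sum.elim (fun p => Positive v p.1) (fun p => Positive w p.1)

/-- Each endpoint lies on exactly one arc. -/
theorem exists_partner (h : Neighbours i v w) (x : Ones v ⊕ Ones w) :
    ∃ y, (∀ z, adj i x z ↔ z = y) ∧ adj i y x ∧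
      (x.isLeft = y.isLeft → (col y ↔ ¬ col x)) ∧ (x.isLeft ≠ y.isLeft → (col y ↔ col x)) := by
  obtain ⟨s, hs, hw⟩ := exists_sign h
  have hwl := hw (lft i)
  have hwr := hw (rgt i)
  rw [root_lft] at hwl
  rw [root_rgt] at hwr
  have bv := v.2.1
  have bw := w.2.1
  have hlr := lft_ne_rgt i
  have pl := positive_iff h (lft i) hlr
  have pv := positive_rgt v i
  have pw := positive_rgt w i
  by_cases hx : pos x = lft i ∨ pos x = rgt i
  · -- there is exactly one endpoint in each of the two positions
    have hL : ∃ y : Ones v ⊕ Ones w, pos y = lft i ∧ ∀ z : Ones v ⊕ Ones w, pos z = lft i → z = y := by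
      by_cases hv : v.1 (lft i) = 1
      · refine ⟨Sum.inl ⟨lft i, hv⟩, rfl, ?_⟩
        rintro (⟨z, hz⟩ | ⟨z, hz⟩) (rfl : z = lft i)
        · rfl
        · exfalso; omega
      · have : w.1 (lft i) = 1 := by
          have := bv (lft i); have := bw (lft i); omega
        refine ⟨Sum.inr ⟨lft i, this⟩, rfl, ?_⟩
        rintro (⟨z, hz⟩ | ⟨z, hz⟩) (rfl : z = lft i)
        · exact absurd hz hv
        · rfl
    have hRt : ∃ y : Ones v ⊕ Ones w, pos y = rgt i ∧ ∀ z : Ones v ⊕ Ones w, pos z = rgt i → z = y := by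
      by_cases hv : v.1 (rgt i) = 1
      · refine ⟨Sum.inl ⟨rgt i, hv⟩, rfl, ?_⟩
        rintro (⟨z, hz⟩ | ⟨z, hz⟩) (rfl : z = rgt i)
        · rfl
        · exfalso; omega
      · have : w.1 (rgt i) = 1 := by
          have := bv (rgt i); have := bw (rgt i); omega
        refine ⟨Sum.inr ⟨rgt i, this⟩, rfl, ?_⟩
        rintro (⟨z, hz⟩ | ⟨z, hz⟩) (rfl : z = rgt i)
        · exact absurd hz hv
        · rfl
    obtain ⟨yl, hyl, hyl'⟩ := hL
    obtain ⟨yr, hyr, hyr'⟩ := hRt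
    have hne : yl ≠ yr := by
      rintro rfl
      exact hlr (hyl.symm.trans hyr)
    have hcol : (yl.isLeft = yr.isLeft → (col yr ↔ ¬ col yl)) ∧
        (yl.isLeft ≠ yr.isLeft → (col yr ↔ col yl)) := by
      rcases yl with ⟨q, hq⟩ | ⟨q, hq⟩ <;> rcases yr with ⟨q', hq'⟩ | ⟨q', hq'⟩ <;>
        (obtain rfl : q = lft i := hyl) <;> (obtain rfl : q' = rgt i := hyr) <;>
        simp only [col, Sum.elim_inl, Sum.elim_inr, Sum.isLeft_inl, Sum.isLeft_inr, ne_eq,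
          not_true_eq_false, false_implies, true_implies, and_true, reduceCtorEq, not_false_eq_true,
          true_and]
      · rw [pv, hq]; simp
      · have : Even (w.1 (lft i)) := by
          rw [hwl, hq]; rcases hs with rfl | rfl <;> decide
        simp only [this, iff_true] at pw
        rw [pw, pl]
      · have : Even (v.1 (lft i)) := by
          have : v.1 (lft i) = 1 - s := by omega
          rw [this]; rcases hs with rfl | rfl <;> decide
        simp only [this, iff_true] at pv
        rw [pv, pl]
      · rw [pw, hq]; simp
    rcases hx with hx | hx
    · obtain rfl := hyl' x hx
      refine ⟨yr, fun z => ⟨?_, ?_⟩, ⟨hne.symm, Or.inr ⟨Or.inr hyr, Or.inl hyl⟩⟩, hcol⟩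
      · rintro ⟨h1, ⟨h2, -⟩ | ⟨-, h2 | h2⟩⟩
        · exact absurd hx h2
        · exact absurd (hyl' z h2).symm h1
        · exact hyr' z h2
      · rintro rfl
        exact ⟨hne, Or.inr ⟨Or.inl hyl, Or.inr hyr⟩⟩
    · obtain rfl := hyr' x hx
      refine ⟨yl, fun z => ⟨?_, ?_⟩, ⟨hne, Or.inr ⟨Or.inl hyl, Or.inr hyr⟩⟩,
        fun e => ?_, fun e => (hcol.2 (Ne.symm e)).symm⟩
      · rintro ⟨h1, ⟨-, h2, -⟩ | ⟨-, h2 | h2⟩⟩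
        · exact absurd hx h2
        · exact hyl' z h2
        · exact absurd (hyr' z h2).symm h1
      · rintro rfl
        exact ⟨hne.symm, Or.inr ⟨Or.inr hyr, Or.inl hyl⟩⟩
      · have k := hcol.1 e.symm
        exact ⟨fun h h' => k.mp h' h, fun h => by_contra fun h' => h (k.mpr h')⟩
  · rw [not_or] at hx
    rcases x with ⟨p, hp⟩ | ⟨p, hp⟩
    · have hp' : w.1 p = 1 := by rw [hw, root_other (p := p) i hx.1 hx.2, hp]; simp
      refine ⟨Sum.inr ⟨p, hp'⟩, fun z => ⟨?_, ?_⟩, ⟨by simp, Or.inl ⟨hx.1, hx.2, rfl⟩⟩, ?_, ?_⟩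
      · rintro ⟨h1, ⟨-, -, h2⟩ | ⟨h2, -⟩⟩
        · rcases z with ⟨z, hz⟩ | ⟨z, hz⟩
          · obtain rfl : z = p := h2
            exact absurd rfl h1
          · obtain rfl : z = p := h2
            rfl
        · exact absurd h2 (not_or.mpr hx)
      · rintro rfl
        exact ⟨by simp, Or.inl ⟨hx.1, hx.2, rfl⟩⟩
      · intro e; cases e
      · intro _; exact (positive_iff h p hx.2).symm
    · have hp' : v.1 p = 1 := by
        have := hw p
        rw [root_other (p := p) i hx.1 hx.2, hp] at this; omega
      refine ⟨Sum.inl ⟨p, hp'⟩, fun z => ⟨?_, ?_⟩, ⟨by simp, Or.inl ⟨hx.1, hx.2, rfl⟩⟩, ?_, ?_⟩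
      · rintro ⟨h1, ⟨-, -, h2⟩ | ⟨h2, -⟩⟩
        · rcases z with ⟨z, hz⟩ | ⟨z, hz⟩
          · obtain rfl : z = p := h2
            rfl
          · obtain rfl : z = p := h2
            exact absurd rfl h1
        · exact absurd h2 (not_or.mpr hx)
      · rintro rfl
        exact ⟨by simp, Or.inl ⟨hx.1, hx.2, rfl⟩⟩
      · intro e; cases e
      · intro _; exact positive_iff h p hx.2

end ElemTangle

open ElemTangle in
/-- The elementary flat tangle from `v` to `w = v ± ε_i`. Away from positions `i`, `i + 1` it consists of
vertical strands. There are exactly two endpoints in the positions `i`, `i + 1`, and it joins them by an arc: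
a strand moving a bottom endpoint to the neighbouring position at the top if
`{v_i, v_{i+1}}` is `{0, 1}` or `{1, 2}`, a cup with two top endpoints if `(v_i, v_{i+1})` is `(0, 2)` or
`(2, 0)`, and a cap with two bottom endpoints if it is `(1, 1)`. -/
def elemTangle (i : Fin (n - 1)) (v w : Weight n k) (h : Neighbours i v w) : FlatTangle v w where
  Pt := Ones v ⊕ Ones w
  finite := inferInstance
  bot := Sum.inl
  top := Sum.inr
  adj := adj i
  bot_inj := Sum.inl_injective
  top_inj := Sum.inr_injective
  colour := by rintro p q h; cases h
  orient := by
    classical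
    intro b a
    choose T hT hT' hsame hdiff using exists_partner h
    have hinv : ∀ x, T (T x) = x := fun x => ((hT _ _).mp (hT' x)).symm
    have fa : ∀ p : Ones v, col (w := w) (Sum.inl (a.toFun p)) ↔ ¬ col (w := w) (Sum.inl p) := a.flip
    have fb : ∀ p : Ones w, col (v := v) (Sum.inr (b.toFun p)) ↔ ¬ col (v := v) (Sum.inr p) := b.flip
    let out : Ones v ⊕ Ones w → Ones v ⊕ Ones w := Sum.elim (fun p => Sum.inl (a.toFun p))
      (fun p => Sum.inr (b.toFun p))
    have hout : ∀ x, out (out x) = x := by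
      rintro (x | x)
      · exact congrArg Sum.inl (a.invol x)
      · exact congrArg Sum.inr (b.invol x)
    have hocol : ∀ x, col (out x) ↔ ¬ col x := by
      rintro (x | x)
      · exact fa x
      · exact fb x
    have holeft : ∀ x, (out x).isLeft = x.isLeft := by
      rintro (x | x) <;> rfl
    -- points left along an external arc
    let ex : Ones v ⊕ Ones w → Prop := fun x => (x.isLeft = true ↔ ¬ col x)
    have hexo : ∀ x, ex (out x) ↔ ¬ ex x := by
      intro x
      simp only [ex, holeft, hocol]
      tauto
    have hexT : ∀ x, ex (T x) ↔ ¬ ex x := by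
      intro x
      simp only [ex]
      by_cases hl : x.isLeft = (T x).isLeft
      · rw [hsame x hl, ← hl]; tauto
      · rw [hdiff x hl]
        have : (T x).isLeft = true ↔ ¬ x.isLeft = true := by
          cases h1 : x.isLeft <;> cases h2 : (T x).isLeft <;> simp_all
        rw [this]; tauto
    refine ⟨⟨fun x => if ex x then out x else T x, fun x => if ex x then T x else out x, ?_, ?_⟩,
      ?_, ?_, ?_, ?_⟩
    · intro x
      by_cases hx : ex x
      · have : ¬ ex (out x) := by rw [hexo]; simpa using hx
        simp only [if_pos hx, if_neg this, hout]
      · have : ex (T x) := by rw [hexT]; exact hx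
        simp only [if_neg hx, if_pos this, hinv]
    · intro x
      by_cases hx : ex x
      · have : ¬ ex (T x) := by rw [hexT]; simpa using hx
        simp only [if_pos hx, if_neg this, hinv]
      · have : ex (out x) := by rw [hexo]; exact hx
        simp only [if_neg hx, if_pos this, hout]
    · intro p hp
      have : ex (Sum.inr p) := by
        have : col (v := v) (Sum.inr p) := hp
        simp [ex, this]
      exact if_pos this
    · intro p hp
      have : ex (Sum.inl p) := by
        have : ¬ col (w := w) (Sum.inl p) := hp
        simp [ex, this]
      exact if_pos this
    · intro z hz
      have : ¬ ex z := by
        intro he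
        apply hz
        rcases z with z | z
        · exact Or.inr ⟨z, by simpa [ex, col] using he, rfl⟩
        · exact Or.inl ⟨z, by simpa [ex, col] using he, rfl⟩
      left
      have e : (if ex z then out z else T z) = T z := if_neg this
      exact (hT z _).mpr e
    · intro z z' hzz
      have e : z' = T z := (hT z z').mp hzz
      have hN : ∀ y, y ∈ {x | (∃ p, Positive w p.1 ∧ x = Sum.inr p) ∨
          ∃ p, ¬ Positive v p.1 ∧ x = Sum.inl p} → ex y := by
        rintro y (⟨p, hp, rfl⟩ | ⟨p, hp, rfl⟩)
        · have : col (v := v) (Sum.inr p) := hp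
          simp [ex, this]
        · have : ¬ col (w := w) (Sum.inl p) := hp
          simp [ex, this]
      by_cases hz : ex z
      · have hz' : ¬ ex z' := by rw [e, hexT]; simpa using hz
        refine Or.inr ⟨fun h => hz' (hN _ h), ?_⟩
        have : (if ex z' then out z' else T z') = z := by
          rw [if_neg hz', e, hinv]
        exact this.symm
      · refine Or.inl ⟨fun h => hz (hN _ h), ?_⟩
        have : (if ex z then out z else T z) = T z := if_neg hz
        exact e.trans this.symm

end

noncomputable section

set_option linter.unusedSectionVars false

open CategoryTheory TensorProduct

theorem internal_induction {M : Type*} [AddCommGroup M] {G : ℤ → AddSubgroup M}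
    (hG : DirectSum.IsInternal G) {p : M → Prop} (h0 : p 0) (hom : ∀ d, ∀ x ∈ G d, p x)
    (hadd : ∀ x y, p x → p y → p (x + y)) (x : M) : p x := by
  obtain ⟨f, rfl⟩ := hG.2 x
  induction f using DirectSum.induction_on with
  | zero => simpa using h0
  | of d x => rw [DirectSum.coeAddMonoidHom_of]; exact hom d _ x.2
  | add f g hf hg => rw [map_add]; exact hadd _ _ hf hg

theorem directSum_of_congr {M : Type*} [AddCommGroup M] {G : ℤ → AddSubgroup M} {d e : ℤ}
    (h : d = e) {x y : M} (hx : x ∈ G d) (hy : y ∈ G e) (hxy : x = y) :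
    DirectSum.of (fun d => G d) d ⟨x, hx⟩ = DirectSum.of (fun d => G d) e ⟨y, hy⟩ := by
  subst h; subst hxy; rfl

/-- A graded bilinear map splits into its homogeneous components. -/
theorem exists_graded_bilin {B M Q : Type*} [AddCommGroup B] [AddCommGroup M] [AddCommGroup Q]
    {ℬ : ℤ → AddSubgroup B} {ℳ : ℤ → AddSubgroup M} {G : ℤ → AddSubgroup Q}
    (hB : DirectSum.IsInternal ℬ) (hM : DirectSum.IsInternal ℳ) (β : B →+ M →+ Q)
    (hβ : ∀ i j, ∀ b ∈ ℬ i, ∀ m ∈ ℳ j, β b m ∈ G (i + j)) :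
    ∃ Ψ : B →+ M →+ DirectSum ℤ fun d => G d, ∀ i j b (hb : b ∈ ℬ i) m (hm : m ∈ ℳ j),
      Ψ b m = DirectSum.of (fun d => G d) (i + j) ⟨β b m, hβ i j b hb m hm⟩ := by
  classical
  let φ : ∀ i j, ℬ i →+ ℳ j →+ DirectSum ℤ fun d => G d := fun i j =>
    AddMonoidHom.mk' (fun b => AddMonoidHom.mk' (fun m => DirectSum.of (fun d => G d) (i + j)
      ⟨β b m, hβ i j b b.2 m m.2⟩) (fun m m' => by
        rw [← map_add]
        exact directSum_of_congr rfl _ _ (map_add _ _ _))) (fun b b' => by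
        ext1 m
        change DirectSum.of (fun d => G d) (i + j) _ = DirectSum.of (fun d => G d) (i + j) _ +
          DirectSum.of (fun d => G d) (i + j) _
        rw [← map_add]
        refine directSum_of_congr rfl _ _ ?_
        change β (b + b' : B) m = _
        rw [map_add]; rfl)
  let Φ : (DirectSum ℤ fun d => ℬ d) →+ (DirectSum ℤ fun d => ℳ d) →+ DirectSum ℤ fun d => G d :=
    DirectSum.toAddMonoid fun i => (DirectSum.toAddMonoid fun j => (φ i j).flip).flip
  let eB := AddEquiv.ofBijective _ hB
  let eM := AddEquiv.ofBijective _ hM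
  refine ⟨((Φ.comp eB.symm.toAddMonoidHom).flip.comp eM.symm.toAddMonoidHom).flip, ?_⟩
  intro i j b hb m hm
  have e1 : eB.symm b = DirectSum.of (fun d => ℬ d) i ⟨b, hb⟩ := by
    rw [AddEquiv.symm_apply_eq]
    exact (DirectSum.coeAddMonoidHom_of ℬ i ⟨b, hb⟩).symm
  have e2 : eM.symm m = DirectSum.of (fun d => ℳ d) j ⟨m, hm⟩ := by
    rw [AddEquiv.symm_apply_eq]
    exact (DirectSum.coeAddMonoidHom_of ℳ j ⟨m, hm⟩).symm
  change Φ (eB.symm b) (eM.symm m) = _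
  rw [e1, e2]
  simp only [Φ, DirectSum.toAddMonoid_of, AddMonoidHom.flip_apply]
  rfl

/-! ### The tensor product over a noncommutative ring -/

section Balanced

variable (R S B M : Type) [Ring R] [Ring S] [AddCommGroup B] [Module R B] [Module Sᵐᵒᵖ B]
  [SMulCommClass R Sᵐᵒᵖ B] [AddCommGroup M] [Module S M]

/-- The relations `b s ⊗ m = b ⊗ s m`. -/
def balancedRel : Submodule R (B ⊗[ℤ] M) :=
  Submodule.span R {x | ∃ (s : S) (b : B) (m : M),
    x = (MulOpposite.op s • b) ⊗ₜ[ℤ] m - b ⊗ₜ[ℤ] (s • m)}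

/-- The left `R`-module `B ⊗_S M` for an `(R, S)`-bimodule `B` and a left `S`-module `M`. -/
abbrev BalancedTensor : Type := (B ⊗[ℤ] M) ⧸ balancedRel R S B M

namespace BalancedTensor

variable {B M}

/-- The class of `b ⊗ m`. -/
def mk (b : B) (m : M) : BalancedTensor R S B M := Submodule.Quotient.mk (b ⊗ₜ[ℤ] m)

theorem mk_add_left (b b' : B) (m : M) : mk R S (b + b') m = mk R S b m + mk R S b' m := by
  simp only [mk, TensorProduct.add_tmul, Submodule.Quotient.mk_add]

theorem mk_add_right (b : B) (m m' : M) : mk R S b (m + m') = mk R S b m + mk R S b m' := by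
  simp only [mk, TensorProduct.tmul_add, Submodule.Quotient.mk_add]

theorem mk_balanced (s : S) (b : B) (m : M) :
    mk R S (MulOpposite.op s • b) m = mk R S b (s • m) :=
  (Submodule.Quotient.eq _).mpr (Submodule.subset_span ⟨s, b, m, rfl⟩)

theorem smul_mk (r : R) (b : B) (m : M) : r • mk R S b m = mk R S (r • b) m := rfl

/-- `mk` as a biadditive map. -/
def mkHom : B →+ M →+ BalancedTensor R S B M :=
  AddMonoidHom.mk' (fun b => AddMonoidHom.mk' (mk R S b) (mk_add_right R S b))
    (fun b b' => by ext m; exact mk_add_left R S b b' m)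

variable {R S}

theorem induction {p : BalancedTensor R S B M → Prop} (h0 : p 0)
    (hmk : ∀ b m, p (mk R S b m)) (hadd : ∀ x y, p x → p y → p (x + y)) (x) : p x := by
  obtain ⟨y, rfl⟩ := Submodule.Quotient.mk_surjective _ x
  induction y using TensorProduct.induction_on with
  | zero => exact h0
  | tmul b m => exact hmk b m
  | add y z hy hz => exact hadd _ _ hy hz

theorem exists_lift {N : Type*} [AddCommGroup N] (Ψ : B →+ M →+ N)
    (hΨ : ∀ (s : S) b m, Ψ (MulOpposite.op s • b) m = Ψ b (s • m)) :
    ∃ f : BalancedTensor R S B M →+ N, ∀ b m, f (mk R S b m) = Ψ b m := by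
  let g : B ⊗[ℤ] M →+ N := TensorProduct.liftAddHom Ψ (fun r b m => by
    rw [map_zsmul, map_zsmul]; rfl)
  have hg : ∀ b m, g (b ⊗ₜ m) = Ψ b m := fun b m => rfl
  have key : ∀ x ∈ balancedRel R S B M, ∀ r : R, g (r • x) = 0 := by
    intro x hx
    induction hx using Submodule.span_induction with
    | mem x h =>
      obtain ⟨s, b, m, rfl⟩ := h
      intro r
      rw [smul_sub, TensorProduct.smul_tmul', TensorProduct.smul_tmul', map_sub, hg, hg,
        smul_comm r, hΨ, sub_self]
    | zero => intro r; simp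
    | add x y _ _ h1 h2 => intro r; rw [smul_add, map_add, h1, h2, add_zero]
    | smul a x _ h => intro r; rw [smul_smul]; exact h _
  refine ⟨QuotientAddGroup.lift (balancedRel R S B M).toAddSubgroup g fun x hx => ?_, ?_⟩
  · have := key x hx 1
    rwa [one_smul] at this
  · intro b m
    rfl

variable (R S) in
/-- The grading of `B ⊗_S M`: `deg (b ⊗ m) = deg b + deg m`. -/
def part (ℬ : ℤ → AddSubgroup B) (ℳ : ℤ → AddSubgroup M) (d : ℤ) :
    AddSubgroup (BalancedTensor R S B M) :=
  AddSubgroup.closure {x | ∃ i j b m, b ∈ ℬ i ∧ m ∈ ℳ j ∧ i + j = d ∧ x = mk R S b m}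

theorem mk_mem_part {ℬ : ℤ → AddSubgroup B} {ℳ : ℤ → AddSubgroup M} {i j : ℤ} {b : B} {m : M}
    (hb : b ∈ ℬ i) (hm : m ∈ ℳ j) : mk R S b m ∈ part R S ℬ ℳ (i + j) :=
  AddSubgroup.subset_closure ⟨i, j, b, m, hb, hm, rfl, rfl⟩

theorem part_isInternal {𝒜 : ℤ → AddSubgroup S} {ℬ : ℤ → AddSubgroup B} {ℳ : ℤ → AddSubgroup M}
    (hA : DirectSum.IsInternal 𝒜) (hB : DirectSum.IsInternal ℬ) (hM : DirectSum.IsInternal ℳ)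
    (hBA : ∀ i j, ∀ b ∈ ℬ i, ∀ s ∈ 𝒜 j, MulOpposite.op s • b ∈ ℬ (i + j))
    (hAM : ∀ i j, ∀ s ∈ 𝒜 i, ∀ m ∈ ℳ j, s • m ∈ ℳ (i + j)) :
    DirectSum.IsInternal (part R S ℬ ℳ) := by
  obtain ⟨Ψ, hΨ⟩ := exists_graded_bilin (G := part R S ℬ ℳ) hB hM (mkHom R S)
    (fun i j b hb m hm => mk_mem_part hb hm)
  have hbal : ∀ (s : S) b m, Ψ (MulOpposite.op s • b) m = Ψ b (s • m) := by
    intro s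
    refine internal_induction hA (p := fun s => ∀ b m, Ψ (MulOpposite.op s • b) m = Ψ b (s • m))
      ?_ ?_ ?_ s
    · intro b m; simp
    · intro a s hs b
      refine internal_induction hB (p := fun b => ∀ m, Ψ (MulOpposite.op s • b) m = Ψ b (s • m))
        ?_ ?_ ?_ b
      · intro m; simp
      · intro i b hb m
        refine internal_induction hM (p := fun m => Ψ (MulOpposite.op s • b) m = Ψ b (s • m))
          ?_ ?_ ?_ m
        · simp
        · intro j m hm
          rw [hΨ _ _ _ (hBA _ _ _ hb _ hs) _ hm, hΨ _ _ _ hb _ (hAM _ _ _ hs _ hm)]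
          exact directSum_of_congr (add_assoc _ _ _) _ _ (mk_balanced R S s b m)
        · intro m m' h h'; rw [smul_add, map_add, map_add, h, h']
      · intro b b' h h' m
        rw [smul_add, map_add, map_add, AddMonoidHom.add_apply, AddMonoidHom.add_apply, h, h']
    · intro s s' h h' b m
      rw [MulOpposite.op_add, add_smul, add_smul, map_add, map_add, AddMonoidHom.add_apply, h, h']
  obtain ⟨ψ, hψ⟩ := exists_lift (R := R) Ψ hbal
  have hr : ∀ x, DirectSum.coeAddMonoidHom (part R S ℬ ℳ) (ψ x) = x := by
    intro x
    induction x using induction with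
    | h0 => simp
    | hadd x y hx hy => rw [map_add, map_add, hx, hy]
    | hmk b m =>
      rw [hψ]
      refine internal_induction hB
        (p := fun b => DirectSum.coeAddMonoidHom (part R S ℬ ℳ) (Ψ b m) = mk R S b m) ?_ ?_ ?_ b
      · rw [map_zero, AddMonoidHom.zero_apply, map_zero]
        exact (DFunLike.congr_fun (map_zero (mkHom (B := B) (M := M) R S)) m).symm
      · intro i b hb
        refine internal_induction hM
          (p := fun m => DirectSum.coeAddMonoidHom (part R S ℬ ℳ) (Ψ b m) = mk R S b m) ?_ ?_ ?_ m
        · rw [map_zero, map_zero]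
          exact (map_zero (mkHom R S b)).symm
        · intro j m hm
          rw [hΨ _ _ _ hb _ hm, DirectSum.coeAddMonoidHom_of]
          rfl
        · intro m m' h h'
          rw [map_add, map_add, h, h', mk_add_right]
      · intro b b' h h'
        rw [map_add, AddMonoidHom.add_apply, map_add, h, h', mk_add_left]
  have hl : ∀ f, ψ (DirectSum.coeAddMonoidHom (part R S ℬ ℳ) f) = f := by
    intro f
    induction f using DirectSum.induction_on with
    | zero => simp
    | add f g hf hg => rw [map_add, map_add, hf, hg]
    | of d x =>
      rw [DirectSum.coeAddMonoidHom_of]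
      obtain ⟨x, hx⟩ := x
      change ψ x = _
      induction hx using AddSubgroup.closure_induction with
      | mem x h =>
        obtain ⟨i, j, b, m, hb, hm, rfl, rfl⟩ := h
        rw [hψ, hΨ _ _ _ hb _ hm]
        rfl
      | zero => rw [map_zero]; exact (map_zero _).symm
      | add x y hx hy h h' => rw [map_add, h, h', ← map_add]; rfl
      | neg x hx h => rw [map_neg, h, ← map_neg]; rfl
  exact ⟨Function.LeftInverse.injective hl, Function.RightInverse.surjective hr⟩

theorem smul_mem_part {𝒜 : ℤ → AddSubgroup R} {ℬ : ℤ → AddSubgroup B} {ℳ : ℤ → AddSubgroup M}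
    (hAB : ∀ i j, ∀ r ∈ 𝒜 i, ∀ b ∈ ℬ j, r • b ∈ ℬ (i + j)) {i j : ℤ} {r : R} (hr : r ∈ 𝒜 i)
    {x : BalancedTensor R S B M} (hx : x ∈ part R S ℬ ℳ j) : r • x ∈ part R S ℬ ℳ (i + j) := by
  induction hx using AddSubgroup.closure_induction with
  | mem x h =>
    obtain ⟨a, c, b, m, hb, hm, rfl, rfl⟩ := h
    rw [smul_mk, ← add_assoc]
    exact mk_mem_part (hAB _ _ _ hr _ hb) hm
  | zero => rw [smul_zero]; exact zero_mem _
  | add x y _ _ h h' => rw [smul_add]; exact add_mem h h'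
  | neg x _ h => rw [smul_neg]; exact neg_mem h

theorem finite [Module.Finite ℤ B] [Module.Finite ℤ S] [Module.Finite S M] :
    Module.Finite R (BalancedTensor R S B M) := by
  have : Module.Finite ℤ M := Module.Finite.trans S M
  let f : (B ⊗[ℤ] M) →ₗ[ℤ] BalancedTensor R S B M :=
    { toFun := Submodule.mkQ (balancedRel R S B M)
      map_add' := map_add _
      map_smul' := fun r x => map_intCast_smul (Submodule.mkQ (balancedRel R S B M)) ℤ ℤ r x }
  have : Module.Finite ℤ (BalancedTensor R S B M) :=
    Module.Finite.of_surjective (hM := Module.Finite.tensorProduct (R := ℤ) (M := B) (N := M)) f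
      (Submodule.mkQ_surjective (balancedRel R S B M))
  exact Module.Finite.of_restrictScalars_finite ℤ R _

variable (R S B) in
/-- The map `id ⊗ f`. -/
def map {M' : Type} [AddCommGroup M'] [Module S M'] (f : M →ₗ[S] M') :
    BalancedTensor R S B M →ₗ[R] BalancedTensor R S B M' :=
  Submodule.mapQ _ _
    (TensorProduct.AlgebraTensorModule.lTensor R B (f.toAddMonoidHom.toIntLinearMap)) (by
      refine Submodule.span_le.mpr ?_
      rintro _ ⟨s, b, m, rfl⟩
      refine Submodule.subset_span ⟨s, b, f m, ?_⟩
      rw [map_sub, ← f.map_smul]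
      rfl)

theorem map_mk {M' : Type} [AddCommGroup M'] [Module S M'] (f : M →ₗ[S] M') (b : B) (m : M) :
    map R S B f (mk R S b m) = mk R S b (f m) := rfl

theorem map_mem_part {M' : Type} [AddCommGroup M'] [Module S M'] {f : M →ₗ[S] M'}
    {ℬ : ℤ → AddSubgroup B} {ℳ : ℤ → AddSubgroup M} {ℳ' : ℤ → AddSubgroup M'}
    (hf : ∀ d, ∀ m ∈ ℳ d, f m ∈ ℳ' d) {d : ℤ} {x} (hx : x ∈ part R S ℬ ℳ d) :
    map R S B f x ∈ part R S ℬ ℳ' d := by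
  induction hx using AddSubgroup.closure_induction with
  | mem x h =>
    obtain ⟨a, c, b, m, hb, hm, rfl, rfl⟩ := h
    exact mk_mem_part hb (hf _ _ hm)
  | zero => rw [map_zero]; exact zero_mem _
  | add x y _ _ h h' => rw [map_add]; exact add_mem h h'
  | neg x _ h => rw [map_neg]; exact neg_mem h

end BalancedTensor

end Balanced

end

noncomputable section

set_option linter.unusedSectionVars false

open CategoryTheory TensorProduct

theorem exists_proj {M : Type*} [AddCommGroup M] {G : ℤ → AddSubgroup M}
    (h : DirectSum.IsInternal G) : ∃ pr : ℤ → M →+ M, (∀ d x, pr d x ∈ G d) ∧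
      (∀ d, ∀ x ∈ G d, pr d x = x) ∧ (∀ d e, d ≠ e → ∀ x ∈ G e, pr d x = 0) ∧
      ∀ x, ∃ s : Finset ℤ, ∀ t, s ⊆ t → ∑ d ∈ t, pr d x = x := by
  classical
  let e := AddEquiv.ofBijective _ h
  let pr : ℤ → M →+ M := fun d => AddMonoidHom.mk' (fun x => (e.symm x d : M)) fun x y => by
    rw [map_add]; rfl
  have he : ∀ d x (hx : x ∈ G d), e.symm x = DirectSum.of (fun d => G d) d ⟨x, hx⟩ := by
    intro d x hx
    rw [AddEquiv.symm_apply_eq]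
    exact (DirectSum.coeAddMonoidHom_of G d ⟨x, hx⟩).symm
  refine ⟨pr, fun d x => (e.symm x d).2, ?_, ?_, ?_⟩
  · intro d x hx
    change (e.symm x d : M) = x
    rw [he d x hx, DirectSum.of_eq_same]
  · intro d d' hd x hx
    change (e.symm x d : M) = 0
    rw [he d' x hx, DirectSum.of_eq_of_ne _ _ _ hd]
    rfl
  · intro x
    refine ⟨(e.symm x).support, fun t ht => ?_⟩
    have h1 : ∑ d ∈ (e.symm x).support, pr d x = x := by
      have h2 := congrArg e (DirectSum.sum_support_of (e.symm x))
      rw [map_sum, AddEquiv.apply_symm_apply] at h2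
      refine Eq.trans (Finset.sum_congr rfl fun d _ => ?_) h2
      exact (DirectSum.coeAddMonoidHom_of G d _).symm
    refine Eq.trans (Finset.sum_subset ht fun d _ hd => ?_).symm h1
    have : e.symm x d = 0 := by simpa using hd
    change (e.symm x d : M) = 0
    rw [this]; rfl

/-! ### Graded modules -/

/-- Finitely generated graded left modules over a ring `R` with grading `𝒜`. -/
structure GrMod {R : Type} [Ring R] (𝒜 : ℤ → AddSubgroup R) where
  carrier : Type
  [grp : AddCommGroup carrier]
  [mod : Module R carrier]
  gr : ℤ → AddSubgroup carrier
  internal : DirectSum.IsInternal gr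
  smul_mem : ∀ i j, ∀ r ∈ 𝒜 i, ∀ x ∈ gr j, r • x ∈ gr (i + j)
  fin : Module.Finite R carrier

attribute [instance] GrMod.grp GrMod.mod GrMod.fin

namespace GrMod

variable {R : Type} [Ring R] {𝒜 : ℤ → AddSubgroup R}

/-- Module homomorphisms preserving the grading. -/
@[ext] structure Hom (M N : GrMod 𝒜) where
  lin : M.carrier →ₗ[R] N.carrier
  map_gr : ∀ d, ∀ x ∈ M.gr d, lin x ∈ N.gr d

instance : Category (GrMod 𝒜) where
  Hom := Hom
  id M := ⟨LinearMap.id, fun _ _ h => h⟩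
  comp f g := ⟨g.lin ∘ₗ f.lin, fun d x h => g.map_gr d _ (f.map_gr d x h)⟩

@[ext] theorem hom_ext {M N : GrMod 𝒜} {f g : M ⟶ N} (h : f.lin = g.lin) : f = g :=
  Hom.ext h

@[simp] theorem id_lin (M : GrMod 𝒜) : Hom.lin (𝟙 M) = LinearMap.id := rfl

@[simp] theorem comp_lin {M N P : GrMod 𝒜} (f : M ⟶ N) (g : N ⟶ P) :
    Hom.lin (f ≫ g) = Hom.lin g ∘ₗ Hom.lin f := rfl

/-- The zero module. -/
def zero : GrMod 𝒜 where
  carrier := PUnit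
  gr _ := ⊤
  internal := isInternal_of_proj _ (fun _ => 0) (fun _ _ => trivial) (fun _ _ _ => rfl)
    (fun _ _ _ _ _ => rfl) (fun _ => ⟨∅, rfl⟩)
  smul_mem _ _ _ _ _ _ := trivial
  fin := inferInstance

/-- `M{a}`, the module `M` with its grading shifted up by `a`. -/
def shiftObj (a : ℤ) (M : GrMod 𝒜) : GrMod 𝒜 where
  carrier := M.carrier
  gr d := M.gr (d - a)
  internal := by
    classical
    obtain ⟨pr, h1, h2, h3, h4⟩ := exists_proj M.internal
    refine isInternal_of_proj _ (fun d => pr (d - a)) (fun d => h1 _) (fun d => h2 _) ?_ ?_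
    · intro d e hde
      exact h3 _ _ fun h => hde (by omega)
    · intro x
      obtain ⟨s, hs⟩ := h4 x
      refine ⟨s.map (Equiv.addRight a).toEmbedding, ?_⟩
      rw [Finset.sum_map]
      simpa using hs s subset_rfl
  smul_mem i j r hr x hx := by
    rw [add_sub_assoc]
    exact M.smul_mem _ _ r hr x hx
  fin := M.fin

/-- The grading shift functor `{a}`. -/
def shift (𝒜 : ℤ → AddSubgroup R) (a : ℤ) : GrMod 𝒜 ⥤ GrMod 𝒜 where
  obj := shiftObj a
  map f := ⟨f.lin, fun d x h => f.map_gr (d - a) x h⟩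

/-- The direct sum of two graded modules. -/
def sum (M N : GrMod 𝒜) : GrMod 𝒜 where
  carrier := M.carrier × N.carrier
  gr d := (M.gr d).prod (N.gr d)
  internal := by
    classical
    obtain ⟨pr, h1, h2, h3, h4⟩ := exists_proj M.internal
    obtain ⟨pr', h1', h2', h3', h4'⟩ := exists_proj N.internal
    refine isInternal_of_proj _ (fun d => (pr d).prodMap (pr' d)) ?_ ?_ ?_ ?_
    · exact fun d x => ⟨h1 d x.1, h1' d x.2⟩
    · exact fun d x hx => Prod.ext (h2 d _ hx.1) (h2' d _ hx.2)
    · exact fun d e h x hx => Prod.ext (h3 d e h _ hx.1) (h3' d e h _ hx.2)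
    · intro x
      obtain ⟨s, hs⟩ := h4 x.1
      obtain ⟨s', hs'⟩ := h4' x.2
      refine ⟨s ∪ s', Prod.ext ?_ ?_⟩
      · rw [Prod.fst_sum]; exact hs _ Finset.subset_union_left
      · rw [Prod.snd_sum]; exact hs' _ Finset.subset_union_right
  smul_mem i j r hr x hx := ⟨M.smul_mem i j r hr _ hx.1, N.smul_mem i j r hr _ hx.2⟩
  fin := inferInstance

/-- The direct sum of two homomorphisms. -/
def sumMap {M N M' N' : GrMod 𝒜} (f : M ⟶ M') (g : N ⟶ N') : M.sum N ⟶ M'.sum N' :=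
  ⟨LinearMap.prodMap f.lin g.lin, fun d _ h => ⟨f.map_gr d _ h.1, g.map_gr d _ h.2⟩⟩

end GrMod

variable {n k : ℕ}

/-- The grading of `H_w`. -/
def ArcRing.part (w : Weight n k) : ℤ → AddSubgroup (ArcRing w) := (FlatTangle.one w).part

/-- The category `C(w)` of finitely generated graded left `H_w`-modules. -/
abbrev ArcMod (w : Weight n k) : Type 1 := GrMod (ArcRing.part w)

instance (w : Weight n k) : Module.Finite ℤ (ArcRing w) :=
  inferInstanceAs (Module.Finite ℤ (FlatTangle.one w).Space)

/-- The functor `F(T) ⊗_{H_v} - : C(v) ⥤ C(w)`. -/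
def FlatTangle.tensorFunctor {v w : Weight n k} (T : FlatTangle v w) : ArcMod v ⥤ ArcMod w where
  obj M :=
    { carrier := BalancedTensor (ArcRing w) (ArcRing v) T.Space M.carrier
      gr := BalancedTensor.part (ArcRing w) (ArcRing v) T.part M.gr
      internal := BalancedTensor.part_isInternal (FlatTangle.one v).part_isInternal
        T.part_isInternal M.internal
        (fun _ _ _ hb _ hs => FlatTangle.compose_mem_part T.gluingRight hb hs) M.smul_mem
      smul_mem := fun _ _ _ hr _ hx => BalancedTensor.smul_mem_part
        (fun _ _ _ hr _ hb => FlatTangle.compose_mem_part T.gluingLeft hr hb) hr hx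
      fin := BalancedTensor.finite }
  map f := ⟨BalancedTensor.map (ArcRing w) (ArcRing v) T.Space f.lin,
    fun _ _ h => BalancedTensor.map_mem_part f.map_gr h⟩
  map_id M := by
    refine GrMod.hom_ext (LinearMap.ext fun x => ?_)
    induction x using BalancedTensor.induction with
    | h0 => simp
    | hmk b m => rfl
    | hadd x y hx hy => rw [map_add, map_add, hx, hy]
  map_comp f g := by
    refine GrMod.hom_ext (LinearMap.ext fun x => ?_)
    induction x using BalancedTensor.induction with
    | h0 => simp
    | hmk b m => rfl
    | hadd x y hx hy => rw [map_add, map_add, hx, hy]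

/-- The category `C`, the direct sum over all admissible weights `w` (finitely many) of the
categories `C(w)`. -/
abbrev ArcCat (n k : ℕ) : Type 1 := ∀ w : Weight n k, ArcMod w

namespace ArcCat

/-- The grading shift functor `{a}` of `C`. -/
def shift (n k : ℕ) (a : ℤ) : ArcCat n k ⥤ ArcCat n k :=
  Functor.pi fun _ => GrMod.shift _ a

/-- The direct sum of two functors. -/
def dsum (F G : ArcCat n k ⥤ ArcCat n k) : ArcCat n k ⥤ ArcCat n k where
  obj M w := (F.obj M w).sum (G.obj M w)
  map f w := GrMod.sumMap (F.map f w) (G.map f w)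
  map_id M := by
    funext w
    rw [F.map_id, G.map_id]
    rfl
  map_comp f g := by
    funext w
    rw [F.map_comp, G.map_comp]
    rfl

open scoped Classical in
/-- The functor `E_i`. Its component `C(λ) ⥤ C(λ + ε_i)`, `ε_i` being the simple root, is the tensor
product with the bimodule of the elementary tangle; the component of the result in a weight `μ` is
zero if `μ - ε_i` is not admissible. -/
def E (k : ℕ) (i : Fin (n - 1)) : ArcCat n k ⥤ ArcCat n k :=
  Functor.pi' fun μ =>
    if h : Admissible n k (μ.1 - root i) then
      Pi.eval ArcMod (⟨μ.1 - root i, h⟩ : Weight n k) ⋙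
        (elemTangle i ⟨μ.1 - root i, h⟩ μ (Or.inl (by simp))).tensorFunctor
    else (Functor.const _).obj GrMod.zero

open scoped Classical in
/-- The functor `F_i`, with components `C(λ) ⥤ C(λ - ε_i)`. -/
def F (k : ℕ) (i : Fin (n - 1)) : ArcCat n k ⥤ ArcCat n k :=
  Functor.pi' fun μ =>
    if h : Admissible n k (μ.1 + root i) then
      Pi.eval ArcMod (⟨μ.1 + root i, h⟩ : Weight n k) ⋙
        (elemTangle i ⟨μ.1 + root i, h⟩ μ (Or.inr (by simp))).tensorFunctor
    else (Functor.const _).obj GrMod.zero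

/-- The functor `K_i`, the shift by `{λ_i - λ_{i+1}}` on `C(λ)`. -/
def K (k : ℕ) (i : Fin (n - 1)) : ArcCat n k ⥤ ArcCat n k :=
  Functor.pi fun w => GrMod.shift _ (w.1 (lft i) - w.1 (rgt i))

/-- The functor `K_i^{-1}`, the shift by `{λ_{i+1} - λ_i}` on `C(λ)`. -/
def Kinv (k : ℕ) (i : Fin (n - 1)) : ArcCat n k ⥤ ArcCat n k :=
  Functor.pi fun w => GrMod.shift _ (w.1 (rgt i) - w.1 (lft i))

end ArcCat

/-- The Cartan matrix of `sl_n`. -/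
def cartan (i j : Fin (n - 1)) : ℤ :=
  if i = j then 2 else if (i : ℕ) = j + 1 ∨ (j : ℕ) = i + 1 then -1 else 0

end

open CategoryTheory

noncomputable section

open Relation Equiv Equiv.Perm

variable {n k : ℕ}

namespace FlatTangle

variable {u v w t : Weight n k}

/-- The diagram `T₁` on top of `T₂`, with the points `T₁.bot p` and `T₂.top p` joined by an arc. -/
def glued (T₁ : FlatTangle w u) (T₂ : FlatTangle v w) (x y : T₁.Pt ⊕ T₂.Pt) : Prop :=
  Sum.LiftRel T₁.adj T₂.adj x y ∨ ∃ p, x = Sum.inl (T₁.bot p) ∧ y = Sum.inr (T₂.top p)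

/-- `T₁₂` is the composition `T₁ T₂` up to isotopy: `π` induces a bijection between the components of
`T₁ T₂` and those of `T₁₂`, compatible with the endpoints. -/
structure Glue (T₁ : FlatTangle w u) (T₂ : FlatTangle v w) (T₁₂ : FlatTangle v u) where
  π : T₁.Pt ⊕ T₂.Pt → T₁₂.Pt
  conn : ∀ x y, EqvGen (glued T₁ T₂) x y ↔ EqvGen T₁₂.adj (π x) (π y)
  surj : ∀ z, ∃ x, EqvGen T₁₂.adj (π x) z
  top : ∀ p, EqvGen T₁₂.adj (π (Sum.inl (T₁.top p))) (T₁₂.top p)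
  bot : ∀ p, EqvGen T₁₂.adj (π (Sum.inr (T₂.bot p))) (T₁₂.bot p)

/-- A strict composition is a composition up to isotopy. -/
def Gluing.toGlue {T₁ : FlatTangle w u} {T₂ : FlatTangle v w} {T₁₂ : FlatTangle v u}
    (g : Gluing T₁ T₂ T₁₂) : Glue T₁ T₂ T₁₂ where
  π := g.π
  conn := by
    refine eqvGen_retract g.π g.σ ?_ ?_ ?_
    · rintro x y (h | ⟨p, rfl, rfl⟩)
      · exact EqvGen.rel _ _ (g.adj _ _ h)
      · rw [g.mid]; exact EqvGen.refl _
    · exact fun x y h => EqvGen.rel _ _ (Or.inl (g.lift x y h))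
    · exact fun x => eqvGen_of_le (fun _ _ h => EqvGen.rel _ _ (Or.inr h)) (g.sect x)
  surj z := ⟨g.σ z, by rw [g.π_σ]; exact EqvGen.refl _⟩
  top p := by rw [g.top]; exact EqvGen.refl _
  bot p := by rw [g.bot]; exact EqvGen.refl _

theorem adj_closed (T : FlatTangle v w) (b : Matching w) (a : Matching v) {x y : T.Pt}
    (h : EqvGen T.adj x y) : EqvGen (T.closed b a) x y :=
  eqvGen_of_le (fun _ _ h => EqvGen.rel _ _ (Or.inl (Or.inl h))) h

theorem circle_eq_of_adj (T : FlatTangle v w) {b : Matching w} {a : Matching v} {x y : T.Pt}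
    (h : EqvGen T.adj x y) : T.circle b a x = T.circle b a y :=
  T.circle_eq.mpr (T.adj_closed b a h)

section

variable {T₁ : FlatTangle w u} {T₂ : FlatTangle v w} {T₁₂ : FlatTangle v u}

theorem Glue.conn_left (g : Glue T₁ T₂ T₁₂) {x y : T₁.Pt} (h : EqvGen T₁.adj x y) :
    EqvGen T₁₂.adj (g.π (Sum.inl x)) (g.π (Sum.inl y)) :=
  (g.conn _ _).mp (eqvGen_map Sum.inl (fun _ _ h => EqvGen.rel _ _ (Or.inl (Sum.LiftRel.inl h))) h)

theorem Glue.conn_right (g : Glue T₁ T₂ T₁₂) {x y : T₂.Pt} (h : EqvGen T₂.adj x y) :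
    EqvGen T₁₂.adj (g.π (Sum.inr x)) (g.π (Sum.inr y)) :=
  (g.conn _ _).mp (eqvGen_map Sum.inr (fun _ _ h => EqvGen.rel _ _ (Or.inl (Sum.LiftRel.inr h))) h)

theorem Glue.mid (g : Glue T₁ T₂ T₁₂) (p : Ones w) :
    EqvGen T₁₂.adj (g.π (Sum.inl (T₁.bot p))) (g.π (Sum.inr (T₂.top p))) :=
  (g.conn _ _).mp (EqvGen.rel _ _ (Or.inr ⟨p, rfl, rfl⟩))

/-- A point of `T₁ T₂` on the component of a point of `T₁₂`. -/
def Glue.σ (g : Glue T₁ T₂ T₁₂) (z : T₁₂.Pt) : T₁.Pt ⊕ T₂.Pt := (g.surj z).choose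

theorem Glue.π_σ (g : Glue T₁ T₂ T₁₂) (z : T₁₂.Pt) : EqvGen T₁₂.adj (g.π (g.σ z)) z :=
  (g.surj z).choose_spec

theorem Glue.conn_σ (g : Glue T₁ T₂ T₁₂) {x : T₁.Pt ⊕ T₂.Pt} {z : T₁₂.Pt}
    (h : EqvGen T₁₂.adj (g.π x) z) : EqvGen (glued T₁ T₂) x (g.σ z) :=
  (g.conn _ _).mpr (h.trans _ _ _ (g.π_σ z).symm)

/-- The product of the factors of the saddles that contract `b` with `W(b)` in the middle of
`W(c) T₁ b W(b) T₂ a`. -/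
def Glue.saddleElement (g : Glue T₁ T₂ T₁₂) (c : Matching u) (b : Matching w) (a : Matching v) :
    CircleAlg (T₁₂.Circles c a) :=
  saddles (Sum.LiftRel (T₁.capped c) (T₂.cupped a)) (fun p => Sum.inl (T₁.bot p))
    (fun p => Sum.inr (T₂.top p)) b.toFun (fun x => CircleAlg.X (T₁₂.circle c a (g.π x))) ∅ b.arcs

/-- The map `F(W(c) T₁ b) ⊗ F(W(b) T₂ a) → F(W(c) T₁ T₂ a)` induced by the contraction cobordism. -/
def Glue.contract (g : Glue T₁ T₂ T₁₂) (c : Matching u) (b : Matching w) (a : Matching v)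
    (f : CircleAlg (T₁.Circles c b)) (h : CircleAlg (T₂.Circles b a)) :
    CircleAlg (T₁₂.Circles c a) :=
  CircleAlg.push (fun C => T₁₂.circle c a (g.π (Sum.inl (T₁.rep C)))) f *
    CircleAlg.push (fun C => T₁₂.circle c a (g.π (Sum.inr (T₂.rep C)))) h *
    g.saddleElement c b a

/-- Gluing along the middle layer. -/
theorem Glue.eqvGen_iff (g : Glue T₁ T₂ T₁₂) (c : Matching u) (b : Matching w) (a : Matching v)
    (x y : T₁.Pt ⊕ T₂.Pt) :
    EqvGen (stage (Sum.LiftRel (T₁.capped c) (T₂.cupped a)) (fun p => Sum.inl (T₁.bot p))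
      (fun p => Sum.inr (T₂.top p)) b.toFun Set.univ) x y ↔
    EqvGen (T₁₂.closed c a) (g.π x) (g.π y) := by
  have hg : ∀ x y, EqvGen (glued T₁ T₂) x y → EqvGen (stage (Sum.LiftRel (T₁.capped c) (T₂.cupped a))
      (fun p => Sum.inl (T₁.bot p)) (fun p => Sum.inr (T₂.top p)) b.toFun Set.univ) x y := by
    intro x y
    refine eqvGen_of_le ?_
    rintro _ _ (h | ⟨p, rfl, rfl⟩)
    · exact EqvGen.rel _ _ (Or.inl (h.mono (fun _ _ h => Or.inl h) (fun _ _ h => Or.inl h)))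
    · exact EqvGen.rel _ _ (Or.inr (Or.inl ⟨p, by simp, rfl, rfl⟩))
  have ha : ∀ {x y}, EqvGen T₁₂.adj x y → EqvGen (T₁₂.closed c a) x y := T₁₂.adj_closed c a
  refine eqvGen_retract g.π g.σ ?_ ?_ (fun x => hg _ _ (g.conn_σ (EqvGen.refl _))) x y
  · rintro x y (h | ⟨p, -, rfl, rfl⟩ | ⟨p, hp, -⟩)
    · rcases h with ⟨h | ⟨p, rfl, rfl⟩⟩ | ⟨h | ⟨p, rfl, rfl⟩⟩
      · exact ha (g.conn_left (EqvGen.rel _ _ h))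
      · refine ((ha (g.top p)).trans _ _ _ ?_).trans _ _ _ (ha (g.top _)).symm
        exact EqvGen.rel _ _ (Or.inl (Or.inr ⟨p, rfl, rfl⟩))
      · exact ha (g.conn_right (EqvGen.rel _ _ h))
      · refine ((ha (g.bot p)).trans _ _ _ ?_).trans _ _ _ (ha (g.bot _)).symm
        exact EqvGen.rel _ _ (Or.inr (Or.inr ⟨p, rfl, rfl⟩))
    · exact ha (g.mid p)
    · exact absurd (Set.mem_univ p) hp
  · have hadj : ∀ x y, T₁₂.adj x y → EqvGen (stage (Sum.LiftRel (T₁.capped c) (T₂.cupped a))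
        (fun p => Sum.inl (T₁.bot p)) (fun p => Sum.inr (T₂.top p)) b.toFun Set.univ)
        (g.σ x) (g.σ y) := fun x y h =>
      hg _ _ (g.conn_σ ((g.π_σ x).trans _ _ _ (EqvGen.rel _ _ h)))
    rintro x y ((h | ⟨p, rfl, rfl⟩) | (h | ⟨p, rfl, rfl⟩))
    · exact hadj x y h
    · refine ((hg _ _ (g.conn_σ (g.top p))).symm.trans _ _ _ ?_).trans _ _ _
        (hg _ _ (g.conn_σ (g.top _)))
      exact EqvGen.rel _ _ (Or.inl (Sum.LiftRel.inl (Or.inr ⟨p, rfl, rfl⟩)))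
    · exact hadj x y h
    · refine ((hg _ _ (g.conn_σ (g.bot p))).symm.trans _ _ _ ?_).trans _ _ _
        (hg _ _ (g.conn_σ (g.bot _)))
      exact EqvGen.rel _ _ (Or.inl (Sum.LiftRel.inr (Or.inr ⟨p, rfl, rfl⟩)))

end

theorem Glue.contract_assoc {T₁ : FlatTangle w u} {T₂ : FlatTangle v w} {T₃ : FlatTangle t v}
    {T₁₂ : FlatTangle v u} {T₂₃ : FlatTangle t w} {T : FlatTangle t u}
    (g₁₂ : Glue T₁ T₂ T₁₂) (g₂₃ : Glue T₂ T₃ T₂₃)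
    (g : Glue T₁₂ T₃ T) (g' : Glue T₁ T₂₃ T)
    (h₁ : ∀ x, EqvGen T.adj (g.π (Sum.inl (g₁₂.π (Sum.inl x)))) (g'.π (Sum.inl x)))
    (h₂ : ∀ x, EqvGen T.adj (g.π (Sum.inl (g₁₂.π (Sum.inr x))))
      (g'.π (Sum.inr (g₂₃.π (Sum.inl x)))))
    (h₃ : ∀ x, EqvGen T.adj (g.π (Sum.inr x)) (g'.π (Sum.inr (g₂₃.π (Sum.inr x)))))
    (d : Matching u) (c : Matching w) (b : Matching v) (a : Matching t)
    (x : CircleAlg (T₁.Circles d c)) (y : CircleAlg (T₂.Circles c b))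
    (z : CircleAlg (T₃.Circles b a)) :
    g.contract d b a (g₁₂.contract d c b x y) z = g'.contract d c a x (g₂₃.contract c b a y z) := by
  classical
  -- the big diagram
  let P := T₁.Pt ⊕ (T₂.Pt ⊕ T₃.Pt)
  let up : Ones w → P := fun p => Sum.inl (T₁.bot p)
  let lo : Ones w → P := fun p => Sum.inr (Sum.inl (T₂.top p))
  let up' : Ones v → P := fun p => Sum.inr (Sum.inl (T₂.bot p))
  let lo' : Ones v → P := fun p => Sum.inr (Sum.inr (T₃.top p))
  let ps : Ones w → Prop := fun p => Positive w p.1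
  let ps' : Ones v → Prop := fun p => Positive v p.1
  let R := tripleRel T₁ T₂ T₃ d a
  have hl : IsLayer up lo c.toFun ps :=
    { invol := c.invol
      flip := c.flip
      up_inj := fun _ _ h => T₁.bot_inj (Sum.inl_injective h)
      lo_inj := fun _ _ h => T₂.top_inj (Sum.inl_injective (Sum.inr_injective h))
      up_ne_lo := fun _ _ h => by cases h }
  have hl' : IsLayer up' lo' b.toFun ps' :=
    { invol := b.invol
      flip := b.flip
      up_inj := fun _ _ h => T₂.bot_inj (Sum.inl_injective (Sum.inr_injective h))
      lo_inj := fun _ _ h => T₃.top_inj (Sum.inr_injective (Sum.inr_injective h))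
      up_ne_lo := fun _ _ h => by cases h }
  have hdisj : ∀ x ∈ exits up lo ps, x ∉ exits up' lo' ps' := by
    rintro _ (⟨p, hp, rfl⟩ | ⟨p, hp, rfl⟩) (⟨q, hq, h⟩ | ⟨q, hq, h⟩)
    · cases h
    · cases h
    · exact T₂.top_ne_bot hp hq (Sum.inl_injective (Sum.inr_injective h))
    · cases h
  obtain ⟨θ₁, a1, a2, a3⟩ := T₁.orient d c
  obtain ⟨θ₂, b1, b2, b3⟩ := T₂.orient c b
  obtain ⟨θ₃, c1, c2, c3⟩ := T₃.orient b a
  have f1 : IsFlow θ₁ (T₁.capped d) {x | ∃ p, ¬ Positive w p.1 ∧ x = T₁.bot p} := by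
    refine T₁.flow_capped d a1 ?_ a3
    rintro p hp ⟨q, hq, h⟩
    exact T₁.top_ne_bot hp hq h
  have f3 : IsFlow θ₃ (T₃.cupped a) {x | ∃ p, Positive v p.1 ∧ x = T₃.top p} := by
    refine T₃.flow_cupped a c2 ?_ ?_
    · rintro p hp ⟨q, hq, h⟩
      exact T₃.top_ne_bot hq hp h.symm
    · rw [Set.union_comm]; exact c3
  let θ : Perm P := Equiv.sumCongr θ₁ (Equiv.sumCongr θ₂ θ₃)
  have hR : IsFlow θ R (exits up lo ps ∪ exits up' lo' ps') := by
    have h := sumCongr_flow f1 (sumCongr_flow b3 f3)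
    have e : (exits up lo ps ∪ exits up' lo' ps') = (Sum.inl '' {x | ∃ p, ¬ Positive w p.1 ∧ x = T₁.bot p} ∪
        Sum.inr '' (Sum.inl '' {x | (∃ p, Positive w p.1 ∧ x = T₂.top p) ∨
          ∃ p, ¬ Positive v p.1 ∧ x = T₂.bot p} ∪
          Sum.inr '' {x | ∃ p, Positive v p.1 ∧ x = T₃.top p}) : Set P) := by
      ext x
      constructor
      · rintro ((⟨p, hp, rfl⟩ | ⟨p, hp, rfl⟩) | (⟨p, hp, rfl⟩ | ⟨p, hp, rfl⟩))
        · exact Or.inl ⟨_, ⟨p, hp, rfl⟩, rfl⟩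
        · exact Or.inr ⟨_, Or.inl ⟨_, Or.inl ⟨p, hp, rfl⟩, rfl⟩, rfl⟩
        · exact Or.inr ⟨_, Or.inl ⟨_, Or.inr ⟨p, hp, rfl⟩, rfl⟩, rfl⟩
        · exact Or.inr ⟨_, Or.inr ⟨_, ⟨p, hp, rfl⟩, rfl⟩, rfl⟩
      · rintro (⟨_, ⟨p, hp, rfl⟩, rfl⟩ | ⟨_, ⟨_, ⟨p, hp, rfl⟩ | ⟨p, hp, rfl⟩, rfl⟩ |
          ⟨_, ⟨p, hp, rfl⟩, rfl⟩, rfl⟩)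
        · exact Or.inl (Or.inl ⟨p, hp, rfl⟩)
        · exact Or.inl (Or.inr ⟨p, hp, rfl⟩)
        · exact Or.inr (Or.inl ⟨p, hp, rfl⟩)
        · exact Or.inr (Or.inr ⟨p, hp, rfl⟩)
    rw [e]
    exact h
  -- points of the final diagram
  let pr₁₂ : P → T₁₂.Pt ⊕ T₃.Pt := Sum.elim (fun x => Sum.inl (g₁₂.π (Sum.inl x)))
    (Sum.elim (fun x => Sum.inl (g₁₂.π (Sum.inr x))) Sum.inr)
  let pr₂₃ : P → T₁.Pt ⊕ T₂₃.Pt := Sum.elim Sum.inl (fun x => Sum.inr (g₂₃.π x))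
  let pr : P → T.Pt := fun x => g.π (pr₁₂ x)
  let ξ : P → CircleAlg (T.Circles d a) := fun x => CircleAlg.X (T.circle d a (pr x))
  have hsq : ∀ x, ξ x * ξ x = 0 := fun x => CircleAlg.X_mul_self _
  -- embeddings and projections
  let i₁₂ : T₁.Pt ⊕ T₂.Pt → P := Sum.elim Sum.inl (fun x => Sum.inr (Sum.inl x))
  let i₂₃ : T₂.Pt ⊕ T₃.Pt → P := Sum.inr
  have hi₁₂ : Function.Injective i₁₂ := by
    rintro (x | x) (y | y) h
    · exact congrArg Sum.inl (Sum.inl_injective h)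
    · cases h
    · cases h
    · exact congrArg Sum.inr (Sum.inl_injective (Sum.inr_injective h))
  let σ₁₂ : T₁₂.Pt ⊕ T₃.Pt → P := Sum.elim (fun x => i₁₂ (g₁₂.σ x)) (fun x => Sum.inr (Sum.inr x))
  let σ₂₃ : T₁.Pt ⊕ T₂₃.Pt → P := Sum.elim Sum.inl (fun x => Sum.inr (g₂₃.σ x))
  have hpri : ∀ x, pr (i₁₂ x) = g.π (Sum.inl (g₁₂.π x)) := by rintro (x | x) <;> rfl
  have hpr : ∀ x, EqvGen T.adj (pr x) (g'.π (pr₂₃ x)) := by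
    rintro (x | x | x)
    · exact h₁ x
    · exact h₂ x
    · exact h₃ x
  have hξ' : ∀ x, ξ x = CircleAlg.X (T.circle d a (g'.π (pr₂₃ x))) := fun x =>
    congrArg CircleAlg.X (T.circle_eq_of_adj (hpr x))
  have tr12 : ∀ (D : Set (Ones w)) x y,
      EqvGen (stage (Sum.LiftRel (T₁.capped d) (T₂.cupped b)) (fun p => Sum.inl (T₁.bot p))
        (fun p => Sum.inr (T₂.top p)) c.toFun D) x y ↔
      EqvGen (stage (stage R up' lo' b.toFun ∅) up lo c.toFun D) (i₁₂ x) (i₁₂ y) := by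
    intro D
    refine eqvGen_embed i₁₂ hi₁₂ ?_ ?_ ?_
    · rintro _ _ ((⟨h⟩ | ⟨h | ⟨p, rfl, rfl⟩⟩) | ⟨p, hp, rfl, rfl⟩ | ⟨p, hp, ⟨rfl, rfl⟩ | ⟨rfl, rfl⟩⟩)
      · exact Or.inl (Or.inl (Sum.LiftRel.inl (by assumption)))
      · exact Or.inl (Or.inl (Sum.LiftRel.inr (Sum.LiftRel.inl h)))
      · exact Or.inl (Or.inr (Or.inr ⟨p, by simp, Or.inl ⟨rfl, rfl⟩⟩))
      · exact Or.inr (Or.inl ⟨p, hp, rfl, rfl⟩)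
      · exact Or.inr (Or.inr ⟨p, hp, Or.inl ⟨rfl, rfl⟩⟩)
      · exact Or.inr (Or.inr ⟨p, hp, Or.inr ⟨rfl, rfl⟩⟩)
    · rintro (x | x) z h
      · rcases h with (h | ⟨p, hp, -⟩ | ⟨p, -, ⟨h, h'⟩ | ⟨h, h'⟩⟩) | ⟨p, hp, h, rfl⟩ |
          ⟨p, hp, ⟨h, rfl⟩ | ⟨h, rfl⟩⟩
        · cases h
          exact ⟨Sum.inl _, rfl, Or.inl (Sum.LiftRel.inl (by assumption))⟩
        · exact absurd hp (by simp)
        · cases h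
        · cases h
        · cases h
          exact ⟨Sum.inr _, rfl, Or.inr (Or.inl ⟨p, hp, rfl, rfl⟩)⟩
        · cases h
          exact ⟨Sum.inl _, rfl, Or.inr (Or.inr ⟨p, hp, Or.inl ⟨rfl, rfl⟩⟩)⟩
        · cases h
      · rcases h with (h | ⟨p, hp, -⟩ | ⟨p, -, ⟨h, rfl⟩ | ⟨h, h'⟩⟩) | ⟨p, hp, h, rfl⟩ |
          ⟨p, hp, ⟨h, rfl⟩ | ⟨h, rfl⟩⟩
        · cases h with
          | inr h =>
            cases h with
            | inl h => exact ⟨Sum.inr _, rfl, Or.inl (Sum.LiftRel.inr (Or.inl h))⟩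
        · exact absurd hp (by simp)
        · cases h
          exact ⟨Sum.inr _, rfl, Or.inl (Sum.LiftRel.inr (Or.inr ⟨p, rfl, rfl⟩))⟩
        · cases h
        · cases h
        · cases h
        · cases h
          exact ⟨Sum.inr _, rfl, Or.inr (Or.inr ⟨p, hp, Or.inr ⟨rfl, rfl⟩⟩)⟩
    · rintro (x | x) z h
      · rcases h with (h | ⟨p, hp, -⟩ | ⟨p, -, ⟨h, h'⟩ | ⟨h, h'⟩⟩) | ⟨p, hp, rfl, h⟩ |
          ⟨p, hp, ⟨rfl, h⟩ | ⟨rfl, h⟩⟩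
        · cases h
          exact ⟨Sum.inl _, rfl, Or.inl (Sum.LiftRel.inl (by assumption))⟩
        · exact absurd hp (by simp)
        · cases h'
        · cases h'
        · cases h
        · cases h
          exact ⟨Sum.inl _, rfl, Or.inr (Or.inr ⟨p, hp, Or.inl ⟨rfl, rfl⟩⟩)⟩
        · cases h
      · rcases h with (h | ⟨p, hp, -⟩ | ⟨p, -, ⟨rfl, h⟩ | ⟨h, h'⟩⟩) | ⟨p, hp, rfl, h⟩ |
          ⟨p, hp, ⟨rfl, h⟩ | ⟨rfl, h⟩⟩
        · cases h with
          | inr h =>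
            cases h with
            | inl h => exact ⟨Sum.inr _, rfl, Or.inl (Sum.LiftRel.inr (Or.inl h))⟩
        · exact absurd hp (by simp)
        · cases h
          exact ⟨Sum.inr _, rfl, Or.inl (Sum.LiftRel.inr (Or.inr ⟨p, rfl, rfl⟩))⟩
        · cases h'
        · cases h
          exact ⟨Sum.inl _, rfl, Or.inr (Or.inl ⟨p, hp, rfl, rfl⟩)⟩
        · cases h
        · cases h
          exact ⟨Sum.inr _, rfl, Or.inr (Or.inr ⟨p, hp, Or.inr ⟨rfl, rfl⟩⟩)⟩
  have tr23 : ∀ (D : Set (Ones v)) x y,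
      EqvGen (stage (Sum.LiftRel (T₂.capped c) (T₃.cupped a)) (fun p => Sum.inl (T₂.bot p))
        (fun p => Sum.inr (T₃.top p)) b.toFun D) x y ↔
      EqvGen (stage (stage R up lo c.toFun ∅) up' lo' b.toFun D) (i₂₃ x) (i₂₃ y) := by
    intro D
    refine eqvGen_embed i₂₃ Sum.inr_injective ?_ ?_ ?_
    · rintro _ _ ((⟨h | ⟨p, rfl, rfl⟩⟩ | ⟨h⟩) | ⟨p, hp, rfl, rfl⟩ | ⟨p, hp, ⟨rfl, rfl⟩ | ⟨rfl, rfl⟩⟩)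
      · exact Or.inl (Or.inl (Sum.LiftRel.inr (Sum.LiftRel.inl h)))
      · exact Or.inl (Or.inr (Or.inr ⟨p, by simp, Or.inr ⟨rfl, rfl⟩⟩))
      · exact Or.inl (Or.inl (Sum.LiftRel.inr (Sum.LiftRel.inr (by assumption))))
      · exact Or.inr (Or.inl ⟨p, hp, rfl, rfl⟩)
      · exact Or.inr (Or.inr ⟨p, hp, Or.inl ⟨rfl, rfl⟩⟩)
      · exact Or.inr (Or.inr ⟨p, hp, Or.inr ⟨rfl, rfl⟩⟩)
    · rintro (x | x) z h
      · rcases h with (h | ⟨p, hp, -⟩ | ⟨p, -, ⟨h, h'⟩ | ⟨h, rfl⟩⟩) | ⟨p, hp, h, rfl⟩ |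
          ⟨p, hp, ⟨h, rfl⟩ | ⟨h, rfl⟩⟩
        · cases h with
          | inr h =>
            cases h with
            | inl h => exact ⟨Sum.inl _, rfl, Or.inl (Sum.LiftRel.inl (Or.inl h))⟩
        · exact absurd hp (by simp)
        · cases h
        · cases h
          exact ⟨Sum.inl _, rfl, Or.inl (Sum.LiftRel.inl (Or.inr ⟨p, rfl, rfl⟩))⟩
        · cases h
          exact ⟨Sum.inr _, rfl, Or.inr (Or.inl ⟨p, hp, rfl, rfl⟩)⟩
        · cases h
          exact ⟨Sum.inl _, rfl, Or.inr (Or.inr ⟨p, hp, Or.inl ⟨rfl, rfl⟩⟩)⟩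
        · cases h
      · rcases h with (h | ⟨p, hp, -⟩ | ⟨p, -, ⟨h, h'⟩ | ⟨h, h'⟩⟩) | ⟨p, hp, h, rfl⟩ |
          ⟨p, hp, ⟨h, rfl⟩ | ⟨h, rfl⟩⟩
        · cases h with
          | inr h =>
            cases h with
            | inr h => exact ⟨Sum.inr _, rfl, Or.inl (Sum.LiftRel.inr h)⟩
        · exact absurd hp (by simp)
        · cases h
        · cases h
        · cases h
        · cases h
        · cases h
          exact ⟨Sum.inr _, rfl, Or.inr (Or.inr ⟨p, hp, Or.inr ⟨rfl, rfl⟩⟩)⟩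
    · rintro (x | x) z h
      · rcases h with (h | ⟨p, hp, -⟩ | ⟨p, -, ⟨h', h⟩ | ⟨rfl, h⟩⟩) | ⟨p, hp, rfl, h⟩ |
          ⟨p, hp, ⟨rfl, h⟩ | ⟨rfl, h⟩⟩
        · cases h with
          | inr h =>
            cases h with
            | inl h => exact ⟨Sum.inl _, rfl, Or.inl (Sum.LiftRel.inl (Or.inl h))⟩
        · exact absurd hp (by simp)
        · cases h
        · cases h
          exact ⟨Sum.inl _, rfl, Or.inl (Sum.LiftRel.inl (Or.inr ⟨p, rfl, rfl⟩))⟩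
        · cases h
        · cases h
          exact ⟨Sum.inl _, rfl, Or.inr (Or.inr ⟨p, hp, Or.inl ⟨rfl, rfl⟩⟩)⟩
        · cases h
      · rcases h with (h | ⟨p, hp, -⟩ | ⟨p, -, ⟨h', h⟩ | ⟨h', h⟩⟩) | ⟨p, hp, rfl, h⟩ |
          ⟨p, hp, ⟨rfl, h⟩ | ⟨rfl, h⟩⟩
        · cases h with
          | inr h =>
            cases h with
            | inr h => exact ⟨Sum.inr _, rfl, Or.inl (Sum.LiftRel.inr h)⟩
        · exact absurd hp (by simp)
        · cases h
        · cases h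
        · cases h
          exact ⟨Sum.inl _, rfl, Or.inr (Or.inl ⟨p, hp, rfl, rfl⟩)⟩
        · cases h
        · cases h
          exact ⟨Sum.inr _, rfl, Or.inr (Or.inr ⟨p, hp, Or.inr ⟨rfl, rfl⟩⟩)⟩
  have tr2 : ∀ (D : Set (Ones v)) x y,
      EqvGen (stage (stage R up lo c.toFun Set.univ) up' lo' b.toFun D) x y ↔
      EqvGen (stage (Sum.LiftRel (T₁₂.capped d) (T₃.cupped a)) (fun p => Sum.inl (T₁₂.bot p))
        (fun p => Sum.inr (T₃.top p)) b.toFun D) (pr₁₂ x) (pr₁₂ y) := by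
    intro D
    have hs : ∀ {x y}, EqvGen (glued T₁ T₂) x y →
        EqvGen (stage (stage R up lo c.toFun Set.univ) up' lo' b.toFun D) (i₁₂ x) (i₁₂ y) := by
      intro x y
      refine eqvGen_map i₁₂ ?_
      rintro _ _ ((h | h) | ⟨p, rfl, rfl⟩)
      · exact EqvGen.rel _ _ (Or.inl (Or.inl (Sum.LiftRel.inl (Or.inl h))))
      · exact EqvGen.rel _ _ (Or.inl (Or.inl (Sum.LiftRel.inr (Sum.LiftRel.inl h))))
      · exact EqvGen.rel _ _ (Or.inl (Or.inr (Or.inl ⟨p, by simp, rfl, rfl⟩)))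
    have hl : ∀ {x y}, EqvGen T₁₂.adj x y → EqvGen (stage (Sum.LiftRel (T₁₂.capped d) (T₃.cupped a))
        (fun p => Sum.inl (T₁₂.bot p)) (fun p => Sum.inr (T₃.top p)) b.toFun D)
        (Sum.inl x) (Sum.inl y) := by
      intro x y
      refine eqvGen_map Sum.inl fun _ _ h => EqvGen.rel _ _ (Or.inl ?_)
      exact Sum.LiftRel.inl (Or.inl h)
    refine eqvGen_retract pr₁₂ σ₁₂ ?_ ?_ ?_
    · rintro x y ((h | ⟨p, -, rfl, rfl⟩ | ⟨p, hp, -⟩) | ⟨p, hp, rfl, rfl⟩ |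
        ⟨p, hp, ⟨rfl, rfl⟩ | ⟨rfl, rfl⟩⟩)
      · rcases h with ⟨h | ⟨p, rfl, rfl⟩⟩ | ⟨⟨h⟩ | ⟨h⟩⟩
        · exact hl (g₁₂.conn_left (EqvGen.rel _ _ h))
        · refine ((hl (g₁₂.top p)).trans _ _ _ ?_).trans _ _ _ (hl (g₁₂.top _)).symm
          exact EqvGen.rel _ _ (Or.inl (Sum.LiftRel.inl (Or.inr ⟨p, rfl, rfl⟩)))
        · exact hl (g₁₂.conn_right (EqvGen.rel _ _ (by assumption)))
        · exact EqvGen.rel _ _ (Or.inl (Sum.LiftRel.inr (by assumption)))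
      · exact hl (g₁₂.mid p)
      · exact absurd (Set.mem_univ p) hp
      · exact (hl (g₁₂.bot p)).trans _ _ _ (EqvGen.rel _ _ (Or.inr (Or.inl ⟨p, hp, rfl, rfl⟩)))
      · refine ((hl (g₁₂.bot p)).trans _ _ _ ?_).trans _ _ _ (hl (g₁₂.bot _)).symm
        exact EqvGen.rel _ _ (Or.inr (Or.inr ⟨p, hp, Or.inl ⟨rfl, rfl⟩⟩))
      · exact EqvGen.rel _ _ (Or.inr (Or.inr ⟨p, hp, Or.inr ⟨rfl, rfl⟩⟩))
    · have hbot : ∀ p, EqvGen (stage (stage R up lo c.toFun Set.univ) up' lo' b.toFun D)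
          (up' p) (σ₁₂ (Sum.inl (T₁₂.bot p))) := fun p => hs (g₁₂.conn_σ (g₁₂.bot p))
      rintro _ _ ((⟨h | ⟨p, rfl, rfl⟩⟩ | ⟨h⟩) | ⟨p, hp, rfl, rfl⟩ | ⟨p, hp, ⟨rfl, rfl⟩ | ⟨rfl, rfl⟩⟩)
      · exact hs (g₁₂.conn_σ ((g₁₂.π_σ _).trans _ _ _ (EqvGen.rel _ _ h)))
      · refine ((hs (g₁₂.conn_σ (g₁₂.top p))).symm.trans _ _ _ ?_).trans _ _ _
          (hs (g₁₂.conn_σ (g₁₂.top _)))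
        exact EqvGen.rel _ _ (Or.inl (Or.inl (Sum.LiftRel.inl (Or.inr ⟨p, rfl, rfl⟩))))
      · exact EqvGen.rel _ _ (Or.inl (Or.inl (Sum.LiftRel.inr (Sum.LiftRel.inr (by assumption)))))
      · refine (hbot p).symm.trans _ _ _ ?_
        exact EqvGen.rel _ _ (Or.inr (Or.inl ⟨p, hp, rfl, rfl⟩))
      · refine ((hbot p).symm.trans _ _ _ ?_).trans _ _ _ (hbot _)
        exact EqvGen.rel _ _ (Or.inr (Or.inr ⟨p, hp, Or.inl ⟨rfl, rfl⟩⟩))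
      · exact EqvGen.rel _ _ (Or.inr (Or.inr ⟨p, hp, Or.inr ⟨rfl, rfl⟩⟩))
    · rintro (x | x | x)
      · exact hs (g₁₂.conn_σ (x := Sum.inl x) (EqvGen.refl _))
      · exact hs (g₁₂.conn_σ (x := Sum.inr x) (EqvGen.refl _))
      · exact EqvGen.refl _
  have tr4 : ∀ (D : Set (Ones w)) x y,
      EqvGen (stage (stage R up' lo' b.toFun Set.univ) up lo c.toFun D) x y ↔
      EqvGen (stage (Sum.LiftRel (T₁.capped d) (T₂₃.cupped a)) (fun p => Sum.inl (T₁.bot p))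
        (fun p => Sum.inr (T₂₃.top p)) c.toFun D) (pr₂₃ x) (pr₂₃ y) := by
    intro D
    have hs : ∀ {x y}, EqvGen (glued T₂ T₃) x y →
        EqvGen (stage (stage R up' lo' b.toFun Set.univ) up lo c.toFun D) (i₂₃ x) (i₂₃ y) := by
      intro x y
      refine eqvGen_map i₂₃ ?_
      rintro _ _ ((h | h) | ⟨p, rfl, rfl⟩)
      · exact EqvGen.rel _ _ (Or.inl (Or.inl (Sum.LiftRel.inr (Sum.LiftRel.inl h))))
      · exact EqvGen.rel _ _ (Or.inl (Or.inl (Sum.LiftRel.inr (Sum.LiftRel.inr (Or.inl h)))))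
      · exact EqvGen.rel _ _ (Or.inl (Or.inr (Or.inl ⟨p, by simp, rfl, rfl⟩)))
    have hl : ∀ {x y}, EqvGen T₂₃.adj x y → EqvGen (stage (Sum.LiftRel (T₁.capped d) (T₂₃.cupped a))
        (fun p => Sum.inl (T₁.bot p)) (fun p => Sum.inr (T₂₃.top p)) c.toFun D)
        (Sum.inr x) (Sum.inr y) := by
      intro x y
      refine eqvGen_map Sum.inr fun _ _ h => EqvGen.rel _ _ (Or.inl ?_)
      exact Sum.LiftRel.inr (Or.inl h)
    refine eqvGen_retract pr₂₃ σ₂₃ ?_ ?_ ?_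
    · rintro x y ((h | ⟨p, -, rfl, rfl⟩ | ⟨p, hp, -⟩) | ⟨p, hp, rfl, rfl⟩ |
        ⟨p, hp, ⟨rfl, rfl⟩ | ⟨rfl, rfl⟩⟩)
      · rcases h with ⟨h⟩ | ⟨⟨h⟩ | ⟨h | ⟨p, rfl, rfl⟩⟩⟩
        · exact EqvGen.rel _ _ (Or.inl (Sum.LiftRel.inl (by assumption)))
        · exact hl (g₂₃.conn_left (EqvGen.rel _ _ (by assumption)))
        · exact hl (g₂₃.conn_right (EqvGen.rel _ _ h))
        · refine ((hl (g₂₃.bot p)).trans _ _ _ ?_).trans _ _ _ (hl (g₂₃.bot _)).symm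
          exact EqvGen.rel _ _ (Or.inl (Sum.LiftRel.inr (Or.inr ⟨p, rfl, rfl⟩)))
      · exact hl (g₂₃.mid p)
      · exact absurd (Set.mem_univ p) hp
      · exact EqvGen.trans _ _ _ (EqvGen.rel _ _ (Or.inr (Or.inl ⟨p, hp, rfl, rfl⟩)))
          (hl (g₂₃.top p)).symm
      · exact EqvGen.rel _ _ (Or.inr (Or.inr ⟨p, hp, Or.inl ⟨rfl, rfl⟩⟩))
      · refine ((hl (g₂₃.top p)).trans _ _ _ ?_).trans _ _ _ (hl (g₂₃.top _)).symm
        exact EqvGen.rel _ _ (Or.inr (Or.inr ⟨p, hp, Or.inr ⟨rfl, rfl⟩⟩))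
    · have htop : ∀ p, EqvGen (stage (stage R up' lo' b.toFun Set.univ) up lo c.toFun D)
          (lo p) (σ₂₃ (Sum.inr (T₂₃.top p))) := fun p => hs (g₂₃.conn_σ (g₂₃.top p))
      rintro _ _ ((⟨h⟩ | ⟨h | ⟨p, rfl, rfl⟩⟩) | ⟨p, hp, rfl, rfl⟩ | ⟨p, hp, ⟨rfl, rfl⟩ | ⟨rfl, rfl⟩⟩)
      · exact EqvGen.rel _ _ (Or.inl (Or.inl (Sum.LiftRel.inl (by assumption))))
      · exact hs (g₂₃.conn_σ ((g₂₃.π_σ _).trans _ _ _ (EqvGen.rel _ _ h)))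
      · refine ((hs (g₂₃.conn_σ (g₂₃.bot p))).symm.trans _ _ _ ?_).trans _ _ _
          (hs (g₂₃.conn_σ (g₂₃.bot _)))
        exact EqvGen.rel _ _ (Or.inl (Or.inl (Sum.LiftRel.inr (Sum.LiftRel.inr
          (Or.inr ⟨p, rfl, rfl⟩)))))
      · refine EqvGen.trans _ _ _ ?_ (htop p)
        exact EqvGen.rel _ _ (Or.inr (Or.inl ⟨p, hp, rfl, rfl⟩))
      · exact EqvGen.rel _ _ (Or.inr (Or.inr ⟨p, hp, Or.inl ⟨rfl, rfl⟩⟩))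
      · refine ((htop p).symm.trans _ _ _ ?_).trans _ _ _ (htop _)
        exact EqvGen.rel _ _ (Or.inr (Or.inr ⟨p, hp, Or.inr ⟨rfl, rfl⟩⟩))
    · rintro (x | x)
      · exact EqvGen.refl _
      · exact hs (g₂₃.conn_σ (EqvGen.refl _))
  -- compatibility with the final circles
  have hξ : ∀ x y, stage (stage R up lo c.toFun Set.univ) up' lo' b.toFun Set.univ x y →
      ξ x = ξ y := by
    intro x y h
    have h1 := (tr2 _ _ _).mp (EqvGen.rel _ _ h)
    rw [g.eqvGen_iff, ← T.circle_eq] at h1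
    exact congrArg CircleAlg.X h1
  obtain ⟨main, kill1, kill2⟩ := two_layers hl hl' hdisj hR
    (fun p hp => congrArg Sum.inl (a2 p hp))
    (fun p hp => congrArg (fun x => Sum.inr (Sum.inl x)) (b1 p hp))
    (fun p hp => congrArg (fun x => Sum.inr (Sum.inl x)) (b2 p hp))
    (fun p hp => congrArg (fun x => Sum.inr (Sum.inr x)) (c1 p hp)) hsq hξ c.arcs_pairwise
    c.arcs_cover b.arcs_pairwise b.arcs_cover
  set E2 := saddles (stage R up lo c.toFun Set.univ) up' lo' b.toFun ξ ∅ b.arcs with hE2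
  set E4 := saddles (stage R up' lo' b.toFun Set.univ) up lo c.toFun ξ ∅ c.arcs with hE4
  have e2 : g.saddleElement d b a = E2 := by
    refine (saddles_transfer (fun D p q => ?_) (fun p => ?_) _ _).symm
    · rw [tr2]
      have hm : ∀ p, EqvGen (stage (Sum.LiftRel (T₁₂.capped d) (T₃.cupped a))
          (fun p => Sum.inl (T₁₂.bot p)) (fun p => Sum.inr (T₃.top p)) b.toFun D)
          (pr₁₂ (up' p)) (Sum.inl (T₁₂.bot p)) := fun p => by
        refine eqvGen_map Sum.inl (fun _ _ h => EqvGen.rel _ _ (Or.inl ?_)) (g₁₂.bot p)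
        exact Sum.LiftRel.inl (Or.inl h)
      exact ⟨fun h => ((hm p).symm.trans _ _ _ h).trans _ _ _ (hm q),
        fun h => ((hm p).trans _ _ _ h).trans _ _ _ (hm q).symm⟩
    · exact congrArg CircleAlg.X (T.circle_eq_of_adj (g.conn_left (g₁₂.bot p)))
  have e4 : g'.saddleElement d c a = E4 := by
    refine (saddles_transfer (fun D p q => ?_) (fun p => ?_) _ _).symm
    · rw [tr4]
      rfl
    · exact hξ' _
  -- values of the pushforwards on generators
  have cl12 : ∀ s s' : T₁₂.Pt, EqvGen (T₁₂.closed d b) s s' →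
      CircleAlg.X (T.circle d a (g.π (Sum.inl s))) * E2 =
      CircleAlg.X (T.circle d a (g.π (Sum.inl s'))) * E2 := by
    have key : ∀ s, CircleAlg.X (T.circle d a (g.π (Sum.inl s))) = ξ (i₁₂ (g₁₂.σ s)) := fun s => by
      simp only [ξ, hpri]
      exact congrArg CircleAlg.X (T.circle_eq_of_adj (g.conn_left (g₁₂.π_σ s).symm))
    intro s s' h
    rw [key, key]
    refine kill1 _ _ ((tr2 _ _ _).mpr ?_)
    have hpi : ∀ x, pr₁₂ (i₁₂ x) = Sum.inl (g₁₂.π x) := by rintro (x | x) <;> rfl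
    rw [hpi, hpi]
    refine eqvGen_map (R := T₁₂.closed d b) Sum.inl ?_
      (((T₁₂.adj_closed d b (g₁₂.π_σ s)).trans _ _ _ h).trans _ _ _
        (T₁₂.adj_closed d b (g₁₂.π_σ s')).symm)
    rintro x y ((h | ⟨p, rfl, rfl⟩) | (h | ⟨p, rfl, rfl⟩))
    · exact EqvGen.rel _ _ (Or.inl (Sum.LiftRel.inl (Or.inl h)))
    · exact EqvGen.rel _ _ (Or.inl (Sum.LiftRel.inl (Or.inr ⟨p, rfl, rfl⟩)))
    · exact EqvGen.rel _ _ (Or.inl (Sum.LiftRel.inl (Or.inl h)))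
    · exact EqvGen.rel _ _ (Or.inr (Or.inr ⟨p, by simp, Or.inl ⟨rfl, rfl⟩⟩))
  have cl23 : ∀ s s' : T₂₃.Pt, EqvGen (T₂₃.closed c a) s s' →
      CircleAlg.X (T.circle d a (g'.π (Sum.inr s))) * E4 =
      CircleAlg.X (T.circle d a (g'.π (Sum.inr s'))) * E4 := by
    have key : ∀ s, CircleAlg.X (T.circle d a (g'.π (Sum.inr s))) = ξ (i₂₃ (g₂₃.σ s)) := fun s => by
      rw [hξ']
      exact congrArg CircleAlg.X (T.circle_eq_of_adj (g'.conn_right (g₂₃.π_σ s).symm))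
    intro s s' h
    rw [key, key]
    refine kill2 _ _ ((tr4 _ _ _).mpr ?_)
    refine eqvGen_map (R := T₂₃.closed c a) Sum.inr ?_
      (((T₂₃.adj_closed c a (g₂₃.π_σ s)).trans _ _ _ h).trans _ _ _
        (T₂₃.adj_closed c a (g₂₃.π_σ s')).symm)
    rintro x y ((h | ⟨p, rfl, rfl⟩) | (h | ⟨p, rfl, rfl⟩))
    · exact EqvGen.rel _ _ (Or.inl (Sum.LiftRel.inr (Or.inl h)))
    · exact EqvGen.rel _ _ (Or.inr (Or.inr ⟨p, by simp, Or.inr ⟨rfl, rfl⟩⟩))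
    · exact EqvGen.rel _ _ (Or.inl (Sum.LiftRel.inr (Or.inl h)))
    · exact EqvGen.rel _ _ (Or.inl (Sum.LiftRel.inr (Or.inr ⟨p, rfl, rfl⟩)))
  -- the common value
  let F : CircleAlg (T₁.Circles d c) →+* CircleAlg (T.Circles d a) :=
    CircleAlg.push (fun C => T.circle d a (pr (Sum.inl (T₁.rep C))))
  let G : CircleAlg (T₂.Circles c b) →+* CircleAlg (T.Circles d a) :=
    CircleAlg.push (fun C => T.circle d a (pr (Sum.inr (Sum.inl (T₂.rep C)))))
  let H : CircleAlg (T₃.Circles b a) →+* CircleAlg (T.Circles d a) :=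
    CircleAlg.push (fun C => T.circle d a (pr (Sum.inr (Sum.inr (T₃.rep C)))))
  let Φ : CircleAlg (T₁₂.Circles d b) →+* CircleAlg (T.Circles d a) :=
    CircleAlg.push (fun C => T.circle d a (g.π (Sum.inl (T₁₂.rep C))))
  let Ψ : CircleAlg (T₂₃.Circles c a) →+* CircleAlg (T.Circles d a) :=
    CircleAlg.push (fun C => T.circle d a (g'.π (Sum.inr (T₂₃.rep C))))
  have ΦX : ∀ s, Φ (CircleAlg.X (T₁₂.circle d b s)) * E2 =
      CircleAlg.X (T.circle d a (g.π (Sum.inl s))) * E2 := by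
    intro s
    simp only [Φ, CircleAlg.push, CircleAlg.eval_X]
    exact cl12 _ _ (T₁₂.rep_circle d b s)
  have ΨX : ∀ s, Ψ (CircleAlg.X (T₂₃.circle c a s)) * E4 =
      CircleAlg.X (T.circle d a (g'.π (Sum.inr s))) * E4 := by
    intro s
    simp only [Ψ, CircleAlg.push, CircleAlg.eval_X]
    exact cl23 _ _ (T₂₃.rep_circle c a s)
  have k1 : Φ (g₁₂.saddleElement d c b) * E2 =
      saddles (stage R up' lo' b.toFun ∅) up lo c.toFun ξ ∅ c.arcs * E2 := by
    unfold Glue.saddleElement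
    rw [saddles_map, ← saddles_transfer (up := fun p => Sum.inl (T₁.bot p))
      (lo := fun p => Sum.inr (T₂.top p)) (R := Sum.LiftRel (T₁.capped d) (T₂.cupped b))
      (ξ := fun x => ξ (i₁₂ x)) (fun D p q => tr12 D _ _) (fun p => rfl)]
    refine saddles_congr_mul _ _ _ _ _ _ (fun p => ?_) _ _
    exact ΦX _
  have k3 : Ψ (g₂₃.saddleElement c b a) * E4 =
      saddles (stage R up lo c.toFun ∅) up' lo' b.toFun ξ ∅ b.arcs * E4 := by
    unfold Glue.saddleElement
    rw [saddles_map, ← saddles_transfer (up := fun p => Sum.inl (T₂.bot p))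
      (lo := fun p => Sum.inr (T₃.top p)) (R := Sum.LiftRel (T₂.capped c) (T₃.cupped a))
      (ξ := fun x => ξ (i₂₃ x)) (fun D p q => tr23 D _ _) (fun p => rfl)]
    refine saddles_congr_mul _ _ _ _ _ _ (fun p => ?_) _ _
    exact (ΨX _).trans (congrArg (· * E4) (hξ' (i₂₃ (Sum.inl (T₂.bot p)))).symm)
  have kF : ∀ f, Φ (CircleAlg.push (fun C => T₁₂.circle d b (g₁₂.π (Sum.inl (T₁.rep C)))) f) * E2
      = F f * E2 := by
    intro f
    refine CircleAlg.hom_congr (φ := Φ.comp (CircleAlg.push _)) (ψ := F) (fun C => ?_) f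
    rw [RingHom.comp_apply]
    simp only [F, CircleAlg.push, CircleAlg.eval_X]
    exact ΦX _
  have kG : ∀ f, Φ (CircleAlg.push (fun C => T₁₂.circle d b (g₁₂.π (Sum.inr (T₂.rep C)))) f) * E2
      = G f * E2 := by
    intro f
    refine CircleAlg.hom_congr (φ := Φ.comp (CircleAlg.push _)) (ψ := G) (fun C => ?_) f
    rw [RingHom.comp_apply]
    simp only [G, CircleAlg.push, CircleAlg.eval_X]
    exact ΦX _
  have kG' : ∀ f, Ψ (CircleAlg.push (fun C => T₂₃.circle c a (g₂₃.π (Sum.inl (T₂.rep C)))) f) * E4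
      = G f * E4 := by
    intro f
    refine CircleAlg.hom_congr (φ := Ψ.comp (CircleAlg.push _)) (ψ := G) (fun C => ?_) f
    rw [RingHom.comp_apply]
    simp only [G, CircleAlg.push, CircleAlg.eval_X]
    exact (ΨX _).trans (congrArg (· * E4) (hξ' (Sum.inr (Sum.inl (T₂.rep C)))).symm)
  have kH' : ∀ f, Ψ (CircleAlg.push (fun C => T₂₃.circle c a (g₂₃.π (Sum.inr (T₃.rep C)))) f) * E4
      = H f * E4 := by
    intro f
    refine CircleAlg.hom_congr (φ := Ψ.comp (CircleAlg.push _)) (ψ := H) (fun C => ?_) f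
    rw [RingHom.comp_apply]
    simp only [H, CircleAlg.push, CircleAlg.eval_X]
    exact (ΨX _).trans (congrArg (· * E4) (hξ' (Sum.inr (Sum.inr (T₃.rep C)))).symm)
  have kF' : CircleAlg.push (fun C => T.circle d a (g'.π (Sum.inl (T₁.rep C)))) = F := by
    have : ∀ x, T.circle d a (g'.π (Sum.inl x)) = T.circle d a (pr (Sum.inl x)) :=
      fun x => (T.circle_eq_of_adj (hpr (Sum.inl x))).symm
    simp only [F, this]
  have lhs : g.contract d b a (g₁₂.contract d c b x y) z =
      F x * G y * H z * (saddles (stage R up' lo' b.toFun ∅) up lo c.toFun ξ ∅ c.arcs * E2) := by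
    have : g.contract d b a (g₁₂.contract d c b x y) z =
        Φ (g₁₂.contract d c b x y) * H z * E2 := by
      rw [← e2]; rfl
    rw [this]
    unfold Glue.contract
    rw [map_mul, map_mul]
    have q1 := kF x
    have q2 := kG y
    generalize Φ (CircleAlg.push _ x) = X1 at *
    generalize Φ (CircleAlg.push _ y) = X2 at *
    generalize Φ (g₁₂.saddleElement d c b) = X3 at *
    linear_combination X2 * X3 * H z * q1 + F x * X3 * H z * q2 + F x * G y * H z * k1
  have rhs : g'.contract d c a x (g₂₃.contract c b a y z) =
      F x * G y * H z * (saddles (stage R up lo c.toFun ∅) up' lo' b.toFun ξ ∅ b.arcs * E4) := by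
    have : g'.contract d c a x (g₂₃.contract c b a y z) =
        F x * Ψ (g₂₃.contract c b a y z) * E4 := by
      rw [← e4, ← kF']; rfl
    rw [this]
    unfold Glue.contract
    rw [map_mul, map_mul]
    have q1 := kG' y
    have q2 := kH' z
    generalize Ψ (CircleAlg.push _ y) = X1 at *
    generalize Ψ (CircleAlg.push _ z) = X2 at *
    generalize Ψ (g₂₃.saddleElement c b a) = X3 at *
    linear_combination F x * X2 * X3 * q1 + F x * G y * X3 * q2 + F x * G y * H z * k3
  rw [lhs, rhs, main]

section

variable {T₁ : FlatTangle w u} {T₂ : FlatTangle v w} {T₁₂ : FlatTangle v u}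

/-- The number of circles after contraction, and the degree of the saddle element. -/
theorem Glue.homog_saddleElement (g : Glue T₁ T₂ T₁₂) (c : Matching u) (b : Matching w)
    (a : Matching v) :
    ∃ e, (g.saddleElement c b a).Homog e ∧
      Nat.card (T₁₂.Circles c a) + b.arcs.length =
        Nat.card (T₁.Circles c b) + Nat.card (T₂.Circles b a) + 2 * e := by
  classical
  let up : Ones w → T₁.Pt ⊕ T₂.Pt := fun p => Sum.inl (T₁.bot p)
  let lo : Ones w → T₁.Pt ⊕ T₂.Pt := fun p => Sum.inr (T₂.top p)
  let ps : Ones w → Prop := fun p => Positive w p.1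
  let R := Sum.LiftRel (T₁.capped c) (T₂.cupped a)
  have hl : IsLayer up lo b.toFun ps := isLayer_mid T₁ T₂ b
  obtain ⟨θ₁, a1, a2, a3⟩ := T₁.orient c b
  obtain ⟨θ₂, b1, b2, b3⟩ := T₂.orient b a
  have f1 : IsFlow θ₁ (T₁.capped c) {x | ∃ p, ¬ Positive w p.1 ∧ x = T₁.bot p} := by
    refine T₁.flow_capped c a1 ?_ a3
    rintro p hp ⟨q, hq, h⟩
    exact T₁.top_ne_bot hp hq h
  have f2 : IsFlow θ₂ (T₂.cupped a) {x | ∃ p, Positive w p.1 ∧ x = T₂.top p} := by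
    refine T₂.flow_cupped a b2 ?_ ?_
    · rintro p hp ⟨q, hq, h⟩
      exact T₂.top_ne_bot hq hp h.symm
    · rw [Set.union_comm]; exact b3
  let θ : Perm (T₁.Pt ⊕ T₂.Pt) := Equiv.sumCongr θ₁ θ₂
  have hR : IsFlow θ R (exits up lo ps) := by
    have h := sumCongr_flow f1 f2
    have e : exits up lo ps = (Sum.inl '' {x | ∃ p, ¬ Positive w p.1 ∧ x = T₁.bot p} ∪
        Sum.inr '' {x | ∃ p, Positive w p.1 ∧ x = T₂.top p} : Set (T₁.Pt ⊕ T₂.Pt)) := by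
      ext x
      constructor
      · rintro (⟨p, hp, rfl⟩ | ⟨p, hp, rfl⟩)
        · exact Or.inl ⟨_, ⟨p, hp, rfl⟩, rfl⟩
        · exact Or.inr ⟨_, ⟨p, hp, rfl⟩, rfl⟩
      · rintro (⟨_, ⟨p, hp, rfl⟩, rfl⟩ | ⟨_, ⟨p, hp, rfl⟩, rfl⟩)
        · exact Or.inl ⟨p, hp, rfl⟩
        · exact Or.inr ⟨p, hp, rfl⟩
    rw [e]
    exact h
  let ξ : T₁.Pt ⊕ T₂.Pt → CircleAlg (T₁₂.Circles c a) :=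
    fun x => CircleAlg.X (T₁₂.circle c a (g.π x))
  have s0 : SurgeryState up lo b.toFun ps θ θ ∅ := SurgeryState.zero
    (fun p hp => congrArg Sum.inl (a2 p hp)) (fun p hp => congrArg Sum.inr (b1 p hp))
  have s1 := s0.list hl b.arcs (by simp) (by simp) b.arcs_pairwise
  have hu : (∅ ∪ {q | q ∈ b.arcs ∨ b.toFun q ∈ b.arcs} : Set (Ones w)) = Set.univ := by
    ext q; simpa using b.arcs_cover q
  rw [hu] at s1
  have e1 : g.saddleElement c b a =
      Surgery.prodFactor ξ θ (b.arcs.map (arcPair up lo b.toFun ps)) := by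
    refine saddles_eq_prodFactor hl hR (fun p => ?_) b.arcs s0 (by simp) (by simp) b.arcs_pairwise
    exact congrArg CircleAlg.X (T₁₂.circle_eq_of_adj (g.mid p).symm)
  obtain ⟨e, he, hcard⟩ := Surgery.homog_prodFactor ξ (fun x => CircleAlg.Homog.X _) θ
    (b.arcs.map (arcPair up lo b.toFun ps)) (by
      intro p hp
      obtain ⟨q, -, rfl⟩ := List.mem_map.mp hp
      exact arcPair_ne hl q)
  refine ⟨e, by rw [e1]; exact he, ?_⟩
  rw [List.length_map] at hcard
  -- circles at the end
  have r1 := s1.rep hl (N := ∅) (by simpa using hR) (by simp) (by simp)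
  have c1 : Surgery.cycles (Surgery.after θ (b.arcs.map (arcPair up lo b.toFun ps))) =
      Nat.card (T₁₂.Circles c a) := by
    refine Nat.card_congr (Equiv.ofBijective (Quotient.map' (s₁ := SameCycle.setoid _)
      (s₂ := EqvGen.setoid (T₁₂.closed c a)) g.π (fun x y h => ?_)) ⟨?_, ?_⟩)
    · exact (g.eqvGen_iff c b a x y).mp ((r1.eqvGen_iff x y).mpr h)
    · intro q1 q2 h
      induction q1 using Quotient.inductionOn with | _ x => ?_
      induction q2 using Quotient.inductionOn with | _ y => ?_
      exact Quotient.sound ((r1.eqvGen_iff x y).mp ((g.eqvGen_iff c b a x y).mpr (Quotient.exact h)))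
    · intro q
      induction q using Quotient.inductionOn with | _ x => ?_
      exact ⟨Quotient.mk _ (g.σ x), T₁₂.circle_eq_of_adj (g.π_σ x)⟩
  -- circles at the start
  have r0 := s0.rep hl (N := ∅) (by simpa using hR) (by simp) (by simp)
  have hrel : ∀ x y, SameCycle θ x y ↔
      EqvGen (Sum.LiftRel (T₁.closed c b) (T₂.closed b a)) x y := by
    intro x y
    rw [← r0.eqvGen_iff]
    constructor
    · refine eqvGen_of_le ?_
      rintro _ _ ((h | h) | ⟨p, hp, -⟩ | ⟨p, -, ⟨rfl, rfl⟩ | ⟨rfl, rfl⟩⟩)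
      · exact EqvGen.rel _ _ (Sum.LiftRel.inl (Or.inl h))
      · exact EqvGen.rel _ _ (Sum.LiftRel.inr (Or.inr h))
      · exact absurd hp (by simp)
      · exact EqvGen.rel _ _ (Sum.LiftRel.inl (Or.inr (Or.inr ⟨p, rfl, rfl⟩)))
      · exact EqvGen.rel _ _ (Sum.LiftRel.inr (Or.inl (Or.inr ⟨p, rfl, rfl⟩)))
    · refine eqvGen_of_le ?_
      rintro _ _ ((h | (h | ⟨p, rfl, rfl⟩)) | ((h | ⟨p, rfl, rfl⟩) | h))
      · exact EqvGen.rel _ _ (Or.inl (Sum.LiftRel.inl h))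
      · exact EqvGen.rel _ _ (Or.inl (Sum.LiftRel.inl (Or.inl h)))
      · exact EqvGen.rel _ _ (Or.inr (Or.inr ⟨p, by simp, Or.inl ⟨rfl, rfl⟩⟩))
      · exact EqvGen.rel _ _ (Or.inl (Sum.LiftRel.inr (Or.inl h)))
      · exact EqvGen.rel _ _ (Or.inr (Or.inr ⟨p, by simp, Or.inr ⟨rfl, rfl⟩⟩))
      · exact EqvGen.rel _ _ (Or.inl (Sum.LiftRel.inr h))
  have il : ∀ x y, EqvGen (T₁.closed c b) x y ↔
      EqvGen (Sum.LiftRel (T₁.closed c b) (T₂.closed b a)) (Sum.inl x) (Sum.inl y) := by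
    refine eqvGen_embed Sum.inl Sum.inl_injective (fun _ _ h => Sum.LiftRel.inl h) ?_ ?_
    · rintro x z (h | h); exact ⟨_, rfl, h⟩
    · rintro x z (h | h); exact ⟨_, rfl, h⟩
  have ir : ∀ x y, EqvGen (T₂.closed b a) x y ↔
      EqvGen (Sum.LiftRel (T₁.closed c b) (T₂.closed b a)) (Sum.inr x) (Sum.inr y) := by
    refine eqvGen_embed Sum.inr Sum.inr_injective (fun _ _ h => Sum.LiftRel.inr h) ?_ ?_
    · rintro x z (h | h); exact ⟨_, rfl, h⟩
    · rintro x z (h | h); exact ⟨_, rfl, h⟩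
  have isep : ∀ x y, ¬ EqvGen (Sum.LiftRel (T₁.closed c b) (T₂.closed b a))
      (Sum.inl x) (Sum.inr y) := by
    intro x y h
    have := eqvGen_map (R' := (Eq : Bool → Bool → Prop)) Sum.isLeft (by
      rintro _ _ (h | h) <;> exact EqvGen.refl _) h
    have h2 : ∀ p q : Bool, EqvGen Eq p q → p = q := by
      intro p q h
      induction h with
      | rel x y h => exact h
      | refl x => rfl
      | symm x y _ ih => exact ih.symm
      | trans x y z _ _ h1 h2 => exact h1.trans h2
    exact absurd (h2 _ _ this) (by simp)
  have c0 : Surgery.cycles θ = Nat.card (T₁.Circles c b) + Nat.card (T₂.Circles b a) := by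
    rw [← Nat.card_sum]
    symm
    refine Nat.card_congr (Equiv.ofBijective (Sum.elim
      (Quotient.map' (s₁ := EqvGen.setoid (T₁.closed c b)) (s₂ := SameCycle.setoid θ) Sum.inl
        (fun x y h => (hrel _ _).mpr ((il x y).mp h)))
      (Quotient.map' (s₁ := EqvGen.setoid (T₂.closed b a)) (s₂ := SameCycle.setoid θ) Sum.inr
        (fun x y h => (hrel _ _).mpr ((ir x y).mp h)))) ⟨?_, ?_⟩)
    · rintro (q1 | q1) (q2 | q2) h <;>
      induction q1 using Quotient.inductionOn with | _ x => ?_ <;>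
      induction q2 using Quotient.inductionOn with | _ y => ?_
      · exact congrArg Sum.inl (Quotient.sound ((il x y).mpr ((hrel _ _).mp (Quotient.exact h))))
      · exact absurd ((hrel _ _).mp (Quotient.exact h)) (isep x y)
      · exact absurd ((hrel _ _).mp (Quotient.exact h.symm)) (isep y x)
      · exact congrArg Sum.inr (Quotient.sound ((ir x y).mpr ((hrel _ _).mp (Quotient.exact h))))
    · intro q
      induction q using Quotient.inductionOn with | _ x => ?_
      rcases x with x | x
      · exact ⟨Sum.inl (Quotient.mk _ x), rfl⟩
      · exact ⟨Sum.inr (Quotient.mk _ x), rfl⟩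
  rw [← c1, ← c0, ← hcard]

theorem Glue.contract_add_left (g : Glue T₁ T₂ T₁₂) (c b a) (f f' h) :
    g.contract c b a (f + f') h = g.contract c b a f h + g.contract c b a f' h := by
  simp only [contract, map_add]; ring

theorem Glue.contract_add_right (g : Glue T₁ T₂ T₁₂) (c b a) (f h h') :
    g.contract c b a f (h + h') = g.contract c b a f h + g.contract c b a f h' := by
  simp only [contract, map_add]; ring

theorem Glue.contract_zero_left (g : Glue T₁ T₂ T₁₂) (c b a) (h) : g.contract c b a 0 h = 0 := by
  simp [contract]

theorem Glue.contract_zero_right (g : Glue T₁ T₂ T₁₂) (c b a) (f) : g.contract c b a f 0 = 0 := by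
  simp [contract]

theorem Glue.contract_sum_left (g : Glue T₁ T₂ T₁₂) (c b a) {ι : Type} (s : Finset ι)
    (f : ι → _) (h) :
    g.contract c b a (∑ i ∈ s, f i) h = ∑ i ∈ s, g.contract c b a (f i) h := by
  simp only [contract, map_sum, Finset.sum_mul]

theorem Glue.contract_sum_right (g : Glue T₁ T₂ T₁₂) (c b a) {ι : Type} (s : Finset ι) (f)
    (h : ι → _) :
    g.contract c b a f (∑ i ∈ s, h i) = ∑ i ∈ s, g.contract c b a f (h i) := by
  simp only [contract, map_sum, Finset.sum_mul, Finset.mul_sum]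

/-- The map `F(T₁) × F(T₂) → F(T₁ T₂)` given by the contraction cobordisms. -/
def Glue.compose (g : Glue T₁ T₂ T₁₂) : T₁.Space →+ T₂.Space →+ T₁₂.Space :=
  AddMonoidHom.mk' (fun x => AddMonoidHom.mk'
    (fun y c a => ∑ b, g.contract c b a (x c b) (y b a)) fun y y' => by
      funext c a
      refine Eq.trans ?_ Finset.sum_add_distrib
      exact Finset.sum_congr rfl fun b _ => g.contract_add_right c b a _ _ _) fun x x' => by
    ext1 y
    funext c a
    refine Eq.trans ?_ Finset.sum_add_distrib
    exact Finset.sum_congr rfl fun b _ => g.contract_add_left c b a _ _ _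

theorem Glue.compose_apply (g : Glue T₁ T₂ T₁₂) (x : T₁.Space) (y : T₂.Space) (c a) :
    g.compose x y c a = ∑ b, g.contract c b a (x c b) (y b a) := rfl

theorem Glue.compose_mem_part (g : Glue T₁ T₂ T₁₂) {d e : ℤ} {x : T₁.Space} {y : T₂.Space}
    (hx : x ∈ T₁.part d) (hy : y ∈ T₂.part e) : g.compose x y ∈ T₁₂.part (d + e) := by
  intro c a S h
  rw [compose_apply, CircleAlg.sum_apply'] at h
  obtain ⟨b, -, h⟩ := Finset.exists_ne_zero_of_sum_ne_zero h
  have hx0 : x c b ≠ 0 := by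
    intro h0
    rw [h0, contract_zero_left] at h
    exact h rfl
  have hy0 : y b a ≠ 0 := by
    intro h0
    rw [h0, contract_zero_right] at h
    exact h rfl
  obtain ⟨S₁, h₁⟩ := Function.ne_iff.mp hx0
  obtain ⟨S₂, h₂⟩ := Function.ne_iff.mp hy0
  have d₁ := hx c b S₁ h₁
  have d₂ := hy b a S₂ h₂
  have k₁ : (x c b).Homog S₁.card := by
    intro S' h'
    have := hx c b S' h'
    simp only [degree] at this d₁
    omega
  have k₂ : (y b a).Homog S₂.card := by
    intro S' h'
    have := hy b a S' h'
    simp only [degree] at this d₂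
    omega
  obtain ⟨s, hs, hc⟩ := g.homog_saddleElement c b a
  have k := ((k₁.push (fun C => T₁₂.circle c a (g.π (Sum.inl (T₁.rep C))))).mul
    (k₂.push (fun C => T₁₂.circle c a (g.π (Sum.inr (T₂.rep C)))))).mul hs
  have hS : S.card = S₁.card + S₂.card + s := k S h
  have hb := two_mul_halfOnes b
  simp only [degree] at d₁ d₂ ⊢
  omega

end

theorem Glue.compose_assoc {T₁ : FlatTangle w u} {T₂ : FlatTangle v w} {T₃ : FlatTangle t v}
    {T₁₂ : FlatTangle v u} {T₂₃ : FlatTangle t w} {T : FlatTangle t u}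
    (g₁₂ : Glue T₁ T₂ T₁₂) (g₂₃ : Glue T₂ T₃ T₂₃)
    (g : Glue T₁₂ T₃ T) (g' : Glue T₁ T₂₃ T)
    (h₁ : ∀ x, EqvGen T.adj (g.π (Sum.inl (g₁₂.π (Sum.inl x)))) (g'.π (Sum.inl x)))
    (h₂ : ∀ x, EqvGen T.adj (g.π (Sum.inl (g₁₂.π (Sum.inr x))))
      (g'.π (Sum.inr (g₂₃.π (Sum.inl x)))))
    (h₃ : ∀ x, EqvGen T.adj (g.π (Sum.inr x)) (g'.π (Sum.inr (g₂₃.π (Sum.inr x)))))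
    (x : T₁.Space) (y : T₂.Space) (z : T₃.Space) :
    g.compose (g₁₂.compose x y) z = g'.compose x (g₂₃.compose y z) := by
  funext d a
  simp only [compose_apply, contract_sum_left, contract_sum_right]
  rw [Finset.sum_comm]
  refine Finset.sum_congr rfl fun c _ => Finset.sum_congr rfl fun b _ => ?_
  exact contract_assoc g₁₂ g₂₃ g g' h₁ h₂ h₃ d c b a _ _ _

section

variable {T₁ : FlatTangle w u} {T₂ : FlatTangle v w} {T₁₂ : FlatTangle v u}

theorem Glue.compose_smul_left (g : Glue T₁ T₂ T₁₂) (r : ArcRing u) (x : T₁.Space) (y : T₂.Space) :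
    g.compose (r • x) y = r • g.compose x y := by
  refine compose_assoc T₁.gluingLeft.toGlue g g T₁₂.gluingLeft.toGlue g.top ?_ ?_ r x y
  · exact fun x => EqvGen.refl _
  · exact fun x => EqvGen.refl _

theorem Glue.compose_smul_mid (g : Glue T₁ T₂ T₁₂) (r : ArcRing w) (x : T₁.Space) (y : T₂.Space) :
    g.compose (MulOpposite.op r • x) y = g.compose x (r • y) := by
  refine compose_assoc (T₂ := one w) T₁.gluingRight.toGlue T₂.gluingLeft.toGlue g g ?_ g.mid ?_ x r y
  · exact fun x => EqvGen.refl _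
  · exact fun x => EqvGen.refl _

theorem Glue.compose_smul_right (g : Glue T₁ T₂ T₁₂) (r : (ArcRing v)ᵐᵒᵖ) (x : T₁.Space)
    (y : T₂.Space) :
    g.compose x (r • y) = r • g.compose x y := by
  refine (compose_assoc (T₃ := one v) g T₂.gluingRight.toGlue T₁₂.gluingRight.toGlue g ?_ ?_ ?_
    x y r.unop).symm
  · exact fun x => EqvGen.refl _
  · exact fun x => EqvGen.refl _
  · exact fun x => (g.bot x).symm

end

end FlatTangle

end

noncomputable section

open Relation Equiv Equiv.Perm

namespace CircleAlg

theorem push_mono {C D : Type} [Finite C] [DecidableEq D] (φ : C → D) (S : Finset C)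
    (h : Set.InjOn φ S) : push φ (mono S) = mono (S.image φ) := by
  rw [← prod_X, ← prod_X, Finset.prod_image h]
  exact eval_prod_X _ _ _

end CircleAlg

variable {n k : ℕ}

namespace FlatTangle

variable {u v w t : Weight n k}

/-- The diagram `T a` is isotopic to a crossingless matching `b` together with closed circles: `f x` is a
top endpoint on the component of `x`, or `none` on a closed circle. -/
structure Cups (T : FlatTangle v w) (a : Matching v) where
  b : Matching w
  f : T.Pt → Option (Ones w)
  f_top : ∀ p, f (T.top p) = some p
  f_edge : ∀ x y, T.cupped a x y → f y = f x ∨ f y = (f x).map b.toFun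
  conn : ∀ x p, f x = some p → EqvGen (T.cupped a) x (T.top p)
  conn_b : ∀ p, EqvGen (T.cupped a) (T.top p) (T.top (b.toFun p))

namespace Glue

variable {T₁ : FlatTangle w u} {T₂ : FlatTangle v w} {T₁₂ : FlatTangle v u}

theorem saddleElement_cups (g : Glue T₁ T₂ T₁₂) (c : Matching u) {a : Matching v}
    (K : T₂.Cups a) : g.saddleElement c K.b a = 1 := by
  refine saddles_eq_one (fun D p hp hp' => ?_) _ _
  refine EqvGen.trans _ _ _ (EqvGen.rel _ _ (Or.inr (Or.inl ⟨p, hp, rfl, rfl⟩))) ?_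
  refine EqvGen.trans _ _ _ ?_ (EqvGen.symm _ _
    (EqvGen.rel _ _ (Or.inr (Or.inl ⟨_, hp', rfl, rfl⟩))))
  refine eqvGen_map Sum.inr (fun x y h => EqvGen.rel _ _ (Or.inl ?_)) (K.conn_b p)
  exact Sum.LiftRel.inr h

/-- The circle of `W(c) T₁ T₂ a` through a circle of `W(c) T₁ b`. -/
def left (g : Glue T₁ T₂ T₁₂) (c : Matching u) (b : Matching w) (a : Matching v)
    (C : T₁.Circles c b) : T₁₂.Circles c a := T₁₂.circle c a (g.π (Sum.inl (T₁.rep C)))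

/-- The circle of `W(c) T₁ T₂ a` through a circle of `W(b) T₂ a`. -/
def right (g : Glue T₁ T₂ T₁₂) (c : Matching u) (b : Matching w) (a : Matching v)
    (C : T₂.Circles b a) : T₁₂.Circles c a := T₁₂.circle c a (g.π (Sum.inr (T₂.rep C)))

/-- The circle of `W(c) T₁ b` or the closed circle of `T₂ a` through a point. -/
def split (T₁ : FlatTangle w u) {T₂ : FlatTangle v w} (c : Matching u) {a : Matching v}
    (K : T₂.Cups a) : T₁.Pt ⊕ T₂.Pt → T₁.Circles c K.b ⊕ T₂.Circles K.b a
  | Sum.inl x => Sum.inl (T₁.circle c K.b x)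
  | Sum.inr y => (K.f y).elim (Sum.inr (T₂.circle K.b a y))
      fun p => Sum.inl (T₁.circle c K.b (T₁.bot p))

theorem split_eq (g : Glue T₁ T₂ T₁₂) (c : Matching u) {a : Matching v} (K : T₂.Cups a)
    {x y : T₁.Pt ⊕ T₂.Pt} (h : T₁₂.circle c a (g.π x) = T₁₂.circle c a (g.π y)) :
    split T₁ c K x = split T₁ c K y := by
  rw [circle_eq, ← g.eqvGen_iff c K.b a] at h
  induction h with
  | refl x => rfl
  | symm x y _ ih => exact ih.symm
  | trans x y z _ _ h1 h2 => exact h1.trans h2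
  | rel x y h =>
    rcases h with (h | h) | ⟨p, -, rfl, rfl⟩ | ⟨p, hp, -⟩
    · exact congrArg Sum.inl (T₁.circle_eq.mpr (EqvGen.rel _ _ (Or.inl h)))
    · rename_i x y
      have hc : T₂.circle K.b a x = T₂.circle K.b a y :=
        T₂.circle_eq.mpr (EqvGen.rel _ _ (Or.inr h))
      have hb : ∀ p, T₁.circle c K.b (T₁.bot p) = T₁.circle c K.b (T₁.bot (K.b.toFun p)) :=
        fun p => T₁.circle_eq.mpr (EqvGen.rel _ _ (Or.inr (Or.inr ⟨p, rfl, rfl⟩)))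
      simp only [split]
      rcases K.f_edge x y h with e | e <;> rw [e] <;> cases K.f x
      · simp [hc]
      · simp
      · simp [hc]
      · simp [← hb]
    · simp [split, K.f_top]
    · exact absurd (Set.mem_univ p) hp

theorem split_inl (c : Matching u) {a : Matching v} (K : T₂.Cups a) (C : T₁.Circles c K.b) :
    split T₁ c K (Sum.inl (T₁.rep C)) = Sum.inl C :=
  congrArg Sum.inl (T₁.circle_rep C)

theorem split_inr (c : Matching u) {a : Matching v} (K : T₂.Cups a) (C : T₂.Circles K.b a)
    (h : K.f (T₂.rep C) = none) : split T₁ c K (Sum.inr (T₂.rep C)) = Sum.inr C := by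
  simp only [split, h, Option.elim_none, T₂.circle_rep]

theorem left_injective (g : Glue T₁ T₂ T₁₂) (c : Matching u) {a : Matching v} (K : T₂.Cups a) :
    Function.Injective (g.left c K.b a) := by
  intro C C' h
  have := g.split_eq c K h
  rw [split_inl, split_inl] at this
  exact Sum.inl_injective this

theorem right_injOn (g : Glue T₁ T₂ T₁₂) (c : Matching u) {a : Matching v} (K : T₂.Cups a) :
    Set.InjOn (g.right c K.b a) {C | K.f (T₂.rep C) = none} := by
  intro C hC C' hC' h
  have := g.split_eq c K h
  rw [split_inr c K C hC, split_inr c K C' hC'] at this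
  exact Sum.inr_injective this

theorem left_ne_right (g : Glue T₁ T₂ T₁₂) (c : Matching u) {a : Matching v} (K : T₂.Cups a)
    (C : T₁.Circles c K.b) (C' : T₂.Circles K.b a) (h : K.f (T₂.rep C') = none) :
    g.left c K.b a C ≠ g.right c K.b a C' := by
  intro e
  have := g.split_eq c K e
  rw [split_inl, split_inr c K C' h] at this
  cases this

theorem exists_left_or_right (g : Glue T₁ T₂ T₁₂) (c : Matching u) {a : Matching v}
    (K : T₂.Cups a) (C : T₁₂.Circles c a) :
    (∃ C₁, g.left c K.b a C₁ = C) ∨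
      ∃ C₂, K.f (T₂.rep C₂) = none ∧ g.right c K.b a C₂ = C := by
  have hl : ∀ x : T₁.Pt, g.left c K.b a (T₁.circle c K.b x) = T₁₂.circle c a (g.π (Sum.inl x)) := by
    intro x
    refine T₁₂.circle_eq.mpr ((g.eqvGen_iff c K.b a _ _).mp ?_)
    refine eqvGen_of_le ?_ (eqvGen_map (R' := stage (Sum.LiftRel (T₁.capped c) (T₂.cupped a))
      (fun p => Sum.inl (T₁.bot p)) (fun p => Sum.inr (T₂.top p)) K.b.toFun Set.univ) Sum.inl ?_
      (T₁.rep_circle c K.b x))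
    · exact fun _ _ h => EqvGen.rel _ _ h
    have hcup : ∀ p, EqvGen (stage (Sum.LiftRel (T₁.capped c) (T₂.cupped a))
        (fun p => Sum.inl (T₁.bot p)) (fun p => Sum.inr (T₂.top p)) K.b.toFun Set.univ)
        (Sum.inl (T₁.bot p)) (Sum.inl (T₁.bot (K.b.toFun p))) := by
      intro p
      refine EqvGen.trans _ _ _ (EqvGen.rel _ _ (Or.inr (Or.inl ⟨p, by simp, rfl, rfl⟩))) ?_
      refine EqvGen.trans _ _ _ ?_ (EqvGen.symm _ _
        (EqvGen.rel _ _ (Or.inr (Or.inl ⟨_, by simp, rfl, rfl⟩))))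
      refine eqvGen_map Sum.inr (fun x y h => EqvGen.rel _ _ (Or.inl ?_)) (K.conn_b p)
      exact Sum.LiftRel.inr h
    rintro x y (h | (h | ⟨p, rfl, rfl⟩))
    · exact EqvGen.rel _ _ (Or.inl (Sum.LiftRel.inl h))
    · exact EqvGen.rel _ _ (Or.inl (Sum.LiftRel.inl (Or.inl h)))
    · exact hcup p
  obtain ⟨x, hx⟩ := g.surj (T₁₂.rep C)
  have hx' : T₁₂.circle c a (g.π x) = C := by
    rw [T₁₂.circle_eq_of_adj hx, T₁₂.circle_rep]
  rcases x with x | y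
  · exact Or.inl ⟨_, (hl x).trans hx'⟩
  · cases hf : K.f y with
    | some p =>
      refine Or.inl ⟨T₁.circle c K.b (T₁.bot p), (hl _).trans (Eq.trans ?_ hx')⟩
      refine T₁₂.circle_eq.mpr ((g.eqvGen_iff c K.b a _ _).mp ?_)
      refine EqvGen.trans _ _ _ (EqvGen.rel _ _ (Or.inr (Or.inl ⟨p, by simp, rfl, rfl⟩)))
        (EqvGen.symm _ _ ?_)
      refine eqvGen_map Sum.inr (fun x y h => EqvGen.rel _ _ (Or.inl ?_)) (K.conn y p hf)
      exact Sum.LiftRel.inr h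
    | none =>
      -- the component of `y` in `T₂ a` is closed
      have key : ∀ x y, EqvGen (T₂.closed K.b a) x y → (K.f x = none ↔ K.f y = none) ∧
          (K.f x = none → EqvGen (T₂.cupped a) x y) := by
        intro x y h
        induction h with
        | refl x => exact ⟨Iff.rfl, fun _ => EqvGen.refl _⟩
        | symm x y _ ih => exact ⟨ih.1.symm, fun h => (ih.2 (ih.1.mpr h)).symm⟩
        | trans x y z _ _ h1 h2 =>
          exact ⟨h1.1.trans h2.1, fun h => (h1.2 h).trans _ _ _ (h2.2 (h1.1.mp h))⟩
        | rel x y h =>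
          have hcup : T₂.cupped a x y → (K.f x = none ↔ K.f y = none) ∧
              (K.f x = none → EqvGen (T₂.cupped a) x y) := by
            intro h
            refine ⟨?_, fun _ => EqvGen.rel _ _ h⟩
            rcases K.f_edge x y h with e | e <;> rw [e]
            simp
          rcases h with (h | ⟨p, rfl, rfl⟩) | h
          · exact hcup (Or.inl h)
          · simp [K.f_top]
          · exact hcup h
      have hk := key _ _ (T₂.rep_circle K.b a y).symm
      refine Or.inr ⟨T₂.circle K.b a y, hk.1.mp hf, Eq.trans ?_ hx'⟩
      refine T₁₂.circle_eq.mpr ((g.eqvGen_iff c K.b a _ _).mp (EqvGen.symm _ _ ?_))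
      refine eqvGen_map Sum.inr (fun x y h => EqvGen.rel _ _ (Or.inl ?_)) (hk.2 hf)
      exact Sum.LiftRel.inr h

open scoped Classical in
theorem contract_mono (g : Glue T₁ T₂ T₁₂) (c : Matching u) {a : Matching v} (K : T₂.Cups a)
    (S₁ : Finset (T₁.Circles c K.b)) (S₂ : Finset (T₂.Circles K.b a))
    (h₂ : ∀ C ∈ S₂, K.f (T₂.rep C) = none) :
    g.contract c K.b a (CircleAlg.mono S₁) (CircleAlg.mono S₂) =
      CircleAlg.mono (S₁.image (g.left c K.b a) ∪ S₂.image (g.right c K.b a)) := by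
  unfold contract
  rw [saddleElement_cups, mul_one]
  refine (congrArg₂ (· * ·) (CircleAlg.push_mono (g.left c K.b a) S₁
    (g.left_injective c K).injOn) (CircleAlg.push_mono (g.right c K.b a) S₂
    ((g.right_injOn c K).mono h₂))).trans ?_
  rw [CircleAlg.mono_mul_mono, if_pos]
  rw [Finset.disjoint_left]
  intro C h h'
  obtain ⟨C₁, -, rfl⟩ := Finset.mem_image.mp h
  obtain ⟨C₂, hC₂, e⟩ := Finset.mem_image.mp h'
  exact g.left_ne_right c K C₁ C₂ (h₂ _ hC₂) e.symm

end Glue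

open scoped Classical in
/-- The element of `F(T)` with one component `f`. -/
def single (T : FlatTangle v w) (b : Matching w) (a : Matching v) :
    CircleAlg (T.Circles b a) →+ T.Space :=
  AddMonoidHom.mk' (fun f => Pi.single b (Pi.single a f)) fun f g => by
    rw [Pi.single_add, Pi.single_add]; rfl

theorem single_same (T : FlatTangle v w) (b : Matching w) (a : Matching v) (f) :
    T.single b a f b a = f := by
  classical
  change Pi.single (M := fun b => (a : Matching v) → CircleAlg (T.Circles b a)) b
    (Pi.single a f) b a = f
  rw [Pi.single_eq_same, Pi.single_eq_same]

theorem single_of_ne (T : FlatTangle v w) {b b' : Matching w} {a a' : Matching v} (f)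
    (h : b' ≠ b ∨ a' ≠ a) : T.single b a f b' a' = 0 := by
  classical
  change Pi.single (M := fun b => (a : Matching v) → CircleAlg (T.Circles b a)) b
    (Pi.single a f) b' a' = 0
  by_cases hb : b' = b
  · subst hb
    rw [Pi.single_eq_same, Pi.single_eq_of_ne (h.resolve_left fun h => h rfl)]
  · rw [Pi.single_eq_of_ne hb]; rfl

/-- The indices of the basis elements of `F(T)`. -/
abbrev Index (T : FlatTangle v w) : Type :=
  Σ (b : Matching w) (a : Matching v), Finset (T.Circles b a)

instance (T : FlatTangle v w) : Fintype T.Index := Fintype.ofFinite _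

/-- The basis elements of `F(T)`. -/
def basisElt (T : FlatTangle v w) (i : T.Index) : T.Space :=
  T.single i.1 i.2.1 (CircleAlg.mono i.2.2)

open scoped Classical in
theorem basisElt_apply (T : FlatTangle v w) (i : T.Index) (b a S) :
    T.basisElt i b a S = if i = ⟨b, a, S⟩ then 1 else 0 := by
  obtain ⟨b', a', S'⟩ := i
  unfold basisElt
  by_cases h : b = b' ∧ a = a'
  · obtain ⟨rfl, rfl⟩ := h
    rw [single_same, CircleAlg.mono_apply]
    by_cases hS : S = S'
    · subst hS; simp
    · rw [if_neg hS, if_neg]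
      rintro h; cases h; exact hS rfl
  · rw [single_of_ne, if_neg]
    · rfl
    · rintro h'; cases h'; exact h ⟨rfl, rfl⟩
    · dsimp only; tauto

theorem sum_basisElt (T : FlatTangle v w) (x : T.Space) :
    ∑ i : T.Index, x i.1 i.2.1 i.2.2 • T.basisElt i = x := by
  classical
  funext b a S
  let ev : T.Space →+ ℤ := AddMonoidHom.mk' (fun x => x b a S) fun _ _ => rfl
  refine (map_sum ev _ _).trans ?_
  have : ∀ i : T.Index, ev (x i.1 i.2.1 i.2.2 • T.basisElt i) =
      if i = ⟨b, a, S⟩ then x i.1 i.2.1 i.2.2 else 0 := by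
    intro i
    rw [map_zsmul]
    change _ • T.basisElt i b a S = _
    rw [basisElt_apply]
    split_ifs <;> simp
  rw [Finset.sum_congr rfl fun i _ => this i, Finset.sum_ite_eq']
  simp

/-- A property that is preserved by sums and multiples and holds for basis elements holds for all
elements. -/
theorem mem_of_basisElt (T : FlatTangle v w) (A : AddSubgroup T.Space)
    (h : ∀ i, T.basisElt i ∈ A) (x : T.Space) : x ∈ A := by
  rw [← T.sum_basisElt x]
  exact sum_mem fun i _ => zsmul_mem (h i) _

namespace Glue

variable {T₁ : FlatTangle w u} {T₂ : FlatTangle v w} {T₁₂ : FlatTangle v u}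

theorem compose_single (g : Glue T₁ T₂ T₁₂) (c : Matching u) (b : Matching w) (a : Matching v)
    (f h) : g.compose (T₁.single c b f) (T₂.single b a h) =
      T₁₂.single c a (g.contract c b a f h) := by
  funext c' a'
  rw [compose_apply]
  by_cases hc : c' = c ∧ a' = a
  · obtain ⟨rfl, rfl⟩ := hc
    rw [single_same, Finset.sum_eq_single b]
    · rw [single_same, single_same]
    · intro b' _ hb
      rw [single_of_ne _ _ (Or.inr hb), contract_zero_left]
    · intro h; exact absurd (Finset.mem_univ b) h
  · rw [single_of_ne _ _ (by tauto)]
    refine Finset.sum_eq_zero fun b' _ => ?_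
    by_cases hc' : c' = c
    · rw [T₂.single_of_ne _ (Or.inr fun e => hc ⟨hc', e⟩), contract_zero_right]
    · rw [T₁.single_of_ne _ (Or.inl hc'), contract_zero_left]

theorem compose_single_of_ne (g : Glue T₁ T₂ T₁₂) (c : Matching u) {b b' : Matching w}
    (a : Matching v) (f h) (hb : b ≠ b') :
    g.compose (T₁.single c b f) (T₂.single b' a h) = 0 := by
  funext c' a'
  rw [compose_apply]
  refine Finset.sum_eq_zero fun b'' _ => ?_
  by_cases h' : b'' = b
  · rw [T₂.single_of_ne _ (Or.inl fun e => hb (h'.symm.trans e)), contract_zero_right]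
  · rw [T₁.single_of_ne _ (Or.inr h'), contract_zero_left]

end Glue

end FlatTangle

end

noncomputable section

open Relation Equiv Equiv.Perm

namespace BalancedTensor

variable {R S B M N : Type} [Ring R] [Ring S] [AddCommGroup B] [Module R B] [Module Sᵐᵒᵖ B]
  [SMulCommClass R Sᵐᵒᵖ B] [AddCommGroup M] [Module S M] [AddCommGroup N]

/-- The homomorphism out of `B ⊗_S M` induced by a balanced map. -/
def lift (Ψ : B →+ M →+ N) (h : ∀ (s : S) b m, Ψ (MulOpposite.op s • b) m = Ψ b (s • m)) :
    BalancedTensor R S B M →+ N := (exists_lift Ψ h).choose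

@[simp] theorem lift_mk (Ψ : B →+ M →+ N)
    (h : ∀ (s : S) b m, Ψ (MulOpposite.op s • b) m = Ψ b (s • m)) (b : B) (m : M) :
    lift (R := R) Ψ h (mk R S b m) = Ψ b m := (exists_lift Ψ h).choose_spec b m

theorem hom_ext {f f' : BalancedTensor R S B M →+ N} (h : ∀ b m, f (mk R S b m) = f' (mk R S b m)) :
    f = f' := by
  ext x
  induction x using induction with
  | h0 => simp
  | hmk b m => exact h b m
  | hadd x y hx hy => rw [map_add, map_add, hx, hy]

theorem mk_zero_right (b : B) : mk R S b (0 : M) = 0 := map_zero (mkHom R S b)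

theorem mk_zero_left (m : M) : mk R S (0 : B) m = 0 :=
  DFunLike.congr_fun (map_zero (mkHom (B := B) (M := M) R S)) m

end BalancedTensor

variable {n k : ℕ}

namespace FlatTangle

variable {u v w t : Weight n k}

/-- The idempotent of a matching. -/
def idem (b : Matching w) : ArcRing w := (one w).single b b 1

theorem idem_smul (T : FlatTangle v w) (b : Matching w) (a : Matching v) (f) :
    idem b • T.single b a f = T.single b a f := by
  have := T.gluingLeft.toGlue.compose_single b b a 1 f
  refine this.trans (congrArg _ ?_)
  exact contract_one_left T b a f

theorem op_idem_smul_of_ne (T : FlatTangle v w) (b : Matching w) {a a' : Matching v} (f)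
    (h : a ≠ a') : MulOpposite.op (idem a') • T.single b a f = 0 :=
  T.gluingRight.toGlue.compose_single_of_ne (T₂ := one v) b a' f 1 h

namespace Glue

variable {T₁ : FlatTangle w u} {T₂ : FlatTangle v w} {T₁₂ : FlatTangle v u}

/-- The map `F(T₁) ⊗ F(T₂) → F(T₁ T₂)`. -/
def tensorMap (g : Glue T₁ T₂ T₁₂) :
    BalancedTensor (ArcRing u) (ArcRing w) T₁.Space T₂.Space →+ T₁₂.Space :=
  BalancedTensor.lift g.compose g.compose_smul_mid

open scoped Classical in
/-- The preimage of a basis element under `F(T₁) ⊗ F(T₂) → F(T₁ T₂)`. -/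
def preimage (g : Glue T₁ T₂ T₁₂) (K : ∀ a, T₂.Cups a) (i : T₁₂.Index) :
    BalancedTensor (ArcRing u) (ArcRing w) T₁.Space T₂.Space :=
  letI := Fintype.ofFinite (T₁.Circles i.1 (K i.2.1).b)
  letI := Fintype.ofFinite (T₂.Circles (K i.2.1).b i.2.1)
  BalancedTensor.mk _ _
    (T₁.basisElt ⟨i.1, (K i.2.1).b, Finset.univ.filter fun C => g.left i.1 (K i.2.1).b i.2.1 C ∈ i.2.2⟩)
    (T₂.basisElt ⟨(K i.2.1).b, i.2.1, Finset.univ.filter fun C => (K i.2.1).f (T₂.rep C) = none ∧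
      g.right i.1 (K i.2.1).b i.2.1 C ∈ i.2.2⟩)

open scoped Classical in
theorem compose_filter (g : Glue T₁ T₂ T₁₂) {a : Matching v} (K : T₂.Cups a) (c : Matching u)
    (S : Finset (T₁₂.Circles c a)) :
    letI := Fintype.ofFinite (T₁.Circles c K.b)
    letI := Fintype.ofFinite (T₂.Circles K.b a)
    g.compose (T₁.basisElt ⟨c, K.b, Finset.univ.filter fun C => g.left c K.b a C ∈ S⟩)
      (T₂.basisElt ⟨K.b, a, Finset.univ.filter fun C => K.f (T₂.rep C) = none ∧
        g.right c K.b a C ∈ S⟩) = T₁₂.basisElt ⟨c, a, S⟩ := by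
  letI := Fintype.ofFinite (T₁.Circles c K.b)
  letI := Fintype.ofFinite (T₂.Circles K.b a)
  refine (g.compose_single c K.b a _ _).trans (congrArg _ ?_)
  rw [g.contract_mono c K _ _ fun C hC => (Finset.mem_filter.mp hC).2.1]
  congr 1
  ext C
  simp only [Finset.mem_union, Finset.mem_image, Finset.mem_filter, Finset.mem_univ, true_and]
  constructor
  · rintro (⟨C, h, rfl⟩ | ⟨C, h, rfl⟩)
    · exact h
    · exact h.2
  · intro h
    rcases g.exists_left_or_right c K C with ⟨C, rfl⟩ | ⟨C, h', rfl⟩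
    · exact Or.inl ⟨C, h, rfl⟩
    · exact Or.inr ⟨C, ⟨h', h⟩, rfl⟩

theorem tensorMap_preimage (g : Glue T₁ T₂ T₁₂) (K : ∀ a, T₂.Cups a) (i : T₁₂.Index) :
    g.tensorMap (g.preimage K i) = T₁₂.basisElt i :=
  (BalancedTensor.lift_mk _ _ _ _).trans (g.compose_filter (K i.2.1) i.1 i.2.2)

theorem preimage_eq (g : Glue T₁ T₂ T₁₂) (K : ∀ a, T₂.Cups a) (c : Matching u) (a : Matching v)
    (S₁ : Finset (T₁.Circles c (K a).b)) (S₂ : Finset (T₂.Circles (K a).b a))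
    (h₂ : ∀ C ∈ S₂, (K a).f (T₂.rep C) = none) :
    BalancedTensor.mk _ _ (T₁.basisElt ⟨c, (K a).b, S₁⟩) (T₂.basisElt ⟨(K a).b, a, S₂⟩) ∈
      Set.range (g.preimage K) := by
  classical
  refine ⟨⟨c, a, S₁.image (g.left c (K a).b a) ∪ S₂.image (g.right c (K a).b a)⟩, ?_⟩
  letI := Fintype.ofFinite (T₁.Circles c (K a).b)
  letI := Fintype.ofFinite (T₂.Circles (K a).b a)
  unfold preimage
  dsimp only
  congr 3
  · congr 1
    ext C
    simp only [Finset.mem_union, Finset.mem_image, Finset.mem_filter, Finset.mem_univ, true_and]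
    constructor
    · rintro (⟨C', h, e⟩ | ⟨C', h, e⟩)
      · rwa [← g.left_injective c (K a) e]
      · exact absurd e.symm (g.left_ne_right c (K a) _ _ (h₂ _ h))
    · exact fun h => Or.inl ⟨C, h, rfl⟩
  · congr 1
    ext C
    simp only [Finset.mem_union, Finset.mem_image, Finset.mem_filter, Finset.mem_univ, true_and]
    constructor
    · rintro ⟨h', ⟨C', h, e⟩ | ⟨C', h, e⟩⟩
      · exact absurd e (g.left_ne_right c (K a) _ _ h')
      · rwa [← g.right_injOn c (K a) (h₂ _ h) h' e]
    · exact fun h => ⟨h₂ _ h, Or.inr ⟨C, h, rfl⟩⟩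

theorem mem_closure_preimage (g : Glue T₁ T₂ T₁₂) (K : ∀ a, T₂.Cups a)
    (t : BalancedTensor (ArcRing u) (ArcRing w) T₁.Space T₂.Space) :
    t ∈ AddSubgroup.closure (Set.range (g.preimage K)) := by
  classical
  set A := AddSubgroup.closure (Set.range (g.preimage K)) with hA
  have step : ∀ a S₂, (∀ C ∈ S₂, (K a).f (T₂.rep C) = none) → ∀ x : T₁.Space,
      BalancedTensor.mk _ _ x (T₂.basisElt ⟨(K a).b, a, S₂⟩) ∈ A := by
    intro a S₂ h₂ x
    refine T₁.mem_of_basisElt (A.comap ((BalancedTensor.mkHom (ArcRing u) (ArcRing w)).flip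
      (T₂.basisElt ⟨(K a).b, a, S₂⟩))) ?_ x
    rintro ⟨c, b, S₁⟩
    change BalancedTensor.mk _ _ _ _ ∈ A
    by_cases hb : b = (K a).b
    · subst hb
      exact AddSubgroup.subset_closure (g.preimage_eq K c a S₁ S₂ h₂)
    · have h1 : BalancedTensor.mk (ArcRing u) (ArcRing w) (T₁.basisElt ⟨c, b, S₁⟩)
          (T₂.basisElt ⟨(K a).b, a, S₂⟩) = 0 := by
        rw [show T₂.basisElt ⟨(K a).b, a, S₂⟩ = idem (K a).b • T₂.basisElt ⟨(K a).b, a, S₂⟩ from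
          (idem_smul ..).symm, ← BalancedTensor.mk_balanced, basisElt,
          op_idem_smul_of_ne _ _ _ hb, BalancedTensor.mk_zero_left]
      rw [h1]
      exact zero_mem A
  have step' : ∀ a S₂, (∀ C ∈ S₂, (K a).f (T₂.rep C) = none) → ∀ (x : T₁.Space) (r : ArcRing w),
      BalancedTensor.mk _ _ x (r • T₂.basisElt ⟨(K a).b, a, S₂⟩) ∈ A := by
    intro a S₂ h₂ x r
    rw [← BalancedTensor.mk_balanced]
    exact step a S₂ h₂ _
  induction t using BalancedTensor.induction with
  | h0 => exact zero_mem A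
  | hadd x y hx hy => exact add_mem hx hy
  | hmk x y =>
    refine T₂.mem_of_basisElt (A.comap (BalancedTensor.mkHom (ArcRing u) (ArcRing w) x)) ?_ y
    rintro ⟨b, a, U⟩
    change BalancedTensor.mk _ _ _ _ ∈ A
    rw [← T₂.gluingLeft.toGlue.compose_filter (K a) b U]
    exact step' a _ (fun C hC => (Finset.mem_filter.mp hC).2.1) _ _

theorem tensorMap_bijective (g : Glue T₁ T₂ T₁₂) (K : ∀ a, T₂.Cups a) :
    Function.Bijective g.tensorMap := by
  classical
  let Θ : T₁₂.Space →+ BalancedTensor (ArcRing u) (ArcRing w) T₁.Space T₂.Space :=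
    AddMonoidHom.mk' (fun z => ∑ i : T₁₂.Index, z i.1 i.2.1 i.2.2 • g.preimage K i) fun z z' => by
      rw [← Finset.sum_add_distrib]
      exact Finset.sum_congr rfl fun i _ => add_smul _ _ _
  have hΘ : ∀ z, Θ z = ∑ i : T₁₂.Index, z i.1 i.2.1 i.2.2 • g.preimage K i := fun _ => rfl
  have h1 : ∀ z, g.tensorMap (Θ z) = z := by
    intro z
    rw [hΘ, map_sum]
    simp only [map_zsmul, tensorMap_preimage]
    exact T₁₂.sum_basisElt z
  have h2 : Function.Surjective Θ := by
    intro t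
    have hle : AddSubgroup.closure (Set.range (g.preimage K)) ≤ Θ.range := by
      rw [AddSubgroup.closure_le]
      rintro _ ⟨i, rfl⟩
      refine ⟨T₁₂.basisElt i, ?_⟩
      rw [hΘ, Finset.sum_eq_single i]
      · rw [basisElt_apply, if_pos rfl, one_smul]
      · intro j _ hj
        rw [basisElt_apply, if_neg fun h => hj h.symm, zero_smul]
      · intro h; exact absurd (Finset.mem_univ i) h
    exact hle (g.mem_closure_preimage K t)
  refine ⟨fun x y h => ?_, fun z => ⟨_, h1 z⟩⟩
  obtain ⟨z, rfl⟩ := h2 x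
  obtain ⟨z', rfl⟩ := h2 y
  rw [h1, h1] at h
  rw [h]

end Glue

end FlatTangle

end

noncomputable section

open Relation Equiv Equiv.Perm

namespace GrMod

variable {R : Type} [Ring R] {𝒜 : ℤ → AddSubgroup R}

/-- A linear equivalence that preserves the grading is an isomorphism of graded modules. -/
def isoMk {M N : GrMod 𝒜} (e : M.carrier ≃ₗ[R] N.carrier) (h : ∀ d, ∀ x ∈ M.gr d, e x ∈ N.gr d) :
    M ≅ N where
  hom := ⟨e, h⟩
  inv := ⟨e.symm, by
    obtain ⟨pr, h1, h2, h3, h4⟩ := exists_proj M.internal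
    obtain ⟨pr', -, h2', h3', -⟩ := exists_proj N.internal
    have key : ∀ d x, pr' d (e x) = e (pr d x) := by
      intro d x
      obtain ⟨s, hs⟩ := h4 x
      conv_lhs => rw [← hs (insert d s) (Finset.subset_insert d s), map_sum, map_sum]
      rw [Finset.sum_eq_single d]
      · exact h2' d _ (h d _ (h1 d x))
      · exact fun d' _ hd => h3' d d' hd.symm _ (h d' _ (h1 d' x))
      · exact fun hd => absurd (Finset.mem_insert_self d s) hd
    intro d y hy
    have := key d (e.symm y)
    rw [e.apply_symm_apply, h2' d y hy] at this
    rw [this]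
    change e.symm (e _) ∈ _
    rw [e.symm_apply_apply]
    exact h1 d _⟩
  hom_inv_id := hom_ext (LinearMap.ext fun x => e.symm_apply_apply x)
  inv_hom_id := hom_ext (LinearMap.ext fun x => e.apply_symm_apply x)

end GrMod

variable {n k : ℕ}

namespace FlatTangle

variable {u v w t : Weight n k}

namespace Glue

variable {T₁ : FlatTangle w u} {T₂ : FlatTangle v w} {T₁₂ : FlatTangle v u}

theorem tensorMap_mk (g : Glue T₁ T₂ T₁₂) (x : T₁.Space) (y : T₂.Space) :
    g.tensorMap (BalancedTensor.mk _ _ x y) = g.compose x y := BalancedTensor.lift_mk _ _ _ _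

section

variable (M : Type) [AddCommGroup M] [Module (ArcRing v) M]

/-- The map `F(T₂) ⊗ M → F(T₁ T₂) ⊗ M` given by an element of `F(T₁)`. -/
def leftHom (g : Glue T₁ T₂ T₁₂) (x : T₁.Space) :
    BalancedTensor (ArcRing w) (ArcRing v) T₂.Space M →+
    BalancedTensor (ArcRing u) (ArcRing v) T₁₂.Space M :=
  BalancedTensor.lift ((BalancedTensor.mkHom (ArcRing u) (ArcRing v)).comp (g.compose x))
    fun s y m => by
      change BalancedTensor.mk _ _ (g.compose x (MulOpposite.op s • y)) m = _
      rw [g.compose_smul_right, BalancedTensor.mk_balanced]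
      rfl

variable {M} in
theorem leftHom_mk (g : Glue T₁ T₂ T₁₂) (x : T₁.Space) (y : T₂.Space) (m : M) :
    g.leftHom M x (BalancedTensor.mk _ _ y m) = BalancedTensor.mk _ _ (g.compose x y) m :=
  BalancedTensor.lift_mk _ _ _ _

/-- The map `F(T₁) ⊗ (F(T₂) ⊗ M) → F(T₁ T₂) ⊗ M`. -/
def assocHom (g : Glue T₁ T₂ T₁₂) :
    BalancedTensor (ArcRing u) (ArcRing w) T₁.Space
      (BalancedTensor (ArcRing w) (ArcRing v) T₂.Space M) →+
    BalancedTensor (ArcRing u) (ArcRing v) T₁₂.Space M :=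
  BalancedTensor.lift (AddMonoidHom.mk' (g.leftHom M) fun x x' =>
      BalancedTensor.hom_ext fun y m => by
        rw [AddMonoidHom.add_apply, leftHom_mk, leftHom_mk, leftHom_mk, map_add,
          AddMonoidHom.add_apply, BalancedTensor.mk_add_left])
    fun s x z => by
      refine DFunLike.congr_fun (f := g.leftHom M (MulOpposite.op s • x))
        (g := (g.leftHom M x).comp (DistribSMul.toAddMonoidHom _ s))
        (BalancedTensor.hom_ext fun y m => ?_) z
      rw [AddMonoidHom.comp_apply, DistribSMul.toAddMonoidHom_apply, BalancedTensor.smul_mk,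
        leftHom_mk, leftHom_mk, g.compose_smul_mid]

variable {M}

theorem assocHom_mk (g : Glue T₁ T₂ T₁₂) (x : T₁.Space) (y : T₂.Space) (m : M) :
    g.assocHom M (BalancedTensor.mk _ _ x (BalancedTensor.mk _ _ y m)) =
      BalancedTensor.mk _ _ (g.compose x y) m :=
  (BalancedTensor.lift_mk _ _ _ _).trans (g.leftHom_mk x y m)

theorem induction₂ {p : BalancedTensor (ArcRing u) (ArcRing w) T₁.Space
      (BalancedTensor (ArcRing w) (ArcRing v) T₂.Space M) → Prop} (h0 : p 0)
    (hmk : ∀ x y m, p (BalancedTensor.mk _ _ x (BalancedTensor.mk _ _ y m)))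
    (hadd : ∀ s t, p s → p t → p (s + t)) (t) : p t := by
  induction t using BalancedTensor.induction with
  | h0 => exact h0
  | hadd s t hs ht => exact hadd s t hs ht
  | hmk x z =>
    induction z using BalancedTensor.induction with
    | h0 => rw [BalancedTensor.mk_zero_right]; exact h0
    | hadd s t hs ht => rw [BalancedTensor.mk_add_right]; exact hadd _ _ hs ht
    | hmk y m => exact hmk x y m

/-- The map `F(T₁) ⊗ F(T₂) → F(T₁) ⊗ (F(T₂) ⊗ M)` given by an element of `M`. -/
def insertHom (m : M) : BalancedTensor (ArcRing u) (ArcRing w) T₁.Space T₂.Space →+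
    BalancedTensor (ArcRing u) (ArcRing w) T₁.Space
      (BalancedTensor (ArcRing w) (ArcRing v) T₂.Space M) :=
  BalancedTensor.lift (AddMonoidHom.mk' (fun x => (BalancedTensor.mkHom _ _ x).comp
      ((BalancedTensor.mkHom _ _).flip m)) fun x x' => by
        rw [map_add, AddMonoidHom.add_comp]) fun r x y => BalancedTensor.mk_balanced _ _ r x (BalancedTensor.mk _ _ y m)

theorem insertHom_mk (m : M) (x : T₁.Space) (y : T₂.Space) :
    insertHom m (BalancedTensor.mk (ArcRing u) (ArcRing w) x y) =
      BalancedTensor.mk _ _ x (BalancedTensor.mk _ _ y m) := BalancedTensor.lift_mk _ _ _ _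

theorem insertHom_add (m m' : M) : insertHom (T₁ := T₁) (T₂ := T₂) (m + m') =
    insertHom m + insertHom m' := by
  refine BalancedTensor.hom_ext fun x y => ?_
  rw [AddMonoidHom.add_apply, insertHom_mk, insertHom_mk, insertHom_mk,
    BalancedTensor.mk_add_right, BalancedTensor.mk_add_right]

theorem assocHom_bijective (g : Glue T₁ T₂ T₁₂) (K : ∀ a, T₂.Cups a) :
    Function.Bijective (g.assocHom M) := by
  let e := AddEquiv.ofBijective g.tensorMap (g.tensorMap_bijective K)
  have he : ∀ x y, e.symm (g.compose x y) = BalancedTensor.mk _ _ x y := by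
    intro x y
    rw [AddEquiv.symm_apply_eq]
    exact (g.tensorMap_mk x y).symm
  have hbal : ∀ (q : ArcRing v) z (m : M),
      insertHom m (e.symm (MulOpposite.op q • z)) = insertHom (q • m) (e.symm z) := by
    intro q z m
    obtain ⟨z, rfl⟩ := e.surjective z
    rw [e.symm_apply_apply]
    induction z using BalancedTensor.induction with
    | h0 => rw [map_zero, smul_zero, map_zero, map_zero, map_zero]
    | hadd s t hs ht => rw [map_add, smul_add, map_add, map_add, hs, ht, map_add]
    | hmk x y =>
      rw [insertHom_mk, show e (BalancedTensor.mk _ _ x y) = g.compose x y from g.tensorMap_mk x y,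
        ← g.compose_smul_right, he, insertHom_mk, BalancedTensor.mk_balanced]
  let θ : BalancedTensor (ArcRing u) (ArcRing v) T₁₂.Space M →+
      BalancedTensor (ArcRing u) (ArcRing w) T₁.Space
        (BalancedTensor (ArcRing w) (ArcRing v) T₂.Space M) :=
    BalancedTensor.lift (AddMonoidHom.mk' (fun z => AddMonoidHom.mk'
      (fun m => insertHom m (e.symm z)) fun m m' => by rw [insertHom_add]; rfl) fun z z' => by
        ext m
        change insertHom m (e.symm (z + z')) = insertHom m (e.symm z) + insertHom m (e.symm z')
        rw [map_add, map_add]) hbal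
  have hθ : ∀ z m, θ (BalancedTensor.mk _ _ z m) = insertHom m (e.symm z) :=
    fun _ _ => BalancedTensor.lift_mk _ _ _ _
  refine Function.bijective_iff_has_inverse.mpr ⟨θ, fun t => ?_, fun t => ?_⟩
  · induction t using induction₂ with
    | h0 => rw [map_zero, map_zero]
    | hadd s t hs ht => rw [map_add, map_add, hs, ht]
    | hmk x y m => rw [assocHom_mk, hθ, he, insertHom_mk]
  · induction t using BalancedTensor.induction with
    | h0 => rw [map_zero, map_zero]
    | hadd s t hs ht => rw [map_add, map_add, hs, ht]
    | hmk z m =>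
      rw [hθ]
      obtain ⟨z, rfl⟩ := e.surjective z
      rw [e.symm_apply_apply]
      induction z using BalancedTensor.induction with
      | h0 => rw [map_zero, map_zero, map_zero, BalancedTensor.mk_zero_left]
      | hadd s t hs ht => rw [map_add, map_add, hs, ht, map_add, BalancedTensor.mk_add_left]
      | hmk x y =>
        rw [insertHom_mk, assocHom_mk]
        exact congrArg (fun z => BalancedTensor.mk _ _ z m) (g.tensorMap_mk x y).symm

theorem assocHom_smul (g : Glue T₁ T₂ T₁₂) (r : ArcRing u) (t) :
    g.assocHom M (r • t) = r • g.assocHom M t := by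
  induction t using induction₂ with
  | h0 => rw [smul_zero, map_zero, smul_zero]
  | hadd s t hs ht => rw [smul_add, map_add, map_add, hs, ht, smul_add]
  | hmk x y m =>
    rw [BalancedTensor.smul_mk, assocHom_mk, assocHom_mk, BalancedTensor.smul_mk, compose_smul_left]

theorem assocHom_mem_part (g : Glue T₁ T₂ T₁₂) (ℳ : ℤ → AddSubgroup M) (d : ℤ) (t)
    (ht : t ∈ BalancedTensor.part (ArcRing u) (ArcRing w) T₁.part
      (BalancedTensor.part (ArcRing w) (ArcRing v) T₂.part ℳ) d) :
    g.assocHom M t ∈ BalancedTensor.part (ArcRing u) (ArcRing v) T₁₂.part ℳ d := by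
  refine (AddSubgroup.closure_le (K := (BalancedTensor.part _ _ T₁₂.part ℳ d).comap
    (g.assocHom M))).mpr ?_ ht
  rintro _ ⟨i, j, x, z, hx, hz, rfl, rfl⟩
  refine (AddSubgroup.closure_le (K := (BalancedTensor.part _ _ T₁₂.part ℳ (i + j)).comap
    ((g.assocHom M).comp (BalancedTensor.mkHom _ _ x)))).mpr ?_ hz
  rintro _ ⟨j, l, y, m, hy, hm, rfl, rfl⟩
  have := BalancedTensor.mk_mem_part (R := ArcRing u) (S := ArcRing v) (g.compose_mem_part hx hy) hm
  rw [← assocHom_mk, add_assoc] at this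
  exact this

end

/-- Tensor product with `F(T₁)` after tensor product with `F(T₂)` is tensor product with `F(T₁ T₂)`. -/
def tensorIso (g : Glue T₁ T₂ T₁₂) (K : ∀ a, T₂.Cups a) :
    T₂.tensorFunctor ⋙ T₁.tensorFunctor ≅ T₁₂.tensorFunctor :=
  NatIso.ofComponents (fun M => GrMod.isoMk
      (LinearEquiv.ofBijective { g.assocHom M.carrier with map_smul' := g.assocHom_smul }
        (g.assocHom_bijective K)) fun d t ht => g.assocHom_mem_part M.gr d t ht) fun f => by
    refine GrMod.hom_ext (LinearMap.ext fun t => ?_)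
    refine DFunLike.congr_fun (f := (g.assocHom _).comp (BalancedTensor.map _ _ _
        (BalancedTensor.map _ _ _ f.lin)).toAddMonoidHom)
      (g := (BalancedTensor.map _ _ _ f.lin).toAddMonoidHom.comp (g.assocHom _)) ?_ t
    ext t
    induction t using induction₂ with
    | h0 => rw [map_zero, map_zero]
    | hadd s t hs ht => rw [map_add, map_add, hs, ht]
    | hmk x y m =>
      refine (g.assocHom_mk x y (f.lin m)).trans ?_
      rw [AddMonoidHom.comp_apply, assocHom_mk]
      rfl

end Glue

end FlatTangle

end

noncomputable section

open Relation Equiv Equiv.Perm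

variable {n k : ℕ}

namespace Matching

variable {v w : Weight n k}

/-- The involution of all positions given by a matching, the identity outside the positions of the 1s. -/
def ext (a : Matching v) (p : Fin n) : Fin n := if h : v.1 p = 1 then (a.toFun ⟨p, h⟩).1 else p

theorem ext_of_one (a : Matching v) (p : Ones v) : a.ext p.1 = (a.toFun p).1 := dif_pos p.2

theorem ext_of_ne (a : Matching v) {p : Fin n} (h : v.1 p ≠ 1) : a.ext p = p := dif_neg h

theorem one_ext (a : Matching v) {p : Fin n} (h : v.1 p = 1) : v.1 (a.ext p) = 1 := by
  rw [a.ext_of_one ⟨p, h⟩]; exact (a.toFun ⟨p, h⟩).2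

theorem ext_ext (a : Matching v) (p : Fin n) : a.ext (a.ext p) = p := by
  by_cases h : v.1 p = 1
  · rw [a.ext_of_one ⟨p, h⟩, a.ext_of_one, a.invol]
  · rw [a.ext_of_ne h, a.ext_of_ne h]

theorem ext_ne (a : Matching v) {p : Fin n} (h : v.1 p = 1) : a.ext p ≠ p := by
  rw [a.ext_of_one ⟨p, h⟩]
  exact fun e => a.ne ⟨p, h⟩ (Subtype.ext e)

theorem ext_noncrossing (a : Matching v) {p q : Fin n} (h₁ : p < q) (h₂ : q < a.ext p) :
    p < a.ext q ∧ a.ext q < a.ext p := by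
  by_cases hq : v.1 q = 1
  · by_cases hp : v.1 p = 1
    · have := a.noncrossing ⟨p, hp⟩ ⟨q, hq⟩ h₁
      rw [a.ext_of_one ⟨p, hp⟩] at h₂ ⊢
      rw [a.ext_of_one ⟨q, hq⟩]
      exact this h₂
    · rw [a.ext_of_ne hp] at h₂
      exact absurd (h₁.trans h₂) (lt_irrefl _)
  · rw [a.ext_of_ne hq]
    exact ⟨h₁, h₂⟩

/-- A matching given by a map of positions. -/
def ofPos (β : Fin n → Fin n) (h : ∀ p, w.1 p = 1 → w.1 (β p) = 1 ∧ β (β p) = p ∧ β p ≠ p)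
    (h' : ∀ p q, w.1 p = 1 → w.1 q = 1 → p < q → q < β p → p < β q ∧ β q < β p) : Matching w where
  toFun p := ⟨β p.1, (h p.1 p.2).1⟩
  invol p := Subtype.ext (h p.1 p.2).2.1
  ne p e := (h p.1 p.2).2.2 (congrArg Subtype.val e)
  noncrossing p q := h' p.1 q.1 p.2 q.2

end Matching

namespace ElemTangle

variable {v w : Weight n k} {i : Fin (n - 1)}

theorem adj_strand {p : Fin n} (hl : p ≠ lft i) (hr : p ≠ rgt i) (hv : v.1 p = 1) (hw : w.1 p = 1) :
    adj (v := v) (w := w) i (Sum.inl ⟨p, hv⟩) (Sum.inr ⟨p, hw⟩) :=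
  ⟨by simp, Or.inl ⟨hl, hr, rfl⟩⟩

theorem adj_arc {x y : Ones v ⊕ Ones w} (h : x ≠ y) (hx : pos x = lft i ∨ pos x = rgt i)
    (hy : pos y = lft i ∨ pos y = rgt i) : adj i x y := ⟨h, Or.inr ⟨hx, hy⟩⟩

theorem lft_lt_rgt (i : Fin (n - 1)) : lft i < rgt i := by simp [lft, rgt, Fin.lt_def]

theorem le_lft {p : Fin n} (h : p < rgt i) : p ≤ lft i := by
  simp only [lft, rgt, Fin.lt_def, Fin.le_def] at *; omega

theorem rgt_le {p : Fin n} (h : lft i < p) : rgt i ≤ p := by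
  simp only [lft, rgt, Fin.lt_def, Fin.le_def] at *; omega

theorem swap_lt {p q : Fin n} (h : p < q) (hpq : p = lft i → q ≠ rgt i) :
    swap (lft i) (rgt i) p < swap (lft i) (rgt i) q := by
  have h₁ := @le_lft n i
  have h₂ := @rgt_le n i
  have h₃ := lft_lt_rgt i
  rw [swap_apply_def, swap_apply_def]
  split_ifs with h1 h2 h3 h4 h5 h6 h7 h8
  · omega
  · exact absurd h3 (hpq h1)
  · have := h₂ (p := q) (by omega); omega
  · omega
  · omega
  · have := h₂ (p := q) (by omega); omega
  · have := h₁ (p := p) (by omega); omega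
  · have := h₁ (p := p) (by omega); omega
  · exact h

/-- Closing a strand of an elementary tangle from below. -/
theorem cups_strand (h : Neighbours i v w) (a : Matching v) (hv : v.1 (lft i) = 1 ↔ v.1 (rgt i) ≠ 1) :
    Nonempty ((elemTangle i v w h).Cups a) := by
  obtain ⟨s, hs, hw⟩ := exists_sign h
  have hwl := hw (lft i)
  have hwr := hw (rgt i)
  rw [root_lft] at hwl
  rw [root_rgt] at hwr
  have bw := w.2.1
  have bv := v.2.1
  have hlr := lft_ne_rgt i
  have hw' : w.1 (lft i) = 1 ↔ w.1 (rgt i) ≠ 1 := by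
    have := bv (lft i); have := bw (lft i); have := bv (rgt i); have := bw (rgt i); omega
  have hvw : v.1 (lft i) = 1 ↔ w.1 (rgt i) = 1 := by
    have := bv (lft i); have := bw (lft i); have := bv (rgt i); have := bw (rgt i); omega
  have hwo : ∀ p, p ≠ lft i → p ≠ rgt i → w.1 p = v.1 p := by
    intro p h1 h2
    rw [hw, root_other i h1 h2, mul_zero, add_zero]
  obtain ⟨τ, hτ⟩ : ∃ τ : Fin n → Fin n, τ = swap (lft i) (rgt i) := ⟨_, rfl⟩
  have τl : τ (lft i) = rgt i := by rw [hτ, swap_apply_left]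
  have τr : τ (rgt i) = lft i := by rw [hτ, swap_apply_right]
  have τo : ∀ p, p ≠ lft i → p ≠ rgt i → τ p = p := by
    intro p h1 h2; rw [hτ, swap_apply_of_ne_of_ne h1 h2]
  have ττ : ∀ p, τ (τ p) = p := by intro p; rw [hτ, swap_apply_self]
  have τlt : ∀ {p q}, p < q → (p = lft i → q ≠ rgt i) → τ p < τ q := by
    intro p q h1 h2; rw [hτ]; exact swap_lt h1 h2
  have τ1 : ∀ p, v.1 p = 1 → w.1 (τ p) = 1 := by
    intro p hp
    by_cases h1 : p = lft i
    · subst h1; rw [τl]; exact hvw.mp hp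
    by_cases h2 : p = rgt i
    · subst h2; rw [τr]; tauto
    rw [τo p h1 h2, hwo p h1 h2, hp]
  have τ2 : ∀ p, w.1 p = 1 → v.1 (τ p) = 1 := by
    intro p hp
    by_cases h1 : p = lft i
    · subst h1; rw [τl]; tauto
    by_cases h2 : p = rgt i
    · subst h2; rw [τr]; exact hvw.mpr hp
    rw [τo p h1 h2, ← hwo p h1 h2, hp]
  let b : Matching w := Matching.ofPos (fun p => τ (a.ext (τ p)))
    (fun p hp => ⟨τ1 _ (a.one_ext (τ2 p hp)), by rw [ττ, a.ext_ext, ττ], fun e => by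
      have := congrArg τ e
      rw [ττ] at this
      exact a.ext_ne (τ2 p hp) this⟩) (by
    intro p q hp hq h1 h2
    have h3 := τlt h1 (by rintro rfl rfl; exact hw'.mp hp hq)
    have h4 := τlt h2 (by
      rintro rfl e
      exact hw'.mp hq (e ▸ τ1 _ (a.one_ext (τ2 p hp))))
    rw [ττ] at h4
    have h5 := a.ext_noncrossing h3 h4
    have o1 := a.one_ext (τ2 p hp)
    have o2 := a.one_ext (τ2 q hq)
    refine ⟨?_, τlt h5.2 (by intro e1 e2; rw [e2] at o1; rw [e1] at o2; exact hv.mp o2 o1)⟩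
    have h6 := τlt h5.1 (by
      intro e1 e2
      have := τ2 p hp
      rw [e2] at o2; rw [e1] at this; exact hv.mp this o2)
    rwa [ττ] at h6)
  let P : Ones v → Ones w := fun p => ⟨τ p.1, τ1 p.1 p.2⟩
  have hP : ∀ p, EqvGen ((elemTangle i v w h).cupped a) (Sum.inl p) (Sum.inr (P p)) := by
    intro p
    refine EqvGen.rel _ _ (Or.inl ?_)
    by_cases h1 : p.1 = lft i
    · refine adj_arc (by simp) (Or.inl h1) (Or.inr ?_)
      change τ p.1 = _
      rw [h1, τl]
    by_cases h2 : p.1 = rgt i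
    · refine adj_arc (by simp) (Or.inr h2) (Or.inl ?_)
      change τ p.1 = _
      rw [h2, τr]
    have : P p = ⟨p.1, by rw [hwo _ h1 h2]; exact p.2⟩ := Subtype.ext (τo _ h1 h2)
    rw [this]
    exact adj_strand h1 h2 _ _
  refine ⟨⟨b, fun x => some (Sum.elim P id x), fun _ => rfl, ?_, ?_, ?_⟩⟩
  · rintro x y (⟨hne, hxy⟩ | ⟨p, rfl, rfl⟩)
    · left
      refine congrArg some (Subtype.ext ?_)
      rcases x with ⟨p, hp⟩ | ⟨p, hp⟩ <;> rcases y with ⟨q, hq⟩ | ⟨q, hq⟩ <;>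
        simp only [pos, Sum.elim_inl, Sum.elim_inr, P, id_eq] at hxy ⊢
      · rcases hxy with ⟨-, -, rfl⟩ | ⟨rfl | rfl, rfl | rfl⟩ <;> first | exact absurd rfl hne | omega
      · rcases hxy with ⟨h1, h2, rfl⟩ | ⟨rfl | rfl, rfl | rfl⟩
        · exact (τo q h1 h2).symm
        · omega
        · exact τl.symm
        · exact τr.symm
        · omega
      · rcases hxy with ⟨h1, h2, rfl⟩ | ⟨rfl | rfl, rfl | rfl⟩
        · exact τo q h1 h2
        · omega
        · exact τr
        · exact τl
        · omega
      · rcases hxy with ⟨-, -, rfl⟩ | ⟨rfl | rfl, rfl | rfl⟩ <;> first | exact absurd rfl hne | omega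
    · right
      refine congrArg some (Subtype.ext ?_)
      change τ (a.toFun p).1 = τ (a.ext (τ (τ p.1)))
      rw [ττ, a.ext_of_one]
  · rintro (x | x) p e
    · obtain rfl : P x = p := Option.some_injective _ e
      exact hP x
    · obtain rfl : x = p := Option.some_injective _ e
      exact EqvGen.refl _
  · intro p
    have h1 := hP ⟨τ p.1, τ2 p.1 p.2⟩
    have h2 := hP (a.toFun ⟨τ p.1, τ2 p.1 p.2⟩)
    have e1 : P ⟨τ p.1, τ2 p.1 p.2⟩ = p := Subtype.ext (ττ _)
    have e2 : P (a.toFun ⟨τ p.1, τ2 p.1 p.2⟩) = b.toFun p :=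
      Subtype.ext (congrArg τ (a.ext_of_one ⟨τ p.1, τ2 p.1 p.2⟩).symm)
    rw [e1] at h1
    rw [e2] at h2
    exact (h1.symm.trans _ _ _ (EqvGen.rel _ _ (Or.inr ⟨_, rfl, rfl⟩))).trans _ _ _ h2

/-- Closing a cup from below. -/
theorem cups_cup (h : Neighbours i v w) (a : Matching v) (hvl : v.1 (lft i) ≠ 1)
    (hvr : v.1 (rgt i) ≠ 1) : Nonempty ((elemTangle i v w h).Cups a) := by
  obtain ⟨s, hs, hw⟩ := exists_sign h
  have hwl := hw (lft i)
  have hwr := hw (rgt i)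
  rw [root_lft] at hwl
  rw [root_rgt] at hwr
  have bw := w.2.1
  have bv := v.2.1
  have hlr := lft_ne_rgt i
  have wl : w.1 (lft i) = 1 := by have := bv (lft i); have := bw (lft i); omega
  have wr : w.1 (rgt i) = 1 := by have := bv (rgt i); have := bw (rgt i); omega
  have hwo : ∀ p, p ≠ lft i → p ≠ rgt i → w.1 p = v.1 p := by
    intro p h1 h2
    rw [hw, root_other i h1 h2, mul_zero, add_zero]
  have v1 : ∀ p, v.1 p = 1 → p ≠ lft i ∧ p ≠ rgt i :=
    fun p hp => ⟨fun e => hvl (e ▸ hp), fun e => hvr (e ▸ hp)⟩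
  have w1 : ∀ p, v.1 p = 1 → w.1 p = 1 := fun p hp => by
    rw [hwo p (v1 p hp).1 (v1 p hp).2, hp]
  let β : Fin n → Fin n := fun p => swap (lft i) (rgt i) (a.ext p)
  have βl : β (lft i) = rgt i := by simp only [β]; rw [a.ext_of_ne hvl, swap_apply_left]
  have βr : β (rgt i) = lft i := by simp only [β]; rw [a.ext_of_ne hvr, swap_apply_right]
  have βo : ∀ p, v.1 p = 1 → β p = a.ext p := fun p hp =>
    swap_apply_of_ne_of_ne (v1 _ (a.one_ext hp)).1 (v1 _ (a.one_ext hp)).2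
  have w2 : ∀ p, w.1 p = 1 → p = lft i ∨ p = rgt i ∨ v.1 p = 1 := by
    intro p hp
    by_cases h1 : p = lft i
    · exact Or.inl h1
    by_cases h2 : p = rgt i
    · exact Or.inr (Or.inl h2)
    · exact Or.inr (Or.inr (by rw [← hwo p h1 h2, hp]))
  let b : Matching w := Matching.ofPos β (by
    intro p hp
    rcases w2 p hp with rfl | rfl | hp
    · rw [βl, βr]; exact ⟨wr, rfl, hlr.symm⟩
    · rw [βr, βl]; exact ⟨wl, rfl, hlr⟩
    · have := a.one_ext hp
      rw [βo p hp, βo _ this, a.ext_ext]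
      exact ⟨w1 _ this, rfl, a.ext_ne hp⟩) (by
    intro p q hp hq h1 h2
    have hlt := lft_lt_rgt i
    rcases w2 p hp with rfl | rfl | hp
    · rw [βl] at h2
      have := le_lft h2; omega
    · rw [βr] at h2; omega
    have o := v1 _ (a.one_ext hp)
    have o' := v1 p hp
    rw [βo p hp] at h2 ⊢
    rcases w2 q hq with rfl | rfl | hq
    · rw [βl]
      have := rgt_le h2; omega
    · rw [βr]
      have := le_lft h1; omega
    · rw [βo q hq]
      exact a.ext_noncrossing h1 h2)
  let P : Ones v → Ones w := fun p => ⟨p.1, w1 p.1 p.2⟩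
  have hP : ∀ p, EqvGen ((elemTangle i v w h).cupped a) (Sum.inl p) (Sum.inr (P p)) := fun p =>
    EqvGen.rel _ _ (Or.inl (adj_strand (v1 p.1 p.2).1 (v1 p.1 p.2).2 _ _))
  refine ⟨⟨b, fun x => some (Sum.elim P id x), fun _ => rfl, ?_, ?_, ?_⟩⟩
  · rintro x y (⟨hne, hxy⟩ | ⟨p, rfl, rfl⟩)
    · rcases hxy with ⟨-, -, e⟩ | ⟨hx, hy⟩
      · left
        refine congrArg some (Subtype.ext ?_)
        rcases x with x | x <;> rcases y with y | y <;> exact e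
      · right
        refine congrArg some (Subtype.ext ?_)
        have key : ∀ z : Ones v ⊕ Ones w, (pos z = lft i ∨ pos z = rgt i) → ∃ p, z = Sum.inr p := by
          rintro (⟨z, hz⟩ | z) h
          · rcases h with (rfl : z = _) | (rfl : z = _)
            · exact absurd hz hvl
            · exact absurd hz hvr
          · exact ⟨z, rfl⟩
        obtain ⟨⟨x, hx'⟩, rfl⟩ := key x hx
        obtain ⟨⟨y, hy'⟩, rfl⟩ := key y hy
        change y = β x
        rcases hx with (rfl : x = _) | (rfl : x = _) <;>
          rcases hy with (rfl : y = _) | (rfl : y = _) <;>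
          first | exact absurd rfl hne | exact βl.symm | exact βr.symm
    · right
      refine congrArg some (Subtype.ext ?_)
      change (a.toFun p).1 = β p.1
      rw [βo _ p.2, a.ext_of_one]
  · rintro (x | x) p e
    · obtain rfl : P x = p := Option.some_injective _ e
      exact hP x
    · obtain rfl : x = p := Option.some_injective _ e
      exact EqvGen.refl _
  · rintro ⟨p, hp⟩
    by_cases hv : v.1 p = 1
    · have e : P (a.toFun ⟨p, hv⟩) = b.toFun ⟨p, hp⟩ := Subtype.ext (by
        change _ = β p
        rw [βo _ hv, a.ext_of_one ⟨p, hv⟩])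
      have h2 := hP (a.toFun ⟨p, hv⟩)
      rw [e] at h2
      exact ((hP ⟨p, hv⟩).symm.trans _ _ _ (EqvGen.rel _ _ (Or.inr ⟨_, rfl, rfl⟩))).trans _ _ _ h2
    · have hb : (b.toFun ⟨p, hp⟩).1 = β p := rfl
      refine EqvGen.rel _ _ (Or.inl (adj_arc ?_ ?_ ?_))
      · exact fun e => b.ne _ (Sum.inr_injective e).symm
      · change p = _ ∨ p = _
        rcases w2 p hp with h | h | h
        · exact Or.inl h
        · exact Or.inr h
        · exact absurd h hv
      · change β p = _ ∨ β p = _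
        rcases w2 p hp with rfl | rfl | h
        · exact Or.inr βl
        · exact Or.inl βr
        · exact absurd h hv

/-- Closing a cap from below. -/
theorem cups_cap (h₀ : Neighbours i v w) (a : Matching v) (hvl : v.1 (lft i) = 1)
    (hvr : v.1 (rgt i) = 1) : Nonempty ((elemTangle i v w h₀).Cups a) := by
  classical
  obtain ⟨s, hs, hw⟩ := exists_sign h₀
  have hwl := hw (lft i)
  have hwr := hw (rgt i)
  rw [root_lft] at hwl
  rw [root_rgt] at hwr
  have hlr := lft_ne_rgt i
  have wl : w.1 (lft i) ≠ 1 := by omega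
  have wr : w.1 (rgt i) ≠ 1 := by omega
  have hwo : ∀ p, p ≠ lft i → p ≠ rgt i → w.1 p = v.1 p := by
    intro p h1 h2
    rw [hw, root_other i h1 h2, mul_zero, add_zero]
  have w1 : ∀ p, w.1 p = 1 → p ≠ lft i ∧ p ≠ rgt i ∧ v.1 p = 1 := by
    intro p hp
    have h1 : p ≠ lft i := fun e => wl (e ▸ hp)
    have h2 : p ≠ rgt i := fun e => wr (e ▸ hp)
    exact ⟨h1, h2, by rw [← hwo p h1 h2, hp]⟩
  obtain ⟨α, hα⟩ : ∃ α, α = a.ext := ⟨_, rfl⟩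
  have αα : ∀ p, α (α p) = p := by rw [hα]; exact a.ext_ext
  have α1 : ∀ p, v.1 p = 1 → v.1 (α p) = 1 := by rw [hα]; exact fun p => a.one_ext
  have αne : ∀ p, v.1 p = 1 → α p ≠ p := by rw [hα]; exact fun p => a.ext_ne
  have αnc : ∀ p q, p < q → q < α p → p < α q ∧ α q < α p := by
    rw [hα]; exact fun p q => a.ext_noncrossing
  have αeq : ∀ p q, α p = q ↔ α q = p := fun p q =>
    ⟨fun e => by rw [← e, αα], fun e => by rw [← e, αα]⟩
  have w2 : ∀ p, v.1 p = 1 → p ≠ lft i → p ≠ rgt i → w.1 p = 1 := by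
    intro p hp h1 h2; rw [hwo p h1 h2, hp]
  let β : Fin n → Fin n := fun p =>
    if α p = lft i then α (rgt i) else if α p = rgt i then α (lft i) else α p
  have βl : ∀ p, α p = lft i → β p = α (rgt i) := fun p hp => if_pos hp
  have βr : ∀ p, α p = rgt i → β p = α (lft i) := fun p hp => by
    simp only [β]; rw [if_neg (hp ▸ hlr.symm), if_pos hp]
  have βo : ∀ p, α p ≠ lft i → α p ≠ rgt i → β p = α p := fun p h1 h2 => by
    simp only [β]; rw [if_neg h1, if_neg h2]
  have hlt := lft_lt_rgt i
  have hle : ∀ p, p ≠ lft i → p ≠ rgt i → p < lft i ∨ rgt i < p := by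
    intro p h1 h2
    rcases lt_or_ge p (rgt i) with h | h
    · have := le_lft h; omega
    · omega
  let b : Matching w := Matching.ofPos β (by
    intro p hp
    obtain ⟨h1, h2, hp⟩ := w1 p hp
    by_cases e1 : α p = lft i
    · have e2 := (αeq _ _).mp e1
      rw [βl p e1]
      have h3 : α (rgt i) ≠ lft i := fun e => by rw [αeq, e2] at e; exact h2 e
      refine ⟨w2 _ (α1 _ hvr) h3 (αne _ hvr), ?_, fun e => ?_⟩
      · rw [βr _ (αα _), e2]
      · rw [← e2] at e
        exact hlr ((αα _).symm.trans ((congrArg α e).symm.trans (αα _)))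
    by_cases e2 : α p = rgt i
    · have e3 := (αeq _ _).mp e2
      rw [βr p e2]
      have h3 : α (lft i) ≠ rgt i := fun e => by rw [αeq, e3] at e; exact h1 e
      refine ⟨w2 _ (α1 _ hvl) (αne _ hvl) h3, ?_, fun e => ?_⟩
      · rw [βl _ (αα _), e3]
      · rw [← e3] at e
        exact hlr ((αα _).symm.trans ((congrArg α e).trans (αα _)))
    · rw [βo p e1 e2, βo _ (by rw [αα]; exact h1) (by rw [αα]; exact h2), αα]
      exact ⟨w2 _ (α1 _ hp) e1 e2, rfl, αne _ hp⟩) (by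
    intro p q hp hq h1 h2
    obtain ⟨p1, p2, hp⟩ := w1 p hp
    obtain ⟨q1, q2, hq⟩ := w1 q hq
    have lp := hle p p1 p2
    have lq := hle q q1 q2
    have npq := αnc p q h1
    have hne : p ≠ q := h1.ne
    by_cases e1 : α p = lft i
    · have e2 := (αeq _ _).mp e1
      rw [βl p e1] at h2 ⊢
      have e3 : α q ≠ lft i := fun e => hne (by rw [← e2, ← e, αα])
      have e4 : α q ≠ rgt i := fun e => by rw [← e, αα] at h2; exact lt_irrefl _ h2
      rw [βo q e3 e4]
      have f1 := αnc p (α (rgt i))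
      have f2 := αnc (rgt i) q
      have f3 := αnc (lft i) (α q)
      rw [αα] at f1 f3
      rw [e1] at f1 npq
      rw [e2] at f3
      have := hle _ e3 e4
      grind
    by_cases e2 : α p = rgt i
    · have e3 := (αeq _ _).mp e2
      rw [βr p e2] at h2 ⊢
      have e4 : α q ≠ rgt i := fun e => hne (by rw [← e3, ← e, αα])
      have e5 : α q ≠ lft i := fun e => by rw [← e, αα] at h2; exact lt_irrefl _ h2
      rw [βo q e5 e4]
      have f1 := αnc p (α (lft i))
      have f2 := αnc (lft i) q
      have f3 := αnc (rgt i) (α q)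
      rw [αα] at f1 f3
      rw [e2] at f1 npq
      rw [e3] at f3
      have := hle _ e5 e4
      grind
    rw [βo p e1 e2] at h2 ⊢
    have lap := hle _ e1 e2
    have f1 := αnc p (lft i)
    have f2 := αnc p (rgt i)
    have npq := npq h2
    by_cases e3 : α q = lft i
    · rw [βl q e3]
      omega
    by_cases e4 : α q = rgt i
    · rw [βr q e4]
      omega
    rw [βo q e3 e4]
    exact npq)
  have w3 : ∀ p, v.1 p = 1 → ¬ (p = lft i ∨ p = rgt i) → w.1 p = 1 := by
    intro p hp h
    rw [not_or] at h
    exact w2 p hp h.1 h.2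
  let f : Ones v ⊕ Ones w → Option (Ones w) := Sum.elim (fun p =>
    if h : p.1 = lft i ∨ p.1 = rgt i then
      if h' : α p.1 = lft i ∨ α p.1 = rgt i then none else some ⟨α p.1, w3 _ (α1 _ p.2) h'⟩
    else some ⟨p.1, w3 _ p.2 h⟩) some
  have fin : ∀ p (h : p.1 = lft i ∨ p.1 = rgt i) (h' : α p.1 = lft i ∨ α p.1 = rgt i),
      f (Sum.inl p) = none := fun p h h' => (dif_pos h).trans (dif_pos h')
  have fio : ∀ p (h : p.1 = lft i ∨ p.1 = rgt i) (h' : ¬ (α p.1 = lft i ∨ α p.1 = rgt i)),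
      f (Sum.inl p) = some ⟨α p.1, w3 _ (α1 _ p.2) h'⟩ := fun p h h' => (dif_pos h).trans (dif_neg h')
  have fo : ∀ p (h : ¬ (p.1 = lft i ∨ p.1 = rgt i)), f (Sum.inl p) = some ⟨p.1, w3 _ p.2 h⟩ :=
    fun p h => dif_neg h
  have ha : ∀ p, (a.toFun p).1 = α p.1 := fun p => by rw [hα, a.ext_of_one]
  have hb : ∀ p, (b.toFun p).1 = β p.1 := fun p => rfl
  have hstrand : ∀ p h, EqvGen ((elemTangle i v w h₀).cupped a) (Sum.inl p)
      (Sum.inr ⟨p.1, w3 p.1 p.2 h⟩) := fun p h =>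
    EqvGen.rel _ _ (Or.inl (adj_strand (not_or.mp h).1 (not_or.mp h).2 _ _))
  have harc : ∀ p, EqvGen ((elemTangle i v w h₀).cupped a) (Sum.inl p) (Sum.inl (a.toFun p)) :=
    fun p => EqvGen.rel _ _ (Or.inr ⟨p, rfl, rfl⟩)
  have hcap : EqvGen ((elemTangle i v w h₀).cupped a) (Sum.inl ⟨lft i, hvl⟩)
      (Sum.inl ⟨rgt i, hvr⟩) :=
    EqvGen.rel _ _ (Or.inl (adj_arc (fun e => hlr (congrArg Subtype.val (Sum.inl_injective e)))
      (Or.inl rfl) (Or.inr rfl)))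
  have hconn : ∀ x p, f x = some p → EqvGen ((elemTangle i v w h₀).cupped a) x (Sum.inr p) := by
    rintro (x | x) p e
    · by_cases h1 : x.1 = lft i ∨ x.1 = rgt i
      · by_cases h2 : α x.1 = lft i ∨ α x.1 = rgt i
        · rw [fin x h1 h2] at e; cases e
        · rw [fio x h1 h2] at e
          obtain rfl := Option.some_injective _ e
          have := hstrand (a.toFun x) (by rw [ha]; exact h2)
          simp only [ha] at this
          exact (harc x).trans _ _ _ this
      · rw [fo x h1] at e
        obtain rfl := Option.some_injective _ e
        exact hstrand x h1
    · obtain rfl : x = p := Option.some_injective _ e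
      exact EqvGen.refl _
  refine ⟨⟨b, f, fun _ => rfl, ?_, hconn, ?_⟩⟩
  · rintro x y (⟨hne, hxy⟩ | ⟨p, rfl, rfl⟩)
    · rcases hxy with ⟨h1, h2, e⟩ | ⟨hx, hy⟩
      · left
        rcases x with x | x <;> rcases y with y | y
        · exact absurd (congrArg Sum.inl (Subtype.ext e.symm)) hne
        · exact ((fo x (not_or.mpr ⟨h1, h2⟩)).trans (congrArg some (Subtype.ext e.symm))).symm
        · exact (fo y (not_or.mpr ⟨ne_of_eq_of_ne e h1, ne_of_eq_of_ne e h2⟩)).trans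
            (congrArg some (Subtype.ext e))
        · exact absurd (congrArg Sum.inr (Subtype.ext e.symm)) hne
      · have key : ∀ z : Ones v ⊕ Ones w, (pos z = lft i ∨ pos z = rgt i) → ∃ p, z = Sum.inl p := by
          rintro (z | ⟨z, hz⟩) h
          · exact ⟨z, rfl⟩
          · rcases h with (rfl : z = _) | (rfl : z = _)
            · exact absurd hz wl
            · exact absurd hz wr
        obtain ⟨x, rfl⟩ := key x hx
        obtain ⟨y, rfl⟩ := key y hy
        change x.1 = _ ∨ x.1 = _ at hx
        change y.1 = _ ∨ y.1 = _ at hy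
        have hne' : x.1 ≠ y.1 := fun e => hne (congrArg Sum.inl (Subtype.ext e))
        have αx := αne _ x.2
        have αy := αne _ y.2
        have αxy := αeq x.1 y.1
        by_cases h1 : α x.1 = y.1
        · left
          rw [fin x hx (by rw [h1]; exact hy), fin y hy (by rw [αxy.mp h1]; exact hx)]
        · right
          have h2 : ¬ (α x.1 = lft i ∨ α x.1 = rgt i) := by grind
          have h3 : ¬ (α y.1 = lft i ∨ α y.1 = rgt i) := by grind
          rw [fio x hx h2, fio y hy h3]
          refine congrArg some (Subtype.ext ?_)
          change α y.1 = β (α x.1)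
          rcases hx with hx | hx
          · rw [βl _ (by rw [αα, hx])]; grind
          · rw [βr _ (by rw [αα, hx])]; grind
    · by_cases h1 : p.1 = lft i ∨ p.1 = rgt i
      · by_cases h2 : α p.1 = lft i ∨ α p.1 = rgt i
        · left
          refine (fin (a.toFun p) (by rw [ha]; exact h2) (by rw [ha, αα]; exact h1)).trans
            (fin p h1 h2).symm
        · left
          refine (fo (a.toFun p) (by rw [ha]; exact h2)).trans (Eq.trans ?_ (fio p h1 h2).symm)
          exact congrArg some (Subtype.ext (ha p))
      · by_cases h2 : α p.1 = lft i ∨ α p.1 = rgt i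
        · left
          refine (fio (a.toFun p) (by rw [ha]; exact h2) (by rw [ha, αα]; exact h1)).trans
            (Eq.trans ?_ (fo p h1).symm)
          exact congrArg some (Subtype.ext ((congrArg α (ha p)).trans (αα _)))
        · right
          refine (fo (a.toFun p) (by rw [ha]; exact h2)).trans
            (Eq.trans ?_ (congrArg _ (fo p h1).symm))
          exact congrArg some (Subtype.ext
            ((ha p).trans (βo p.1 (not_or.mp h2).1 (not_or.mp h2).2).symm))
  · rintro ⟨p, hp⟩
    obtain ⟨h1, h2, hv⟩ := w1 p hp
    have s1 := (hstrand ⟨p, hv⟩ (not_or.mpr ⟨h1, h2⟩)).symm.trans _ _ _ (harc _)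
    refine s1.trans _ _ _ ?_
    by_cases h3 : α p = lft i ∨ α p = rgt i
    · have key : ∀ q (hq : v.1 q = 1), (α q = β p) → (q = lft i ∨ q = rgt i) →
          EqvGen ((elemTangle i v w h₀).cupped a) (Sum.inl ⟨q, hq⟩)
          (Sum.inr (b.toFun ⟨p, hp⟩)) := by
        intro q hq e hq'
        refine hconn _ _ ?_
        have hn : ¬ (α q = lft i ∨ α q = rgt i) := by
          rw [e]
          have := w1 _ (b.toFun ⟨p, hp⟩).2
          exact not_or.mpr ⟨this.1, this.2.1⟩
        exact (fio ⟨q, hq⟩ hq' hn).trans (congrArg some (Subtype.ext e))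
      rcases h3 with h3 | h3
      · rw [show a.toFun ⟨p, hv⟩ = ⟨lft i, hvl⟩ from Subtype.ext ((ha _).trans h3)]
        exact hcap.trans _ _ _ (key _ hvr (βl p h3).symm (Or.inr rfl))
      · rw [show a.toFun ⟨p, hv⟩ = ⟨rgt i, hvr⟩ from Subtype.ext ((ha _).trans h3)]
        exact hcap.symm.trans _ _ _ (key _ hvl (βr p h3).symm (Or.inl rfl))
    · refine hconn _ _ ((fo _ (by rw [ha]; exact h3)).trans (congrArg some (Subtype.ext ?_)))
      exact (ha _).trans (βo p (not_or.mp h3).1 (not_or.mp h3).2).symm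

theorem cups (h : Neighbours i v w) (a : Matching v) : Nonempty ((elemTangle i v w h).Cups a) := by
  by_cases hl : v.1 (lft i) = 1 <;> by_cases hr : v.1 (rgt i) = 1
  · exact cups_cap h a hl hr
  · exact cups_strand h a (by tauto)
  · exact cups_strand h a (by tauto)
  · exact cups_cup h a hl hr

end ElemTangle

end

noncomputable section

open Relation Equiv Equiv.Perm

namespace CircleAlg

variable {C D : Type}

theorem push_apply [Finite C] [DecidableEq D] {φ : C → D} (hφ : Function.Injective φ)
    (f : CircleAlg C) (S : Finset D) :
    letI := Fintype.ofFinite C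
    push φ f S = ∑ T : Finset C, f T * if S = T.image φ then 1 else 0 := by
  letI := Fintype.ofFinite C
  conv_lhs => rw [eq_sum f]
  simp_rw [prod_X]
  rw [map_sum, sum_apply']
  refine Finset.sum_congr rfl fun T _ => ?_
  rw [map_zsmul, push_mono φ T hφ.injOn]
  change f T • mono _ _ = _
  rw [mono_apply, smul_eq_mul]
  congr

theorem push_apply_image [Finite C] [DecidableEq D] {φ : C → D} (hφ : Function.Injective φ)
    (f : CircleAlg C) (S : Finset C) : push φ f (S.image φ) = f S := by
  rw [push_apply hφ, Finset.sum_eq_single S, if_pos rfl, mul_one]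
  · intro T _ hT
    rw [if_neg fun e => hT (Finset.image_injective hφ e).symm, mul_zero]
  · exact fun h => absurd (@Finset.mem_univ _ (_) S) h

theorem push_apply_of_mem [Finite C] {φ : C → D} (hφ : Function.Injective φ) (f : CircleAlg C)
    {d : D} (hd : ∀ c, φ c ≠ d) {S : Finset D} (hS : d ∈ S) : push φ f S = 0 := by
  classical
  rw [push_apply hφ]
  refine Finset.sum_eq_zero fun T _ => ?_
  rw [if_neg, mul_zero]
  rintro rfl
  obtain ⟨c, -, e⟩ := Finset.mem_image.mp hS
  exact hd c e

theorem X_mul_apply [DecidableEq C] (c : C) (f : CircleAlg C) (S : Finset C) :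
    (X c * f) S = if c ∈ S then f (S.erase c) else 0 := by
  classical
  rw [mul_apply']
  split_ifs with h
  · rw [Finset.sum_eq_single {c}]
    · rw [X, mono_apply, if_pos rfl, one_mul]
      congr 1
      ext x
      simp [and_comm]
    · intro T _ hT
      rw [X, mono_apply, if_neg hT, zero_mul]
    · exact fun h' => absurd (Finset.mem_powerset.mpr (Finset.singleton_subset_iff.mpr h)) h'
  · refine Finset.sum_eq_zero fun T hT => ?_
    rw [X, mono_apply, if_neg, zero_mul]
    rintro rfl
    exact h (Finset.mem_powerset.mp hT (Finset.mem_singleton_self c))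

/-- `A^{⊗ D} = A^{⊗ C} ⊕ X A^{⊗ C}` if `D` consists of `C` and one further circle `d`, with generator `X`. -/
theorem push_add_X_mul_push_bijective [Finite C] {φ : C → D} (hφ : Function.Injective φ) (d : D)
    (hd : ∀ c, φ c ≠ d) (h : ∀ x, x = d ∨ ∃ c, φ c = x) :
    Function.Bijective fun p : CircleAlg C × CircleAlg C => push φ p.1 + X d * push φ p.2 := by
  classical
  have hS : ∀ S : Finset C, d ∉ S.image φ := fun S h => by
    obtain ⟨c, -, e⟩ := Finset.mem_image.mp h
    exact hd c e
  have h1 : ∀ (p : CircleAlg C × CircleAlg C) S,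
      (push φ p.1 + X d * push φ p.2) (S.image φ) = p.1 S := by
    intro p S
    rw [add_apply', push_apply_image hφ, X_mul_apply, if_neg (hS S), add_zero]
  have h2 : ∀ (p : CircleAlg C × CircleAlg C) S,
      (push φ p.1 + X d * push φ p.2) (insert d (S.image φ)) = p.2 S := by
    intro p S
    rw [add_apply', push_apply_of_mem hφ _ hd (Finset.mem_insert_self _ _), X_mul_apply,
      if_pos (Finset.mem_insert_self _ _), Finset.erase_insert (hS S), push_apply_image hφ, zero_add]
  have h3 : ∀ T : Finset D, ∃ S : Finset C, T = S.image φ ∨ T = insert d (S.image φ) := by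
    intro T
    refine ⟨T.preimage φ hφ.injOn, ?_⟩
    by_cases hT : d ∈ T
    · right
      ext x
      rcases h x with rfl | ⟨c, rfl⟩
      · simp [hT]
      · simp [hφ.eq_iff, hd]
    · left
      ext x
      rcases h x with rfl | ⟨c, rfl⟩
      · simp [hT, hd]
      · simp [hφ.eq_iff]
  constructor
  · intro p q e
    refine Prod.ext (CircleAlg.ext' fun S => ?_) (CircleAlg.ext' fun S => ?_)
    · rw [← h1 p, ← h1 q]; exact congrFun e _
    · rw [← h2 p, ← h2 q]; exact congrFun e _
  · intro F
    refine ⟨⟨fun S => F (S.image φ), fun S => F (insert d (S.image φ))⟩, CircleAlg.ext' fun T => ?_⟩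
    obtain ⟨S, rfl | rfl⟩ := h3 T
    · exact h1 _ S
    · exact h2 _ S

end CircleAlg

namespace GrMod

variable {R : Type} [Ring R] (𝒜 : ℤ → AddSubgroup R)

/-- The functor `M ↦ M{1} ⊕ M{-1}`. -/
def double : GrMod 𝒜 ⥤ GrMod 𝒜 where
  obj M := ((shift 𝒜 1).obj M).sum ((shift 𝒜 (-1)).obj M)
  map f := sumMap ((shift 𝒜 1).map f) ((shift 𝒜 (-1)).map f)

end GrMod

variable {n k : ℕ}

namespace FlatTangle

variable {u v w t : Weight n k}

/-- The disjoint union of a tangle with a circle. -/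
def addCircle (T : FlatTangle v w) : FlatTangle v w where
  Pt := Option T.Pt
  finite := inferInstance
  bot p := some (T.bot p)
  top p := some (T.top p)
  adj := Option.Rel T.adj
  bot_inj _ _ h := T.bot_inj (Option.some_injective _ h)
  top_inj _ _ h := T.top_inj (Option.some_injective _ h)
  colour p q h := T.colour p q (Option.some_injective _ h)
  orient b a := by
    obtain ⟨θ, h1, h2, h3, h4⟩ := T.orient b a
    refine ⟨Equiv.optionCongr θ, fun p hp => congrArg some (h1 p hp),
      fun p hp => congrArg some (h2 p hp), ?_, ?_⟩
    · rintro (_ | z) hz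
      · exact Or.inl Option.Rel.none
      · refine (h3 z fun h => hz ?_).imp Option.Rel.some Option.Rel.some
        rcases h with ⟨p, hp, rfl⟩ | ⟨p, hp, rfl⟩
        · exact Or.inl ⟨p, hp, rfl⟩
        · exact Or.inr ⟨p, hp, rfl⟩
    · have key : ∀ z, (some z : Option T.Pt) ∈ {x | (∃ p, Positive w p.1 ∧ x = some (T.top p)) ∨
          ∃ p, ¬ Positive v p.1 ∧ x = some (T.bot p)} →
          z ∈ {x | (∃ p, Positive w p.1 ∧ x = T.top p) ∨ ∃ p, ¬ Positive v p.1 ∧ x = T.bot p} := by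
        rintro z (⟨p, hp, e⟩ | ⟨p, hp, e⟩)
        · exact Or.inl ⟨p, hp, Option.some_injective _ e⟩
        · exact Or.inr ⟨p, hp, Option.some_injective _ e⟩
      rintro _ _ (h | -)
      · rename_i z z'
        rcases h4 z z' h with ⟨h5, rfl⟩ | ⟨h5, rfl⟩
        · exact Or.inl ⟨fun h => h5 (key _ h), rfl⟩
        · exact Or.inr ⟨fun h => h5 (key _ h), rfl⟩
      · left
        refine ⟨?_, rfl⟩
        rintro (⟨p, -, e⟩ | ⟨p, -, e⟩) <;> cases e

theorem closed_addCircle (T : FlatTangle v w) {b : Matching w} {a : Matching v}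
    {x y : Option T.Pt} (h : EqvGen (T.addCircle.closed b a) x y) :
    Option.Rel (EqvGen (T.closed b a)) x y := by
  induction h with
  | rel x y h =>
    rcases h with (h | ⟨p, rfl, rfl⟩) | (h | ⟨p, rfl, rfl⟩)
    · rcases h with h | -
      · exact Option.Rel.some (EqvGen.rel _ _ (Or.inl (Or.inl h)))
      · exact Option.Rel.none
    · exact Option.Rel.some (EqvGen.rel _ _ (Or.inl (Or.inr ⟨p, rfl, rfl⟩)))
    · rcases h with h | -
      · exact Option.Rel.some (EqvGen.rel _ _ (Or.inl (Or.inl h)))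
      · exact Option.Rel.none
    · exact Option.Rel.some (EqvGen.rel _ _ (Or.inr (Or.inr ⟨p, rfl, rfl⟩)))
  | refl x =>
    cases x with
    | none => exact Option.Rel.none
    | some x => exact Option.Rel.some (EqvGen.refl x)
  | symm x y _ ih =>
    rcases ih with h | -
    · exact Option.Rel.some h.symm
    · exact Option.Rel.none
  | trans x y z _ _ h1 h2 =>
    rcases h1 with h1 | -
    · rcases h2 with h2 | -
      exact Option.Rel.some (h1.trans _ _ _ h2)
    · exact h2

theorem closed_addCircle_some (T : FlatTangle v w) {b : Matching w} {a : Matching v}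
    {x y : T.Pt} (h : EqvGen (T.closed b a) x y) :
    EqvGen (T.addCircle.closed b a) (some x) (some y) := by
  refine eqvGen_map some (fun x y h => EqvGen.rel _ _ ?_) h
  rcases h with (h | ⟨p, rfl, rfl⟩) | (h | ⟨p, rfl, rfl⟩)
  · exact Or.inl (Or.inl (Option.Rel.some h))
  · exact Or.inl (Or.inr ⟨p, rfl, rfl⟩)
  · exact Or.inl (Or.inl (Option.Rel.some h))
  · exact Or.inr (Or.inr ⟨p, rfl, rfl⟩)

section

variable (T : FlatTangle v w) (b : Matching w) (a : Matching v)

/-- A circle of `T` as a circle of the union of `T` with a circle. -/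
def old (C : T.Circles b a) : T.addCircle.Circles b a := T.addCircle.circle b a (some (T.rep C))

/-- The additional circle. -/
def new : T.addCircle.Circles b a := T.addCircle.circle b a none

theorem old_circle (x : T.Pt) : T.old b a (T.circle b a x) = T.addCircle.circle b a (some x) :=
  T.addCircle.circle_eq.mpr (T.closed_addCircle_some (T.rep_circle b a x))

theorem old_injective : Function.Injective (T.old b a) := by
  intro C C' h
  rw [← T.circle_rep C, ← T.circle_rep C', T.circle_eq]
  cases T.closed_addCircle (T.addCircle.circle_eq.mp h) with
  | some h => exact h

theorem old_ne_new (C : T.Circles b a) : T.old b a C ≠ T.new b a := fun h => by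
  cases T.closed_addCircle (T.addCircle.circle_eq.mp h)

theorem rep_new : T.addCircle.rep (T.new b a) = none := by
  have h := T.closed_addCircle (T.addCircle.rep_circle b a none)
  change Option.Rel _ (T.addCircle.rep (T.new b a)) none at h
  cases h3 : T.addCircle.rep (T.new b a) with
  | none => rfl
  | some x =>
    rw [h3] at h
    cases h

theorem eq_new_or_old (C : T.addCircle.Circles b a) : C = T.new b a ∨ ∃ C', T.old b a C' = C := by
  obtain ⟨x, rfl⟩ : ∃ x, T.addCircle.circle b a x = C := ⟨_, T.addCircle.circle_rep C⟩
  rcases x with _ | x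
  · exact Or.inl rfl
  · exact Or.inr ⟨_, T.old_circle b a x⟩

theorem card_addCircle : Nat.card (T.addCircle.Circles b a) = Nat.card (T.Circles b a) + 1 := by
  rw [← Finite.card_option]
  refine (Nat.card_eq_of_bijective (fun C : Option (T.Circles b a) => C.elim (T.new b a) (T.old b a))
    ⟨?_, fun C => ?_⟩).symm
  · rintro (_ | C) (_ | C') h
    · rfl
    · exact absurd h.symm (T.old_ne_new b a C')
    · exact absurd h (T.old_ne_new b a C)
    · exact congrArg some (T.old_injective b a h)
  · rcases T.eq_new_or_old b a C with rfl | ⟨C, rfl⟩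
    · exact ⟨none, rfl⟩
    · exact ⟨some C, rfl⟩

end

/-- The union of `T` with a circle as a composition. -/
def glueCircle (T : FlatTangle v w) : Glue (one w).addCircle T T.addCircle where
  π := Sum.elim (Option.map T.top) some
  conn := by
    refine eqvGen_retract _ (fun x => x.elim (Sum.inl none) Sum.inr) ?_ ?_ ?_
    · rintro _ _ ((h | h) | ⟨p, rfl, rfl⟩)
      · rcases h with h | -
        · exact h.elim
        · exact EqvGen.refl _
      · exact EqvGen.rel _ _ (Option.Rel.some h)
      · exact EqvGen.refl _
    · rintro _ _ (h | -)
      · exact EqvGen.rel _ _ (Or.inl (Sum.LiftRel.inr h))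
      · exact EqvGen.refl _
    · rintro ((_ | p) | x)
      · exact EqvGen.refl _
      · exact EqvGen.rel _ _ (Or.inr ⟨p, rfl, rfl⟩)
      · exact EqvGen.refl _
  surj := by
    rintro (_ | x)
    · exact ⟨Sum.inl none, EqvGen.refl _⟩
    · exact ⟨Sum.inr x, EqvGen.refl _⟩
  top _ := EqvGen.refl _
  bot _ := EqvGen.refl _

open scoped Classical in
/-- The element of `F` of the identity tangle with a circle that is `X^e` on the circle. -/
def dot (w : Weight n k) (e : ℕ) : (one w).addCircle.Space :=
  fun b a => if b = a then CircleAlg.X ((one w).new b a) ^ e else 0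

theorem compose_dot {T : FlatTangle v w} (g : Glue (one w).addCircle T T.addCircle)
    (h₀ : EqvGen T.addCircle.adj (g.π (Sum.inl none)) none)
    (h : ∀ x, EqvGen T.addCircle.adj (g.π (Sum.inr x)) (some x)) (e : ℕ) (y : T.Space)
    (c : Matching w) (a : Matching v) :
    g.compose (dot w e) y c a =
      CircleAlg.X (T.new c a) ^ e * CircleAlg.push (T.old c a) (y c a) := by
  rw [Glue.compose_apply, Finset.sum_eq_single c]
  · have hs : g.saddleElement c c a = 1 := by
      refine saddles_eq_one (fun D p hp hp' => ?_) _ _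
      exact EqvGen.rel _ _ (Or.inl (Sum.LiftRel.inl (Or.inr ⟨p, rfl, rfl⟩)))
    rw [Glue.contract, hs, mul_one, dot, if_pos rfl, map_pow]
    congr 2
    · refine (CircleAlg.eval_X (B := CircleAlg (T.addCircle.Circles c a)) _ _ _).trans
        (congrArg _ ?_)
      beta_reduce
      rw [rep_new]
      exact T.addCircle.circle_eq_of_adj h₀
    · congr 1
      funext C
      exact T.addCircle.circle_eq_of_adj (h _)
  · intro b _ hb
    rw [dot, if_neg hb.symm, Glue.contract_zero_left]
  · exact fun h => absurd (Finset.mem_univ c) h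

theorem smul_dot (w : Weight n k) (e : ℕ) (r : ArcRing w) : r • dot w e = MulOpposite.op r • dot w e := by
  funext c a
  refine Eq.trans ?_ (compose_dot (T := one w) (one w).addCircle.gluingRight.toGlue (EqvGen.refl _)
    (fun _ => EqvGen.refl _) e r c a).symm
  refine Eq.trans (b := ∑ b, (one w).addCircle.gluingLeft.toGlue.contract c b a (r c b)
    (dot w e b a)) rfl ?_
  rw [Finset.sum_eq_single a]
  · have hs : (one w).addCircle.gluingLeft.toGlue.saddleElement c a a = 1 := by
      refine saddles_eq_one (fun D p hp hp' => ?_) _ _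
      refine EqvGen.trans _ _ _ (EqvGen.rel _ _ (Or.inr (Or.inl ⟨p, hp, rfl, rfl⟩))) ?_
      refine EqvGen.trans _ _ _ ?_ (EqvGen.symm _ _
        (EqvGen.rel _ _ (Or.inr (Or.inl ⟨_, hp', rfl, rfl⟩))))
      exact EqvGen.rel _ _ (Or.inl (Sum.LiftRel.inr (Or.inr ⟨p, rfl, rfl⟩)))
    rw [Glue.contract, hs, mul_one, dot, if_pos rfl, map_pow, mul_comm]
    congr 2
    refine (CircleAlg.eval_X (B := CircleAlg ((one w).addCircle.Circles c a)) _ _ _).trans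
      (congrArg _ ?_)
    beta_reduce
    rw [rep_new]
    rfl
  · intro b _ hb
    rw [dot, if_neg hb, Glue.contract_zero_right]
  · exact fun h => absurd (Finset.mem_univ a) h

/-- The map `F(T) → F(T ⊔ O)` that puts `X^e` on the circle `O`. -/
def putDot (T : FlatTangle v w) (e : ℕ) : T.Space →+ T.addCircle.Space :=
  T.glueCircle.compose (dot w e)

theorem putDot_apply (T : FlatTangle v w) (e : ℕ) (y : T.Space) (c a) :
    T.putDot e y c a = CircleAlg.X (T.new c a) ^ e * CircleAlg.push (T.old c a) (y c a) :=
  compose_dot T.glueCircle (EqvGen.refl _) (fun _ => EqvGen.refl _) e y c a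

theorem putDot_op_smul (T : FlatTangle v w) (e : ℕ) (r : (ArcRing v)ᵐᵒᵖ) (y : T.Space) :
    T.putDot e (r • y) = r • T.putDot e y :=
  T.glueCircle.compose_smul_right r _ y

theorem putDot_smul (T : FlatTangle v w) (e : ℕ) (r : ArcRing w) (y : T.Space) :
    T.putDot e (r • y) = r • T.putDot e y := by
  unfold putDot
  rw [← Glue.compose_smul_mid, ← smul_dot, Glue.compose_smul_left]

theorem putDot_mem_part (T : FlatTangle v w) (e : ℕ) {d : ℤ} {y : T.Space} (hy : y ∈ T.part d) :
    T.putDot e y ∈ T.addCircle.part (d - 1 + 2 * e) := by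
  intro c a S h
  rw [putDot_apply] at h
  have hy0 : y c a ≠ 0 := by
    intro h0
    rw [h0, map_zero, mul_zero] at h
    exact h rfl
  obtain ⟨S₁, h₁⟩ := Function.ne_iff.mp hy0
  have d₁ := hy c a S₁ h₁
  have k₁ : (y c a).Homog S₁.card := by
    intro S' h'
    have := hy c a S' h'
    simp only [degree] at this d₁
    omega
  have k₂ : (CircleAlg.X (T.new c a) ^ e).Homog e := by
    have := CircleAlg.Homog.prod (Finset.range e) (fun _ => CircleAlg.X (T.new c a))
      fun _ _ => CircleAlg.Homog.X _
    simpa using this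
  have k := (k₂.mul (k₁.push (T.old c a))) S h
  have := T.card_addCircle c a
  simp only [degree] at d₁ ⊢
  omega

/-- `F(T ⊔ O)` is the sum of two copies of `F(T)`. -/
def dotHom (T : FlatTangle v w) : T.Space × T.Space →+ T.addCircle.Space :=
  (T.putDot 0).coprod (T.putDot 1)

theorem dotHom_bijective (T : FlatTangle v w) : Function.Bijective T.dotHom := by
  have key := fun c a => CircleAlg.push_add_X_mul_push_bijective (T.old_injective c a) (T.new c a)
    (T.old_ne_new c a) (T.eq_new_or_old c a)
  have h : ∀ y c a, T.dotHom y c a = CircleAlg.push (T.old c a) (y.1 c a) +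
      CircleAlg.X (T.new c a) * CircleAlg.push (T.old c a) (y.2 c a) := by
    intro y c a
    refine (congrArg₂ (· + ·) (T.putDot_apply 0 y.1 c a) (T.putDot_apply 1 y.2 c a)).trans ?_
    rw [pow_zero, one_mul, pow_one]
  constructor
  · intro y y' e
    have h' : ∀ c a, (y.1 c a, y.2 c a) = (y'.1 c a, y'.2 c a) := by
      intro c a
      refine (key c a).1 ?_
      refine (h y c a).symm.trans (Eq.trans ?_ (h y' c a))
      rw [e]
    exact Prod.ext (funext fun c => funext fun a => congrArg Prod.fst (h' c a))
      (funext fun c => funext fun a => congrArg Prod.snd (h' c a))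
  · intro z
    choose p hp using fun c a => (key c a).2 (z c a)
    refine ⟨⟨fun c a => (p c a).1, fun c a => (p c a).2⟩, ?_⟩
    funext c a
    exact (h _ c a).trans (hp c a)

/-- `F(T ⊔ O)` is the sum of two copies of `F(T)`. -/
def dotEquiv (T : FlatTangle v w) : T.Space × T.Space ≃+ T.addCircle.Space :=
  AddEquiv.ofBijective T.dotHom T.dotHom_bijective

theorem dotEquiv_symm_putDot_zero (T : FlatTangle v w) (y : T.Space) :
    T.dotEquiv.symm (T.putDot 0 y) = (y, 0) := by
  rw [AddEquiv.symm_apply_eq]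
  exact ((congrArg (T.putDot 0 y + ·) (map_zero (T.putDot 1))).trans (add_zero _)).symm

theorem dotEquiv_symm_putDot_one (T : FlatTangle v w) (y : T.Space) :
    T.dotEquiv.symm (T.putDot 1 y) = (0, y) := by
  rw [AddEquiv.symm_apply_eq]
  exact ((congrArg (· + T.putDot 1 y) (map_zero (T.putDot 0))).trans (zero_add _)).symm

theorem dotEquiv_symm_op_smul (T : FlatTangle v w) (r : (ArcRing v)ᵐᵒᵖ) (z : T.addCircle.Space) :
    T.dotEquiv.symm (r • z) = r • T.dotEquiv.symm z := by
  obtain ⟨⟨y, y'⟩, rfl⟩ := T.dotEquiv.surjective z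
  rw [AddEquiv.symm_apply_apply, AddEquiv.symm_apply_eq]
  change r • (T.putDot 0 y + T.putDot 1 y') = T.putDot 0 (r • y) + T.putDot 1 (r • y')
  rw [putDot_op_smul, putDot_op_smul, smul_add]

end FlatTangle

namespace BalancedTensor

variable {R S B B' M : Type} [Ring R] [Ring S] [AddCommGroup B] [Module R B] [Module Sᵐᵒᵖ B]
  [SMulCommClass R Sᵐᵒᵖ B] [AddCommGroup B'] [Module R B'] [Module Sᵐᵒᵖ B']
  [SMulCommClass R Sᵐᵒᵖ B'] [AddCommGroup M] [Module S M]

variable (R M) in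
/-- The map `f ⊗ id`. -/
def mapLeft (f : B →+ B') (hf : ∀ (s : Sᵐᵒᵖ) b, f (s • b) = s • f b) :
    BalancedTensor R S B M →+ BalancedTensor R S B' M :=
  lift ((mkHom R S).comp f) fun s b m => by
    change mk R S (f (MulOpposite.op s • b)) m = _
    rw [hf, mk_balanced]
    rfl

theorem mapLeft_mk (f : B →+ B') (hf : ∀ (s : Sᵐᵒᵖ) b, f (s • b) = s • f b) (b : B) (m : M) :
    mapLeft R M f hf (mk R S b m) = mk R S (f b) m := lift_mk _ _ _ _

theorem mapLeft_smul (f : B →+ B') (hf : ∀ (s : Sᵐᵒᵖ) b, f (s • b) = s • f b)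
    (hf' : ∀ (r : R) b, f (r • b) = r • f b) (r : R) (t : BalancedTensor R S B M) :
    mapLeft R M f hf (r • t) = r • mapLeft R M f hf t := by
  induction t using induction with
  | h0 => rw [smul_zero, map_zero, smul_zero]
  | hadd s t hs ht => rw [smul_add, map_add, map_add, hs, ht, smul_add]
  | hmk b m => rw [smul_mk, mapLeft_mk, mapLeft_mk, hf', smul_mk]

theorem mapLeft_mem_part (f : B →+ B') (hf : ∀ (s : Sᵐᵒᵖ) b, f (s • b) = s • f b)
    {ℬ : ℤ → AddSubgroup B} {ℬ' : ℤ → AddSubgroup B'} {ℳ : ℤ → AddSubgroup M} {e : ℤ}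
    (h : ∀ d, ∀ b ∈ ℬ d, f b ∈ ℬ' (d + e)) (d : ℤ) (t) (ht : t ∈ part R S ℬ ℳ d) :
    mapLeft R M f hf t ∈ part R S ℬ' ℳ (d + e) := by
  refine (AddSubgroup.closure_le (K := (part R S ℬ' ℳ (d + e)).comap (mapLeft R M f hf))).mpr ?_ ht
  rintro _ ⟨i, j, b, m, hb, hm, rfl, rfl⟩
  have := mk_mem_part (R := R) (S := S) (h i b hb) hm
  rw [← mapLeft_mk f hf, add_right_comm] at this
  exact this

end BalancedTensor

namespace FlatTangle

variable {u v w t : Weight n k}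

section

variable (T : FlatTangle v w) (M : Type) [AddCommGroup M] [Module (ArcRing v) M]

/-- The map `(F(T) ⊗ M) ⊕ (F(T) ⊗ M) → F(T ⊔ O) ⊗ M`. -/
def circleHom : BalancedTensor (ArcRing w) (ArcRing v) T.Space M ×
    BalancedTensor (ArcRing w) (ArcRing v) T.Space M →+
    BalancedTensor (ArcRing w) (ArcRing v) T.addCircle.Space M :=
  (BalancedTensor.mapLeft _ M (T.putDot 1) (T.putDot_op_smul 1)).coprod
    (BalancedTensor.mapLeft _ M (T.putDot 0) (T.putDot_op_smul 0))

theorem circleHom_bijective : Function.Bijective (T.circleHom M) := by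
  let p₀ : BalancedTensor (ArcRing w) (ArcRing v) T.addCircle.Space M →+
      BalancedTensor (ArcRing w) (ArcRing v) T.Space M :=
    BalancedTensor.mapLeft _ M ((AddMonoidHom.fst _ _).comp T.dotEquiv.symm.toAddMonoidHom)
      fun r z => congrArg Prod.fst (T.dotEquiv_symm_op_smul r z)
  let p₁ : BalancedTensor (ArcRing w) (ArcRing v) T.addCircle.Space M →+
      BalancedTensor (ArcRing w) (ArcRing v) T.Space M :=
    BalancedTensor.mapLeft _ M ((AddMonoidHom.snd _ _).comp T.dotEquiv.symm.toAddMonoidHom)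
      fun r z => congrArg Prod.snd (T.dotEquiv_symm_op_smul r z)
  have h₀ : ∀ z m, p₀ (BalancedTensor.mk _ _ z m) = BalancedTensor.mk _ _ (T.dotEquiv.symm z).1 m :=
    fun z m => BalancedTensor.mapLeft_mk _ _ _ _
  have h₁ : ∀ z m, p₁ (BalancedTensor.mk _ _ z m) = BalancedTensor.mk _ _ (T.dotEquiv.symm z).2 m :=
    fun z m => BalancedTensor.mapLeft_mk _ _ _ _
  refine Function.bijective_iff_has_inverse.mpr ⟨fun z => (p₁ z, p₀ z), ?_, ?_⟩
  · have e₁₁ : ∀ t, p₁ (BalancedTensor.mapLeft _ M (T.putDot 1) (T.putDot_op_smul 1) t) = t :=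
      DFunLike.congr_fun (f := p₁.comp _) (g := AddMonoidHom.id _)
        (BalancedTensor.hom_ext fun y m => by
          rw [AddMonoidHom.comp_apply, BalancedTensor.mapLeft_mk, h₁, dotEquiv_symm_putDot_one]
          rfl)
    have e₁₀ : ∀ t, p₁ (BalancedTensor.mapLeft _ M (T.putDot 0) (T.putDot_op_smul 0) t) = 0 :=
      DFunLike.congr_fun (f := p₁.comp _) (g := 0) (BalancedTensor.hom_ext fun y m => by
        rw [AddMonoidHom.comp_apply, BalancedTensor.mapLeft_mk, h₁, dotEquiv_symm_putDot_zero]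
        exact BalancedTensor.mk_zero_left m)
    have e₀₁ : ∀ t, p₀ (BalancedTensor.mapLeft _ M (T.putDot 1) (T.putDot_op_smul 1) t) = 0 :=
      DFunLike.congr_fun (f := p₀.comp _) (g := 0) (BalancedTensor.hom_ext fun y m => by
        rw [AddMonoidHom.comp_apply, BalancedTensor.mapLeft_mk, h₀, dotEquiv_symm_putDot_one]
        exact BalancedTensor.mk_zero_left m)
    have e₀₀ : ∀ t, p₀ (BalancedTensor.mapLeft _ M (T.putDot 0) (T.putDot_op_smul 0) t) = t :=
      DFunLike.congr_fun (f := p₀.comp _) (g := AddMonoidHom.id _)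
        (BalancedTensor.hom_ext fun y m => by
          rw [AddMonoidHom.comp_apply, BalancedTensor.mapLeft_mk, h₀, dotEquiv_symm_putDot_zero]
          rfl)
    rintro ⟨t, t'⟩
    refine Prod.ext ((map_add p₁ _ _).trans ?_) ((map_add p₀ _ _).trans ?_)
    · exact (congrArg₂ (· + ·) (e₁₁ t) (e₁₀ t')).trans (add_zero t)
    · exact (congrArg₂ (· + ·) (e₀₁ t) (e₀₀ t')).trans (zero_add t')
  · refine DFunLike.congr_fun (f := (T.circleHom M).comp (p₁.prod p₀)) (g := AddMonoidHom.id _)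
      (BalancedTensor.hom_ext fun z m => ?_)
    obtain ⟨⟨y, y'⟩, rfl⟩ := T.dotEquiv.surjective z
    change BalancedTensor.mapLeft _ M _ _ (p₁ _) + BalancedTensor.mapLeft _ M _ _ (p₀ _) = _
    rw [h₀, h₁, AddEquiv.symm_apply_apply, BalancedTensor.mapLeft_mk, BalancedTensor.mapLeft_mk,
      ← BalancedTensor.mk_add_left, add_comm]
    rfl

theorem circleHom_smul (r : ArcRing w) (t) : T.circleHom M (r • t) = r • T.circleHom M t := by
  change BalancedTensor.mapLeft _ M _ _ (r • t.1) + BalancedTensor.mapLeft _ M _ _ (r • t.2) =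
    r • (BalancedTensor.mapLeft _ M _ _ t.1 + BalancedTensor.mapLeft _ M _ _ t.2)
  rw [BalancedTensor.mapLeft_smul _ _ (T.putDot_smul 1),
    BalancedTensor.mapLeft_smul _ _ (T.putDot_smul 0), smul_add]

end

/-- Adding a circle to `T` amounts to replacing `F(T) ⊗ M` by `(F(T) ⊗ M){1} ⊕ (F(T) ⊗ M){-1}`. -/
def circleIso (T : FlatTangle v w) :
    T.tensorFunctor ⋙ GrMod.double _ ≅ T.addCircle.tensorFunctor :=
  NatIso.ofComponents (fun M => GrMod.isoMk
      (LinearEquiv.ofBijective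
        { T.circleHom M.carrier with map_smul' := T.circleHom_smul M.carrier }
        (T.circleHom_bijective M.carrier)) fun d t ht => by
      have h₁ := BalancedTensor.mapLeft_mem_part (R := ArcRing w) (T.putDot 1) (T.putDot_op_smul 1)
        (ℬ := T.part) (ℬ' := T.addCircle.part) (ℳ := M.gr) (e := 1) (fun d y hy => by have := T.putDot_mem_part 1 hy; convert this using 2; simp; ring)
        (d - 1) t.1 ht.1
      have h₂ := BalancedTensor.mapLeft_mem_part (R := ArcRing w) (T.putDot 0) (T.putDot_op_smul 0)
        (ℬ := T.part) (ℬ' := T.addCircle.part) (ℳ := M.gr) (e := -1) (fun d y hy => by have := T.putDot_mem_part 0 hy; convert this using 2; simp; ring)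
        (d - -1) t.2 ht.2
      rw [sub_add_cancel] at h₁ h₂
      exact add_mem h₁ h₂) fun {M N} f => by
    refine GrMod.hom_ext (LinearMap.ext fun t => ?_)
    have key : ∀ e t, BalancedTensor.mapLeft _ _ (T.putDot e) (T.putDot_op_smul e)
        (BalancedTensor.map (ArcRing w) (ArcRing v) T.Space f.lin t) =
        BalancedTensor.map (ArcRing w) (ArcRing v) T.addCircle.Space f.lin
          (BalancedTensor.mapLeft _ _ (T.putDot e) (T.putDot_op_smul e) t) := fun e =>
      DFunLike.congr_fun (f := (BalancedTensor.mapLeft _ _ _ _).comp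
        (BalancedTensor.map _ _ _ f.lin).toAddMonoidHom)
        (g := (BalancedTensor.map _ _ _ f.lin).toAddMonoidHom.comp (BalancedTensor.mapLeft _ _ _ _))
        (BalancedTensor.hom_ext fun y m => by
          rw [AddMonoidHom.comp_apply, AddMonoidHom.comp_apply, BalancedTensor.mapLeft_mk]
          exact BalancedTensor.mapLeft_mk _ _ _ _)
    refine Eq.trans ?_ (map_add (BalancedTensor.map (ArcRing w) (ArcRing v) T.addCircle.Space f.lin)
      _ _).symm
    exact congrArg₂ (· + ·) (key 1 t.1) (key 0 t.2)

end FlatTangle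

end

noncomputable section

open Relation Equiv Equiv.Perm

variable {n k : ℕ}

namespace FlatTangle

variable {u v w t : Weight n k}

/-- The composition of two flat tangles, both copies of the points in the middle being kept. -/
def comp (T₁ : FlatTangle w u) (T₂ : FlatTangle v w) (hw : Matching v → Nonempty (Matching w)) :
    FlatTangle v u where
  Pt := T₁.Pt ⊕ T₂.Pt
  finite := inferInstance
  bot p := Sum.inr (T₂.bot p)
  top p := Sum.inl (T₁.top p)
  adj := glued T₁ T₂
  bot_inj _ _ h := T₂.bot_inj (Sum.inr_injective h)
  top_inj _ _ h := T₁.top_inj (Sum.inl_injective h)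
  colour p q h := by cases h
  orient c a := by
    classical
    obtain ⟨b⟩ := hw a
    obtain ⟨θ₁, a1, a2, a3, a4⟩ := T₁.orient c b
    obtain ⟨θ₂, b1, b2, b3, b4⟩ := T₂.orient b a
    have hl := isLayer_mid T₁ T₂ b
    have s0 : SurgeryState (fun p => Sum.inl (T₁.bot p)) (fun p => Sum.inr (T₂.top p)) b.toFun
        (fun p => Positive w p.1) (Equiv.sumCongr θ₁ θ₂) (Equiv.sumCongr θ₁ θ₂) ∅ :=
      SurgeryState.zero (fun p hp => congrArg Sum.inl (a2 p hp)) (fun p hp => congrArg Sum.inr (b1 p hp))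
    have s1 := s0.list hl b.arcs (by simp) (by simp) b.arcs_pairwise
    have hu : (∅ ∪ {q | q ∈ b.arcs ∨ b.toFun q ∈ b.arcs} : Set (Ones w)) = Set.univ := by
      ext q; simpa using b.arcs_cover q
    rw [hu] at s1
    obtain ⟨θ, c1, c2, c3⟩ : ∃ θ : Perm (T₁.Pt ⊕ T₂.Pt), SurgeryState _ _ _ _ _ θ _ := ⟨_, s1⟩
    simp only [Set.mem_univ, if_true] at c1 c2
    have o1 : ∀ x, (∀ p, ¬ Positive w p.1 → x ≠ T₁.bot p) → (Sum.inl x : T₁.Pt ⊕ T₂.Pt) ∉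
        exits (fun p => Sum.inl (T₁.bot p)) (fun p => Sum.inr (T₂.top p))
          (fun p : Ones w => Positive w p.1) := by
      rintro x hx (⟨p, hp, e⟩ | ⟨p, hp, e⟩)
      · exact hx p hp (Sum.inl_injective e)
      · cases e
    have o2 : ∀ x, (∀ p, Positive w p.1 → x ≠ T₂.top p) → (Sum.inr x : T₁.Pt ⊕ T₂.Pt) ∉
        exits (fun p => Sum.inl (T₁.bot p)) (fun p => Sum.inr (T₂.top p))
          (fun p : Ones w => Positive w p.1) := by
      rintro x hx (⟨p, hp, e⟩ | ⟨p, hp, e⟩)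
      · cases e
      · exact hx p hp (Sum.inr_injective e)
    refine ⟨θ, fun p hp => ?_, fun p hp => ?_, ?_, ?_⟩
    · exact (c3 _ (o1 _ fun q hq => T₁.top_ne_bot hp hq)).trans (congrArg Sum.inl (a1 p hp))
    · exact (c3 _ (o2 _ fun q hq => (T₂.top_ne_bot hq hp).symm)).trans (congrArg Sum.inr (b2 p hp))
    · rintro (x | x) hz
      · by_cases hx : ∃ p, ¬ Positive w p.1 ∧ x = T₁.bot p
        · obtain ⟨p, hp, rfl⟩ := hx
          rw [c1 p hp]
          exact Or.inl (Or.inr ⟨p, rfl, rfl⟩)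
        · rw [c3 _ (o1 x fun p hp e => hx ⟨p, hp, e⟩)]
          refine (a3 x ?_).imp (fun h => Or.inl (Sum.LiftRel.inl h))
            (fun h => Or.inl (Sum.LiftRel.inl h))
          rintro (⟨p, hp, e⟩ | h)
          · exact hz (Or.inl ⟨p, hp, congrArg Sum.inl e⟩)
          · exact hx h
      · by_cases hx : ∃ p, Positive w p.1 ∧ x = T₂.top p
        · obtain ⟨p, hp, rfl⟩ := hx
          rw [c2 p hp]
          exact Or.inr (Or.inr ⟨p, rfl, rfl⟩)
        · rw [c3 _ (o2 x fun p hp e => hx ⟨p, hp, e⟩)]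
          refine (b3 x ?_).imp (fun h => Or.inl (Sum.LiftRel.inr h))
            (fun h => Or.inl (Sum.LiftRel.inr h))
          rintro (h | ⟨p, hp, e⟩)
          · exact hx h
          · exact hz (Or.inr ⟨p, hp, congrArg Sum.inr e⟩)
    · have n1 : ∀ x, x ∉ {x | (∃ p, Positive u p.1 ∧ x = T₁.top p) ∨
          ∃ p, ¬ Positive w p.1 ∧ x = T₁.bot p} → (Sum.inl x : T₁.Pt ⊕ T₂.Pt) ∉
          {x | (∃ p, Positive u p.1 ∧ x = Sum.inl (T₁.top p)) ∨
            ∃ p, ¬ Positive v p.1 ∧ x = Sum.inr (T₂.bot p)} ∧ Sum.inl (θ₁ x) = θ (Sum.inl x) := by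
        refine fun x hx => ⟨?_, (c3 _ (o1 x fun p hp e => hx (Or.inr ⟨p, hp, e⟩))).symm⟩
        rintro (⟨p, hp, e⟩ | ⟨p, hp, e⟩)
        · exact hx (Or.inl ⟨p, hp, Sum.inl_injective e⟩)
        · cases e
      have n2 : ∀ x, x ∉ {x | (∃ p, Positive w p.1 ∧ x = T₂.top p) ∨
          ∃ p, ¬ Positive v p.1 ∧ x = T₂.bot p} → (Sum.inr x : T₁.Pt ⊕ T₂.Pt) ∉
          {x | (∃ p, Positive u p.1 ∧ x = Sum.inl (T₁.top p)) ∨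
            ∃ p, ¬ Positive v p.1 ∧ x = Sum.inr (T₂.bot p)} ∧ Sum.inr (θ₂ x) = θ (Sum.inr x) := by
        refine fun x hx => ⟨?_, (c3 _ (o2 x fun p hp e => hx (Or.inl ⟨p, hp, e⟩))).symm⟩
        rintro (⟨p, hp, e⟩ | ⟨p, hp, e⟩)
        · cases e
        · exact hx (Or.inr ⟨p, hp, Sum.inr_injective e⟩)
      rintro z z' (h | ⟨p, rfl, rfl⟩)
      · rcases h with h | h
        · rcases a4 _ _ h with ⟨h1, rfl⟩ | ⟨h1, rfl⟩
          · exact Or.inl (n1 _ h1)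
          · exact Or.inr (n1 _ h1)
        · rcases b4 _ _ h with ⟨h1, rfl⟩ | ⟨h1, rfl⟩
          · exact Or.inl (n2 _ h1)
          · exact Or.inr (n2 _ h1)
      · by_cases hp : Positive w p.1
        · refine Or.inr ⟨?_, (c2 p hp).symm⟩
          rintro (⟨q, hq, e⟩ | ⟨q, hq, e⟩)
          · cases e
          · exact T₂.top_ne_bot hp hq (Sum.inr_injective e)
        · refine Or.inl ⟨?_, (c1 p hp).symm⟩
          rintro (⟨q, hq, e⟩ | ⟨q, hq, e⟩)
          · exact T₁.top_ne_bot hq hp (Sum.inl_injective e).symm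
          · cases e

/-- The composition of two flat tangles as a composition. -/
def glueComp (T₁ : FlatTangle w u) (T₂ : FlatTangle v w) (hw : Matching v → Nonempty (Matching w)) :
    Glue T₁ T₂ (comp T₁ T₂ hw) where
  π := id
  conn _ _ := Iff.rfl
  surj z := ⟨z, EqvGen.refl _⟩
  top _ := EqvGen.refl _
  bot _ := EqvGen.refl _

/-- The components of `T` that meet the boundary are labelled by the labels `f p` of the positions `p` of
their endpoints; the label `none` is that of one circle if `o` holds, and does not occur otherwise. -/
def Marked (T : FlatTangle v w) (f : Fin n → Fin n) (o : Prop) : Prop :=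
  ∃ l : T.Pt → Option (Fin n), (∀ x y, EqvGen T.adj x y ↔ l x = l y) ∧
    (∀ p, l (T.top p) = some (f p.1)) ∧ (∀ p, l (T.bot p) = some (f p.1)) ∧
    (∀ x q, l x = some q → (∃ p : Ones w, f p.1 = q) ∨ ∃ p : Ones v, f p.1 = q) ∧
    ((∃ x, l x = none) ↔ o)

theorem Marked.addCircle {T : FlatTangle v w} {f : Fin n → Fin n} (h : T.Marked f False) :
    T.addCircle.Marked f True := by
  obtain ⟨l, h1, h2, h3, h4, h5⟩ := h
  simp only [iff_false, not_exists] at h5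
  refine ⟨fun x => x.bind l, ?_, h2, h3, ?_, ?_⟩
  · intro x y
    constructor
    · intro h
      induction h with
      | rel x y h =>
        cases h with
        | some h => exact (h1 _ _).mp (EqvGen.rel _ _ h)
        | none => rfl
      | refl x => rfl
      | symm x y _ ih => exact ih.symm
      | trans x y z _ _ ih ih' => exact ih.trans ih'
    · intro h
      rcases x with _ | x <;> rcases y with _ | y
      · exact EqvGen.refl _
      · exact absurd h.symm (h5 y)
      · exact absurd h (h5 x)
      · exact eqvGen_map some (fun x y h => EqvGen.rel _ _ (Option.Rel.some h)) ((h1 x y).mpr h)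
  · rintro (_ | x) q h
    · cases h
    · exact h4 x q h
  · simp only [iff_true]
    exact ⟨none, rfl⟩

/-- Compositions with the same labels agree. -/
theorem Marked.glue {T₁ : FlatTangle w u} {T₂ : FlatTangle v w} {hw} {T : FlatTangle v u}
    {f : Fin n → Fin n} {o : Prop} (h : (comp T₁ T₂ hw).Marked f o) (h' : T.Marked f o) :
    Nonempty (Glue T₁ T₂ T) := by
  obtain ⟨l, h1, h2, h3, h4, h5⟩ := h
  obtain ⟨l', h1', h2', h3', h4', h5'⟩ := h'
  have key : ∀ x, ∃ z, l' z = l x := by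
    intro x
    cases e : l x with
    | none =>
      exact h5'.mpr (h5.mp ⟨x, e⟩)
    | some q =>
      rcases h4 x q e with ⟨p, rfl⟩ | ⟨p, rfl⟩
      · exact ⟨_, h2' p⟩
      · exact ⟨_, h3' p⟩
  have key' : ∀ z, ∃ x, l x = l' z := by
    intro z
    cases e : l' z with
    | none =>
      exact h5.mpr (h5'.mp ⟨z, e⟩)
    | some q =>
      rcases h4' z q e with ⟨p, rfl⟩ | ⟨p, rfl⟩
      · exact ⟨_, h2 p⟩
      · exact ⟨_, h3 p⟩
  choose π hπ using key
  refine ⟨⟨π, fun x y => ?_, fun z => ?_, fun p => ?_, fun p => ?_⟩⟩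
  · exact (h1 x y).trans ((Eq.congr (hπ x) (hπ y)).symm.trans (h1' _ _).symm)
  · obtain ⟨x, hx⟩ := key' z
    exact ⟨x, (h1' _ _).mpr ((hπ x).trans hx)⟩
  · exact (h1' _ _).mpr ((hπ _).trans ((h2 p).trans (h2' p).symm))
  · exact (h1' _ _).mpr ((hπ _).trans ((h3 p).trans (h3' p).symm))

end FlatTangle

end

noncomputable section

open Relation Equiv Equiv.Perm

variable {n k : ℕ}

/-- The positions `p` and `q` are equal or exchanged by the `i`-th simple root. -/
def Near (i : Fin (n - 1)) (p q : Fin n) : Prop :=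
  (p ≠ lft i ∧ p ≠ rgt i ∧ q = p) ∨ ((p = lft i ∨ p = rgt i) ∧ (q = lft i ∨ q = rgt i))

namespace FlatTangle

variable {u v w t : Weight n k}

/-- The points of a composition of elementary tangles for the simple roots `I t`, `s ≤ t < e`, located by a
level `ℓ` and a position `p`; there is such a point if the weight `W ℓ` has a 1 in position `p`. -/
structure Chart (T : FlatTangle v w) (W : ℕ → Fin n → ℤ) (I : ℕ → Fin (n - 1)) (s e : ℕ) where
  Φ : T.Pt → ℕ × Fin n
  le : s ≤ e
  bot_eq : W s = v.1
  top_eq : W e = w.1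
  const : ∀ t p, s ≤ t → t < e → p ≠ lft (I t) → p ≠ rgt (I t) → W (t + 1) p = W t p
  range : ∀ x, s ≤ (Φ x).1 ∧ (Φ x).1 ≤ e
  one : ∀ x, W (Φ x).1 (Φ x).2 = 1
  top : ∀ p, Φ (T.top p) = (e, p.1)
  bot : ∀ p, Φ (T.bot p) = (s, p.1)
  same : ∀ x y, Φ x = Φ y → EqvGen T.adj x y
  exist : ∀ l p, s ≤ l → l ≤ e → W l p = 1 → ∃ x, Φ x = (l, p)
  join : ∀ t x y, s ≤ t → t < e → ((Φ x).1 = t ∨ (Φ x).1 = t + 1) →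
    ((Φ y).1 = t ∨ (Φ y).1 = t + 1) → Near (I t) (Φ x).2 (Φ y).2 → EqvGen T.adj x y
  edge : ∀ x y, T.adj x y → Φ x = Φ y ∨ ∃ t, s ≤ t ∧ t < e ∧ ((Φ x).1 = t ∨ (Φ x).1 = t + 1) ∧
    ((Φ y).1 = t ∨ (Φ y).1 = t + 1) ∧ Near (I t) (Φ x).2 (Φ y).2

/-- The chart of an elementary tangle. -/
def Chart.elem {i : Fin (n - 1)} (h : Neighbours i v w) {W : ℕ → Fin n → ℤ} {I : ℕ → Fin (n - 1)}
    {s : ℕ} (hv : W s = v.1) (hw : W (s + 1) = w.1) (hI : I s = i) :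
    (elemTangle i v w h).Chart W I s (s + 1) where
  Φ := Sum.elim (fun p => (s, p.1)) fun p => (s + 1, p.1)
  le := by omega
  bot_eq := hv
  top_eq := hw
  const t p h1 h2 h3 h4 := by
    obtain rfl : s = t := by omega
    obtain ⟨δ, -, hδ⟩ := ElemTangle.exists_sign h
    rw [hI] at h3 h4
    rw [hw, hv, hδ, ElemTangle.root_other i h3 h4, mul_zero, add_zero]
  range := by rintro (x | x) <;> simp
  one := by
    rintro (x | x)
    · exact (congrFun hv _).trans x.2
    · exact (congrFun hw _).trans x.2
  top _ := rfl
  bot _ := rfl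
  same := by
    rintro (x | x) (y | y) h <;> have h1 := congrArg Prod.fst h <;> have h2 := congrArg Prod.snd h <;>
      simp at h1 h2
    · rw [Subtype.ext h2]; exact EqvGen.refl _
    · rw [Subtype.ext h2]; exact EqvGen.refl _
  exist l p h1 h2 hp := by
    obtain rfl | rfl : l = s ∨ l = s + 1 := by omega
    · exact ⟨Sum.inl ⟨p, by rw [← hv]; exact hp⟩, rfl⟩
    · exact ⟨Sum.inr ⟨p, by rw [← hw]; exact hp⟩, rfl⟩
  join t x y h1 h2 _ _ h := by
    obtain rfl : s = t := by omega
    by_cases hxy : x = y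
    · rw [hxy]; exact EqvGen.refl _
    · refine EqvGen.rel _ _ ⟨hxy, ?_⟩
      rw [hI] at h
      rcases x with x | x <;> rcases y with y | y <;> exact h
  edge x y hxy := by
    refine Or.inr ⟨s, le_refl s, Nat.lt_succ_self s, ?_, ?_, ?_⟩
    · rcases x with x | x
      · exact Or.inl rfl
      · exact Or.inr rfl
    · rcases y with x | x
      · exact Or.inl rfl
      · exact Or.inr rfl
    · have := hxy.2
      rw [hI]
      rcases x with x | x <;> rcases y with y | y <;> exact this

/-- The chart of a composition. -/
def Chart.comp {T₁ : FlatTangle w u} {T₂ : FlatTangle v w} {W : ℕ → Fin n → ℤ}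
    {I : ℕ → Fin (n - 1)} {s m e : ℕ} (C₁ : T₁.Chart W I m e) (C₂ : T₂.Chart W I s m) (hw) :
    (T₁.comp T₂ hw).Chart W I s e := by
  have inl_eqv : ∀ {x y}, EqvGen T₁.adj x y → EqvGen (T₁.glued T₂) (Sum.inl x) (Sum.inl y) :=
    fun h => eqvGen_map Sum.inl (fun _ _ h => EqvGen.rel _ _ (Or.inl (Sum.LiftRel.inl h))) h
  have inr_eqv : ∀ {x y}, EqvGen T₂.adj x y → EqvGen (T₁.glued T₂) (Sum.inr x) (Sum.inr y) :=
    fun h => eqvGen_map Sum.inr (fun _ _ h => EqvGen.rel _ _ (Or.inl (Sum.LiftRel.inr h))) h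
  have mid : ∀ x y, C₁.Φ x = C₂.Φ y → EqvGen (T₁.glued T₂) (Sum.inl x) (Sum.inr y) := by
    intro x y h
    have h1 := (C₁.range x).1
    have h2 := (C₂.range y).2
    rw [h] at h1
    have h3 : (C₂.Φ y).1 = m := by omega
    have h4 : w.1 (C₂.Φ y).2 = 1 := by
      have := C₂.one y
      rw [h3] at this
      exact (congrFun C₂.top_eq _).symm.trans this
    have h5 := C₁.same x (T₁.bot ⟨_, h4⟩) (by rw [C₁.bot, h]; exact Prod.ext h3 rfl)
    have h6 := C₂.same (T₂.top ⟨_, h4⟩) y (by rw [C₂.top]; exact Prod.ext h3.symm rfl)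
    exact ((inl_eqv h5).trans _ _ _ (EqvGen.rel _ _ (Or.inr ⟨_, rfl, rfl⟩))).trans _ _ _ (inr_eqv h6)
  have up : ∀ x : T₁.Pt ⊕ T₂.Pt, m ≤ (Sum.elim C₁.Φ C₂.Φ x).1 → ∃ x', C₁.Φ x' = Sum.elim C₁.Φ C₂.Φ x ∧
      EqvGen (T₁.glued T₂) (Sum.inl x') x := by
    rintro (x | x) hx
    · exact ⟨x, rfl, EqvGen.refl _⟩
    · have hx : m ≤ (C₂.Φ x).1 := hx
      have h3 : (C₂.Φ x).1 = m := le_antisymm (C₂.range x).2 hx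
      obtain ⟨x', e⟩ := C₁.exist _ (C₂.Φ x).2 hx (h3.trans_le C₁.le) (C₂.one x)
      exact ⟨x', e, mid x' x e⟩
  have down : ∀ x : T₁.Pt ⊕ T₂.Pt, (Sum.elim C₁.Φ C₂.Φ x).1 ≤ m → ∃ x', C₂.Φ x' = Sum.elim C₁.Φ C₂.Φ x ∧
      EqvGen (T₁.glued T₂) (Sum.inr x') x := by
    rintro (x | x) hx
    · have hx : (C₁.Φ x).1 ≤ m := hx
      have h3 : (C₁.Φ x).1 = m := le_antisymm hx (C₁.range x).1
      obtain ⟨x', e⟩ := C₂.exist _ (C₁.Φ x).2 (C₂.le.trans_eq h3.symm) hx (C₁.one x)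
      exact ⟨x', e, (mid x x' e.symm).symm⟩
    · exact ⟨x, rfl, EqvGen.refl _⟩
  exact {
    Φ := Sum.elim C₁.Φ C₂.Φ
    le := C₂.le.trans C₁.le
    bot_eq := C₂.bot_eq
    top_eq := C₁.top_eq
    const := fun t p h1 h2 h3 h4 => by
      by_cases h : t < m
      · exact C₂.const t p h1 h h3 h4
      · exact C₁.const t p (by omega) h2 h3 h4
    range := by
      have := C₁.le
      have := C₂.le
      rintro (x | x)
      · have := C₁.range x
        exact ⟨by simp; omega, by simp; omega⟩
      · have := C₂.range x
        exact ⟨by simp; omega, by simp; omega⟩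
    one := by
      rintro (x | x)
      · exact C₁.one x
      · exact C₂.one x
    top := C₁.top
    bot := C₂.bot
    same := by
      rintro (x | x) (y | y) h
      · exact inl_eqv (C₁.same x y h)
      · exact mid x y h
      · exact (mid y x h.symm).symm
      · exact inr_eqv (C₂.same x y h)
    exist := fun l p h1 h2 hp => by
      by_cases h : l ≤ m
      · obtain ⟨x, hx⟩ := C₂.exist l p h1 h hp
        exact ⟨Sum.inr x, hx⟩
      · obtain ⟨x, hx⟩ := C₁.exist l p (by omega) h2 hp
        exact ⟨Sum.inl x, hx⟩
    join := fun t x y h1 h2 hx hy h => by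
      by_cases ht : t < m
      · obtain ⟨x', ex, hx'⟩ := down x (by omega)
        obtain ⟨y', ey, hy'⟩ := down y (by omega)
        rw [← ex] at hx h
        rw [← ey] at hy h
        exact (hx'.symm.trans _ _ _ (inr_eqv (C₂.join t x' y' h1 ht hx hy h))).trans _ _ _ hy'
      · obtain ⟨x', ex, hx'⟩ := up x (by omega)
        obtain ⟨y', ey, hy'⟩ := up y (by omega)
        rw [← ex] at hx h
        rw [← ey] at hy h
        exact (hx'.symm.trans _ _ _ (inl_eqv (C₁.join t x' y' (by omega) h2 hx hy h))).trans _ _ _ hy'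
    edge := by
      have := C₁.le
      have := C₂.le
      rintro _ _ ((h | h) | ⟨p, rfl, rfl⟩)
      · refine (C₁.edge _ _ h).imp id fun ⟨t, h1, h2, h3⟩ => ⟨t, by omega, h2, h3⟩
      · refine (C₂.edge _ _ h).imp id fun ⟨t, h1, h2, h3⟩ => ⟨t, h1, by omega, h3⟩
      · exact Or.inl ((C₁.bot p).trans (C₂.top p).symm) }

theorem _root_.near_refl (i : Fin (n - 1)) (p : Fin n) : Near i p p := by
  by_cases h : p = lft i ∨ p = rgt i
  · exact Or.inr ⟨h, h⟩
  · exact Or.inl ⟨(not_or.mp h).1, (not_or.mp h).2, rfl⟩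

namespace Chart

variable {T : FlatTangle v w} {W : ℕ → Fin n → ℤ} {I : ℕ → Fin (n - 1)} {s e : ℕ}

theorem marked (C : T.Chart W I s e) (f : Fin n → Fin n) (circ : ℕ × Fin n → Prop) (o : Prop)
    (ho : (∃ x, circ (C.Φ x)) ↔ o)
    (hf : ∀ t, s ≤ t → t < e → f (lft (I t)) = f (rgt (I t)))
    (hc : ∀ t, s ≤ t → t < e → ∀ z z' : ℕ × Fin n, circ z → (z.1 = t ∨ z.1 = t + 1) →
      (z'.1 = t ∨ z'.1 = t + 1) → W z'.1 z'.2 = 1 → (Near (I t) z.2 z'.2 ∨ Near (I t) z'.2 z.2) →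
      circ z')
    (hs : ∀ z, circ z → z.1 ≠ s ∧ z.1 ≠ e)
    (h1 : ∀ x y, ¬ circ (C.Φ x) → ¬ circ (C.Φ y) → f (C.Φ x).2 = f (C.Φ y).2 → EqvGen T.adj x y)
    (h2 : ∀ x y, circ (C.Φ x) → circ (C.Φ y) → EqvGen T.adj x y)
    (h3 : ∀ x, ¬ circ (C.Φ x) → (∃ p, w.1 p = 1 ∧ f p = f (C.Φ x).2) ∨
      ∃ p, v.1 p = 1 ∧ f p = f (C.Φ x).2) : T.Marked f o := by
  classical
  have hN : ∀ t, s ≤ t → t < e → ∀ p q, Near (I t) p q → f p = f q := by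
    rintro t ht ht' p q (⟨-, -, rfl⟩ | ⟨rfl | rfl, rfl | rfl⟩)
    · rfl
    · rfl
    · exact hf t ht ht'
    · exact (hf t ht ht').symm
    · rfl
  refine ⟨fun x => if circ (C.Φ x) then none else some (f (C.Φ x).2), fun x y => ⟨fun h => ?_, fun h => ?_⟩,
    fun p => ?_, fun p => ?_, fun x q h => ?_, ?_⟩
  · induction h with
    | rel x y h =>
      rcases C.edge x y h with e | ⟨t, ht, ht', hx, hy, hn⟩
      · simp only [e]
      · have e1 : circ (C.Φ x) ↔ circ (C.Φ y) :=
          ⟨fun h => hc t ht ht' _ _ h hx hy (C.one y) (Or.inl hn),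
            fun h => hc t ht ht' _ _ h hy hx (C.one x) (Or.inr hn)⟩
        simp only [e1, hN t ht ht' _ _ hn]
    | refl x => rfl
    | symm x y _ ih => exact ih.symm
    | trans x y z _ _ ih ih' => exact ih.trans ih'
  · by_cases hx : circ (C.Φ x) <;> by_cases hy : circ (C.Φ y) <;> simp only [hx, hy, if_true, if_false] at h
    · exact h2 x y hx hy
    · cases h
    · cases h
    · exact h1 x y hx hy (Option.some_injective _ h)
  · have : ¬ circ (C.Φ (T.top p)) := fun h => (hs _ h).2 (by rw [C.top])
    exact (if_neg this).trans (by rw [C.top])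
  · have : ¬ circ (C.Φ (T.bot p)) := fun h => (hs _ h).1 (by rw [C.bot])
    exact (if_neg this).trans (by rw [C.bot])
  · by_cases hx : circ (C.Φ x)
    · simp only [if_pos hx] at h
      cases h
    · simp only [if_neg hx] at h
      obtain rfl := Option.some_injective _ h
      exact (h3 x hx).imp (fun ⟨p, hp, e⟩ => ⟨⟨p, hp⟩, e⟩) fun ⟨p, hp, e⟩ => ⟨⟨p, hp⟩, e⟩
  · rw [← ho]
    refine exists_congr fun x => ?_
    by_cases hx : circ (C.Φ x) <;> simp [hx]

theorem exists_succ (C : T.Chart W I s e) {t : ℕ} (ht : s ≤ t) (ht' : t < e) {x : T.Pt}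
    (hx : (C.Φ x).1 = t) (h : ¬ ((C.Φ x).2 = lft (I t) ∨ (C.Φ x).2 = rgt (I t))) :
    ∃ y, C.Φ y = (t + 1, (C.Φ x).2) ∧ EqvGen T.adj x y := by
  have h1 := C.one x
  rw [hx, ← C.const t _ ht ht' (not_or.mp h).1 (not_or.mp h).2] at h1
  obtain ⟨y, hy⟩ := C.exist _ _ (by omega) (by omega) h1
  refine ⟨y, hy, C.join t x y ht ht' (Or.inl hx) (Or.inr (by rw [hy])) ?_⟩
  rw [hy]
  exact near_refl _ _

theorem exists_pred (C : T.Chart W I s e) {t : ℕ} (ht : s ≤ t) (ht' : t < e) {x : T.Pt}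
    (hx : (C.Φ x).1 = t + 1) (h : ¬ ((C.Φ x).2 = lft (I t) ∨ (C.Φ x).2 = rgt (I t))) :
    ∃ y, C.Φ y = (t, (C.Φ x).2) ∧ EqvGen T.adj x y := by
  have h1 := C.one x
  rw [hx, C.const t _ ht ht' (not_or.mp h).1 (not_or.mp h).2] at h1
  obtain ⟨y, hy⟩ := C.exist _ _ (by omega) (by omega) h1
  refine ⟨y, hy, C.join t x y ht ht' (Or.inr hx) (Or.inl (by rw [hy])) ?_⟩
  rw [hy]
  exact near_refl _ _

/-- A strand away from all positions that are moved reaches the bottom. -/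
theorem exists_bot (C : T.Chart W I s e) {p : Fin n}
    (h : ∀ t, s ≤ t → t < e → ¬ (p = lft (I t) ∨ p = rgt (I t))) (l : ℕ) :
    ∀ x, C.Φ x = (l, p) → ∃ y, C.Φ y = (s, p) ∧ EqvGen T.adj x y := by
  induction l with
  | zero =>
    intro x hx
    have := (C.range x).1
    rw [hx] at this
    obtain rfl : s = 0 := by simpa using this
    exact ⟨x, hx, EqvGen.refl x⟩
  | succ l ih =>
    intro x hx
    have h1 := C.range x
    rw [hx] at h1
    simp only at h1
    by_cases hl : s = l + 1
    · subst hl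
      exact ⟨x, hx, EqvGen.refl x⟩
    · obtain ⟨y, hy, hxy⟩ := C.exists_pred (t := l) (x := x) (by omega) (by omega) (by rw [hx])
        (by rw [hx]; exact h l (by omega) (by omega))
      rw [hx] at hy
      obtain ⟨z, hz, hyz⟩ := ih y hy
      exact ⟨z, hz, hxy.trans _ _ _ hyz⟩

theorem strand (C : T.Chart W I s e) {p : Fin n}
    (h : ∀ t, s ≤ t → t < e → ¬ (p = lft (I t) ∨ p = rgt (I t))) {x y : T.Pt}
    (hx : (C.Φ x).2 = p) (hy : (C.Φ y).2 = p) : EqvGen T.adj x y := by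
  obtain ⟨x', hx', h1⟩ := C.exists_bot h _ x (Prod.ext rfl hx)
  obtain ⟨y', hy', h2⟩ := C.exists_bot h _ y (Prod.ext rfl hy)
  exact (h1.trans _ _ _ (C.same x' y' (hx'.trans hy'.symm))).trans _ _ _ h2.symm

theorem one_bot (C : T.Chart W I s e) {p : Fin n}
    (h : ∀ t, s ≤ t → t < e → ¬ (p = lft (I t) ∨ p = rgt (I t))) {x : T.Pt}
    (hx : (C.Φ x).2 = p) : v.1 p = 1 := by
  obtain ⟨x', hx', -⟩ := C.exists_bot h _ x (Prod.ext rfl hx)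
  have := C.one x'
  rw [hx'] at this
  exact (congrFun C.bot_eq p).symm.trans this

/-- The case that all components other than circles and vertical strands are connected to one point. -/
theorem marked_of_hub (C : T.Chart W I s e) (f : Fin n → Fin n) (m : Fin n) (B : Fin n → Prop)
    (hB : ∀ t, s ≤ t → t < e → ∀ p, p = lft (I t) ∨ p = rgt (I t) → B p)
    (hfB : ∀ p, B p → f p = f m) (hff : ∀ p q, f p = f q → p = q ∨ B p ∧ B q)
    (circ : ℕ × Fin n → Prop) (o : Prop)
    (ho : (∃ x, circ (C.Φ x)) ↔ o)
    (hc : ∀ t, s ≤ t → t < e → ∀ z z' : ℕ × Fin n, circ z → (z.1 = t ∨ z.1 = t + 1) →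
      (z'.1 = t ∨ z'.1 = t + 1) → W z'.1 z'.2 = 1 → (Near (I t) z.2 z'.2 ∨ Near (I t) z'.2 z.2) →
      circ z')
    (hs : ∀ z, circ z → z.1 ≠ s ∧ z.1 ≠ e)
    (h1 : ∃ z, ∀ x, ¬ circ (C.Φ x) → B (C.Φ x).2 → EqvGen T.adj x z)
    (h2 : ∀ x y, circ (C.Φ x) → circ (C.Φ y) → EqvGen T.adj x y)
    (h3 : (∃ p, W e p = 1 ∧ B p) ∨ ∃ p, W s p = 1 ∧ B p) : T.Marked f o := by
  obtain ⟨z, hz⟩ := h1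
  have hn : ∀ p, ¬ B p → ∀ t, s ≤ t → t < e → ¬ (p = lft (I t) ∨ p = rgt (I t)) :=
    fun p hp t ht ht' h => hp (hB t ht ht' p h)
  refine C.marked f circ o ho (fun t ht ht' => ?_) hc hs (fun x y hx hy e => ?_) h2 fun x hx => ?_
  · rw [hfB _ (hB t ht ht' _ (Or.inl rfl)), hfB _ (hB t ht ht' _ (Or.inr rfl))]
  · by_cases hb : B (C.Φ x).2 ∧ B (C.Φ y).2
    · exact (hz x hx hb.1).trans _ _ _ (hz y hy hb.2).symm
    · have e' := (hff _ _ e).resolve_right hb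
      exact C.strand (hn (C.Φ x).2 fun h => hb ⟨h, e' ▸ h⟩) rfl e'.symm
  · by_cases hb : B (C.Φ x).2
    · rcases h3 with ⟨p, hp, hp'⟩ | ⟨p, hp, hp'⟩
      · exact Or.inl ⟨p, by rw [← C.top_eq]; exact hp, by rw [hfB p hp', hfB _ hb]⟩
      · exact Or.inr ⟨p, by rw [← C.bot_eq]; exact hp, by rw [hfB p hp', hfB _ hb]⟩
    · exact Or.inr ⟨_, C.one_bot (hn _ hb) rfl, rfl⟩

end Chart

end FlatTangle

end

noncomputable section

open Relation Equiv Equiv.Perm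

variable {n k : ℕ}

/-- The positions `a, m` of the `i`-th and `m, c` of the `j`-th simple root, `i` and `j` being neighbours, and
the values `ε = ± 1` of the simple roots in these positions. -/
structure Corner (i j : Fin (n - 1)) (a m c : Fin n) (ε : ℤ) : Prop where
  i_iff : ∀ p, (p = lft i ∨ p = rgt i) ↔ (p = a ∨ p = m)
  j_iff : ∀ p, (p = lft j ∨ p = rgt j) ↔ (p = m ∨ p = c)
  am : a ≠ m
  mc : m ≠ c
  ac : a ≠ c
  sign : ε = 1 ∨ ε = -1
  ia : root i a = ε
  im : root i m = -ε
  ic : root i c = 0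
  ja : root j a = 0
  jm : root j m = ε
  jc : root j c = -ε

/-- The map of positions that sends `a`, `m`, `c` to `m`. -/
def pinch (a m c p : Fin n) : Fin n := if p = a ∨ p = c then m else p

theorem pinch_of {a m c p : Fin n} (h : p = a ∨ p = m ∨ p = c) : pinch a m c p = m := by
  unfold pinch
  split_ifs with h'
  · rfl
  · tauto

theorem eq_of_pinch {a m c p q : Fin n} (h : pinch a m c p = pinch a m c q) :
    p = q ∨ (p = a ∨ p = m ∨ p = c) ∧ (q = a ∨ q = m ∨ q = c) := by
  unfold pinch at h
  split_ifs at h <;> subst_vars <;> tauto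

theorem pinch_comm (a m c : Fin n) : pinch c m a = pinch a m c := by
  funext p
  simp only [pinch, or_comm]

namespace Corner

variable {i j : Fin (n - 1)} {a m c : Fin n} {ε : ℤ}

theorem symm (h : Corner i j a m c ε) : Corner j i c m a (-ε) where
  i_iff p := (h.j_iff p).trans or_comm
  j_iff p := (h.i_iff p).trans or_comm
  am := h.mc.symm
  mc := h.am.symm
  ac := h.ac.symm
  sign := by have := h.sign; omega
  ia := h.jc
  im := by rw [h.jm, neg_neg]
  ic := h.ja
  ja := h.ic
  jm := h.im
  jc := by rw [h.ia, neg_neg]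

theorem root_ne (h : Corner i j a m c ε) {p : Fin n} (ha : p ≠ a) (hm : p ≠ m) : root i p = 0 := by
  have := not_or.mp (mt (h.i_iff p).mp (by tauto))
  exact ElemTangle.root_other i this.1 this.2

theorem exists_of (h : |(i : ℤ) - (j : ℤ)| = 1) : ∃ a m c : Fin n, ∃ ε : ℤ, Corner i j a m c ε := by
  have key : ∀ i j : Fin (n - 1), (j : ℕ) = i + 1 → Corner i j (lft i) (rgt i) (rgt j) 1 := by
    intro i j hij
    have e : rgt i = lft j := Fin.ext hij.symm
    have h1 : lft i ≠ rgt i := lft_ne_rgt i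
    have h2 : rgt i ≠ rgt j := e ▸ lft_ne_rgt j
    have h3 : lft i ≠ rgt j := by simp only [lft, rgt, ne_eq, Fin.mk.injEq]; omega
    exact {
      i_iff := fun p => Iff.rfl
      j_iff := fun p => by rw [e]
      am := h1
      mc := h2
      ac := h3
      sign := Or.inl rfl
      ia := ElemTangle.root_lft i
      im := ElemTangle.root_rgt i
      ic := ElemTangle.root_other i h3.symm h2.symm
      ja := ElemTangle.root_other j (e ▸ h1) h3
      jm := by rw [e]; exact ElemTangle.root_lft j
      jc := ElemTangle.root_rgt j }
  rcases (show (j : ℕ) = i + 1 ∨ (i : ℕ) = j + 1 by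
    rcases abs_eq (zero_le_one' ℤ) |>.mp h with h | h <;> omega) with h | h
  · exact ⟨_, _, _, _, key i j h⟩
  · exact ⟨_, _, _, _, (key j i h).symm⟩

end Corner

namespace FlatTangle.Chart

variable {v w : Weight n k} {T : FlatTangle v w} {W : ℕ → Fin n → ℤ} {I : ℕ → Fin (n - 1)} {s e : ℕ}
  {i j : Fin (n - 1)} {a m c : Fin n} {ε : ℤ}

theorem marked_far (C : T.Chart W I 0 2) {f : Fin n → Fin n}
    (hd : ∀ p, p = lft (I 0) ∨ p = rgt (I 0) → ¬ (p = lft (I 1) ∨ p = rgt (I 1)))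
    (h0 : f (lft (I 0)) = f (rgt (I 0))) (h1 : f (lft (I 1)) = f (rgt (I 1)))
    (hff : ∀ p q, f p = f q → p = q ∨
      (p = lft (I 0) ∨ p = rgt (I 0)) ∧ (q = lft (I 0) ∨ q = rgt (I 0)) ∨
      (p = lft (I 1) ∨ p = rgt (I 1)) ∧ (q = lft (I 1) ∨ q = rgt (I 1))) : T.Marked f False := by
  have down : ∀ x, ((C.Φ x).2 = lft (I 0) ∨ (C.Φ x).2 = rgt (I 0)) → ∃ y, EqvGen T.adj x y ∧
      ((C.Φ y).1 = 0 ∨ (C.Φ y).1 = 0 + 1) ∧ ((C.Φ y).2 = lft (I 0) ∨ (C.Φ y).2 = rgt (I 0)) := by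
    intro x hx
    have := (C.range x).2
    by_cases h2 : (C.Φ x).1 = 1 + 1
    · obtain ⟨y, hy, e⟩ := C.exists_pred (t := 1) (by omega) (by omega) h2 (hd _ hx)
      exact ⟨y, e, by rw [hy]; exact ⟨Or.inr rfl, hx⟩⟩
    · exact ⟨x, EqvGen.refl x, by omega, hx⟩
  have up : ∀ x, ((C.Φ x).2 = lft (I 1) ∨ (C.Φ x).2 = rgt (I 1)) → ∃ y, EqvGen T.adj x y ∧
      ((C.Φ y).1 = 1 ∨ (C.Φ y).1 = 1 + 1) ∧ ((C.Φ y).2 = lft (I 1) ∨ (C.Φ y).2 = rgt (I 1)) := by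
    intro x hx
    have := (C.range x).2
    by_cases h2 : (C.Φ x).1 = 0
    · obtain ⟨y, hy, e⟩ := C.exists_succ (t := 0) (by omega) (by omega) h2 (fun h => hd _ h hx)
      exact ⟨y, e, by rw [hy]; exact ⟨Or.inl rfl, hx⟩⟩
    · exact ⟨x, EqvGen.refl x, by omega, hx⟩
  refine C.marked f (fun _ => False) False (by simp) ?_ (fun _ _ _ _ _ h => h.elim) (fun _ h => h.elim)
    (fun x y _ _ hxy => ?_) (fun _ _ h => h.elim) fun x _ => ?_
  · intro t _ ht
    obtain rfl | rfl : t = 0 ∨ t = 1 := by omega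
    · exact h0
    · exact h1
  · have step0 : ∀ x y, ((C.Φ x).2 = lft (I 0) ∨ (C.Φ x).2 = rgt (I 0)) →
        ((C.Φ y).2 = lft (I 0) ∨ (C.Φ y).2 = rgt (I 0)) → EqvGen T.adj x y := by
      intro x y hx hy
      obtain ⟨x', e, e1, e2⟩ := down x hx
      obtain ⟨y', e', e1', e2'⟩ := down y hy
      exact (e.trans _ _ _ (C.join 0 x' y' le_rfl (by omega) e1 e1' (Or.inr ⟨e2, e2'⟩))).trans _ _ _ e'.symm
    have step1 : ∀ x y, ((C.Φ x).2 = lft (I 1) ∨ (C.Φ x).2 = rgt (I 1)) →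
        ((C.Φ y).2 = lft (I 1) ∨ (C.Φ y).2 = rgt (I 1)) → EqvGen T.adj x y := by
      intro x y hx hy
      obtain ⟨x', e, e1, e2⟩ := up x hx
      obtain ⟨y', e', e1', e2'⟩ := up y hy
      exact (e.trans _ _ _ (C.join 1 x' y' (by omega) (by omega) e1 e1' (Or.inr ⟨e2, e2'⟩))).trans _ _ _
        e'.symm
    rcases hff _ _ hxy with h | h | h
    · by_cases hb0 : (C.Φ x).2 = lft (I 0) ∨ (C.Φ x).2 = rgt (I 0)
      · exact step0 x y hb0 (h ▸ hb0)
      by_cases hb1 : (C.Φ x).2 = lft (I 1) ∨ (C.Φ x).2 = rgt (I 1)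
      · exact step1 x y hb1 (h ▸ hb1)
      refine C.strand (p := (C.Φ x).2) (fun t _ ht => ?_) rfl h.symm
      obtain rfl | rfl : t = 0 ∨ t = 1 := by omega
      · exact hb0
      · exact hb1
    · exact step0 x y h.1 h.2
    · exact step1 x y h.1 h.2
  · have h2 := C.range x
    have h3 := C.one x
    have bot : W 0 (C.Φ x).2 = 1 → v.1 (C.Φ x).2 = 1 := (congrFun C.bot_eq _).symm.trans
    have top : W 2 (C.Φ x).2 = 1 → w.1 (C.Φ x).2 = 1 := (congrFun C.top_eq _).symm.trans
    obtain h | h | h : (C.Φ x).1 = 0 ∨ (C.Φ x).1 = 1 ∨ (C.Φ x).1 = 2 := by omega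
    · rw [h] at h3
      exact Or.inr ⟨_, bot h3, rfl⟩
    · rw [h] at h3
      by_cases hb : (C.Φ x).2 = lft (I 0) ∨ (C.Φ x).2 = rgt (I 0)
      · have hb' := not_or.mp (hd _ hb)
        exact Or.inl ⟨_, top ((C.const 1 _ (by omega) (by omega) hb'.1 hb'.2).trans h3), rfl⟩
      · have hb' := not_or.mp hb
        exact Or.inr ⟨_, bot ((C.const 0 _ (by omega) (by omega) hb'.1 hb'.2).symm.trans h3), rfl⟩
    · rw [h] at h3
      exact Or.inl ⟨_, top h3, rfl⟩

theorem marked_corner (C : T.Chart W I 0 2) (h : Corner i j a m c ε) (h0 : I 0 = i) (h1 : I 1 = j)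
    (hm : W 1 m = 1) (ha : W 0 a = 1 ∨ W 1 a = 1) : T.Marked (pinch a m c) False := by
  have ni : ∀ {p}, p = a ∨ p = m → (p = lft (I 0) ∨ p = rgt (I 0)) := fun {p} => by
    rw [h0, h.i_iff]; exact id
  have nj : ∀ {p}, p = m ∨ p = c → (p = lft (I 1) ∨ p = rgt (I 1)) := fun {p} => by
    rw [h1, h.j_iff]; exact id
  have aj : ¬ (a = lft (I 1) ∨ a = rgt (I 1)) := by
    rw [h1, h.j_iff]; exact not_or.mpr ⟨h.am, h.ac⟩
  have ci : ¬ (c = lft (I 0) ∨ c = rgt (I 0)) := by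
    rw [h0, h.i_iff]; exact not_or.mpr ⟨h.ac.symm, h.mc.symm⟩
  obtain ⟨z, hz⟩ := C.exist 1 m (by omega) (by omega) hm
  have hB0 : ∀ x, ((C.Φ x).1 = 0 ∨ (C.Φ x).1 = 0 + 1) → ((C.Φ x).2 = a ∨ (C.Φ x).2 = m) →
      EqvGen T.adj x z := fun x h1 h2 => C.join 0 x z le_rfl (by omega) h1 (Or.inr (by rw [hz]))
        (Or.inr ⟨ni h2, ni (Or.inr (by rw [hz]))⟩)
  have hB1 : ∀ x, ((C.Φ x).1 = 1 ∨ (C.Φ x).1 = 1 + 1) → ((C.Φ x).2 = m ∨ (C.Φ x).2 = c) →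
      EqvGen T.adj x z := fun x h1 h2 => C.join 1 x z (by omega) (by omega) h1 (Or.inl (by rw [hz]))
        (Or.inr ⟨nj h2, nj (Or.inl (by rw [hz]))⟩)
  refine C.marked_of_hub _ m (fun p => p = a ∨ p = m ∨ p = c) ?_ ?_ (fun _ _ => eq_of_pinch)
    (fun _ => False) False (by simp) (fun _ _ _ _ _ h => h.elim) (fun _ h => h.elim)
    ⟨z, fun x _ hx => ?_⟩ (fun _ _ h => h.elim) ?_
  · intro t _ ht p hp
    obtain rfl | rfl : t = 0 ∨ t = 1 := by omega
    · rw [h0, h.i_iff] at hp; tauto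
    · rw [h1, h.j_iff] at hp; tauto
  · intro p hp
    rw [pinch_of hp, pinch_of (Or.inr (Or.inl rfl))]
  · have hr := (C.range x).2
    rcases hx with hx | hx | hx
    · by_cases h2 : (C.Φ x).1 = 1 + 1
      · obtain ⟨y, hy, e⟩ := C.exists_pred (t := 1) (by omega) (by omega) h2 (by rw [hx]; exact aj)
        exact e.trans _ _ _ (hB0 y (Or.inr (by rw [hy])) (Or.inl (by rw [hy, hx])))
      · exact hB0 x (by omega) (Or.inl hx)
    · by_cases h2 : (C.Φ x).1 = 1 + 1
      · exact hB1 x (Or.inr h2) (Or.inl hx)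
      · exact hB0 x (by omega) (Or.inr hx)
    · by_cases h2 : (C.Φ x).1 = 0
      · obtain ⟨y, hy, e⟩ := C.exists_succ (t := 0) (by omega) (by omega) h2 (by rw [hx]; exact ci)
        exact e.trans _ _ _ (hB1 y (Or.inl (by rw [hy])) (Or.inr (by rw [hy, hx])))
      · exact hB1 x (by omega) (Or.inr hx)
  · have h2 := not_or.mp aj
    refine ha.symm.imp (fun ha => ⟨a, ?_, Or.inl rfl⟩) fun ha => ⟨a, ha, Or.inl rfl⟩
    rw [← ha]
    exact C.const 1 a (by omega) (by omega) h2.1 h2.2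

theorem marked_middle (C : T.Chart W I 0 3) (h : Corner i j a m c ε) (h0 : I 0 = i) (h1 : I 1 = j)
    (h2 : I 2 = i) (ha : W 1 a = 1) (hm : W 1 m = 1 ∨ W 2 m = 1) (hc : W 1 c = 1 ∨ W 2 c = 1) :
    T.Marked (pinch a m c) False := by
  have n0 : ∀ {p}, p = a ∨ p = m → (p = lft (I 0) ∨ p = rgt (I 0)) := fun {p} => by
    rw [h0, h.i_iff]; exact id
  have n2 : ∀ {p}, p = a ∨ p = m → (p = lft (I 2) ∨ p = rgt (I 2)) := fun {p} => by
    rw [h2, h.i_iff]; exact id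
  have n1 : ∀ {p}, p = m ∨ p = c → (p = lft (I 1) ∨ p = rgt (I 1)) := fun {p} => by
    rw [h1, h.j_iff]; exact id
  have a1 : ¬ (a = lft (I 1) ∨ a = rgt (I 1)) := by
    rw [h1, h.j_iff]; exact not_or.mpr ⟨h.am, h.ac⟩
  have c0 : ¬ (c = lft (I 0) ∨ c = rgt (I 0)) := by
    rw [h0, h.i_iff]; exact not_or.mpr ⟨h.ac.symm, h.mc.symm⟩
  have c2 : ¬ (c = lft (I 2) ∨ c = rgt (I 2)) := by
    rw [h2, h.i_iff]; exact not_or.mpr ⟨h.ac.symm, h.mc.symm⟩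
  obtain ⟨z, hz⟩ := C.exist 1 a (by omega) (by omega) ha
  obtain ⟨z', hz', hzz⟩ := C.exists_succ (t := 1) (x := z) (by omega) (by omega) (by rw [hz])
    (by rw [hz]; exact a1)
  rw [hz] at hz'
  have hB : ∀ x, ((C.Φ x).2 = a ∨ (C.Φ x).2 = m) → EqvGen T.adj x z := by
    intro x hx
    have hr := (C.range x).2
    by_cases hl : (C.Φ x).1 = 0 ∨ (C.Φ x).1 = 0 + 1
    · exact C.join 0 x z (by omega) (by omega) hl (Or.inr (by rw [hz]))
        (Or.inr ⟨n0 hx, n0 (Or.inl (by rw [hz]))⟩)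
    · exact (C.join 2 x z' (by omega) (by omega) (by omega) (Or.inl (by rw [hz']))
        (Or.inr ⟨n2 hx, n2 (Or.inl (by rw [hz']))⟩)).trans _ _ _ hzz.symm
  obtain ⟨y, hy, hy'⟩ : ∃ y, ((C.Φ y).1 = 1 ∨ (C.Φ y).1 = 1 + 1) ∧ (C.Φ y).2 = m := by
    rcases hm with hm | hm
    · obtain ⟨y, hy⟩ := C.exist 1 m (by omega) (by omega) hm
      exact ⟨y, by rw [hy]; exact ⟨Or.inl rfl, rfl⟩⟩
    · obtain ⟨y, hy⟩ := C.exist 2 m (by omega) (by omega) hm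
      exact ⟨y, by rw [hy]; exact ⟨Or.inr rfl, rfl⟩⟩
  have hC : ∀ x, ((C.Φ x).1 = 1 ∨ (C.Φ x).1 = 1 + 1) → (C.Φ x).2 = c → EqvGen T.adj x z := by
    intro x hx hx'
    exact (C.join 1 x y (by omega) (by omega) hx hy (Or.inr ⟨n1 (Or.inr hx'), n1 (Or.inl hy')⟩)).trans
      _ _ _ (hB y (Or.inr hy'))
  refine C.marked_of_hub _ m (fun p => p = a ∨ p = m ∨ p = c) ?_ ?_ (fun _ _ => eq_of_pinch)
    (fun _ => False) False (by simp) (fun _ _ _ _ _ h => h.elim) (fun _ h => h.elim)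
    ⟨z, fun x _ hx => ?_⟩ (fun _ _ h => h.elim) ?_
  · intro t _ ht p hp
    obtain rfl | rfl | rfl : t = 0 ∨ t = 1 ∨ t = 2 := by omega
    · rw [h0, h.i_iff] at hp; tauto
    · rw [h1, h.j_iff] at hp; tauto
    · rw [h2, h.i_iff] at hp; tauto
  · intro p hp
    rw [pinch_of hp, pinch_of (Or.inr (Or.inl rfl))]
  · rcases hx with hx | hx | hx
    · exact hB x (Or.inl hx)
    · exact hB x (Or.inr hx)
    · have hr := (C.range x).2
      by_cases e0 : (C.Φ x).1 = 0
      · obtain ⟨y, hy, e⟩ := C.exists_succ (t := 0) (by omega) (by omega) e0 (by rw [hx]; exact c0)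
        exact e.trans _ _ _ (hC y (Or.inl (by rw [hy])) (by rw [hy, hx]))
      by_cases e3 : (C.Φ x).1 = 2 + 1
      · obtain ⟨y, hy, e⟩ := C.exists_pred (t := 2) (by omega) (by omega) e3 (by rw [hx]; exact c2)
        exact e.trans _ _ _ (hC y (Or.inr (by rw [hy])) (by rw [hy, hx]))
      exact hC x (by omega) hx
  · have b0 := not_or.mp c0
    have b2 := not_or.mp c2
    refine hc.symm.imp (fun hc => ⟨c, ?_, by tauto⟩) fun hc => ⟨c, ?_, by tauto⟩
    · rw [← hc]
      exact C.const 2 c (by omega) (by omega) b2.1 b2.2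
    · rw [← hc]
      exact (C.const 0 c (by omega) (by omega) b0.1 b0.2).symm

/-- The first two tangles compose to a circle. -/
theorem marked_circle_left (C : T.Chart W I 0 3) (h : Corner i j a m c ε) (h0 : I 0 = i) (h1 : I 1 = i)
    (h2 : I 2 = j) (m1 : W 1 m = 1) (m3 : W 3 m = 1) (a0 : W 0 a ≠ 1) (a2 : W 2 a ≠ 1) (m0 : W 0 m ≠ 1)
    (m2 : W 2 m ≠ 1) : T.Marked (pinch a m c) True := by
  have n0 : ∀ {p}, p = a ∨ p = m ↔ (p = lft (I 0) ∨ p = rgt (I 0)) := fun {p} => by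
    rw [h0, h.i_iff]
  have n1 : ∀ {p}, p = a ∨ p = m ↔ (p = lft (I 1) ∨ p = rgt (I 1)) := fun {p} => by
    rw [h1, h.i_iff]
  have n2 : ∀ {p}, p = m ∨ p = c ↔ (p = lft (I 2) ∨ p = rgt (I 2)) := fun {p} => by
    rw [h2, h.j_iff]
  have a2' := not_or.mp (mt n2.mpr (not_or.mpr ⟨h.am, h.ac⟩))
  have c0 := mt n0.mpr (not_or.mpr ⟨h.ac.symm, h.mc.symm⟩)
  have c1 := mt n1.mpr (not_or.mpr ⟨h.ac.symm, h.mc.symm⟩)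
  have a3 : W 3 a ≠ 1 := by
    rw [C.const 2 a (by omega) (by omega) a2'.1 a2'.2]
    exact a2
  obtain ⟨z, hz⟩ := C.exist 3 m (by omega) (by omega) m3
  have hB : ∀ x, ((C.Φ x).1 = 2 ∨ (C.Φ x).1 = 2 + 1) → ((C.Φ x).2 = m ∨ (C.Φ x).2 = c) →
      EqvGen T.adj x z := fun x h1 h2 => C.join 2 x z (by omega) (by omega) h1 (Or.inr (by rw [hz]))
        (Or.inr ⟨n2.mp h2, n2.mp (Or.inl (by rw [hz]))⟩)
  have hC : ∀ x, (C.Φ x).1 = 1 → (C.Φ x).2 = c → EqvGen T.adj x z := by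
    intro x hx hx'
    obtain ⟨y, hy, e⟩ := C.exists_succ (t := 1) (by omega) (by omega) hx (by rw [hx']; exact c1)
    exact e.trans _ _ _ (hB y (Or.inl (by rw [hy])) (Or.inr (by rw [hy, hx'])))
  refine C.marked_of_hub _ m (fun p => p = a ∨ p = m ∨ p = c) ?_ ?_ (fun _ _ => eq_of_pinch)
    (fun z => z.1 = 1 ∧ (z.2 = a ∨ z.2 = m)) True ?_ ?_ (fun _ h => by omega)
    ⟨z, fun x hx hx' => ?_⟩ (fun x y hx hy => ?_) (Or.inl ⟨m, m3, by tauto⟩)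
  · intro t _ ht p hp
    obtain rfl | rfl | rfl : t = 0 ∨ t = 1 ∨ t = 2 := by omega
    · rw [← n0] at hp; tauto
    · rw [← n1] at hp; tauto
    · rw [← n2] at hp; tauto
  · intro p hp
    rw [pinch_of hp, pinch_of (Or.inr (Or.inl rfl))]
  · obtain ⟨x, hx⟩ := C.exist 1 m (by omega) (by omega) m1
    exact iff_true_intro ⟨x, by rw [hx]; simp⟩
  · rintro t _ ht z z' ⟨e, hp⟩ ht1 ht2 hW hn
    have hI : I t = i := by
      obtain rfl | rfl : t = 0 ∨ t = 1 := by omega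
      · exact h0
      · exact h1
    have hz' : z'.2 = a ∨ z'.2 = m := by
      rw [hI] at hn
      rw [← h.i_iff] at hp ⊢
      rcases hn with (hn | hn) | (hn | hn)
      · tauto
      · exact hn.2
      · have := hn.2.2; rw [this] at hp; tauto
      · exact hn.1
    refine ⟨?_, hz'⟩
    obtain h | h | h : z'.1 = 1 ∨ z'.1 = 0 ∨ z'.1 = 2 := by omega
    · exact h
    · rw [h] at hW
      rcases hz' with e | e <;> rw [e] at hW <;> contradiction
    · rw [h] at hW
      rcases hz' with e | e <;> rw [e] at hW <;> contradiction
  · have hr := (C.range x).2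
    have h1 := C.one x
    rcases hx' with e | e | e
    · exfalso
      rw [e] at h1
      obtain h | h | h | h : (C.Φ x).1 = 0 ∨ (C.Φ x).1 = 1 ∨ (C.Φ x).1 = 2 ∨ (C.Φ x).1 = 3 := by omega
      · rw [h] at h1; contradiction
      · exact hx ⟨h, Or.inl e⟩
      · rw [h] at h1; contradiction
      · rw [h] at h1; contradiction
    · rw [e] at h1
      obtain h | h | h | h : (C.Φ x).1 = 0 ∨ (C.Φ x).1 = 1 ∨ (C.Φ x).1 = 2 ∨ (C.Φ x).1 = 3 := by omega
      · rw [h] at h1; contradiction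
      · exact (hx ⟨h, Or.inr e⟩).elim
      · rw [h] at h1; contradiction
      · exact hB x (Or.inr h) (Or.inl e)
    · by_cases e0 : (C.Φ x).1 = 0
      · obtain ⟨y, hy, hxy⟩ := C.exists_succ (t := 0) (by omega) (by omega) e0 (by rw [e]; exact c0)
        exact hxy.trans _ _ _ (hC y (by rw [hy]) (by rw [hy, e]))
      by_cases e1 : (C.Φ x).1 = 1
      · exact hC x e1 e
      · exact hB x (by omega) (Or.inr e)
  · exact C.join 0 x y (by omega) (by omega) (Or.inr hx.1) (Or.inr hy.1)
      (Or.inr ⟨n0.mp hx.2, n0.mp hy.2⟩)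

/-- The last two tangles compose to a circle. -/
theorem marked_circle_right (C : T.Chart W I 0 3) (h : Corner i j a m c ε) (h0 : I 0 = j) (h1 : I 1 = i)
    (h2 : I 2 = i) (m2 : W 2 m = 1) (m0 : W 0 m = 1) (a1 : W 1 a ≠ 1) (a3 : W 3 a ≠ 1) (m1 : W 1 m ≠ 1)
    (m3 : W 3 m ≠ 1) : T.Marked (pinch a m c) True := by
  have n0 : ∀ {p}, p = m ∨ p = c ↔ (p = lft (I 0) ∨ p = rgt (I 0)) := fun {p} => by
    rw [h0, h.j_iff]
  have n1 : ∀ {p}, p = a ∨ p = m ↔ (p = lft (I 1) ∨ p = rgt (I 1)) := fun {p} => by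
    rw [h1, h.i_iff]
  have n2 : ∀ {p}, p = a ∨ p = m ↔ (p = lft (I 2) ∨ p = rgt (I 2)) := fun {p} => by
    rw [h2, h.i_iff]
  have a0' := not_or.mp (mt n0.mpr (not_or.mpr ⟨h.am, h.ac⟩))
  have c1 := mt n1.mpr (not_or.mpr ⟨h.ac.symm, h.mc.symm⟩)
  have c2 := mt n2.mpr (not_or.mpr ⟨h.ac.symm, h.mc.symm⟩)
  have a0 : W 0 a ≠ 1 := by
    rw [← C.const 0 a (by omega) (by omega) a0'.1 a0'.2]
    exact a1
  obtain ⟨z, hz⟩ := C.exist 0 m (by omega) (by omega) m0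
  have hB : ∀ x, ((C.Φ x).1 = 0 ∨ (C.Φ x).1 = 0 + 1) → ((C.Φ x).2 = m ∨ (C.Φ x).2 = c) →
      EqvGen T.adj x z := fun x h1 h2 => C.join 0 x z (by omega) (by omega) h1 (Or.inl (by rw [hz]))
        (Or.inr ⟨n0.mp h2, n0.mp (Or.inl (by rw [hz]))⟩)
  have hC : ∀ x, (C.Φ x).1 = 1 + 1 → (C.Φ x).2 = c → EqvGen T.adj x z := by
    intro x hx hx'
    obtain ⟨y, hy, e⟩ := C.exists_pred (t := 1) (by omega) (by omega) hx (by rw [hx']; exact c1)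
    exact e.trans _ _ _ (hB y (Or.inr (by rw [hy])) (Or.inr (by rw [hy, hx'])))
  refine C.marked_of_hub _ m (fun p => p = a ∨ p = m ∨ p = c) ?_ ?_ (fun _ _ => eq_of_pinch)
    (fun z => z.1 = 2 ∧ (z.2 = a ∨ z.2 = m)) True ?_ ?_ (fun _ h => by omega)
    ⟨z, fun x hx hx' => ?_⟩ (fun x y hx hy => ?_) (Or.inr ⟨m, m0, by tauto⟩)
  · intro t _ ht p hp
    obtain rfl | rfl | rfl : t = 0 ∨ t = 1 ∨ t = 2 := by omega
    · rw [← n0] at hp; tauto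
    · rw [← n1] at hp; tauto
    · rw [← n2] at hp; tauto
  · intro p hp
    rw [pinch_of hp, pinch_of (Or.inr (Or.inl rfl))]
  · obtain ⟨x, hx⟩ := C.exist 2 m (by omega) (by omega) m2
    exact iff_true_intro ⟨x, by rw [hx]; simp⟩
  · rintro t _ ht z z' ⟨e, hp⟩ ht1 ht2 hW hn
    have hI : I t = i := by
      obtain rfl | rfl : t = 1 ∨ t = 2 := by omega
      · exact h1
      · exact h2
    have hz' : z'.2 = a ∨ z'.2 = m := by
      rw [hI] at hn
      rw [← h.i_iff] at hp ⊢
      rcases hn with (hn | hn) | (hn | hn)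
      · tauto
      · exact hn.2
      · have := hn.2.2; rw [this] at hp; tauto
      · exact hn.1
    refine ⟨?_, hz'⟩
    obtain h | h | h : z'.1 = 2 ∨ z'.1 = 1 ∨ z'.1 = 3 := by omega
    · exact h
    · rw [h] at hW
      rcases hz' with e | e <;> rw [e] at hW <;> contradiction
    · rw [h] at hW
      rcases hz' with e | e <;> rw [e] at hW <;> contradiction
  · have hr := (C.range x).2
    have h1 := C.one x
    rcases hx' with e | e | e
    · exfalso
      rw [e] at h1
      obtain h | h | h | h : (C.Φ x).1 = 0 ∨ (C.Φ x).1 = 1 ∨ (C.Φ x).1 = 2 ∨ (C.Φ x).1 = 3 := by omega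
      · rw [h] at h1; contradiction
      · rw [h] at h1; contradiction
      · exact hx ⟨h, Or.inl e⟩
      · rw [h] at h1; contradiction
    · rw [e] at h1
      obtain h | h | h | h : (C.Φ x).1 = 0 ∨ (C.Φ x).1 = 1 ∨ (C.Φ x).1 = 2 ∨ (C.Φ x).1 = 3 := by omega
      · exact hB x (Or.inl h) (Or.inl e)
      · rw [h] at h1; contradiction
      · exact (hx ⟨h, Or.inr e⟩).elim
      · rw [h] at h1; contradiction
    · by_cases e3 : (C.Φ x).1 = 2 + 1
      · obtain ⟨y, hy, hxy⟩ := C.exists_pred (t := 2) (by omega) (by omega) e3 (by rw [e]; exact c2)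
        exact hxy.trans _ _ _ (hC y (by rw [hy]) (by rw [hy, e]))
      by_cases e2 : (C.Φ x).1 = 1 + 1
      · exact hC x e2 e
      · exact hB x (by omega) (Or.inr e)
  · exact C.join 2 x y (by omega) (by omega) (Or.inl hx.1) (Or.inl hy.1)
      (Or.inr ⟨n2.mp hx.2, n2.mp hy.2⟩)

end FlatTangle.Chart

end

noncomputable section

open Relation Equiv Equiv.Perm

variable {n k : ℕ}

/-- `w = v + δ ε_i`. -/
def Step (i : Fin (n - 1)) (δ : ℤ) (v w : Weight n k) : Prop := ∀ p, w.1 p = v.1 p + δ * root i p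

theorem Step.neighbours {i : Fin (n - 1)} {δ : ℤ} {v w : Weight n k} (hδ : δ = 1 ∨ δ = -1)
    (h : Step i δ v w) : Neighbours i v w := by
  rcases hδ with rfl | rfl
  · exact Or.inl (funext fun p => by rw [h p]; simp)
  · exact Or.inr (funext fun p => by rw [h p]; simp [sub_eq_add_neg])

theorem sum_root_univ (i : Fin (n - 1)) : ∑ p, root i p = 0 := by
  simp [root, Finset.sum_sub_distrib]

theorem Admissible.add_root {v : Fin n → ℤ} (h : Admissible n k v) (i : Fin (n - 1)) (δ : ℤ)
    (hb : ∀ p, 0 ≤ v p + δ * root i p ∧ v p + δ * root i p ≤ 2) :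
    Admissible n k fun p => v p + δ * root i p :=
  ⟨hb, by rw [Finset.sum_add_distrib, h.2, ← Finset.mul_sum, sum_root_univ, mul_zero, add_zero]⟩

theorem exists_step {v : Weight n k} (i : Fin (n - 1)) (δ : ℤ)
    (hb : ∀ p, 0 ≤ v.1 p + δ * root i p ∧ v.1 p + δ * root i p ≤ 2) : ∃ w : Weight n k, Step i δ v w :=
  ⟨⟨_, v.2.add_root i δ hb⟩, fun _ => rfl⟩

/-- The changes of the weight in the positions of a corner. -/
theorem Corner.scaled {i j : Fin (n - 1)} {a m c : Fin n} {ε : ℤ} (h : Corner i j a m c ε) {δ : ℤ}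
    (hδ : δ = 1 ∨ δ = -1) : ∃ η : ℤ, (η = 1 ∨ η = -1) ∧ δ * root i a = η ∧ δ * root i m = -η ∧
      δ * root i c = 0 ∧ δ * root j a = 0 ∧ δ * root j m = η ∧ δ * root j c = -η := by
  refine ⟨δ * ε, ?_, by rw [h.ia], by rw [h.im, mul_neg], by rw [h.ic, mul_zero], by rw [h.ja, mul_zero],
    by rw [h.jm], by rw [h.jc, mul_neg]⟩
  have := h.sign
  rcases hδ with rfl | rfl <;> omega

theorem Corner.cases {i j : Fin (n - 1)} {a m c : Fin n} {ε : ℤ} (h : Corner i j a m c ε) (p : Fin n) :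
    p = a ∨ p = m ∨ p = c ∨ (∀ δ : ℤ, δ * root i p = 0) ∧ ∀ δ : ℤ, δ * root j p = 0 := by
  by_cases ha : p = a
  · exact Or.inl ha
  by_cases hm : p = m
  · exact Or.inr (Or.inl hm)
  by_cases hc : p = c
  · exact Or.inr (Or.inr (Or.inl hc))
  refine Or.inr (Or.inr (Or.inr ⟨fun δ => ?_, fun δ => ?_⟩))
  · rw [h.root_ne ha hm, mul_zero]
  · rw [h.symm.root_ne hc hm, mul_zero]

namespace FlatTangle

variable {u v w x y t : Weight n k}

theorem exists_matching {T : FlatTangle v w} (K : ∀ a, Nonempty (T.Cups a)) (a : Matching v) :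
    Nonempty (Matching w) := ⟨(K a).some.b⟩

theorem tensor_iso_two {T₁ : FlatTangle w u} {T₂ : FlatTangle v w} (K : ∀ a, Nonempty (T₂.Cups a))
    {T : FlatTangle v u} {f : Fin n → Fin n} {o : Prop} (h : (comp T₁ T₂ (exists_matching K)).Marked f o)
    (h' : T.Marked f o) : Nonempty (T₂.tensorFunctor ⋙ T₁.tensorFunctor ≅ T.tensorFunctor) :=
  (h.glue h').map fun g => g.tensorIso fun a => (K a).some

theorem tensor_iso_three {T₁ : FlatTangle x u} {T₂ : FlatTangle w x} {T₃ : FlatTangle v w}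
    (K₂ : ∀ a, Nonempty (T₂.Cups a)) (K₃ : ∀ a, Nonempty (T₃.Cups a)) {T : FlatTangle v u}
    {f : Fin n → Fin n} {o : Prop}
    (h : (comp (comp T₁ T₂ (exists_matching K₂)) T₃ (exists_matching K₃)).Marked f o) (h' : T.Marked f o) :
    Nonempty (T₃.tensorFunctor ⋙ T₂.tensorFunctor ⋙ T₁.tensorFunctor ≅ T.tensorFunctor) := by
  obtain ⟨e⟩ := tensor_iso_two K₃ h h'
  exact ⟨Functor.isoWhiskerLeft _ ((glueComp T₁ T₂ (exists_matching K₂)).tensorIso fun a => (K₂ a).some)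
    ≪≫ e⟩

/-- Up to four consecutive weights. -/
def levels (v w x u : Weight n k) : ℕ → Fin n → ℤ
  | 0 => v.1
  | 1 => w.1
  | 2 => x.1
  | _ => u.1

/-- Up to three consecutive simple roots. -/
def roots (i j l : Fin (n - 1)) : ℕ → Fin (n - 1)
  | 0 => i
  | 1 => j
  | _ => l

section

variable {i j l : Fin (n - 1)} {a m c : Fin n} {ε : ℤ}

/-- The chart of a composition of two elementary tangles. -/
def chartTwo (h₁ : Neighbours i v w) (h₂ : Neighbours j w u) :
    ((elemTangle j w u h₂).comp (elemTangle i v w h₁) (exists_matching (ElemTangle.cups h₁))).Chart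
      (levels v w u u) (roots i j j) 0 2 :=
  (Chart.elem h₂ (s := 1) rfl rfl rfl).comp (Chart.elem h₁ (s := 0) rfl rfl rfl) _

/-- The composition of three elementary tangles. -/
def compThree (h₁ : Neighbours i v w) (h₂ : Neighbours j w x) (h₃ : Neighbours l x u) :
    FlatTangle v u :=
  ((elemTangle l x u h₃).comp (elemTangle j w x h₂) (exists_matching (ElemTangle.cups h₂))).comp
    (elemTangle i v w h₁) (exists_matching (ElemTangle.cups h₁))

/-- The chart of a composition of three elementary tangles. -/
def chartThree (h₁ : Neighbours i v w) (h₂ : Neighbours j w x) (h₃ : Neighbours l x u) :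
    (compThree h₁ h₂ h₃).Chart (levels v w x u) (roots i j l) 0 3 :=
  ((Chart.elem h₃ (s := 2) rfl rfl rfl).comp (Chart.elem h₂ (s := 1) rfl rfl rfl) _).comp
    (Chart.elem h₁ (s := 0) rfl rfl rfl) _

theorem exchange_iso {f : Fin n → Fin n} (h₁ : Neighbours i v w) (h₂ : Neighbours j w u)
    (h₁' : Neighbours j v x) (h₂' : Neighbours i x u)
    (h : ((elemTangle j w u h₂).comp (elemTangle i v w h₁)
      (exists_matching (ElemTangle.cups h₁))).Marked f False)
    (h' : ((elemTangle i x u h₂').comp (elemTangle j v x h₁')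
      (exists_matching (ElemTangle.cups h₁'))).Marked f False) :
    Nonempty ((elemTangle i v w h₁).tensorFunctor ⋙ (elemTangle j w u h₂).tensorFunctor ≅
      (elemTangle j v x h₁').tensorFunctor ⋙ (elemTangle i x u h₂').tensorFunctor) := by
  obtain ⟨e⟩ := tensor_iso_two (ElemTangle.cups h₁) h h'
  exact ⟨e ≪≫ ((glueComp _ _ _).tensorIso fun a => (ElemTangle.cups h₁' a).some).symm⟩

/-- Elementary tangles for distant simple roots commute. -/
theorem exchange_far (hij : 1 < |(i : ℤ) - (j : ℤ)|) (h₁ : Neighbours i v w) (h₂ : Neighbours j w u)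
    (h₁' : Neighbours j v x) (h₂' : Neighbours i x u) :
    Nonempty ((elemTangle i v w h₁).tensorFunctor ⋙ (elemTangle j w u h₂).tensorFunctor ≅
      (elemTangle j v x h₁').tensorFunctor ⋙ (elemTangle i x u h₂').tensorFunctor) := by
  classical
  have hd : ∀ p, p = lft i ∨ p = rgt i → ¬ (p = lft j ∨ p = rgt j) := by
    intro p hp hp'
    rw [lt_abs] at hij
    simp only [lft, rgt, Fin.ext_iff] at hp hp'
    omega
  have hji : ∀ p, p = lft j ∨ p = rgt j → ¬ (p = lft i ∨ p = rgt i) := fun p h h' => hd p h' h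
  let f : Fin n → Fin n := fun p =>
    if p = lft i ∨ p = rgt i then lft i else if p = lft j ∨ p = rgt j then lft j else p
  have fi : ∀ p, p = lft i ∨ p = rgt i → f p = lft i := fun p hp => if_pos hp
  have fj : ∀ p, p = lft j ∨ p = rgt j → f p = lft j := fun p hp =>
    (if_neg (hji p hp)).trans (if_pos hp)
  have fo : ∀ p, ¬ (p = lft i ∨ p = rgt i) → ¬ (p = lft j ∨ p = rgt j) → f p = p := fun p hp hp' =>
    (if_neg hp).trans (if_neg hp')
  have hff : ∀ p q, f p = f q → p = q ∨ (p = lft i ∨ p = rgt i) ∧ (q = lft i ∨ q = rgt i) ∨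
      (p = lft j ∨ p = rgt j) ∧ (q = lft j ∨ q = rgt j) := by
    intro p q h
    by_cases hp : p = lft i ∨ p = rgt i <;> by_cases hq : q = lft i ∨ q = rgt i
    · exact Or.inr (Or.inl ⟨hp, hq⟩)
    · rw [fi p hp] at h
      by_cases hq' : q = lft j ∨ q = rgt j
      · rw [fj q hq'] at h
        exact (hji _ (Or.inl rfl) (Or.inl h.symm)).elim
      · rw [fo q hq hq'] at h
        exact (hq (Or.inl h.symm)).elim
    · rw [fi q hq] at h
      by_cases hp' : p = lft j ∨ p = rgt j
      · rw [fj p hp'] at h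
        exact (hji _ (Or.inl rfl) (Or.inl h)).elim
      · rw [fo p hp hp'] at h
        exact (hp (Or.inl h)).elim
    · by_cases hp' : p = lft j ∨ p = rgt j <;> by_cases hq' : q = lft j ∨ q = rgt j
      · exact Or.inr (Or.inr ⟨hp', hq'⟩)
      · rw [fj p hp', fo q hq hq'] at h
        exact (hq' (Or.inl h.symm)).elim
      · rw [fj q hq', fo p hp hp'] at h
        exact (hp' (Or.inl h)).elim
      · rw [fo p hp hp', fo q hq hq'] at h
        exact Or.inl h
  have f1 : f (lft i) = f (rgt i) := by rw [fi _ (Or.inl rfl), fi _ (Or.inr rfl)]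
  have f2 : f (lft j) = f (rgt j) := by rw [fj _ (Or.inl rfl), fj _ (Or.inr rfl)]
  exact exchange_iso h₁ h₂ h₁' h₂' ((chartTwo h₁ h₂).marked_far hd f1 f2 hff)
    ((chartTwo h₁' h₂').marked_far hji f2 f1 fun p q h => (hff p q h).imp id Or.symm)

/-- Elementary tangles for neighbouring simple roots commute if the weight in the common position
changes by 2. -/
theorem exchange_near (h : Corner i j a m c ε) {δ : ℤ} (hδ : δ = 1 ∨ δ = -1) (h₁ : Step i δ v w)
    (h₂ : Step j (-δ) w u) (h₁' : Step j (-δ) v x) (n₁ : Neighbours i v w) (n₂ : Neighbours j w u) (n₁' : Neighbours j v x) (n₂' : Neighbours i x u) :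
    Nonempty ((elemTangle i v w n₁).tensorFunctor ⋙ (elemTangle j w u n₂).tensorFunctor ≅
      (elemTangle j v x n₁').tensorFunctor ⋙ (elemTangle i x u n₂').tensorFunctor) := by
  obtain ⟨η, hη, e1, e2, e3, e4, e5, e6⟩ := h.scaled hδ
  have am := h₁ m
  have aa := h₁ a
  have bm := h₂ m
  have xm := h₁' m
  have xc := h₁' c
  rw [neg_mul] at bm xm xc
  have bv := v.2.1 m
  have bu := u.2.1 m
  have bva := v.2.1 a
  have bwa := w.2.1 a
  have bvc := v.2.1 c
  have bxc := x.2.1 c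
  refine exchange_iso n₁ n₂ n₁' n₂' (f := pinch a m c)
    ((chartTwo n₁ n₂).marked_corner h rfl rfl ?_ ?_) ?_
  · change w.1 m = 1
    omega
  · change v.1 a = 1 ∨ w.1 a = 1
    omega
  · rw [← pinch_comm]
    refine (chartTwo n₁' n₂').marked_corner h.symm rfl rfl ?_ ?_
    · change x.1 m = 1
      omega
    · change v.1 c = 1 ∨ x.1 c = 1
      omega

theorem serre_circle_left (h : Corner i j a m c ε) {δ : ℤ} (hδ : δ = 1 ∨ δ = -1)
    (h₁ : Step i δ v w) (h₂ : Step i δ w x) (h₃ : Step j δ x u) (n₁ : Neighbours i v w)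
    (n₂ : Neighbours i w x) (n₃ : Neighbours j x u) : (compThree n₁ n₂ n₃).Marked (pinch a m c) True := by
  obtain ⟨η, hη, e1, e2, e3, e4, e5, e6⟩ := h.scaled hδ
  have := h₁ a
  have := h₁ m
  have := h₂ a
  have := h₂ m
  have := h₃ m
  have := v.2.1 a
  have := v.2.1 m
  have := x.2.1 a
  have := x.2.1 m
  refine (chartThree n₁ n₂ n₃).marked_circle_left h rfl rfl rfl ?_ ?_ ?_ ?_ ?_ ?_
  · change w.1 m = 1; omega
  · change u.1 m = 1; omega
  · change v.1 a ≠ 1; omega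
  · change x.1 a ≠ 1; omega
  · change v.1 m ≠ 1; omega
  · change x.1 m ≠ 1; omega

theorem serre_circle_right (h : Corner i j a m c ε) {δ : ℤ} (hδ : δ = 1 ∨ δ = -1)
    (h₁ : Step j δ v w) (h₂ : Step i δ w x) (h₃ : Step i δ x u) (n₁ : Neighbours j v w)
    (n₂ : Neighbours i w x) (n₃ : Neighbours i x u) : (compThree n₁ n₂ n₃).Marked (pinch a m c) True := by
  obtain ⟨η, hη, e1, e2, e3, e4, e5, e6⟩ := h.scaled hδ
  have := h₁ m
  have := h₂ a
  have := h₂ m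
  have := h₃ a
  have := h₃ m
  have := w.2.1 a
  have := w.2.1 m
  have := u.2.1 a
  have := u.2.1 m
  refine (chartThree n₁ n₂ n₃).marked_circle_right h rfl rfl rfl ?_ ?_ ?_ ?_ ?_ ?_
  · change x.1 m = 1; omega
  · change v.1 m = 1; omega
  · change w.1 a ≠ 1; omega
  · change u.1 a ≠ 1; omega
  · change w.1 m ≠ 1; omega
  · change u.1 m ≠ 1; omega

theorem serre_middle (h : Corner i j a m c ε) {δ : ℤ} (hδ : δ = 1 ∨ δ = -1)
    (h₁ : Step i δ v w) (h₂ : Step j δ w x) (h₃ : Step i δ x u) (n₁ : Neighbours i v w)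
    (n₂ : Neighbours j w x) (n₃ : Neighbours i x u) : (compThree n₁ n₂ n₃).Marked (pinch a m c) False := by
  obtain ⟨η, hη, e1, e2, e3, e4, e5, e6⟩ := h.scaled hδ
  have := h₁ a
  have := h₂ a
  have := h₂ m
  have := h₂ c
  have := h₃ a
  have := v.2.1 a
  have := u.2.1 a
  have := w.2.1 m
  have := x.2.1 m
  have := w.2.1 c
  have := x.2.1 c
  refine (chartThree n₁ n₂ n₃).marked_middle h rfl rfl rfl ?_ ?_ ?_
  · change w.1 a = 1; omega
  · change w.1 m = 1 ∨ x.1 m = 1; omega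
  · change w.1 c = 1 ∨ x.1 c = 1; omega

end

end FlatTangle

end

noncomputable section

open Relation Equiv Equiv.Perm

variable {n k : ℕ}

namespace GrMod

variable {R : Type} [Ring R] {𝒜 : ℤ → AddSubgroup R} {C : Type*} [Category C] {F G : C ⥤ GrMod 𝒜}

/-- Functors with values in modules with one element are isomorphic. -/
def isoOfSubsingleton (hF : ∀ M, Subsingleton (F.obj M).carrier) (hG : ∀ M, Subsingleton (G.obj M).carrier) :
    F ≅ G :=
  NatIso.ofComponents (fun M =>
      have := hF M
      have := hG M
      isoMk (0 : (F.obj M).carrier ≃ₗ[R] (G.obj M).carrier) fun _ _ _ => zero_mem _) fun {_ N} _ =>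
    hom_ext (LinearMap.ext fun _ => (hG N).elim _ _)

theorem subsingleton_of_iso {M N : GrMod 𝒜} (e : M ≅ N) (h : Subsingleton N.carrier) :
    Subsingleton M.carrier := by
  refine subsingleton_of_forall_eq 0 fun x => ?_
  have h1 : e.inv.lin (e.hom.lin x) = x := LinearMap.congr_fun (congrArg Hom.lin e.hom_inv_id) x
  rw [← h1, h.elim (e.hom.lin x) 0, map_zero]

/-- Functors with the same values up to the identification of the gradings are isomorphic. -/
def isoOfLinearEquiv (e : ∀ M, (F.obj M).carrier ≃ₗ[R] (G.obj M).carrier)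
    (he : ∀ M d, ∀ x ∈ (F.obj M).gr d, e M x ∈ (G.obj M).gr d)
    (hn : ∀ {M N : C} (f : M ⟶ N) x, e N ((F.map f).lin x) = (G.map f).lin (e M x)) : F ≅ G :=
  NatIso.ofComponents (fun M => isoMk (e M) (he M)) fun f =>
    hom_ext (LinearMap.ext fun x => hn f x)

/-- The composition of two shifts. -/
def shiftShift (𝒜 : ℤ → AddSubgroup R) {a b c : ℤ} (h : a + b = c) :
    shift 𝒜 a ⋙ shift 𝒜 b ≅ shift 𝒜 c :=
  isoOfLinearEquiv (fun M => LinearEquiv.refl R M.carrier) (fun M d x hx => by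
    have : d - b - a = d - c := by omega
    change x ∈ M.gr (d - c)
    rw [← this]
    exact hx) fun _ _ => rfl

/-- The shift by zero. -/
def shiftZero (𝒜 : ℤ → AddSubgroup R) : shift 𝒜 0 ≅ 𝟭 _ :=
  isoOfLinearEquiv (fun M => LinearEquiv.refl R M.carrier) (fun M d x hx => by
    have : d - 0 = d := by omega
    change x ∈ M.gr d
    rw [← this]
    exact hx) fun _ _ => rfl

end GrMod

/-- Tensor products commute with shifts. -/
def FlatTangle.shiftTensor {v w : Weight n k} (T : FlatTangle v w) (a : ℤ) :
    GrMod.shift _ a ⋙ T.tensorFunctor ≅ T.tensorFunctor ⋙ GrMod.shift _ a :=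
  GrMod.isoOfLinearEquiv (fun M => LinearEquiv.refl _ (T.tensorFunctor.obj M).carrier)
    (fun M d x hx => by
      change x ∈ BalancedTensor.part _ _ T.part M.gr (d - a)
      have h : x ∈ BalancedTensor.part _ _ T.part (fun d => M.gr (d - a)) d := hx
      clear hx
      induction h using AddSubgroup.closure_induction with
      | mem x h =>
        obtain ⟨i, j, b, m, hb, hm, rfl, rfl⟩ := h
        rw [add_sub_assoc]
        exact BalancedTensor.mk_mem_part hb hm
      | zero => exact zero_mem _
      | add x y _ _ h h' => exact add_mem h h'
      | neg x _ h => exact neg_mem h) fun _ _ => rfl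

theorem root_sub_root (i j : Fin (n - 1)) : root j (lft i) - root j (rgt i) = cartan i j := by
  simp only [root, Pi.sub_apply, Pi.single_apply, cartan, lft, rgt, Fin.ext_iff]
  split_ifs <;> omega

namespace ArcCat

/-- The values of `F` are zero in the weight `μ`. -/
def Vanishes (F : ArcCat n k ⥤ ArcCat n k) (μ : Weight n k) : Prop :=
  ∀ M, Subsingleton ((F.obj M) μ).carrier

theorem nonempty_iso {F G : ArcCat n k ⥤ ArcCat n k}
    (h : ∀ μ, Nonempty (F ⋙ Pi.eval ArcMod μ ≅ G ⋙ Pi.eval ArcMod μ)) : Nonempty (F ≅ G) :=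
  ⟨NatIso.pi' fun μ => (h μ).some⟩

theorem Vanishes.iso {F G : ArcCat n k ⥤ ArcCat n k} {μ : Weight n k} (hF : Vanishes F μ)
    (hG : Vanishes G μ) : Nonempty (F ⋙ Pi.eval ArcMod μ ≅ G ⋙ Pi.eval ArcMod μ) :=
  ⟨GrMod.isoOfSubsingleton hF hG⟩

theorem Vanishes.dsum {F G : ArcCat n k ⥤ ArcCat n k} {μ : Weight n k} (hF : Vanishes F μ)
    (hG : Vanishes G μ) : Vanishes (ArcCat.dsum F G) μ := fun M =>
  have := hF M
  have := hG M
  inferInstanceAs (Subsingleton (((F.obj M) μ).carrier × ((G.obj M) μ).carrier))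

theorem Vanishes.dsum_left {F G : ArcCat n k ⥤ ArcCat n k} {μ : Weight n k} (hF : Vanishes F μ) :
    Nonempty (ArcCat.dsum F G ⋙ Pi.eval ArcMod μ ≅ G ⋙ Pi.eval ArcMod μ) :=
  ⟨GrMod.isoOfLinearEquiv (fun M =>
    { LinearMap.snd _ ((F.obj M) μ).carrier ((G.obj M) μ).carrier with
      invFun := fun x => (0, x)
      left_inv := fun _ => Prod.ext ((hF M).elim _ _) rfl
      right_inv := fun _ => rfl }) (fun _ _ _ hx => hx.2) fun _ _ => rfl⟩

theorem Vanishes.dsum_right {F G : ArcCat n k ⥤ ArcCat n k} {μ : Weight n k} (hG : Vanishes G μ) :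
    Nonempty (ArcCat.dsum F G ⋙ Pi.eval ArcMod μ ≅ F ⋙ Pi.eval ArcMod μ) :=
  ⟨GrMod.isoOfLinearEquiv (fun M =>
    { LinearMap.fst _ ((F.obj M) μ).carrier ((G.obj M) μ).carrier with
      invFun := fun x => (x, 0)
      left_inv := fun _ => Prod.ext rfl ((hG M).elim _ _)
      right_inv := fun _ => rfl }) (fun _ _ _ hx => hx.1) fun _ _ => rfl⟩

/-- `G` takes `C(λ)` to `C(λ + δ ε_i)` by the tensor product with the bimodule of the elementary tangle. -/
structure Acts (G : ArcCat n k ⥤ ArcCat n k) (i : Fin (n - 1)) (δ : ℤ) : Prop where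
  sign : δ = 1 ∨ δ = -1
  step : ∀ ν μ : Weight n k, Step i δ ν μ → ∀ h : Neighbours i ν μ,
    Nonempty (G ⋙ Pi.eval ArcMod μ ≅ Pi.eval ArcMod ν ⋙ (elemTangle i ν μ h).tensorFunctor)
  vanish : ∀ μ : Weight n k, (∀ ν, ¬ Step i δ ν μ) → Vanishes G μ

theorem subsingleton_zero : Subsingleton (GrMod.zero : ArcMod (n := n) (k := k) μ).carrier :=
  inferInstanceAs (Subsingleton PUnit)

theorem acts_E (i : Fin (n - 1)) : Acts (E k i) i 1 where
  sign := Or.inl rfl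
  step ν μ h hn := by
    have e : ν.1 = μ.1 - root i := funext fun p => by rw [Pi.sub_apply, h p]; ring
    have ha : Admissible n k (μ.1 - root i) := e ▸ ν.2
    obtain rfl : ν = ⟨μ.1 - root i, ha⟩ := Subtype.ext e
    exact ⟨eqToIso (dif_pos ha)⟩
  vanish μ h M := by
    classical
    have ha : ¬ Admissible n k (μ.1 - root i) := fun ha => h ⟨_, ha⟩ fun p => by simp
    have e : E k i ⋙ Pi.eval ArcMod μ = (Functor.const _).obj GrMod.zero := dif_neg ha
    have := congrArg (fun F => (F.obj M).carrier) e
    exact (Equiv.cast this).subsingleton_congr.mpr subsingleton_zero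

theorem acts_F (i : Fin (n - 1)) : Acts (F k i) i (-1) where
  sign := Or.inr rfl
  step ν μ h hn := by
    have e : ν.1 = μ.1 + root i := funext fun p => by rw [Pi.add_apply, h p]; ring
    have ha : Admissible n k (μ.1 + root i) := e ▸ ν.2
    obtain rfl : ν = ⟨μ.1 + root i, ha⟩ := Subtype.ext e
    exact ⟨eqToIso (dif_pos ha)⟩
  vanish μ h M := by
    classical
    have ha : ¬ Admissible n k (μ.1 + root i) := fun ha => h ⟨_, ha⟩ fun p => by simp
    have e : F k i ⋙ Pi.eval ArcMod μ = (Functor.const _).obj GrMod.zero := dif_neg ha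
    have := congrArg (fun F => (F.obj M).carrier) e
    exact (Equiv.cast this).subsingleton_congr.mpr subsingleton_zero

namespace Acts

variable {G H L : ArcCat n k ⥤ ArcCat n k} {i j l : Fin (n - 1)} {δ δ' : ℤ}

theorem subsingleton_tensor {v w : Weight n k} (T : FlatTangle v w) (M : ArcMod v) (h : Subsingleton M.carrier) :
    Subsingleton (T.tensorFunctor.obj M).carrier := by
  refine subsingleton_of_forall_eq 0 fun x => ?_
  induction x using BalancedTensor.induction with
  | h0 => rfl
  | hmk b m => rw [h.elim m 0]; exact map_zero (BalancedTensor.mkHom _ _ b)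
  | hadd x y hx hy => rw [hx, hy]; exact add_zero _

theorem vanishes_comp (hG : Acts G i δ) (H) {μ : Weight n k} (h : ∀ ν, Step i δ ν μ → Vanishes H ν) :
    Vanishes (H ⋙ G) μ := by
  by_cases hν : ∃ ν, Step i δ ν μ
  · obtain ⟨ν, hν⟩ := hν
    intro M
    obtain ⟨e⟩ := hG.step ν μ hν (hν.neighbours hG.sign)
    exact GrMod.subsingleton_of_iso (e.app (H.obj M)) (subsingleton_tensor _ _ (h ν hν M))
  · exact fun M => hG.vanish μ (not_exists.mp hν) _

theorem iso_two (hG : Acts G i δ) (hH : Acts H j δ') {v w u : Weight n k} (h₁ : Step i δ v w)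
    (h₂ : Step j δ' w u) (n₁ : Neighbours i v w) (n₂ : Neighbours j w u) :
    Nonempty ((G ⋙ H) ⋙ Pi.eval ArcMod u ≅ Pi.eval ArcMod v ⋙
      (elemTangle i v w n₁).tensorFunctor ⋙ (elemTangle j w u n₂).tensorFunctor) := by
  obtain ⟨e₁⟩ := hG.step v w h₁ n₁
  obtain ⟨e₂⟩ := hH.step w u h₂ n₂
  exact ⟨Functor.isoWhiskerLeft G e₂ ≪≫ Functor.isoWhiskerRight e₁ (elemTangle j w u n₂).tensorFunctor⟩

theorem iso_three (hG : Acts G i δ) (hH : Acts H j δ) (hL : Acts L l δ) {v w x u : Weight n k}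
    (h₁ : Step i δ v w) (h₂ : Step j δ w x) (h₃ : Step l δ x u) (n₁ : Neighbours i v w)
    (n₂ : Neighbours j w x) (n₃ : Neighbours l x u) :
    Nonempty ((G ⋙ H ⋙ L) ⋙ Pi.eval ArcMod u ≅ Pi.eval ArcMod v ⋙ (elemTangle i v w n₁).tensorFunctor ⋙
      (elemTangle j w x n₂).tensorFunctor ⋙ (elemTangle l x u n₃).tensorFunctor) := by
  obtain ⟨e₁⟩ := hG.iso_two hH h₁ h₂ n₁ n₂
  obtain ⟨e₂⟩ := hL.step x u h₃ n₃
  exact ⟨Functor.isoWhiskerLeft (G ⋙ H) e₂ ≪≫ Functor.isoWhiskerRight e₁ (elemTangle l x u n₃).tensorFunctor⟩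

theorem iso_of_marked (hG : Acts G i δ) (hH : Acts H j δ) (hL : Acts L l δ) {v w x u : Weight n k}
    (h₁ : Step i δ v w) (h₂ : Step j δ w x) (h₃ : Step l δ x u) {T : FlatTangle v u} {f : Fin n → Fin n}
    {o : Prop} (h : ∀ (n₁ : Neighbours i v w) (n₂ : Neighbours j w x) (n₃ : Neighbours l x u),
      (FlatTangle.compThree n₁ n₂ n₃).Marked f o) (h' : T.Marked f o) :
    Nonempty ((G ⋙ H ⋙ L) ⋙ Pi.eval ArcMod u ≅ Pi.eval ArcMod v ⋙ T.tensorFunctor) := by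
  have n₁ := h₁.neighbours hG.sign
  have n₂ := h₂.neighbours hG.sign
  have n₃ := h₃.neighbours hG.sign
  obtain ⟨e₁⟩ := hG.iso_three hH hL h₁ h₂ h₃ n₁ n₂ n₃
  obtain ⟨e₂⟩ := FlatTangle.tensor_iso_three (ElemTangle.cups n₂) (ElemTangle.cups n₁) (h n₁ n₂ n₃) h'
  exact ⟨e₁ ≪≫ Functor.isoWhiskerLeft _ e₂⟩

theorem K_comm (hG : Acts G j δ) (i : Fin (n - 1)) {c : ℤ} (hc : c = δ * cartan i j) :
    Nonempty (G ⋙ K k i ≅ (K k i ⋙ G) ⋙ shift n k c) := by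
  refine nonempty_iso fun μ => ?_
  by_cases hν : ∃ ν, Step j δ ν μ
  · obtain ⟨ν, hν⟩ := hν
    obtain ⟨e⟩ := hG.step ν μ hν (hν.neighbours hG.sign)
    have hr : ν.1 (lft i) - ν.1 (rgt i) + c = μ.1 (lft i) - μ.1 (rgt i) := by
      rw [hc, ← root_sub_root, hν, hν]
      ring
    let T := elemTangle j ν μ (hν.neighbours hG.sign)
    let e₁ : (G ⋙ K k i) ⋙ Pi.eval ArcMod μ ≅
        (Pi.eval ArcMod ν ⋙ T.tensorFunctor) ⋙ GrMod.shift _ (μ.1 (lft i) - μ.1 (rgt i)) :=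
      Functor.isoWhiskerRight e (GrMod.shift _ (μ.1 (lft i) - μ.1 (rgt i)))
    let e₂ : ((K k i ⋙ G) ⋙ shift n k c) ⋙ Pi.eval ArcMod μ ≅
        (K k i ⋙ Pi.eval ArcMod ν ⋙ T.tensorFunctor) ⋙ GrMod.shift _ c :=
      Functor.isoWhiskerRight (Functor.isoWhiskerLeft (K k i) e) (GrMod.shift _ c)
    let e₃ : (K k i ⋙ Pi.eval ArcMod ν ⋙ T.tensorFunctor) ⋙ GrMod.shift _ c ≅
        (Pi.eval ArcMod ν ⋙ T.tensorFunctor) ⋙ GrMod.shift _ (ν.1 (lft i) - ν.1 (rgt i)) ⋙ GrMod.shift _ c :=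
      Functor.isoWhiskerRight (Functor.isoWhiskerLeft (Pi.eval ArcMod ν)
        (T.shiftTensor (ν.1 (lft i) - ν.1 (rgt i)))) (GrMod.shift _ c)
    exact ⟨e₁ ≪≫ (e₂ ≪≫ e₃ ≪≫ Functor.isoWhiskerLeft _ (GrMod.shiftShift _ hr)).symm⟩
  · have h := hG.vanish μ (not_exists.mp hν)
    exact Vanishes.iso (F := G ⋙ K k i) (G := (K k i ⋙ G) ⋙ shift n k c) (fun M => h M)
      fun M => h ((K k i).obj M)

theorem comm_of_exists (hG : Acts G i δ) (hH : Acts H j δ')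
    (hw : ∀ v u : Weight n k, (∀ p, u.1 p = v.1 p + δ * root i p + δ' * root j p) →
      ∃ w, Step i δ v w ∧ Step j δ' w u)
    (hx : ∀ v u : Weight n k, (∀ p, u.1 p = v.1 p + δ * root i p + δ' * root j p) →
      ∃ x, Step j δ' v x ∧ Step i δ x u)
    (hex : ∀ v w x u : Weight n k, Step i δ v w → Step j δ' w u → Step j δ' v x → Step i δ x u →
      ∀ (n₁ : Neighbours i v w) (n₂ : Neighbours j w u) (n₁' : Neighbours j v x) (n₂' : Neighbours i x u),
      Nonempty ((elemTangle i v w n₁).tensorFunctor ⋙ (elemTangle j w u n₂).tensorFunctor ≅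
        (elemTangle j v x n₁').tensorFunctor ⋙ (elemTangle i x u n₂').tensorFunctor)) :
    Nonempty (G ⋙ H ≅ H ⋙ G) := by
  refine nonempty_iso fun u => ?_
  by_cases hv : ∃ v : Weight n k, ∀ p, u.1 p = v.1 p + δ * root i p + δ' * root j p
  · obtain ⟨v, hv⟩ := hv
    obtain ⟨w, h₁, h₂⟩ := hw v u hv
    obtain ⟨x, h₁', h₂'⟩ := hx v u hv
    have n₁ := h₁.neighbours hG.sign
    have n₂ := h₂.neighbours hH.sign
    have n₁' := h₁'.neighbours hH.sign
    have n₂' := h₂'.neighbours hG.sign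
    obtain ⟨e⟩ := hex v w x u h₁ h₂ h₁' h₂' n₁ n₂ n₁' n₂'
    obtain ⟨e₁⟩ := hG.iso_two hH h₁ h₂ n₁ n₂
    obtain ⟨e₂⟩ := hH.iso_two hG h₁' h₂' n₁' n₂'
    exact ⟨e₁ ≪≫ Functor.isoWhiskerLeft _ e ≪≫ e₂.symm⟩
  · refine Vanishes.iso (hH.vanishes_comp G fun w hw => hG.vanish w fun v hv' => hv ⟨v, fun p => ?_⟩)
      (hG.vanishes_comp H fun w hw => hH.vanish w fun v hv' => hv ⟨v, fun p => ?_⟩)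
    · rw [hw p, hv' p]
    · rw [hw p, hv' p]; ring

theorem comm_far (hG : Acts G i δ) (hH : Acts H j δ') (hij : 1 < |(i : ℤ) - (j : ℤ)|) :
    Nonempty (G ⋙ H ≅ H ⋙ G) := by
  have hr : ∀ p, root i p = 0 ∨ root j p = 0 := by
    intro p
    rw [lt_abs] at hij
    by_cases hp : p = lft i ∨ p = rgt i
    · refine Or.inr (ElemTangle.root_other j ?_ ?_) <;> simp only [lft, rgt, ne_eq, Fin.ext_iff] at hp ⊢ <;> omega
    · exact Or.inl (ElemTangle.root_other i (not_or.mp hp).1 (not_or.mp hp).2)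
  refine hG.comm_of_exists hH (fun v u h => ?_) (fun v u h => ?_) fun v w x u _ _ _ _ =>
    FlatTangle.exchange_far hij
  · obtain ⟨w, hw⟩ := exists_step (v := v) i δ fun p => by
      have := v.2.1 p
      have := u.2.1 p
      have := h p
      rcases hr p with h | h <;> simp only [h, mul_zero, add_zero] at * <;> omega
    exact ⟨w, hw, fun p => by rw [h p, hw p]⟩
  · obtain ⟨w, hw⟩ := exists_step (v := v) j δ' fun p => by
      have := v.2.1 p
      have := u.2.1 p
      have := h p
      rcases hr p with h | h <;> simp only [h, mul_zero, add_zero] at * <;> omega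
    exact ⟨w, hw, fun p => by rw [h p, hw p]; ring⟩

theorem comm_near (hG : Acts G i δ) (hH : Acts H j (-δ)) (hij : |(i : ℤ) - (j : ℤ)| = 1) :
    Nonempty (G ⋙ H ≅ H ⋙ G) := by
  obtain ⟨a, m, c, ε, hC⟩ := Corner.exists_of hij
  obtain ⟨η, hη, e1, e2, e3, e4, e5, e6⟩ := hC.scaled hG.sign
  refine hG.comm_of_exists hH (fun v u h => ?_) (fun v u h => ?_) fun v w x u h₁ h₂ h₁' _ =>
    FlatTangle.exchange_near hC hG.sign h₁ h₂ h₁'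
  · obtain ⟨w, hw⟩ := exists_step (v := v) i δ fun p => by
      have := v.2.1 p
      have := u.2.1 p
      have := h p
      rw [neg_mul] at this
      rcases hC.cases p with rfl | rfl | rfl | ⟨h1, h2⟩
      · omega
      · omega
      · omega
      · have := h1 δ
        omega
    exact ⟨w, hw, fun p => by rw [h p, hw p]⟩
  · obtain ⟨w, hw⟩ := exists_step (v := v) j (-δ) fun p => by
      have := v.2.1 p
      have := u.2.1 p
      have := h p
      rw [neg_mul] at this ⊢
      rcases hC.cases p with rfl | rfl | rfl | ⟨h1, h2⟩
      · omega
      · omega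
      · omega
      · have := h2 δ
        omega
    exact ⟨w, hw, fun p => by rw [h p, hw p]; ring⟩

theorem serre (hG : Acts G i δ) (hH : Acts H j δ) (hij : |(i : ℤ) - (j : ℤ)| = 1) :
    Nonempty (dsum (H ⋙ G ⋙ G) (G ⋙ G ⋙ H) ≅
      dsum ((G ⋙ H ⋙ G) ⋙ shift n k 1) ((G ⋙ H ⋙ G) ⋙ shift n k (-1))) := by
  obtain ⟨a, m, c, ε, hC⟩ := Corner.exists_of hij
  obtain ⟨η, hη, e1, e2, e3, e4, e5, e6⟩ := hC.scaled hG.sign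
  refine nonempty_iso fun u => ?_
  by_cases hv : ∃ v : Weight n k, ∀ p, u.1 p = v.1 p + 2 * (δ * root i p) + δ * root j p
  · obtain ⟨v, hv⟩ := hv
    have va := v.2.1 a
    have vm := v.2.1 m
    have vc := v.2.1 c
    have ua := u.2.1 a
    have um := u.2.1 m
    have uc := u.2.1 c
    have ha := hv a
    have hm := hv m
    have hc := hv c
    obtain ⟨w, h₁⟩ := exists_step (v := v) i δ fun p => by
      have := v.2.1 p
      rcases hC.cases p with rfl | rfl | rfl | ⟨h1, h2⟩
      · omega
      · omega
      · omega
      · have := h1 δ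
        omega
    obtain ⟨x, h₂⟩ := exists_step (v := w) j δ fun p => by
      have := w.2.1 p
      have := h₁ p
      rcases hC.cases p with rfl | rfl | rfl | ⟨h1, h2⟩
      · omega
      · omega
      · omega
      · have := h2 δ
        omega
    have h₃ : Step i δ x u := fun p => by rw [hv p, h₂ p, h₁ p]; ring
    have n₁ := h₁.neighbours hG.sign
    have n₂ := h₂.neighbours hG.sign
    have n₃ := h₃.neighbours hG.sign
    have hS := FlatTangle.serre_middle hC hG.sign h₁ h₂ h₃ n₁ n₂ n₃
    obtain ⟨e₀⟩ := hG.iso_of_marked hH hG h₁ h₂ h₃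
      (FlatTangle.serre_middle hC hG.sign h₁ h₂ h₃) hS
    let S := FlatTangle.compThree n₁ n₂ n₃
    let e : dsum ((G ⋙ H ⋙ G) ⋙ shift n k 1) ((G ⋙ H ⋙ G) ⋙ shift n k (-1)) ⋙ Pi.eval ArcMod u ≅
        Pi.eval ArcMod v ⋙ S.addCircle.tensorFunctor :=
      Functor.isoWhiskerRight e₀ (GrMod.double _) ≪≫ Functor.isoWhiskerLeft _ S.circleIso
    by_cases hvm : v.1 m = 1
    · have hz : Vanishes (G ⋙ G ⋙ H) u := by
        refine hH.vanishes_comp (G ⋙ G) fun y hy => ?_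
        have := hy m
        have := y.2.1 m
        omega
      obtain ⟨y, g₁⟩ := exists_step (v := v) j δ fun p => by
        have := v.2.1 p
        rcases hC.cases p with rfl | rfl | rfl | ⟨h1, h2⟩
        · omega
        · omega
        · omega
        · have := h2 δ
          omega
      obtain ⟨z, g₂⟩ := exists_step (v := y) i δ fun p => by
        have := y.2.1 p
        have := g₁ p
        rcases hC.cases p with rfl | rfl | rfl | ⟨h1, h2⟩
        · omega
        · omega
        · omega
        · have := h1 δ
          omega
      have g₃ : Step i δ z u := fun p => by rw [hv p, g₂ p, g₁ p]; ring
      obtain ⟨e'⟩ := hz.dsum_right (F := H ⋙ G ⋙ G)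
      obtain ⟨e''⟩ := hH.iso_of_marked hG hG g₁ g₂ g₃
        (FlatTangle.serre_circle_right hC hG.sign g₁ g₂ g₃) hS.addCircle
      exact ⟨e' ≪≫ e'' ≪≫ e.symm⟩
    · have hz : Vanishes (H ⋙ G ⋙ G) u := by
        refine hG.vanishes_comp (H ⋙ G) fun y hy => hG.vanishes_comp H fun z hz => ?_
        have := hy m
        have := hz m
        have := z.2.1 m
        omega
      obtain ⟨z, g₂⟩ := exists_step (v := w) i δ fun p => by
        have := w.2.1 p
        have := h₁ p
        rcases hC.cases p with rfl | rfl | rfl | ⟨h1, h2⟩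
        · omega
        · omega
        · omega
        · have := h1 δ
          omega
      have g₃ : Step j δ z u := fun p => by rw [hv p, g₂ p, h₁ p]; ring
      obtain ⟨e'⟩ := hz.dsum_left (G := G ⋙ G ⋙ H)
      obtain ⟨e''⟩ := hG.iso_of_marked hG hH h₁ g₂ g₃
        (FlatTangle.serre_circle_left hC hG.sign h₁ g₂ g₃) hS.addCircle
      exact ⟨e' ≪≫ e'' ≪≫ e.symm⟩
  · have hmid : Vanishes (G ⋙ H ⋙ G) u :=
      hG.vanishes_comp (G ⋙ H) fun x hx => hH.vanishes_comp G fun w hw => hG.vanish w fun v hv' =>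
        hv ⟨v, fun p => by rw [hx p, hw p, hv' p]; ring⟩
    refine Vanishes.iso (Vanishes.dsum ?_ ?_) (Vanishes.dsum (fun M => hmid M) fun M => hmid M)
    · exact hG.vanishes_comp (H ⋙ G) fun x hx => hG.vanishes_comp H fun w hw => hH.vanish w fun v hv' =>
        hv ⟨v, fun p => by rw [hx p, hw p, hv' p]; ring⟩
    · exact hH.vanishes_comp (G ⋙ G) fun x hx => hG.vanishes_comp G fun w hw => hG.vanish w fun v hv' =>
        hv ⟨v, fun p => by rw [hx p, hw p, hv' p]; ring⟩

end Acts

theorem comm_E_F (i j : Fin (n - 1)) (hij : i ≠ j) : Nonempty (F k j ⋙ E k i ≅ E k i ⋙ F k j) := by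
  have h : |(i : ℤ) - (j : ℤ)| = 1 ∨ 1 < |(i : ℤ) - (j : ℤ)| := by
    have : (i : ℤ) ≠ j := fun h => hij (Fin.ext (by exact_mod_cast h))
    have := abs_pos.mpr (sub_ne_zero.mpr this)
    omega
  rcases h with h | h
  · exact ((acts_E i).comm_near (acts_F j) h).map Iso.symm
  · exact ((acts_E i).comm_far (acts_F j) h).map Iso.symm

/-- Compositions of shifts in each weight. -/
def piShift (n k : ℕ) {a b c : Weight n k → ℤ} (h : ∀ w, a w + b w = c w) :
    (Functor.pi fun w => GrMod.shift (ArcRing.part w) (a w)) ⋙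
      (Functor.pi fun w => GrMod.shift (ArcRing.part w) (b w)) ≅
    Functor.pi fun w => GrMod.shift (ArcRing.part w) (c w) :=
  NatIso.pi' fun w => Functor.isoWhiskerLeft (Pi.eval ArcMod w) (GrMod.shiftShift _ (h w))

/-- The shift by zero in each weight. -/
def piShiftZero (n k : ℕ) : (Functor.pi fun w : Weight n k => GrMod.shift (ArcRing.part w) 0) ≅
    𝟭 (ArcCat n k) :=
  NatIso.pi' fun w => Functor.isoWhiskerLeft (Pi.eval ArcMod w) (GrMod.shiftZero _)

end ArcCat

end

theorem mainTheorem2 (n k : ℕ) (hk : 1 ≤ k) (hkn : k ≤ n - 1) :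
    (∀ i : Fin (n - 1),
      Nonempty (ArcCat.Kinv k i ⋙ ArcCat.K k i ≅ 𝟭 (ArcCat n k)) ∧
      Nonempty (𝟭 (ArcCat n k) ≅ ArcCat.K k i ⋙ ArcCat.Kinv k i)) ∧
    (∀ i j : Fin (n - 1),
      Nonempty (ArcCat.K k j ⋙ ArcCat.K k i ≅ ArcCat.K k i ⋙ ArcCat.K k j)) ∧
    (∀ i j : Fin (n - 1),
      Nonempty (ArcCat.E k j ⋙ ArcCat.K k i ≅
        (ArcCat.K k i ⋙ ArcCat.E k j) ⋙ ArcCat.shift n k (cartan i j))) ∧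
    (∀ i j : Fin (n - 1),
      Nonempty (ArcCat.F k j ⋙ ArcCat.K k i ≅
        (ArcCat.K k i ⋙ ArcCat.F k j) ⋙ ArcCat.shift n k (-cartan i j))) ∧
    (∀ i j : Fin (n - 1), i ≠ j →
      Nonempty (ArcCat.F k j ⋙ ArcCat.E k i ≅ ArcCat.E k i ⋙ ArcCat.F k j)) ∧
    (∀ i j : Fin (n - 1), 1 < |(i : ℤ) - (j : ℤ)| →
      Nonempty (ArcCat.E k j ⋙ ArcCat.E k i ≅ ArcCat.E k i ⋙ ArcCat.E k j)) ∧
    (∀ i j : Fin (n - 1), 1 < |(i : ℤ) - (j : ℤ)| →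
      Nonempty (ArcCat.F k j ⋙ ArcCat.F k i ≅ ArcCat.F k i ⋙ ArcCat.F k j)) ∧
    (∀ i j : Fin (n - 1), |(i : ℤ) - (j : ℤ)| = 1 →
      Nonempty (ArcCat.dsum (ArcCat.E k j ⋙ ArcCat.E k i ⋙ ArcCat.E k i)
          (ArcCat.E k i ⋙ ArcCat.E k i ⋙ ArcCat.E k j) ≅
        ArcCat.dsum ((ArcCat.E k i ⋙ ArcCat.E k j ⋙ ArcCat.E k i) ⋙ ArcCat.shift n k 1)
          ((ArcCat.E k i ⋙ ArcCat.E k j ⋙ ArcCat.E k i) ⋙ ArcCat.shift n k (-1)))) ∧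
    (∀ i j : Fin (n - 1), |(i : ℤ) - (j : ℤ)| = 1 →
      Nonempty (ArcCat.dsum (ArcCat.F k j ⋙ ArcCat.F k i ⋙ ArcCat.F k i)
          (ArcCat.F k i ⋙ ArcCat.F k i ⋙ ArcCat.F k j) ≅
        ArcCat.dsum ((ArcCat.F k i ⋙ ArcCat.F k j ⋙ ArcCat.F k i) ⋙ ArcCat.shift n k 1)
          ((ArcCat.F k i ⋙ ArcCat.F k j ⋙ ArcCat.F k i) ⋙ ArcCat.shift n k (-1)))) := by
  refine ⟨fun i => ⟨⟨ArcCat.piShift n k (c := fun _ => 0) (fun w => ?_) ≪≫ ArcCat.piShiftZero n k⟩,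
    ⟨(ArcCat.piShift n k (c := fun _ => 0) (fun w => ?_) ≪≫ ArcCat.piShiftZero n k).symm⟩⟩,
    fun i j => ⟨ArcCat.piShift n k (fun _ => rfl) ≪≫ (ArcCat.piShift n k fun w => add_comm _ _).symm⟩,
    fun i j => (ArcCat.acts_E j).K_comm i (one_mul _).symm,
    fun i j => (ArcCat.acts_F j).K_comm i (neg_one_mul _).symm,
    ArcCat.comm_E_F,
    fun i j hij => ((ArcCat.acts_E i).comm_far (ArcCat.acts_E j) hij).map Iso.symm,
    fun i j hij => ((ArcCat.acts_F i).comm_far (ArcCat.acts_F j) hij).map Iso.symm,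
    fun i j => (ArcCat.acts_E i).serre (ArcCat.acts_E j),
    fun i j => (ArcCat.acts_F i).serre (ArcCat.acts_F j)⟩
  · ring
  · ring
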